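/- Let $k$ be a commutative ring. Degrees are homological and differentials have degree $-1$. A box operad is a collection of modules $B(p,q,r)$, $p,q,r\in\mathbb N$, with associative compositions $B(p,n,r)\otimes\bigotimes_{i=1}^n B(p_{i-1},q_i,p_i)\to B(p+p_0,\sum_i q_i,r+p_n)$ (for $n=0$: $B(p,0,r)\to B(p+p_0,0,r+p_0)$) and a unit in $B(0,1,0)$. The operations of box operads are indexed by stackings $S$ of labelled boxes $(p_1,q_1,r_1),\dots,(p_n,q_n,r_n)$ that form one $(p,q,r)$-labelled box, together with the unit stacking without boxes. We number the boxes of a stacking in standard order (below before above, left before right). The horizontal graph of $S$ has the boxes as vertices and the horizontal adjacencies as edges, and it also contains the bare horizontal strands (wires through open space that meet no box); a bare strand is a connected component. A box $(p,q,r)$ is thin if $p=r=0$, semi-thin if exactly one of $p,r$ is $0$, and non-thin if $p,r>0$. The thin desuspension $s_{\mathrm{thin}}^{-1}M$ of an $\mathbb N^3$-graded dg module $M$ is $s^{-1}M$ in thin arities and $M$ in the other arities. A stacking $S$ with $n$ boxes and outer label $(p,q,r)$ is thin-quadratic if it has no semi-thin boxes, its horizontal graph has exactly two connected components, and $\mathrm{td}(S)=2-n$,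 where $\mathrm{td}(S)=0$ if $(p,r)=(0,0)$ and $\mathrm{td}(S)=1+\#\{\text{thin boxes of }S\}-n$ otherwise. It is of type I if it consists of two thin boxes, of type II if its bottom box is not thin (it is then a non-thin box with one thin box on top), and of type III otherwise (its bottom box is thin, and what lies above it is non-thin and horizontally connected). Let $C=\overline C\oplus k$ be a conilpotent dg box cooperad, that is, $\overline C$ is a coalgebra, with components $\Delta_S$, over the comonad $M\mapsto\bigoplus_S\bigotimes_i M(p_i,q_i,r_i)$ on $\mathbb N^3$-dg modules, the sum being over the stackings $S$ different from the unit, in standard order. Let $T(s_{\mathrm{thin}}^{-1}\overline C)$ be the free dg box operad, with differential $d_{s_{\mathrm{thin}}^{-1}\overline C}$. Writing $\Delta_S(c)=\sum c_{(1)}\otimes\dots\otimes c_{(n)}$, define the thin desuspended infinitesimal decomposition $\Delta_{(1)}\colon s_{\mathrm{thin}}^{-1}\overline C\to T(s_{\mathrm{thin}}^{-1}\overline C)$ of degree $-1$ by $$\Delta_{(1)}(s_{\mathrm{thin}}^{-1}c)=\sum_{S\text{ type I}}(-1)^{|c_{(1)}|}(S;s^{-1}c_{(1)}\otimes s^{-1}c_{(2)})+\sum_{S\text{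 type II}}(-1)^{|c_{(1)}|+1}(S;c_{(1)}\otimes s^{-1}c_{(2)})+\sum_{S\text{ type III}}(S;s^{-1}c_{(1)}\otimes c_{(2)}\otimes\dots\otimes c_{(n)}).$$ Then $\Delta_{(1)}$ extends uniquely to a derivation $d_\square$ of degree $-1$ of the graded box operad $T(s_{\mathrm{thin}}^{-1}\overline C)$, and $d_\square^2=0$. Moreover $(d_{s_{\mathrm{thin}}^{-1}\overline C}+d_\square)^2=0$, and the cobar construction $\Omega C=\bigl(T(s_{\mathrm{thin}}^{-1}\overline C),\,d_{s_{\mathrm{thin}}^{-1}\overline C}+d_\square\bigr)$ is a dg box operad. -/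

import Mathlib

open scoped TensorProduct DirectSum

universe u

/-! # Labels of boxes -/

/-- A label `(p,q,r)` in `ℕ³` together with a degree. A graded `ℕ³`-module is a family of modules
indexed by `BoxLabel`: its value at `⟨p, q, r, n⟩` is the degree `n` part of the module of
arity `(p,q,r)`. -/
@[ext] structure BoxLabel where
  p : ℕ
  q : ℕ
  r : ℕ
  deg : ℤ
  deriving DecidableEq

namespace BoxLabel

/-- The same arity, one degree lower. -/
def pred (g : BoxLabel) : BoxLabel := ⟨g.p, g.q, g.r, g.deg - 1⟩

/-- Thin arities: `(0,q,0)`. -/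
def Thin (g : BoxLabel) : Prop := g.p = 0 ∧ g.r = 0

instance (g : BoxLabel) : Decidable g.Thin := inferInstanceAs (Decidable (_ ∧ _))

/-- Semi-thin arities: `(0,q,r)` with `r > 0`, or `(p,q,0)` with `p > 0`. -/
def SemiThin (g : BoxLabel) : Prop := (g.p = 0 ∧ 0 < g.r) ∨ (0 < g.p ∧ g.r = 0)

/-- The degree after thin desuspension. If `c` lies in the component `g` of `C`, then
`s_thin⁻¹ c` has the same arity as `c` and degree `sdeg g`. Hence the graded module
`s_thin⁻¹ C` is the family `C` itself, with degrees counted by `sdeg` instead of `deg`. -/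
def sdeg (g : BoxLabel) : ℤ := if g.Thin then g.deg - 1 else g.deg

end BoxLabel

/-- The scalar `(-1)^n`. -/
def koszul (k : Type*) [Ring k] (n : ℤ) : k := ((n.negOnePow : ℤ) : k)

/-! # Stackings of boxes

A stacking is encoded by its bottom box and the row of stackings lying on it (this is the vertical
composite tree, together with the widths of the open spaces above boxes without vertical inputs).
The boxes are always numbered in standard order: below before above, left before right.
`leaf` as a whole stacking is the unit `η` of arity `(0,1,0)`; inside of a row it is an open
vertical input. A row `S₁, …, Sₙ` with sides `p₀, …, pₙ` is `cons S₁ (… (cons Sₙ (nil pₙ)))`; so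
the empty row still remembers its side `p₀`. -/

mutual
/-- Stackings whose sides need not match yet. -/
inductive Stk : Type
  | leaf : Stk
  | node (g : BoxLabel) (row : StkRow) : Stk
/-- Rows of stackings. -/
inductive StkRow : Type
  | nil (side : ℕ) : StkRow
  | cons (t : Stk) (f : StkRow) : StkRow
end

/-- Length of a row. -/
def StkRow.length : StkRow → ℕ
  | .nil _ => 0
  | .cons _ f => f.length + 1

/-- Number of horizontal outputs of a row. -/
def StkRow.right : StkRow → ℕ
  | .nil s => s
  | .cons _ f => f.right

/-- Number of horizontal outputs. -/
def Stk.right : Stk → ℕ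
  | .leaf => 0
  | .node g f => g.r + f.right

mutual
/-- Number of horizontal inputs. -/
def Stk.left : Stk → ℕ
  | .leaf => 0
  | .node g f => g.p + f.left
/-- Number of horizontal inputs of a row. -/
def StkRow.left : StkRow → ℕ
  | .nil s => s
  | .cons t _ => t.left
end

mutual
/-- Number of vertical inputs. -/
def Stk.inputs : Stk → ℕ
  | .leaf => 1
  | .node _ f => f.inputs
/-- Number of vertical inputs of a row. -/
def StkRow.inputs : StkRow → ℕ
  | .nil _ => 0
  | .cons t f => t.inputs + f.inputs
end

mutual
/-- The labels of the boxes, in standard order. -/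
def Stk.boxes : Stk → List BoxLabel
  | .leaf => []
  | .node g f => g :: f.boxes
/-- The labels of the boxes of a row, in standard order. -/
def StkRow.boxes : StkRow → List BoxLabel
  | .nil _ => []
  | .cons t f => t.boxes ++ f.boxes
end

/-- Total degree of the labels, where a label `g` counts with degree `δ g`. -/
def Stk.degree (δ : BoxLabel → ℤ) (t : Stk) : ℤ := (t.boxes.map δ).sum

/-- Total degree of the labels of a row. -/
def StkRow.degree (δ : BoxLabel → ℤ) (f : StkRow) : ℤ := (f.boxes.map δ).sum

mutual
/-- In- and outputs match: every box carries as many stackings as it has vertical inputs, and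
neighbours in a row have the same number of horizontal wires at their common side. -/
def Stk.Valid : Stk → Prop
  | .leaf => True
  | .node g f => f.length = g.q ∧ f.Valid
/-- Matching for a row. -/
def StkRow.Valid : StkRow → Prop
  | .nil _ => True
  | .cons t f => t.Valid ∧ f.Valid ∧ t.right = f.left
end

/-- The label (arity and total degree) of the big box formed by a stacking. -/
def Stk.out (δ : BoxLabel → ℤ) (t : Stk) : BoxLabel := ⟨t.left, t.inputs, t.right, t.degree δ⟩

/-- A row of `n` open inputs. -/
def StkRow.leaves : ℕ → StkRow
  | 0 => .nil 0
  | n + 1 => .cons .leaf (StkRow.leaves n)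

/-- The stacking that consists of a single box (the operadic identity). -/
def Stk.corolla (g : BoxLabel) : Stk := .node g (StkRow.leaves g.q)

/-- The last part of a row, without the first `n` entries. -/
def StkRow.drop : ℕ → StkRow → StkRow
  | 0, f => f
  | _ + 1, .nil s => .nil s
  | n + 1, .cons _ f => StkRow.drop n f

/-- The first `n` entries of a row. -/
def StkRow.take : ℕ → StkRow → StkRow
  | 0, f => .nil f.left
  | _ + 1, .nil s => .nil s
  | n + 1, .cons t f => .cons t (StkRow.take n f)

mutual
/-- Put the row `f` on top of a stacking: the `i`-th entry goes to the `i`-th vertical input. -/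
def Stk.graft : Stk → StkRow → Stk
  | .leaf, .nil _ => .leaf
  | .leaf, .cons t _ => t
  | .node g c, f => .node g (StkRow.graft c f)
/-- Put the row `f` on top of a row. -/
def StkRow.graft : StkRow → StkRow → StkRow
  | .nil s, f => .nil (s + f.left)
  | .cons t c, f => .cons (Stk.graft t (f.take t.inputs)) (StkRow.graft c (f.drop t.inputs))
end

mutual
/-- The boxes with label `h` in a stacking. -/
inductive Stk.Pos : Stk → BoxLabel → Type
  | root (g : BoxLabel) (c : StkRow) : Stk.Pos (.node g c) g
  | above (g : BoxLabel) {c : StkRow} {h : BoxLabel} (v : StkRow.Pos c h) : Stk.Pos (.node g c) h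
/-- The boxes with label `h` in a row. -/
inductive StkRow.Pos : StkRow → BoxLabel → Type
  | here {t : Stk} {h : BoxLabel} (v : Stk.Pos t h) (c : StkRow) : StkRow.Pos (.cons t c) h
  | there (t : Stk) {c : StkRow} {h : BoxLabel} (v : StkRow.Pos c h) : StkRow.Pos (.cons t c) h
end

mutual
/-- Substitution of the stacking `t'` into the box `v`, put in standard order. -/
def Stk.Pos.subst (t' : Stk) : {t : Stk} → {h : BoxLabel} → Stk.Pos t h → Stk
  | _, _, .root _ c => t'.graft c
  | _, _, .above g v => .node g (v.subst t')
/-- Substitution of the stacking `t'` into the box `v` of a row. -/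
def StkRow.Pos.subst (t' : Stk) : {c : StkRow} → {h : BoxLabel} → StkRow.Pos c h → StkRow
  | _, _, .here v c => .cons (v.subst t') c
  | _, _, .there t v => .cons t (v.subst t')
end

/-! # The horizontal composite graph

Its vertices are the boxes; moreover it can contain bare strands (horizontal wires that pass through
an open space). A strand is a connected piece of the graph of its own unless it is attached to
something. -/

mutual
/-- The pieces of the horizontal composite graph: boxes, and pieces of wire. -/
inductive Stk.Cell : Stk → Type
  | root (g : BoxLabel) (c : StkRow) : Stk.Cell (.node g c)
  | above (g : BoxLabel) {c : StkRow} (a : StkRow.Cell c) : Stk.Cell (.node g c)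
/-- The pieces of the horizontal composite graph of a row. -/
inductive StkRow.Cell : StkRow → Type
  | wire {s : ℕ} (i : Fin s) : StkRow.Cell (.nil s)
  | here {t : Stk} (a : Stk.Cell t) (c : StkRow) : StkRow.Cell (.cons t c)
  | there (t : Stk) {c : StkRow} (a : StkRow.Cell c) : StkRow.Cell (.cons t c)
end

mutual
/-- `a` carries the `i`-th horizontal input, counted from the bottom. -/
inductive Stk.LeftPort : (t : Stk) → ℕ → t.Cell → Prop
  | root (g : BoxLabel) (c : StkRow) (i : ℕ) (hi : i < g.p) :
      Stk.LeftPort (.node g c) i (.root g c)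
  | above (g : BoxLabel) {c : StkRow} {i : ℕ} {a : c.Cell} (h : StkRow.LeftPort c i a) :
      Stk.LeftPort (.node g c) (g.p + i) (.above g a)
/-- `a` carries the `i`-th horizontal input of a row. -/
inductive StkRow.LeftPort : (c : StkRow) → ℕ → c.Cell → Prop
  | wire {s : ℕ} (i : Fin s) : StkRow.LeftPort (.nil s) i (.wire i)
  | here {t : Stk} {i : ℕ} {a : t.Cell} (h : Stk.LeftPort t i a) (c : StkRow) :
      StkRow.LeftPort (.cons t c) i (.here a c)
end

mutual
/-- `a` carries the `i`-th horizontal output, counted from the bottom. -/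
inductive Stk.RightPort : (t : Stk) → ℕ → t.Cell → Prop
  | root (g : BoxLabel) (c : StkRow) (i : ℕ) (hi : i < g.r) :
      Stk.RightPort (.node g c) i (.root g c)
  | above (g : BoxLabel) {c : StkRow} {i : ℕ} {a : c.Cell} (h : StkRow.RightPort c i a) :
      Stk.RightPort (.node g c) (g.r + i) (.above g a)
/-- `a` carries the `i`-th horizontal output of a row. -/
inductive StkRow.RightPort : (c : StkRow) → ℕ → c.Cell → Prop
  | wire {s : ℕ} (i : Fin s) : StkRow.RightPort (.nil s) i (.wire i)
  | there (t : Stk) {c : StkRow} {i : ℕ} {a : c.Cell} (h : StkRow.RightPort c i a) :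
      StkRow.RightPort (.cons t c) i (.there t a)
end

mutual
/-- Horizontal adjacency. -/
inductive Stk.Adj : (t : Stk) → t.Cell → t.Cell → Prop
  | above (g : BoxLabel) {c : StkRow} {a b : c.Cell} (h : StkRow.Adj c a b) :
      Stk.Adj (.node g c) (.above g a) (.above g b)
/-- Horizontal adjacency in a row: a horizontal output of an entry is joined to the horizontal input
of the same height of the rest of the row. -/
inductive StkRow.Adj : (c : StkRow) → c.Cell → c.Cell → Prop
  | join {t : Stk} {c : StkRow} {i : ℕ} {a : t.Cell} {b : c.Cell}
      (ha : Stk.RightPort t i a) (hb : StkRow.LeftPort c i b) :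
      StkRow.Adj (.cons t c) (.here a c) (.there t b)
  | here {t : Stk} {a b : t.Cell} (h : Stk.Adj t a b) (c : StkRow) :
      StkRow.Adj (.cons t c) (.here a c) (.here b c)
  | there (t : Stk) {c : StkRow} {a b : c.Cell} (h : StkRow.Adj c a b) :
      StkRow.Adj (.cons t c) (.there t a) (.there t b)
end

/-- Number of connected components of the horizontal composite graph (`Quot` divides by the
equivalence relation generated by adjacency). -/
noncomputable def Stk.components (t : Stk) : ℕ := Nat.card (Quot (Stk.Adj t))

/-! # Thin-quadratic stackings -/

/-- The thin desuspended degree. -/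
def Stk.thinDegree (t : Stk) : ℤ :=
  if t.left = 0 ∧ t.right = 0 then 0
  else 1 + (t.boxes.countP fun g => g.Thin) - t.boxes.length

/-- Thin-quadratic stackings; being in standard order is built into `Stk`. -/
def Stk.ThinQuadratic (t : Stk) : Prop :=
  (∀ g ∈ t.boxes, ¬ g.SemiThin) ∧ t.thinDegree = 2 - t.boxes.length ∧ t.components = 2

/-- Type I: two thin boxes. -/
def Stk.IsTypeI : Stk → Prop
  | .leaf => False
  | .node g c => g.Thin ∧ ∃ h : BoxLabel, h.Thin ∧ c.boxes = [h]

/-- Type II: a bottom box which is not thin. -/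
def Stk.IsTypeII : Stk → Prop
  | .leaf => False
  | .node g _ => ¬ g.Thin

/-- The degree of the bottom box. -/
def Stk.bottomDeg : Stk → ℤ
  | .leaf => 0
  | .node g _ => g.deg

open Classical in
/-- The coefficient of a stacking in the thin desuspended infinitesimal decomposition. The
remaining thin-quadratic stackings, of type III, have a thin bottom box and above it only non-thin
boxes, which are horizontally connected. -/
noncomputable def Stk.thinSign (k : Type*) [Ring k] (t : Stk) : k :=
  if t.ThinQuadratic then
    if t.IsTypeI then koszul k t.bottomDeg
    else if t.IsTypeII then koszul k (t.bottomDeg + 1)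
    else 1
  else 0

/-! # Tensors -/

section Tensors

variable (k : Type u) [CommRing k]
variable (C : BoxLabel → Type u) [∀ g, AddCommGroup (C g)] [∀ g, Module k (C g)]

mutual
/-- `C g₁ ⊗ ⋯ ⊗ C gₙ` for the boxes `g₁, …, gₙ` of a stacking in standard order (with factors `k`
at the open inputs and at the ends of the rows). -/
noncomputable def Stk.tens : Stk → ModuleCat.{u} k
  | .leaf => ModuleCat.of k k
  | .node g c => ModuleCat.of k (C g ⊗[k] (StkRow.tens c : ModuleCat.{u} k))
/-- The same tensor product for a row. -/
noncomputable def StkRow.tens : StkRow → ModuleCat.{u} k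
  | .nil _ => ModuleCat.of k k
  | .cons t c => ModuleCat.of k ((Stk.tens t : ModuleCat.{u} k) ⊗[k] (StkRow.tens c : ModuleCat.{u} k))
end

/-- The defining equation of `tens` at a leaf. -/
noncomputable def tensLeaf : Stk.tens k C .leaf ≃ₗ[k] k := LinearEquiv.refl k k

/-- The defining equation of `tens` at a box. -/
noncomputable def tensNode (g : BoxLabel) (c : StkRow) :
    Stk.tens k C (.node g c) ≃ₗ[k] C g ⊗[k] StkRow.tens k C c :=
  LinearEquiv.refl k (C g ⊗[k] StkRow.tens k C c)

/-- The defining equation of `tens` at an empty row. -/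
noncomputable def tensNil (s : ℕ) : StkRow.tens k C (.nil s) ≃ₗ[k] k := LinearEquiv.refl k k

/-- The defining equation of `tens` at a non-empty row. -/
noncomputable def tensCons (t : Stk) (c : StkRow) :
    StkRow.tens k C (.cons t c) ≃ₗ[k] Stk.tens k C t ⊗[k] StkRow.tens k C c :=
  LinearEquiv.refl k (Stk.tens k C t ⊗[k] StkRow.tens k C c)

/-- The element `1 ⊗ ⋯ ⊗ 1` of the tensor product over a row of open inputs. -/
noncomputable def tensOnes : (n : ℕ) → StkRow.tens k C (StkRow.leaves n)
  | 0 => (tensNil k C 0).symm 1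
  | n + 1 => (tensCons k C .leaf (StkRow.leaves n)).symm ((tensLeaf k C).symm 1 ⊗ₜ tensOnes n)

/-- Evaluation of the empty tensor product on an empty row (and zero on the other rows). -/
noncomputable def tensAug : (c : StkRow) → StkRow.tens k C c →ₗ[k] k
  | .nil s => (tensNil k C s).toLinearMap
  | .cons _ _ => 0

/-- The tensor product over a row, cut into the first `n` entries and the other ones. -/
noncomputable def tensSplit : (n : ℕ) → (c : StkRow) →
    StkRow.tens k C c →ₗ[k] StkRow.tens k C (c.take n) ⊗[k] StkRow.tens k C (c.drop n)
  | 0, c => TensorProduct.mk k (StkRow.tens k C (.nil c.left)) (StkRow.tens k C c)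
      ((tensNil k C c.left).symm 1)
  | _ + 1, .nil s => TensorProduct.mk k (StkRow.tens k C (.nil s)) (StkRow.tens k C (.nil s))
      ((tensNil k C s).symm 1)
  | n + 1, .cons t c =>
      ((tensCons k C t (c.take n)).symm.toLinearMap.rTensor (StkRow.tens k C (c.drop n))) ∘ₗ
        (TensorProduct.assoc k (Stk.tens k C t) (StkRow.tens k C (c.take n))
          (StkRow.tens k C (c.drop n))).symm.toLinearMap ∘ₗ
        ((tensSplit n c).lTensor (Stk.tens k C t)) ∘ₗ (tensCons k C t c).toLinearMap

variable (δ : BoxLabel → ℤ)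

mutual
/-- The shuffle `(S; x) ⊗ (row; y) ↦ (S with the row on top; x and y in standard order)`, with its
Koszul sign, where the elements of `C g` have degree `δ g`. -/
noncomputable def Stk.graftMap : (t : Stk) → (f : StkRow) →
    Stk.tens k C t ⊗[k] StkRow.tens k C f →ₗ[k] Stk.tens k C (t.graft f)
  | .leaf, .nil _ => 0
  | .leaf, .cons t c =>
      (TensorProduct.rid k (Stk.tens k C t)).toLinearMap ∘ₗ
        ((tensAug k C c).lTensor (Stk.tens k C t)) ∘ₗ (tensCons k C t c).toLinearMap ∘ₗ
        (TensorProduct.lid k (StkRow.tens k C (.cons t c))).toLinearMap ∘ₗ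
        ((tensLeaf k C).toLinearMap.rTensor (StkRow.tens k C (.cons t c)))
  | .node g c, f =>
      (tensNode k C g (c.graft f)).symm.toLinearMap ∘ₗ
        ((StkRow.graftMap c f).lTensor (C g)) ∘ₗ
        (TensorProduct.assoc k (C g) (StkRow.tens k C c) (StkRow.tens k C f)).toLinearMap ∘ₗ
        ((tensNode k C g c).toLinearMap.rTensor (StkRow.tens k C f))
/-- The same shuffle for a row on top of a row. -/
noncomputable def StkRow.graftMap : (c : StkRow) → (f : StkRow) →
    StkRow.tens k C c ⊗[k] StkRow.tens k C f →ₗ[k] StkRow.tens k C (c.graft f)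
  | .nil s, f =>
      (tensNil k C (s + f.left)).symm.toLinearMap ∘ₗ
        (tensAug k C f) ∘ₗ
        (TensorProduct.lid k (StkRow.tens k C f)).toLinearMap ∘ₗ
        ((tensNil k C s).toLinearMap.rTensor (StkRow.tens k C f))
  | .cons t c, f =>
      koszul k (c.degree δ * (f.take t.inputs).degree δ) •
      ((tensCons k C (t.graft (f.take t.inputs)) (c.graft (f.drop t.inputs))).symm.toLinearMap ∘ₗ
        TensorProduct.map (Stk.graftMap t (f.take t.inputs))
          (StkRow.graftMap c (f.drop t.inputs)) ∘ₗ
        (TensorProduct.tensorTensorTensorComm k (Stk.tens k C t) (StkRow.tens k C c)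
          (StkRow.tens k C (f.take t.inputs)) (StkRow.tens k C (f.drop t.inputs))).toLinearMap ∘ₗ
        TensorProduct.map (tensCons k C t c).toLinearMap (tensSplit k C t.inputs f))
end

mutual
/-- For `φ : C h → C g₁ ⊗ ⋯ ⊗ C gₙ` of degree `0`, with target the tensor product over a stacking
`t'`: apply `φ` to the factor at the box `v`, and bring the result into the standard order of the
stacking with `t'` substituted into `v`. -/
noncomputable def Stk.Pos.substMap (t' : Stk) : {t : Stk} → {h : BoxLabel} → (v : Stk.Pos t h) →
    (C h →ₗ[k] Stk.tens k C t') → (Stk.tens k C t →ₗ[k] Stk.tens k C (v.subst t'))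
  | _, _, .root g c, φ =>
      t'.graftMap k C δ c ∘ₗ (φ.rTensor (StkRow.tens k C c)) ∘ₗ (tensNode k C g c).toLinearMap
  | _, _, .above (c := c) g v, φ =>
      (tensNode k C g (v.subst t')).symm.toLinearMap ∘ₗ ((v.substMap t' φ).lTensor (C g)) ∘ₗ
        (tensNode k C g c).toLinearMap
/-- The same map for a row. -/
noncomputable def StkRow.Pos.substMap (t' : Stk) : {c : StkRow} → {h : BoxLabel} →
    (v : StkRow.Pos c h) → (C h →ₗ[k] Stk.tens k C t') →
    (StkRow.tens k C c →ₗ[k] StkRow.tens k C (v.subst t'))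
  | _, _, .here (t := t) v c, φ =>
      (tensCons k C (v.subst t') c).symm.toLinearMap ∘ₗ
        ((v.substMap t' φ).rTensor (StkRow.tens k C c)) ∘ₗ (tensCons k C t c).toLinearMap
  | _, _, .there (c := c) t v, φ =>
      (tensCons k C t (v.subst t')).symm.toLinearMap ∘ₗ
        ((v.substMap t' φ).lTensor (Stk.tens k C t)) ∘ₗ (tensCons k C t c).toLinearMap
end

end Tensors

/-! # The free box operad -/

/-- Stackings of boxes in standard order, including the unit `η`: they represent the
operations of box operads up to renumbering of the boxes. -/
abbrev Stacking : Type := {t : Stk // t.Valid}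

noncomputable instance : DecidableEq Stacking := Classical.decEq _

noncomputable instance : DecidableEq StkRow := Classical.decEq _

section Free

variable (k : Type u) [CommRing k]
variable (C : BoxLabel → Type u) [∀ g, AddCommGroup (C g)] [∀ g, Module k (C g)]

/-- The underlying module of `T(C)`: the direct sum over all stackings (in standard order) of the
tensor products `C g₁ ⊗ ⋯ ⊗ C gₙ` over their boxes. -/
abbrev FreeBox : Type u := ⨁ S : Stacking, Stk.tens k C S.1

/-- The direct sum of the tensor products over rows. -/
abbrev FreeRow : Type u := ⨁ c : StkRow, StkRow.tens k C c

open Classical in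
/-- The inclusion of a summand (zero if the sides of `t` do not match). -/
noncomputable def freeIn (t : Stk) : Stk.tens k C t →ₗ[k] FreeBox k C :=
  if h : t.Valid then DirectSum.lof k Stacking (fun S => (Stk.tens k C S.1 : Type u)) ⟨t, h⟩ else 0

open Classical in
/-- The projection to a summand (zero if the sides of `t` do not match). -/
noncomputable def freeProj (t : Stk) : FreeBox k C →ₗ[k] Stk.tens k C t :=
  if h : t.Valid then
    DirectSum.component k Stacking (fun S => (Stk.tens k C S.1 : Type u)) ⟨t, h⟩ else 0

/-- The inclusion of a summand. -/
noncomputable def rowIn (c : StkRow) : StkRow.tens k C c →ₗ[k] FreeRow k C :=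
  DirectSum.lof k StkRow (fun c => (StkRow.tens k C c : Type u)) c

/-- `C g ⊗ C g₁ ⊗ ⋯ ⊗ C gₙ → T(C)`: a single box with a row on top of it. -/
noncomputable def nodeMul (g : BoxLabel) : C g →ₗ[k] FreeRow k C →ₗ[k] FreeBox k C :=
  (DirectSum.toModule k StkRow (C g →ₗ[k] FreeBox k C) fun c =>
    (TensorProduct.curry (freeIn k C (.node g c) ∘ₗ (tensNode k C g c).symm.toLinearMap)).flip).flip

/-- Put a stacking in front of a row. -/
noncomputable def consMul : FreeBox k C →ₗ[k] FreeRow k C →ₗ[k] FreeRow k C :=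
  DirectSum.toModule k Stacking (FreeRow k C →ₗ[k] FreeRow k C) fun S =>
    (DirectSum.toModule k StkRow (Stk.tens k C S.1 →ₗ[k] FreeRow k C) fun c =>
      (TensorProduct.curry
        (rowIn k C (.cons S.1 c) ∘ₗ (tensCons k C S.1 c).symm.toLinearMap)).flip).flip

/-- The generators: `C g → T(C)` sends `x` to the stacking with the single box `x`. -/
noncomputable def freeGen (g : BoxLabel) : C g →ₗ[k] FreeBox k C :=
  freeIn k C (Stk.corolla g) ∘ₗ (tensNode k C g (StkRow.leaves g.q)).symm.toLinearMap ∘ₗ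
    (TensorProduct.mk k (C g) (StkRow.tens k C (StkRow.leaves g.q))).flip (tensOnes k C g.q)

variable (δ : BoxLabel → ℤ)

/-- Put a row on top of a stacking, with the Koszul sign for elements of `C g` of degree `δ g`. -/
noncomputable def graftMul : FreeBox k C →ₗ[k] FreeRow k C →ₗ[k] FreeBox k C :=
  DirectSum.toModule k Stacking (FreeRow k C →ₗ[k] FreeBox k C) fun S =>
    (DirectSum.toModule k StkRow (Stk.tens k C S.1 →ₗ[k] FreeBox k C) fun c =>
      (TensorProduct.curry (freeIn k C (S.1.graft c) ∘ₗ S.1.graftMap k C δ c)).flip).flip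

mutual
/-- On one summand: the derivation of `T(C)` of odd degree that extends `ψ : C → T(C)`. It is
the sum over the boxes of `(S; x₁ ⊗ ⋯ ⊗ xₙ) ↦ (-1)^(|x₁| + ⋯ + |xᵢ₋₁|) (S; x₁ ⊗ ⋯ ⊗ ψ xᵢ ⊗ ⋯ ⊗ xₙ)`,
where `ψ xᵢ` is then substituted into the `i`-th box. -/
noncomputable def Stk.derivMap (ψ : ∀ g, C g →ₗ[k] FreeBox k C) :
    (t : Stk) → Stk.tens k C t →ₗ[k] FreeBox k C
  | .leaf => 0
  | .node g c =>
      TensorProduct.lift ((graftMul k C δ).compl₁₂ (ψ g) (rowIn k C c) +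
        koszul k (δ g) • (nodeMul k C g).compl₂ (StkRow.derivMap ψ c)) ∘ₗ
        (tensNode k C g c).toLinearMap
/-- The same map for a row. -/
noncomputable def StkRow.derivMap (ψ : ∀ g, C g →ₗ[k] FreeBox k C) :
    (c : StkRow) → StkRow.tens k C c →ₗ[k] FreeRow k C
  | .nil _ => 0
  | .cons t c =>
      TensorProduct.lift ((consMul k C).compl₁₂ (Stk.derivMap ψ t) (rowIn k C c) +
        koszul k (t.degree δ) • (consMul k C).compl₁₂ (freeIn k C t) (StkRow.derivMap ψ c)) ∘ₗ
        (tensCons k C t c).toLinearMap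
end

/-- The derivation of `T(C)` of odd degree that extends `ψ : C → T(C)`. -/
noncomputable def freeDeriv (ψ : ∀ g, C g →ₗ[k] FreeBox k C) : FreeBox k C →ₗ[k] FreeBox k C :=
  DirectSum.toModule k Stacking (FreeBox k C) fun S => S.1.derivMap k C δ ψ

end Free

/-! # Box operads -/

/-- A row `x₁, …, xₙ` of elements, each one with its label, together with the last side `pₙ`. -/
inductive ElemRow (B : Type u) : Type u
  | nil (side : ℕ) : ElemRow B
  | cons (g : BoxLabel) (x : B) (xs : ElemRow B) : ElemRow B

namespace ElemRow

variable {B : Type u}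

/-- The number of elements. -/
def length : ElemRow B → ℕ
  | nil _ => 0
  | cons _ _ xs => xs.length + 1

/-- The first side `p₀`. -/
def left : ElemRow B → ℕ
  | nil s => s
  | cons g _ _ => g.p

/-- The last side `pₙ`. -/
def right : ElemRow B → ℕ
  | nil s => s
  | cons _ _ xs => xs.right

/-- The number `q₁ + ⋯ + qₙ` of vertical inputs. -/
def inputs : ElemRow B → ℕ
  | nil _ => 0
  | cons g _ xs => g.q + xs.inputs

/-- The total degree. -/
def deg : ElemRow B → ℤ
  | nil _ => 0
  | cons g _ xs => g.deg + xs.deg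

/-- The elements have the announced labels, and `rᵢ = pᵢ₊₁` for neighbours. -/
def Matching {k : Type u} [CommRing k] [AddCommGroup B] [Module k B]
    (gr : BoxLabel → Submodule k B) : ElemRow B → Prop
  | nil _ => True
  | cons g x xs => x ∈ gr g ∧ xs.Matching gr ∧ g.r = xs.left

/-- The row without its first `n` elements. -/
def drop : ℕ → ElemRow B → ElemRow B
  | 0, xs => xs
  | _ + 1, nil s => nil s
  | n + 1, cons _ _ xs => drop n xs

/-- The first `n` elements of a row. -/
def take : ℕ → ElemRow B → ElemRow B
  | 0, xs => nil xs.left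
  | _ + 1, nil s => nil s
  | n + 1, cons g x xs => cons g x (take n xs)

/-- Put elements in front of a row. -/
def prepend : List (BoxLabel × B) → ElemRow B → ElemRow B
  | [], xs => xs
  | a :: l, xs => cons a.1 a.2 (prepend l xs)

/-- The row of `n` units. -/
def units (one : B) : ℕ → ElemRow B
  | 0 => nil 0
  | n + 1 => cons ⟨0, 1, 0, 0⟩ one (units one n)

end ElemRow

/-- The label of `μ(x; x₁ ⊗ ⋯ ⊗ xₙ)` for `x` with label `g`. -/
def BoxLabel.comp {B : Type u} (g : BoxLabel) (xs : ElemRow B) : BoxLabel :=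
  ⟨g.p + xs.left, xs.inputs, g.r + xs.right, g.deg + xs.deg⟩

/-- The data of a graded box operad on an (internally graded) module `B`. -/
structure BoxOperadData (k : Type u) [CommRing k] (B : Type u) [AddCommGroup B] [Module k B] where
  /-- the homogeneous elements of arity `(p,q,r)` and degree `n`, for `g = ⟨p, q, r, n⟩` -/
  gr : BoxLabel → Submodule k B
  /-- the composition `μ(x; x₁ ⊗ ⋯ ⊗ xₙ)` -/
  comp : B → ElemRow B → B
  /-- the unit -/
  one : B

namespace BoxOperadData

variable {k : Type u} [CommRing k] {B : Type u} [AddCommGroup B] [Module k B]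

/-- The row `μ(x₁; y¹), …, μ(xₙ; yⁿ)`, where the row `y` is cut into pieces `yⁱ` of the lengths
that fit on the `xᵢ`. -/
def compRow (X : BoxOperadData k B) : ElemRow B → ElemRow B → ElemRow B
  | .nil s, ys => .nil (s + ys.left)
  | .cons g x xs, ys =>
      .cons (g.comp (ys.take g.q)) (X.comp x (ys.take g.q)) (compRow X xs (ys.drop g.q))

/-- The Koszul sign of the shuffle `x₁ ⋯ xₙ y¹ ⋯ yⁿ ↦ x₁ y¹ ⋯ xₙ yⁿ`. -/
def shuffleSign (k : Type u) [CommRing k] {B : Type u} : ElemRow B → ElemRow B → k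
  | .nil _, _ => 1
  | .cons g _ xs, ys =>
      koszul k (xs.deg * (ys.take g.q).deg) * shuffleSign k xs (ys.drop g.q)

/-- The axioms of a graded box operad. -/
structure IsGradedBoxOperad (X : BoxOperadData k B) : Prop where
  internal : DirectSum.IsInternal X.gr
  comp_linear_left : ∀ xs, IsLinearMap k fun x => X.comp x xs
  comp_linear_row : ∀ x (l : List (BoxLabel × B)) (g : BoxLabel) (xs : ElemRow B),
    IsLinearMap k fun y => X.comp x (ElemRow.prepend l (.cons g y xs))
  comp_mem : ∀ g x xs, x ∈ X.gr g → xs.Matching X.gr → xs.length = g.q →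
    X.comp x xs ∈ X.gr (g.comp xs)
  one_mem : X.one ∈ X.gr ⟨0, 1, 0, 0⟩
  one_comp : ∀ g x, x ∈ X.gr g → X.comp X.one (.cons g x (.nil g.r)) = x
  comp_one : ∀ g x, x ∈ X.gr g → X.comp x (ElemRow.units X.one g.q) = x
  comp_assoc : ∀ g x xs ys, x ∈ X.gr g → xs.Matching X.gr → xs.length = g.q →
    ys.Matching X.gr → ys.length = xs.inputs →
    X.comp x (X.compRow xs ys) = shuffleSign k xs ys • X.comp (X.comp x xs) ys

/-- `∑ᵢ (-1)^(|x₁| + ⋯ + |xᵢ₋₁|) F(x₁ ⊗ ⋯ ⊗ D xᵢ ⊗ ⋯ ⊗ xₙ)` for `D` of degree `-1`. -/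
def leibniz (k : Type u) [CommRing k] {B : Type u} [AddCommGroup B] [Module k B] (D : B → B) :
    (ElemRow B → B) → ElemRow B → B
  | _, .nil _ => 0
  | F, .cons g x xs =>
      F (.cons g.pred (D x) xs) + koszul k g.deg • leibniz k D (fun ys => F (.cons g x ys)) xs

/-- Derivations of degree `-1` (with respect to the identity). -/
structure IsDerivation (X : BoxOperadData k B) (D : B →ₗ[k] B) : Prop where
  mem : ∀ g x, x ∈ X.gr g → D x ∈ X.gr g.pred
  map_one : D X.one = 0
  map_comp : ∀ g x xs, x ∈ X.gr g → xs.Matching X.gr → xs.length = g.q →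
    D (X.comp x xs) =
      X.comp (D x) xs + koszul k g.deg • leibniz k D (fun ys => X.comp x ys) xs

/-- Dg box operads: graded box operads with a differential `D` of degree `-1` for which composition
and unit are chain maps. -/
structure IsDgBoxOperad (X : BoxOperadData k B) (D : B →ₗ[k] B) : Prop where
  graded : X.IsGradedBoxOperad
  derivation : X.IsDerivation D
  sq_zero : D ∘ₗ D = 0

end BoxOperadData

section FreeOperad

variable (k : Type u) [CommRing k]
variable (C : BoxLabel → Type u) [∀ g, AddCommGroup (C g)] [∀ g, Module k (C g)]

/-- A row of elements of `T(C)` as an element of the direct sum over rows of stackings. -/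
noncomputable def rowOf : ElemRow (FreeBox k C) → FreeRow k C
  | .nil s => rowIn k C (.nil s) ((tensNil k C s).symm 1)
  | .cons _ x xs => consMul k C x (rowOf xs)

/-- The free graded box operad `T(C)`, where the elements of `C g` have degree `δ g`; composition is
stacking. -/
noncomputable def freeBoxOperad (δ : BoxLabel → ℤ) : BoxOperadData k (FreeBox k C) where
  gr g := ⨆ (t : Stk) (_ : t.out δ = g), LinearMap.range (freeIn k C t)
  comp x xs := graftMul k C δ x (rowOf k C xs)
  one := freeIn k C .leaf ((tensLeaf k C).symm 1)

/-- A conilpotent dg box cooperad, given by its coaugmentation coideal `C`: a coalgebra over the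
comonad of stackings different from the unit. The component of `Δ x` at a stacking `S` is the
decomposition `Δ_S x` of `x` along `S`; only finitely many of them are nonzero. -/
structure ConilpotentDgBoxCooperad where
  /-- the differential -/
  d : ∀ g, C g →ₗ[k] C g.pred
  d_d : ∀ g x, d g.pred (d g x) = 0
  /-- the decomposition -/
  Δ : ∀ g, C g →ₗ[k] FreeBox k C
  /-- the unit stacking does not occur, and arities and degrees are preserved -/
  Δ_support : ∀ g x (t : Stk), freeProj k C t (Δ g x) ≠ 0 →
    t ≠ .leaf ∧ t.out BoxLabel.deg = g
  /-- counit: the component at the stacking with a single box is the identity -/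
  counit : ∀ g x, freeProj k C (Stk.corolla g) (Δ g x) =
    (tensNode k C g (StkRow.leaves g.q)).symm (x ⊗ₜ tensOnes k C g.q)
  /-- coassociativity: decomposing along `t`, and then its box `v` along `t'`, is decomposing
  along the stacking with `t'` substituted into `v` -/
  coassoc : ∀ g x (t : Stk) (h : BoxLabel) (v : t.Pos h) (t' : Stk), t.Valid → t'.Valid →
    t' ≠ .leaf → t'.out BoxLabel.deg = h →
    v.substMap k C BoxLabel.deg t' (freeProj k C t' ∘ₗ Δ h) (freeProj k C t (Δ g x)) =
      freeProj k C (v.subst t') (Δ g x)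
  /-- the decomposition is a chain map -/
  Δ_d : ∀ g x, Δ g.pred (d g x) =
    freeDeriv k C BoxLabel.deg (fun g => freeGen k C g.pred ∘ₗ d g) (Δ g x)

end FreeOperad

namespace ConilpotentDgBoxCooperad

variable {k : Type u} [CommRing k]
variable {C : BoxLabel → Type u} [∀ g, AddCommGroup (C g)] [∀ g, Module k (C g)]

/-- The thin desuspended infinitesimal decomposition `s_thin⁻¹ C → T(s_thin⁻¹ C)`. -/
noncomputable def infDecomp (𝒞 : ConilpotentDgBoxCooperad k C) (g : BoxLabel) :
    C g →ₗ[k] FreeBox k C :=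
  (DirectSum.toModule k Stacking (FreeBox k C) fun S => S.1.thinSign k • freeIn k C S.1) ∘ₗ 𝒞.Δ g

/-- The differential of `s_thin⁻¹ C`: `d (s⁻¹ x) = - s⁻¹ (d x)` on thin elements. -/
noncomputable def desuspD (𝒞 : ConilpotentDgBoxCooperad k C) (g : BoxLabel) :
    C g →ₗ[k] C g.pred :=
  if g.Thin then - 𝒞.d g else 𝒞.d g

/-- The differential of the free dg box operad `T(s_thin⁻¹ C)` induced by that of `s_thin⁻¹ C`. -/
noncomputable def dInt (𝒞 : ConilpotentDgBoxCooperad k C) : FreeBox k C →ₗ[k] FreeBox k C :=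
  freeDeriv k C BoxLabel.sdeg fun g => freeGen k C g.pred ∘ₗ 𝒞.desuspD g

/-- The derivation `d_□` of `T(s_thin⁻¹ C)` induced by the infinitesimal decomposition. -/
noncomputable def dSquare (𝒞 : ConilpotentDgBoxCooperad k C) : FreeBox k C →ₗ[k] FreeBox k C :=
  freeDeriv k C BoxLabel.sdeg 𝒞.infDecomp

end ConilpotentDgBoxCooperad

/-! # The cobar construction of a conilpotent dg box cooperad

A derivation of the free box operad is determined by its values on the generators, and its square
is a derivation again, so all claims reduce to identities on generators (`freeDeriv_isDerivation`,
`derivation_ext`, `freeDeriv_comp_self`). For these, the free operad is described by pure tensors,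
that is, by stackings decorated with elements (`DStk`).

For `d_□² = 0`, the component at a stacking `T` of a derivation is a sum over the factorizations of
`T`: the ways to obtain `T` by substituting a stacking `t'` into a box `v` of a stacking `t`
(`boxAt_freeDeriv`). On the infinitesimal decomposition of `c`, coassociativity turns each summand
into a sign times the decomposition of `c` along `T`, so that it remains to see that the signs add
up to zero. They are the product of two parts. The first one is the sign of `s_thin⁻¹ ⊗ ⋯ ⊗
s_thin⁻¹` on the factors of the decomposition (`twist`), and it turns the Koszul signs of `C` into
those of `s_thin⁻¹ C`. After it is split off, all degrees of elements have disappeared, and there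
remain integers `tqSign` that only depend on the arities (`Stk.thinSign_eq`, `sign_of_isFact`).

That the remaining sum is zero (`Stk.factSum_tqSign`) is a matter of shapes. In a thin-quadratic
stacking there lies on the bottom box either a single thin box, or, if the bottom box is thin, a
horizontally connected row of non-thin boxes (`Stk.thinQuadratic_node`). Hence `T` is a bottom box
with two more thin boxes, or a thin bottom box with a row of non-thin boxes and one thin box. In
the first case, two thin boxes side by side occur twice, with opposite signs as they are odd, and
two thin boxes above each other can be composed with each other or can be attached one after the
other (`StkRow.cutSum_oneThin_oneThin`, `StkRow.factSum_oneThin`). In the second case, the thin box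
can be composed with the part of the row below it or with the part above it, and these
contributions telescope, up to those of a thin box at the bottom or at the top of the row, which
cancel with those where the bottom box takes part (`StkRow.factSum_indec`). Horizontal connectivity
is expressed by the absence of horizontal cuts (`Sep`), which behave well under composition.

Finally, the internal differentials of `T(C)` and of `T(s_thin⁻¹ C)` correspond to each other under
the twist (`DStk.boxScale_freeDeriv`). As a thin-quadratic decomposition changes the total degree
of the desuspensions by one, the internal differential anticommutes with `d_□`
(`freeDeriv_boxScale`, `dInt_infDecomp`). -/

/-! ### Shapes: rows, cutting, grafting -/

/-- Concatenation of rows; the side at the end of the first row is dropped. -/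
def StkRow.append : StkRow → StkRow → StkRow
  | .nil _, f => f
  | .cons t c, f => .cons t (StkRow.append c f)

namespace StkRow

@[simp] theorem left_take (n : ℕ) (f : StkRow) : (f.take n).left = f.left := by
  cases n <;> cases f <;> simp [take, left]

@[simp] theorem right_drop (n : ℕ) (f : StkRow) : (f.drop n).right = f.right := by
  induction n generalizing f with
  | zero => simp [drop]
  | succ n ih => cases f <;> simp [drop, right, ih]

theorem length_take {n : ℕ} {f : StkRow} (h : n ≤ f.length) : (f.take n).length = n := by
  induction n generalizing f with
  | zero => simp [take, length]
  | succ n ih => cases f with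
    | nil => simp [length] at h
    | cons t c => simp [take, length, ih (by simpa [length] using h)]

@[simp] theorem length_drop (n : ℕ) (f : StkRow) : (f.drop n).length = f.length - n := by
  induction n generalizing f with
  | zero => simp [drop]
  | succ n ih => cases f <;> simp [drop, length, ih]

theorem Valid.take_drop {f : StkRow} (h : f.Valid) (n : ℕ) :
    (f.take n).Valid ∧ (f.drop n).Valid ∧ (f.take n).right = (f.drop n).left := by
  induction n generalizing f with
  | zero => simp [StkRow.take, StkRow.drop, Valid, right, h]
  | succ n ih => cases f with
    | nil => simp [StkRow.take, StkRow.drop, Valid, right, left]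
    | cons t c =>
      obtain ⟨ht, hc, hs⟩ := h
      obtain ⟨h1, h2, h3⟩ := ih hc
      exact ⟨⟨ht, h1, by simpa using hs⟩, h2, h3⟩

theorem inputs_take_add_drop (n : ℕ) (f : StkRow) :
    (f.take n).inputs + (f.drop n).inputs = f.inputs := by
  induction n generalizing f with
  | zero => simp [take, drop, inputs]
  | succ n ih => cases f with
    | nil => simp [take, drop, inputs]
    | cons t c => simp [take, drop, inputs, ← ih c, add_assoc]

@[simp] theorem degree_nil (δ : BoxLabel → ℤ) (s : ℕ) : (nil s).degree δ = 0 := rfl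

@[simp] theorem degree_cons (δ : BoxLabel → ℤ) (t : Stk) (c : StkRow) :
    (cons t c).degree δ = t.degree δ + c.degree δ := by
  simp [degree, Stk.degree, boxes]

theorem degree_take_add_drop (δ : BoxLabel → ℤ) (n : ℕ) (f : StkRow) :
    (f.take n).degree δ + (f.drop n).degree δ = f.degree δ := by
  induction n generalizing f with
  | zero => simp [take, drop]
  | succ n ih => cases f with
    | nil => simp [take, drop]
    | cons t c => simp [take, drop, ← ih c, add_assoc]

theorem length_eq_zero {f : StkRow} (h : f.length = 0) : ∃ s, f = nil s := by
  cases f with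
  | nil s => exact ⟨s, rfl⟩
  | cons => simp [length] at h

end StkRow

@[simp] theorem Stk.degree_leaf (δ : BoxLabel → ℤ) : Stk.leaf.degree δ = 0 := rfl

@[simp] theorem Stk.degree_node (δ : BoxLabel → ℤ) (g : BoxLabel) (c : StkRow) :
    (Stk.node g c).degree δ = δ g + c.degree δ := by
  simp [Stk.degree, StkRow.degree, Stk.boxes]

mutual
theorem Stk.graft_spec : ∀ (t : Stk) (f : StkRow), t.Valid → f.Valid → f.length = t.inputs →
    (t.graft f).Valid ∧ (t.graft f).left = t.left + f.left ∧
      (t.graft f).right = t.right + f.right ∧ (t.graft f).inputs = f.inputs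
  | .leaf, f, _, hf, hl => by
    cases f with
    | nil => simp [StkRow.length, Stk.inputs] at hl
    | cons t c =>
      obtain ⟨s, rfl⟩ := StkRow.length_eq_zero (by simpa [StkRow.length, Stk.inputs] using hl)
      simp only [StkRow.Valid, StkRow.left] at hf
      simp [Stk.graft, Stk.left, StkRow.left, show Stk.leaf.right = 0 from rfl, StkRow.right,
        StkRow.inputs, hf]
  | .node g c, f, ht, hf, hl => by
    obtain ⟨h1, h2, h3, h4, h5⟩ := StkRow.graft_spec c f ht.2 hf hl
    exact ⟨⟨h5.trans ht.1, h1⟩, by simp [Stk.graft, Stk.left, h2, add_assoc],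
      by simp [Stk.graft, Stk.right, h3, add_assoc], h4⟩
theorem StkRow.graft_spec : ∀ (c : StkRow) (f : StkRow), c.Valid → f.Valid → f.length = c.inputs →
    (c.graft f).Valid ∧ (c.graft f).left = c.left + f.left ∧
      (c.graft f).right = c.right + f.right ∧ (c.graft f).inputs = f.inputs ∧
      (c.graft f).length = c.length
  | .nil s, f, _, hf, hl => by
    obtain ⟨s, rfl⟩ := StkRow.length_eq_zero (by simpa [StkRow.inputs] using hl)
    simp [StkRow.graft, StkRow.left, StkRow.right, StkRow.inputs, StkRow.length, StkRow.Valid]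
  | .cons t c, f, ht, hf, hl => by
    obtain ⟨h1, h2, h3⟩ := hf.take_drop t.inputs
    have hle : t.inputs ≤ f.length := by simp [hl, StkRow.inputs]
    obtain ⟨a1, a2, a3, a4⟩ := Stk.graft_spec t (f.take t.inputs) ht.1 h1 (StkRow.length_take hle)
    obtain ⟨b1, b2, b3, b4, b5⟩ := StkRow.graft_spec c (f.drop t.inputs) ht.2.1 h2
      (by simp [hl, StkRow.inputs])
    refine ⟨⟨a1, b1, ?_⟩, ?_, ?_, ?_, ?_⟩
    · rw [a3, b2, ht.2.2, h3]
    · simpa [StkRow.graft, StkRow.left] using a2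
    · simpa [StkRow.graft, StkRow.right] using b3
    · simp [StkRow.graft, StkRow.inputs, a4, b4, StkRow.inputs_take_add_drop]
    · simp [StkRow.graft, StkRow.length, b5]
end

mutual
theorem Stk.degree_graft (δ : BoxLabel → ℤ) : ∀ (t : Stk) (f : StkRow), f.length = t.inputs →
    (t.graft f).degree δ = t.degree δ + f.degree δ
  | .leaf, f, hl => by
    cases f with
    | nil => simp [StkRow.length, Stk.inputs] at hl
    | cons t c =>
      obtain ⟨s, rfl⟩ := StkRow.length_eq_zero (by simpa [StkRow.length, Stk.inputs] using hl)
      simp [Stk.graft]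
  | .node g c, f, hl => by
    simp [Stk.graft, StkRow.degree_graft δ c f hl, add_assoc]
theorem StkRow.degree_graft (δ : BoxLabel → ℤ) : ∀ (c : StkRow) (f : StkRow),
    f.length = c.inputs → (c.graft f).degree δ = c.degree δ + f.degree δ
  | .nil s, f, hl => by
    obtain ⟨s, rfl⟩ := StkRow.length_eq_zero (by simpa [StkRow.inputs] using hl)
    simp [StkRow.graft]
  | .cons t c, f, hl => by
    have hle : t.inputs ≤ f.length := by simp [hl, StkRow.inputs]
    rw [StkRow.graft, StkRow.degree_cons, StkRow.degree_cons,
      Stk.degree_graft δ t _ (StkRow.length_take hle),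
      StkRow.degree_graft δ c _ (by simp [hl, StkRow.inputs]),
      ← StkRow.degree_take_add_drop δ t.inputs f]
    ring
end

mutual
/-- The exponent of the Koszul sign of the shuffle that puts a row on top of a stacking. -/
def Stk.shuf (δ : BoxLabel → ℤ) : Stk → StkRow → ℤ
  | .leaf, _ => 0
  | .node _ c, f => StkRow.shuf δ c f
/-- The exponent of the Koszul sign of the shuffle that puts a row on top of a row. -/
def StkRow.shuf (δ : BoxLabel → ℤ) : StkRow → StkRow → ℤ
  | .nil _, _ => 0
  | .cons t c, f => c.degree δ * (f.take t.inputs).degree δ + Stk.shuf δ t (f.take t.inputs) +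
      StkRow.shuf δ c (f.drop t.inputs)
end

section koszul
variable (k : Type*) [CommRing k]

theorem koszul_add (m n : ℤ) : koszul k (m + n) = koszul k m * koszul k n := by
  simp [koszul, Int.negOnePow_add]

@[simp] theorem koszul_zero : koszul k 0 = 1 := by simp [koszul]

@[simp] theorem koszul_mul_self (m : ℤ) : koszul k m * koszul k m = 1 := by
  rw [← koszul_add]; simp [koszul, Int.negOnePow_even _ ⟨m, rfl⟩]

theorem koszul_one : koszul k 1 = -1 := by simp [koszul]

theorem koszul_sub (m n : ℤ) : koszul k (m - n) = koszul k m * koszul k n := by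
  simp [koszul, Int.negOnePow_sub]

theorem koszul_neg (m : ℤ) : koszul k (-m) = koszul k m := by
  simp [koszul, Int.negOnePow_neg]

theorem koszul_congr {m n : ℤ} (h : Even (m - n)) : koszul k m = koszul k n := by
  have := koszul_add k (m - n) n
  rw [sub_add_cancel] at this
  rw [this]; simp [koszul, Int.negOnePow_even _ h]

theorem koszul_add_one (m : ℤ) : koszul k (m + 1) = -koszul k m := by
  rw [koszul_add, koszul_one]; ring

theorem koszul_sub_one (m : ℤ) : koszul k (m - 1) = -koszul k m := by
  rw [koszul_sub, koszul_one]; ring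
end koszul

/-! ### Decorated stackings -/

mutual
/-- Stackings with an element of `C g` at every box of label `g`: pure tensors in `T(C)`. -/
inductive DStk (C : BoxLabel → Type u) : Type u
  | leaf : DStk C
  | node (g : BoxLabel) (x : C g) (row : DRow C) : DStk C
/-- Rows of decorated stackings. -/
inductive DRow (C : BoxLabel → Type u) : Type u
  | nil (side : ℕ) : DRow C
  | cons (t : DStk C) (f : DRow C) : DRow C
end

section decorated
variable {C : BoxLabel → Type u}

mutual
/-- The underlying stacking. -/
def DStk.sh : DStk C → Stk
  | .leaf => .leaf
  | .node g _ c => .node g c.sh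
/-- The underlying row of stackings. -/
def DRow.sh : DRow C → StkRow
  | .nil s => .nil s
  | .cons t c => .cons t.sh c.sh
end

namespace DRow

/-- Concatenation of rows. -/
def append : DRow C → DRow C → DRow C
  | .nil _, f => f
  | .cons t c, f => .cons t (append c f)

/-- The row without its first `n` entries. -/
def drop : ℕ → DRow C → DRow C
  | 0, f => f
  | _ + 1, .nil s => .nil s
  | n + 1, .cons _ f => drop n f

/-- The first `n` entries of a row. -/
def take : ℕ → DRow C → DRow C
  | 0, f => .nil f.sh.left
  | _ + 1, .nil s => .nil s
  | n + 1, .cons t f => .cons t (take n f)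

/-- A row of `n` open inputs. -/
def leaves : ℕ → DRow C
  | 0 => .nil 0
  | n + 1 => .cons .leaf (leaves n)

end DRow

mutual
/-- Put a row on top of a stacking. -/
def DStk.graft : DStk C → DRow C → DStk C
  | .leaf, .nil _ => .leaf
  | .leaf, .cons t _ => t
  | .node g x c, f => .node g x (DRow.graft c f)
/-- Put a row on top of a row. -/
def DRow.graft : DRow C → DRow C → DRow C
  | .nil s, f => .nil (s + f.sh.left)
  | .cons t c, f =>
      .cons (DStk.graft t (f.take t.sh.inputs)) (DRow.graft c (f.drop t.sh.inputs))
end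

namespace DRow

@[simp] theorem sh_take (n : ℕ) (f : DRow C) : (f.take n).sh = f.sh.take n := by
  induction n generalizing f with
  | zero => cases f <;> simp [take, sh, StkRow.take]
  | succ n ih => cases f <;> simp [take, sh, StkRow.take, ih]

@[simp] theorem sh_drop (n : ℕ) (f : DRow C) : (f.drop n).sh = f.sh.drop n := by
  induction n generalizing f with
  | zero => cases f <;> simp [drop, sh, StkRow.drop]
  | succ n ih => cases f <;> simp [drop, sh, StkRow.drop, ih]

@[simp] theorem sh_leaves (n : ℕ) : (leaves n : DRow C).sh = StkRow.leaves n := by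
  induction n with
  | zero => rfl
  | succ n ih => simp [leaves, sh, StkRow.leaves, ih, DStk.sh]

theorem take_append (f f' : DRow C) (h : f.sh.right = f'.sh.left) :
    (f.append f').take f.sh.length = f := by
  match f with
  | .nil s => simp [append, sh, StkRow.length, take]; simpa [sh, StkRow.right] using h.symm
  | .cons t c => simp [append, sh, StkRow.length, take]; exact take_append c f' h

theorem drop_append (f f' : DRow C) : (f.append f').drop f.sh.length = f' := by
  match f with
  | .nil s => simp [append, sh, StkRow.length, drop]
  | .cons t c => simp [append, sh, StkRow.length, drop]; exact drop_append c f'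

theorem append_take_drop (n : ℕ) (f : DRow C) : (f.take n).append (f.drop n) = f := by
  induction n generalizing f with
  | zero => cases f <;> simp [take, drop, append]
  | succ n ih => cases f <;> simp [take, drop, append, ih]

end DRow

mutual
@[simp] theorem DStk.sh_graft : ∀ (t : DStk C) (f : DRow C), (t.graft f).sh = t.sh.graft f.sh
  | .leaf, .nil _ => rfl
  | .leaf, .cons _ _ => rfl
  | .node g x c, f => by simp [DStk.graft, DStk.sh, Stk.graft, DRow.sh_graft c f]
@[simp] theorem DRow.sh_graft : ∀ (c f : DRow C), (c.graft f).sh = c.sh.graft f.sh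
  | .nil s, f => rfl
  | .cons t c, f => by
    simp [DRow.graft, DRow.sh, StkRow.graft, DStk.sh_graft t, DRow.sh_graft c]
end

/-! ### Associativity of grafting -/

theorem DRow.take_take_add (m n : ℕ) (f : DRow C) : (f.take (m + n)).take m = f.take m := by
  induction m generalizing f with
  | zero => cases f <;> simp [DRow.take]
  | succ m ih =>
    rw [Nat.succ_add]
    cases f <;> simp [DRow.take, ih]

theorem DRow.drop_take_add (m n : ℕ) (f : DRow C) :
    (f.take (m + n)).drop m = (f.drop m).take n := by
  induction m generalizing f with
  | zero => simp [DRow.drop]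
  | succ m ih =>
    rw [Nat.succ_add]
    cases f with
    | nil s => cases n <;> simp [DRow.take, DRow.drop, DRow.sh, StkRow.left]
    | cons t c => simp [DRow.take, DRow.drop, ih]

theorem DRow.drop_drop_add (m n : ℕ) (f : DRow C) : f.drop (m + n) = (f.drop m).drop n := by
  induction m generalizing f with
  | zero => simp [DRow.drop]
  | succ m ih =>
    rw [Nat.succ_add]
    cases f with
    | nil s => cases n <;> simp [DRow.drop]
    | cons t c => simp [DRow.drop, ih]

theorem DRow.take_length (f : DRow C) : f.take f.sh.length = f := by
  match f with
  | .nil s => simp [DRow.take, DRow.sh, StkRow.length, StkRow.left]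
  | .cons t c => simp [DRow.take, DRow.sh, StkRow.length, DRow.take_length c]

theorem DRow.take_drop_graft : ∀ (n : ℕ) (c f : DRow C), c.sh.Valid → f.sh.Valid →
    f.sh.length = c.sh.inputs →
    (c.graft f).take n = (c.take n).graft (f.take (c.take n).sh.inputs) ∧
      (c.graft f).drop n = (c.drop n).graft (f.drop (c.take n).sh.inputs)
  | 0, c, f, hc, hf, hl => by
    have := (StkRow.graft_spec c.sh f.sh hc hf hl).2.1
    simp only [DRow.take, DRow.drop, DRow.graft, DRow.sh, StkRow.inputs, StkRow.left, DRow.sh_graft]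
    simp [this]
  | n + 1, .nil s, f, hc, hf, hl => by
    simp only [DRow.take, DRow.drop, DRow.graft, DRow.sh, StkRow.inputs, StkRow.left]
    simp
  | n + 1, .cons t c, f, hc, hf, hl => by
    have hl' : f.sh.length = t.sh.inputs + c.sh.inputs := hl
    obtain ⟨h1, h2⟩ := DRow.take_drop_graft n c (f.drop t.sh.inputs) hc.2.1
      (by simpa using (hf.take_drop _).2.1) (by simp [hl'])
    constructor
    · simp only [DRow.take, DRow.graft, h1, DRow.sh, StkRow.inputs, DRow.take_take_add,
        DRow.drop_take_add]
    · change DRow.drop n (c.graft (f.drop t.sh.inputs)) =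
        (c.drop n).graft (f.drop (t.sh.inputs + (c.take n).sh.inputs))
      rw [h2, DRow.drop_drop_add]

mutual
theorem DStk.graft_assoc : ∀ (t : DStk C) (c f : DRow C), t.sh.Valid → c.sh.Valid → f.sh.Valid →
    c.sh.length = t.sh.inputs → f.sh.length = c.sh.inputs →
    (t.graft c).graft f = t.graft (c.graft f)
  | .leaf, .nil _, f, _, _, _, h, _ => by simp [DRow.sh, DStk.sh, StkRow.length, Stk.inputs] at h
  | .leaf, .cons t c, f, _, hc, hf, h, hl => by
    cases c with
    | cons => simp [DRow.sh, DStk.sh, StkRow.length, Stk.inputs] at h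
    | nil s =>
      have : f.sh.length = t.sh.inputs := by simpa [DRow.sh, StkRow.inputs] using hl
      rw [DStk.graft, DRow.graft, DStk.graft, ← this, DRow.take_length]
  | .node g x c', c, f, ht, hc, hf, h, hl => by
    simp only [DStk.graft]
    rw [DRow.graft_assoc c' c f ht.2 hc hf h hl]
theorem DRow.graft_assoc : ∀ (t c f : DRow C), t.sh.Valid → c.sh.Valid → f.sh.Valid →
    c.sh.length = t.sh.inputs → f.sh.length = c.sh.inputs →
    (t.graft c).graft f = t.graft (c.graft f)
  | .nil s, c, f, ht, hc, hf, h, hl => by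
    have := (StkRow.graft_spec c.sh f.sh hc hf hl).2.1
    simp [DRow.graft, this, add_assoc]
  | .cons t c', c, f, ht, hc, hf, h, hl => by
    have h' : c.sh.length = t.sh.inputs + c'.sh.inputs := h
    obtain ⟨h1, h2⟩ := DRow.take_drop_graft t.sh.inputs c f hc hf hl
    obtain ⟨v1, v2, v3⟩ := hc.take_drop t.sh.inputs
    have l1 : (c.sh.take t.sh.inputs).length = t.sh.inputs := StkRow.length_take (by omega)
    have l2 : (c.sh.drop t.sh.inputs).length = c'.sh.inputs := by simp [h']
    have hi := StkRow.inputs_take_add_drop t.sh.inputs c.sh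
    set i := (c.sh.take t.sh.inputs).inputs with hi'
    obtain ⟨w1, w2, w3⟩ := hf.take_drop i
    have hin : (t.sh.graft (c.sh.take t.sh.inputs)).inputs = i :=
      (Stk.graft_spec _ _ ht.1 v1 l1).2.2.2
    rw [DRow.sh_take, ← hi'] at h1 h2
    simp only [DRow.graft, h1, h2, DStk.sh_graft, DRow.sh_take, hin]
    rw [DStk.graft_assoc t _ _ ht.1 (by simpa using v1) (by simpa using w1) (by simpa using l1)
        (by simpa using StkRow.length_take (by omega)),
      DRow.graft_assoc c' _ _ ht.2.1 (by simpa using v2) (by simpa using w2) (by simpa using l2)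
        (by simp; omega)]
end

theorem DRow.degree_take_add (δ : BoxLabel → ℤ) (m n : ℕ) (f : DRow C) :
    (f.take (m + n)).sh.degree δ = (f.take m).sh.degree δ + ((f.drop m).take n).sh.degree δ := by
  rw [← DRow.drop_take_add, ← DRow.take_take_add m n f]
  simp only [DRow.sh_take, DRow.sh_drop]
  rw [StkRow.degree_take_add_drop]

theorem DRow.shuf_take_drop (δ : BoxLabel → ℤ) : ∀ (n : ℕ) (c f : DRow C),
    c.sh.shuf δ f.sh = (c.drop n).sh.degree δ * (f.take (c.take n).sh.inputs).sh.degree δ +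
      (c.take n).sh.shuf δ (f.take (c.take n).sh.inputs).sh +
      (c.drop n).sh.shuf δ (f.drop (c.take n).sh.inputs).sh
  | 0, c, f => by simp [DRow.take, DRow.drop, DRow.sh, StkRow.inputs, StkRow.shuf]
  | n + 1, .nil s, f => by simp [DRow.take, DRow.drop, DRow.sh, StkRow.inputs, StkRow.shuf]
  | n + 1, .cons t c, f => by
    have ih := DRow.shuf_take_drop δ n c (f.drop t.sh.inputs)
    have e1 : ((DRow.cons t c).take (n + 1)).sh.inputs = t.sh.inputs + (c.take n).sh.inputs := rfl
    have e2 : (DRow.cons t c).drop (n + 1) = c.drop n := rfl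
    have e3 : ((DRow.cons t c).take (n + 1)).sh = .cons t.sh (c.take n).sh := rfl
    have e4 : (DRow.cons t c).sh = .cons t.sh c.sh := rfl
    have hd := StkRow.degree_take_add_drop δ n c.sh
    rw [e1, e2, e3, e4, StkRow.shuf, StkRow.shuf, DRow.drop_drop_add, DRow.degree_take_add]
    rw [← DRow.sh_take, ← DRow.sh_drop, ih, ← DRow.sh_take, ← DRow.sh_drop, DRow.take_take_add,
      DRow.drop_take_add, ← hd]
    simp only [DRow.sh_take, DRow.sh_drop]
    ring

mutual
/-- The Koszul signs of the shuffles satisfy the cocycle identity behind associativity. -/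
theorem DStk.shuf_assoc (δ : BoxLabel → ℤ) : ∀ (t : DStk C) (c f : DRow C), t.sh.Valid →
    c.sh.Valid → f.sh.Valid → c.sh.length = t.sh.inputs → f.sh.length = c.sh.inputs →
    t.sh.shuf δ c.sh + (t.graft c).sh.shuf δ f.sh =
      c.sh.shuf δ f.sh + t.sh.shuf δ (c.graft f).sh
  | .leaf, .nil _, f, _, _, _, h, _ => by simp [DRow.sh, DStk.sh, StkRow.length, Stk.inputs] at h
  | .leaf, .cons t c, f, _, hc, hf, h, hl => by
    cases c with
    | cons => simp [DRow.sh, DStk.sh, StkRow.length, Stk.inputs] at h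
    | nil s =>
      have : f.sh.length = t.sh.inputs := by simpa [DRow.sh, StkRow.inputs] using hl
      have h2 := congrArg DRow.sh (DRow.take_length f)
      rw [DRow.sh_take, this] at h2
      simp [DStk.graft, DRow.sh, DStk.sh, Stk.shuf, StkRow.shuf, h2]
  | .node g x c', c, f, ht, hc, hf, h, hl => by
    simpa [DStk.graft, DStk.sh, Stk.shuf, Stk.graft] using DRow.shuf_assoc δ c' c f ht.2 hc hf h hl
theorem DRow.shuf_assoc (δ : BoxLabel → ℤ) : ∀ (t c f : DRow C), t.sh.Valid →
    c.sh.Valid → f.sh.Valid → c.sh.length = t.sh.inputs → f.sh.length = c.sh.inputs →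
    t.sh.shuf δ c.sh + (t.graft c).sh.shuf δ f.sh =
      c.sh.shuf δ f.sh + t.sh.shuf δ (c.graft f).sh
  | .nil s, c, f, ht, hc, hf, h, hl => by
    obtain ⟨s', h'⟩ := StkRow.length_eq_zero (f := c.sh) h
    rw [h', DRow.sh_graft, h']
    simp [DRow.sh, StkRow.shuf, StkRow.graft]
  | .cons t c', c, f, ht, hc, hf, h, hl => by
    have h' : c.sh.length = t.sh.inputs + c'.sh.inputs := h
    obtain ⟨h1, h2⟩ := DRow.take_drop_graft t.sh.inputs c f hc hf hl
    obtain ⟨v1, v2, v3⟩ := hc.take_drop t.sh.inputs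
    have l1 : (c.sh.take t.sh.inputs).length = t.sh.inputs := StkRow.length_take (by omega)
    have l2 : (c.sh.drop t.sh.inputs).length = c'.sh.inputs := by simp [h']
    have hi := StkRow.inputs_take_add_drop t.sh.inputs c.sh
    have hsp := DRow.shuf_take_drop δ t.sh.inputs c f
    have hi0 : (c.take t.sh.inputs).sh.inputs = (c.sh.take t.sh.inputs).inputs := by simp
    rw [hi0] at h1 h2 hsp
    set i := (c.sh.take t.sh.inputs).inputs with hi'
    obtain ⟨w1, w2, w3⟩ := hf.take_drop i
    have hin : (t.sh.graft (c.sh.take t.sh.inputs)).inputs = i :=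
      (Stk.graft_spec _ _ ht.1 v1 l1).2.2.2
    have l3 : (f.sh.take i).length = i := StkRow.length_take (by omega)
    have i1 := DStk.shuf_assoc δ t (c.take t.sh.inputs) (f.take i) ht.1 (by simpa using v1)
      (by simpa using w1) (by simpa using l1) (by simpa using l3)
    have i2 := DRow.shuf_assoc δ c' (c.drop t.sh.inputs) (f.drop i) ht.2.1 (by simpa using v2)
      (by simpa using w2) (by simpa using l2) (by simp; omega)
    have d1 : (c'.graft (c.drop t.sh.inputs)).sh.degree δ =
        c'.sh.degree δ + (c.drop t.sh.inputs).sh.degree δ := by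
      simpa using StkRow.degree_graft δ c'.sh (c.sh.drop t.sh.inputs) l2
    have d2 : ((c.take t.sh.inputs).graft (f.take i)).sh.degree δ =
        (c.take t.sh.inputs).sh.degree δ + (f.take i).sh.degree δ := by
      simpa using StkRow.degree_graft δ (c.sh.take t.sh.inputs) (f.sh.take i) l3
    have e1 : (DRow.cons t c').sh.shuf δ c.sh = c'.sh.degree δ *
        (c.take t.sh.inputs).sh.degree δ + t.sh.shuf δ (c.take t.sh.inputs).sh +
          c'.sh.shuf δ (c.drop t.sh.inputs).sh := by
      simp [DRow.sh, StkRow.shuf]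
    have e2 : ((DRow.cons t c').graft c).sh.shuf δ f.sh =
        (c'.graft (c.drop t.sh.inputs)).sh.degree δ * (f.take i).sh.degree δ +
        (t.graft (c.take t.sh.inputs)).sh.shuf δ (f.take i).sh +
          (c'.graft (c.drop t.sh.inputs)).sh.shuf δ (f.drop i).sh := by
      simp [DRow.graft, DRow.sh, StkRow.shuf, hin]
    have e3 : (DRow.cons t c').sh.shuf δ (c.graft f).sh = c'.sh.degree δ *
        ((c.take t.sh.inputs).graft (f.take i)).sh.degree δ +
        t.sh.shuf δ ((c.take t.sh.inputs).graft (f.take i)).sh +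
          c'.sh.shuf δ ((c.drop t.sh.inputs).graft (f.drop i)).sh := by
      rw [← h1, ← h2]
      simp [DRow.sh, StkRow.shuf]
    rw [e1, e2, e3, hsp, d1, d2]
    linear_combination i1 + i2
end
end decorated

section elements
variable (k : Type u) [CommRing k]
variable {C : BoxLabel → Type u} [∀ g, AddCommGroup (C g)] [∀ g, Module k (C g)]

mutual
/-- The pure tensor of a decorated stacking. -/
noncomputable def DStk.elt : (t : DStk C) → Stk.tens k C t.sh
  | .leaf => (tensLeaf k C).symm 1
  | .node g x c => (tensNode k C g c.sh).symm (x ⊗ₜ[k] c.elt)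
/-- The pure tensor of a row of decorated stackings. -/
noncomputable def DRow.elt : (c : DRow C) → StkRow.tens k C c.sh
  | .nil s => (tensNil k C s).symm 1
  | .cons t c => (tensCons k C t.sh c.sh).symm (t.elt ⊗ₜ[k] c.elt)
end

/-- `y`, a tensor over the stacking `t`, is the pure tensor of the decorated stacking `T`. This is
an equality in a sigma type, since the shape of `T` need not be `t` by definition. -/
def DStk.Rep (T : DStk C) (t : Stk) (y : Stk.tens k C t) : Prop :=
  (⟨T.sh, T.elt k⟩ : Σ t, (Stk.tens k C t : Type u)) = ⟨t, y⟩

/-- `y`, a tensor over the row `c`, is the pure tensor of the row `R`. -/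
def DRow.Rep (R : DRow C) (c : StkRow) (y : StkRow.tens k C c) : Prop :=
  (⟨R.sh, R.elt k⟩ : Σ c, (StkRow.tens k C c : Type u)) = ⟨c, y⟩

variable {k}

theorem DStk.Rep.shape {T : DStk C} {t : Stk} {y : Stk.tens k C t} (h : T.Rep k t y) :
    T.sh = t := congrArg Sigma.fst h

theorem DRow.Rep.shape {T : DRow C} {t : StkRow} {y : StkRow.tens k C t} (h : T.Rep k t y) :
    T.sh = t := congrArg Sigma.fst h

theorem DStk.rep_self (T : DStk C) : T.Rep k T.sh (T.elt k) := rfl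
theorem DRow.rep_self (T : DRow C) : T.Rep k T.sh (T.elt k) := rfl

theorem DRow.Rep.node {g : BoxLabel} {x : C g} {R : DRow C} {c : StkRow} {y : StkRow.tens k C c}
    (h : R.Rep k c y) :
    (DStk.node g x R).Rep k (.node g c) ((tensNode k C g c).symm (x ⊗ₜ[k] y)) := by
  obtain rfl := h.shape
  obtain rfl := eq_of_heq (Sigma.mk.inj h).2
  rfl

theorem DStk.Rep.cons {T : DStk C} {t : Stk} {z : Stk.tens k C t} (hz : T.Rep k t z)
    {R : DRow C} {c : StkRow} {y : StkRow.tens k C c} (h : R.Rep k c y) :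
    (DRow.cons T R).Rep k (.cons t c) ((tensCons k C t c).symm (z ⊗ₜ[k] y)) := by
  obtain rfl := h.shape
  obtain rfl := eq_of_heq (Sigma.mk.inj h).2
  obtain rfl := hz.shape
  obtain rfl := eq_of_heq (Sigma.mk.inj hz).2
  rfl

variable (k)

/-- Cutting a pure tensor over a row cuts the decorated row. -/
theorem DRow.rep_split : ∀ (n : ℕ) (F : DRow C), ∃ z₁ z₂,
    (F.take n).Rep k (F.sh.take n) z₁ ∧ (F.drop n).Rep k (F.sh.drop n) z₂ ∧
      tensSplit k C n F.sh (F.elt k) = z₁ ⊗ₜ[k] z₂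
  | 0, F => by
    refine ⟨(tensNil k C F.sh.left).symm 1, F.elt k, ?_, ?_, ?_⟩
    · cases F <;> exact rfl
    · cases F <;> exact rfl
    · cases F <;> exact rfl
  | n + 1, .nil s => ⟨_, _, rfl, rfl, rfl⟩
  | n + 1, .cons t c => by
    obtain ⟨z₁, z₂, h1, h2, h3⟩ := DRow.rep_split n c
    refine ⟨(tensCons k C t.sh (c.sh.take n)).symm (t.elt k ⊗ₜ[k] z₁), z₂,
      DStk.Rep.cons t.rep_self h1, h2, ?_⟩
    change ((tensCons k C t.sh (c.sh.take n)).symm.toLinearMap.rTensor (StkRow.tens k C (c.sh.drop n)))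
      ((TensorProduct.assoc k _ _ _).symm (t.elt k ⊗ₜ[k] tensSplit k C n c.sh (c.elt k))) = _
    rw [h3]
    rfl

/-- All labels get degree zero. The maps on tensors for these degrees are free of signs; the maps for
other degrees differ from them by a sign. -/
abbrev zdeg : BoxLabel → ℤ := fun _ => 0

@[simp] theorem StkRow.degree_zdeg (t : StkRow) : t.degree zdeg = 0 := by simp [StkRow.degree]

mutual
/-- Without signs, the shuffle of pure tensors is grafting of decorated stackings. -/
theorem DStk.rep_graft : ∀ (T : DStk C) (F : DRow C) (f : StkRow) (z : StkRow.tens k C f),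
    F.Rep k f z → f.length = T.sh.inputs →
    (T.graft F).Rep k (T.sh.graft f) (T.sh.graftMap k C zdeg f (T.elt k ⊗ₜ[k] z))
  | .leaf, .nil s, f, z, h, hl => by
    obtain rfl := h.shape
    simp [DRow.sh, DStk.sh, StkRow.length, Stk.inputs] at hl
  | .leaf, .cons T c, f, z, h, hl => by
    obtain rfl := h.shape
    obtain rfl := eq_of_heq (Sigma.mk.inj h).2
    cases c with
    | cons => simp [DRow.sh, DStk.sh, StkRow.length, Stk.inputs] at hl
    | nil s =>
      have : Stk.graftMap k C zdeg Stk.leaf (DRow.cons T (DRow.nil s)).sh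
          (DStk.elt k (DStk.leaf : DStk C) ⊗ₜ[k] DRow.elt k (DRow.cons T (DRow.nil s))) =
          T.elt k := by
        change (TensorProduct.rid k (Stk.tens k C T.sh)) ((tensAug k C (.nil s)).lTensor _
          (tensCons k C T.sh (.nil s) ((1 : k) • (tensCons k C T.sh (.nil s)).symm
            (T.elt k ⊗ₜ[k] (tensNil k C s).symm 1)))) = _
        rw [one_smul, LinearEquiv.apply_symm_apply, LinearMap.lTensor_tmul]
        exact one_smul _ _
      exact congrArg (Sigma.mk T.sh) this.symm
  | .node g x c, F, f, z, h, hl => by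
    have ih := DRow.rep_graft c F f z h hl
    exact DRow.Rep.node (x := x) ih
theorem DRow.rep_graft : ∀ (T F : DRow C) (f : StkRow) (z : StkRow.tens k C f),
    F.Rep k f z → f.length = T.sh.inputs →
    (T.graft F).Rep k (T.sh.graft f) (T.sh.graftMap k C zdeg f (T.elt k ⊗ₜ[k] z))
  | .nil s, F, f, z, h, hl => by
    obtain rfl := h.shape
    obtain rfl := eq_of_heq (Sigma.mk.inj h).2
    cases F with
    | cons => simp [DRow.sh, StkRow.length, StkRow.inputs] at hl
    | nil s' =>
      have : StkRow.graftMap k C zdeg (StkRow.nil s) (StkRow.nil s')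
          ((tensNil k C s).symm 1 ⊗ₜ[k] (tensNil k C s').symm 1) =
          (tensNil k C (s + s')).symm 1 := by
        exact congrArg (tensNil k C (s + s')).symm (one_smul k (1 : k))
      exact congrArg (Sigma.mk _) this.symm
  | .cons t c, F, f, z, h, hl => by
    obtain rfl := h.shape
    obtain rfl := eq_of_heq (Sigma.mk.inj h).2
    have hl' : F.sh.length = t.sh.inputs + c.sh.inputs := hl
    obtain ⟨z₁, z₂, h1, h2, h3⟩ := DRow.rep_split k t.sh.inputs F
    have i1 := DStk.rep_graft t _ _ z₁ h1 (StkRow.length_take (by omega))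
    have i2 := DRow.rep_graft c _ _ z₂ h2 (by simp; omega)
    refine Eq.trans (i1.cons i2) (congrArg (Sigma.mk _) (Eq.symm ?_))
    have e : koszul k (c.sh.degree zdeg * (F.sh.take t.sh.inputs).degree zdeg) = 1 := by simp
    change koszul k (c.sh.degree zdeg * (F.sh.take t.sh.inputs).degree zdeg) •
      (tensCons k C _ _).symm (TensorProduct.map (t.sh.graftMap k C zdeg (F.sh.take t.sh.inputs))
        (c.sh.graftMap k C zdeg (F.sh.drop t.sh.inputs))
          (TensorProduct.tensorTensorTensorComm k _ _ _ _ ((t.elt k ⊗ₜ[k] c.elt k) ⊗ₜ[k]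
            (tensSplit k C t.sh.inputs F.sh (F.elt k))))) = _
    rw [e, h3]
    exact one_smul k _
end

variable (C) in
mutual
theorem Stk.graftMap_eq (δ : BoxLabel → ℤ) : ∀ (t : Stk) (f : StkRow), t.graftMap k C δ f =
    koszul k (t.shuf δ f) • t.graftMap k C zdeg f
  | .leaf, .nil _ => by simp [Stk.graftMap]
  | .leaf, .cons _ _ => by simp [Stk.graftMap, Stk.shuf]
  | .node g c, f => by
    refine LinearMap.ext fun z => ?_
    change (tensNode k C g (c.graft f)).symm ((StkRow.graftMap k C δ c f).lTensor (C g) _) = _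
    rw [StkRow.graftMap_eq δ c f, LinearMap.lTensor_smul, LinearMap.smul_apply]
    exact map_smul (tensNode k C g (c.graft f)).symm _ _
theorem StkRow.graftMap_eq (δ : BoxLabel → ℤ) : ∀ (t : StkRow) (f : StkRow), t.graftMap k C δ f =
    koszul k (t.shuf δ f) • t.graftMap k C zdeg f
  | .nil s, f => by simp [StkRow.graftMap, StkRow.shuf]
  | .cons t c, f => by
    rw [StkRow.graftMap, Stk.graftMap_eq δ t, StkRow.graftMap_eq δ c, StkRow.graftMap, StkRow.shuf]
    simp only [TensorProduct.map_smul_left, TensorProduct.map_smul_right, LinearMap.smul_comp,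
      LinearMap.comp_smul, StkRow.degree_zdeg, mul_zero, koszul_zero, one_smul, smul_smul,
      koszul_add]
    congr 1; ring
end

variable {k}

/-- The element of `T(C)` given by a decorated stacking (zero if the sides do not match). -/
noncomputable def DStk.val (k : Type u) [CommRing k] [∀ g, Module k (C g)] (T : DStk C) :
    FreeBox k C := freeIn k C T.sh (T.elt k)

/-- The element of the direct sum over rows given by a decorated row. -/
noncomputable def DRow.val (k : Type u) [CommRing k] [∀ g, Module k (C g)] (R : DRow C) :
    FreeRow k C := rowIn k C R.sh (R.elt k)

theorem DStk.Rep.freeIn {T : DStk C} {t : Stk} {y : Stk.tens k C t} (h : T.Rep k t y) :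
    freeIn k C t y = T.val k := by
  obtain rfl := h.shape
  obtain rfl := eq_of_heq (Sigma.mk.inj h).2
  rfl

theorem DRow.Rep.rowIn {T : DRow C} {t : StkRow} {y : StkRow.tens k C t} (h : T.Rep k t y) :
    rowIn k C t y = T.val k := by
  obtain rfl := h.shape
  obtain rfl := eq_of_heq (Sigma.mk.inj h).2
  rfl

mutual
/-- The tensor product over a stacking is spanned by the pure tensors. -/
theorem Stk.exists_rep : ∀ (t : Stk) (y : Stk.tens k C t),
    y ∈ Submodule.span k {y | ∃ T : DStk C, T.Rep k t y}
  | .leaf, y => by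
    have : y = (tensLeaf k C y) • (tensLeaf k C).symm 1 := by
      apply (tensLeaf k C).injective; simp
    rw [this]
    exact Submodule.smul_mem _ _ (Submodule.subset_span ⟨.leaf, rfl⟩)
  | .node g c, y => by
    obtain ⟨y, rfl⟩ := (tensNode k C g c).symm.surjective y
    induction y with
    | zero => simp
    | add a b ha hb => rw [map_add]; exact add_mem ha hb
    | tmul x z =>
      induction StkRow.exists_rep c z using Submodule.span_induction with
      | mem z h => obtain ⟨T, h⟩ := h; exact Submodule.subset_span ⟨_, h.node⟩
      | zero => simp
      | add a b _ _ ha hb => rw [TensorProduct.tmul_add, map_add]; exact add_mem ha hb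
      | smul r a _ h => rw [TensorProduct.tmul_smul, map_smul]; exact Submodule.smul_mem _ _ h
theorem StkRow.exists_rep : ∀ (t : StkRow) (y : StkRow.tens k C t),
    y ∈ Submodule.span k {y | ∃ T : DRow C, T.Rep k t y}
  | .nil s, y => by
    have : y = (tensNil k C s y) • (tensNil k C s).symm 1 := by
      apply (tensNil k C s).injective; simp
    rw [this]
    exact Submodule.smul_mem _ _ (Submodule.subset_span ⟨.nil s, rfl⟩)
  | .cons t c, y => by
    obtain ⟨y, rfl⟩ := (tensCons k C t c).symm.surjective y
    induction y with
    | zero => simp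
    | add a b ha hb => rw [map_add]; exact add_mem ha hb
    | tmul x z =>
      induction StkRow.exists_rep c z using Submodule.span_induction with
      | mem z h =>
        obtain ⟨R, h⟩ := h
        induction Stk.exists_rep t x using Submodule.span_induction with
        | mem x h' => obtain ⟨T, h'⟩ := h'; exact Submodule.subset_span ⟨_, h'.cons h⟩
        | zero => simp
        | add a b _ _ ha hb => rw [TensorProduct.add_tmul, map_add]; exact add_mem ha hb
        | smul r a _ h =>
          rw [← TensorProduct.smul_tmul', map_smul]; exact Submodule.smul_mem _ _ h
      | zero => simp
      | add a b _ _ ha hb => rw [TensorProduct.tmul_add, map_add]; exact add_mem ha hb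
      | smul r a _ h => rw [TensorProduct.tmul_smul, map_smul]; exact Submodule.smul_mem _ _ h
end

/-! ### The bilinear operations on pure tensors -/

theorem nodeMul_rowIn (g : BoxLabel) (x : C g) (c : StkRow) (y : StkRow.tens k C c) :
    nodeMul k C g x (rowIn k C c y) = freeIn k C (.node g c) ((tensNode k C g c).symm (x ⊗ₜ y)) := by
  simp [nodeMul, rowIn, DirectSum.toModule_lof]

theorem freeIn_of_valid {t : Stk} (h : t.Valid) (y : Stk.tens k C t) : freeIn k C t y =
    DirectSum.lof k Stacking (fun S => (Stk.tens k C S.1 : Type u)) ⟨t, h⟩ y := by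
  simp [freeIn, h]

theorem freeIn_of_not_valid {t : Stk} (h : ¬ t.Valid) : freeIn k C t = 0 := by
  simp [freeIn, h]

theorem consMul_freeIn {t : Stk} (h : t.Valid) (y : Stk.tens k C t) (c : StkRow)
    (z : StkRow.tens k C c) : consMul k C (freeIn k C t y) (rowIn k C c z) =
      rowIn k C (.cons t c) ((tensCons k C t c).symm (y ⊗ₜ z)) := by
  rw [freeIn_of_valid h]
  simp only [consMul, rowIn, DirectSum.toModule_lof, LinearMap.flip_apply, TensorProduct.curry_apply,
    LinearMap.comp_apply, LinearEquiv.coe_coe]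

theorem graftMul_freeIn (δ : BoxLabel → ℤ) {t : Stk} (h : t.Valid) (y : Stk.tens k C t)
    (c : StkRow) (z : StkRow.tens k C c) : graftMul k C δ (freeIn k C t y) (rowIn k C c z) =
      freeIn k C (t.graft c) (t.graftMap k C δ c (y ⊗ₜ z)) := by
  rw [freeIn_of_valid h]
  simp only [graftMul, rowIn, DirectSum.toModule_lof, LinearMap.flip_apply, TensorProduct.curry_apply,
    LinearMap.comp_apply]

theorem nodeMul_val (g : BoxLabel) (x : C g) (R : DRow C) :
    nodeMul k C g x (R.val k) = (DStk.node g x R).val k := by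
  rw [DRow.val, nodeMul_rowIn, R.rep_self.node.freeIn]

theorem consMul_val {T : DStk C} (h : T.sh.Valid) (R : DRow C) :
    consMul k C (T.val k) (R.val k) = (DRow.cons T R).val k := by
  rw [DRow.val, DStk.val, consMul_freeIn h, (T.rep_self.cons R.rep_self).rowIn]

theorem graftMul_val (δ : BoxLabel → ℤ) {T : DStk C} (h : T.sh.Valid) {R : DRow C}
    (hl : R.sh.length = T.sh.inputs) : graftMul k C δ (T.val k) (R.val k) =
      koszul k (T.sh.shuf δ R.sh) • (T.graft R).val k := by
  rw [DRow.val, DStk.val, graftMul_freeIn δ h, Stk.graftMap_eq, LinearMap.smul_apply, map_smul,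
    (T.rep_graft k R _ _ R.rep_self hl).freeIn]

variable (k C) in
/-- Put a row on top of a row, with the Koszul sign. -/
noncomputable def rowGraftMul (δ : BoxLabel → ℤ) : FreeRow k C →ₗ[k] FreeRow k C →ₗ[k] FreeRow k C :=
  DirectSum.toModule k StkRow (FreeRow k C →ₗ[k] FreeRow k C) fun c =>
    (DirectSum.toModule k StkRow (StkRow.tens k C c →ₗ[k] FreeRow k C) fun f =>
      (TensorProduct.curry (rowIn k C (c.graft f) ∘ₗ c.graftMap k C δ f)).flip).flip

theorem rowGraftMul_val (δ : BoxLabel → ℤ) {T R : DRow C}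
    (hl : R.sh.length = T.sh.inputs) : rowGraftMul k C δ (T.val k) (R.val k) =
      koszul k (T.sh.shuf δ R.sh) • (T.graft R).val k := by
  rw [DRow.val, DRow.val, ← (T.rep_graft k R _ _ R.rep_self hl).rowIn, ← map_smul,
    ← LinearMap.smul_apply, ← StkRow.graftMap_eq]
  simp only [rowGraftMul]
  conv_lhs => rw [rowIn, rowIn]
  simp only [DirectSum.toModule_lof, LinearMap.flip_apply,
    TensorProduct.curry_apply, LinearMap.comp_apply]

variable (k C) in
/-- Concatenate a tensor over the row `c` with a row. -/
noncomputable def StkRow.appMap : (c : StkRow) → StkRow.tens k C c →ₗ[k] FreeRow k C →ₗ[k] FreeRow k C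
  | .nil s => (LinearMap.lsmul k (FreeRow k C)) ∘ₗ (tensNil k C s).toLinearMap
  | .cons t c => TensorProduct.lift ((LinearMap.llcomp k _ _ _ ∘ₗ (consMul k C ∘ₗ freeIn k C t)).compl₂
      (StkRow.appMap c)) ∘ₗ (tensCons k C t c).toLinearMap

variable (k C) in
/-- Concatenation of rows. -/
noncomputable def appMul : FreeRow k C →ₗ[k] FreeRow k C →ₗ[k] FreeRow k C :=
  DirectSum.toModule k StkRow _ fun c => c.appMap k C

theorem appMul_nil (s : ℕ) (r : FreeRow k C) : appMul k C ((DRow.nil s).val k) r = r := by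
  rw [DRow.val, rowIn, appMul, DirectSum.toModule_lof]
  exact one_smul k r

theorem appMul_rowIn (c : StkRow) (z : StkRow.tens k C c) (r : FreeRow k C) :
    appMul k C (rowIn k C c z) r = c.appMap k C z r := by
  rw [rowIn, appMul, DirectSum.toModule_lof]

theorem appMul_consMul (x : FreeBox k C) (r s : FreeRow k C) :
    appMul k C (consMul k C x r) s = consMul k C x (appMul k C r s) := by
  induction x using DirectSum.induction_on with
  | zero => simp
  | add a b ha hb => simp only [map_add, LinearMap.add_apply, ha, hb]
  | of S y =>
    induction r using DirectSum.induction_on with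
    | zero => simp
    | add a b ha hb => simp only [map_add, LinearMap.add_apply, ha, hb]
    | of c z =>
      have e1 : DirectSum.of (fun S : Stacking => (Stk.tens k C S.1 : Type u)) S y =
        freeIn k C S.1 y := (freeIn_of_valid S.2 y).symm
      have e2 : DirectSum.of (fun c : StkRow => (StkRow.tens k C c : Type u)) c z =
        rowIn k C c z := rfl
      rw [e1, e2, consMul_freeIn S.2, appMul_rowIn, appMul_rowIn]
      simp [StkRow.appMap]

theorem appMul_val : ∀ {R : DRow C} (_ : R.sh.Valid) (F : DRow C),
    appMul k C (R.val k) (F.val k) = (R.append F).val k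
  | .nil s, _, F => appMul_nil s _
  | .cons T R, h, F => by
    rw [← consMul_val h.1, appMul_consMul, appMul_val h.2.1, consMul_val h.1]; rfl

end elements

/-! ### Homogeneous elements -/

theorem DRow.length_append {C : BoxLabel → Type u} : ∀ F F' : DRow C,
    (F.append F').sh.length = F.sh.length + F'.sh.length
  | .nil s, F' => by simp [DRow.append, DRow.sh, StkRow.length]
  | .cons t c, F' => by
    simp only [DRow.append, DRow.sh, StkRow.length, DRow.length_append c F']; omega

/-- The arity and the total degree of a row. -/
def StkRow.out (δ : BoxLabel → ℤ) (c : StkRow) : BoxLabel := ⟨c.left, c.inputs, c.right, c.degree δ⟩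

/-- The arity and degree of `μ(x; row)` for `x` of label `g` and a row of label `h`. -/
def BoxLabel.stack (g h : BoxLabel) : BoxLabel := ⟨g.p + h.p, h.q, g.r + h.r, g.deg + h.deg⟩

theorem DStk.graft_out {C : BoxLabel → Type u} {δ : BoxLabel → ℤ} {T : DStk C} {R : DRow C}
    (hT : T.sh.Valid) (hR : R.sh.Valid)
    (hl : R.sh.length = T.sh.inputs) : (T.graft R).sh.Valid ∧
      (T.graft R).sh.out δ = (T.sh.out δ).stack (R.sh.out δ) := by
  obtain ⟨h1, h2, h3, h4⟩ := Stk.graft_spec T.sh R.sh hT hR hl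
  rw [DStk.sh_graft]
  refine ⟨h1, ?_⟩
  simp [Stk.out, BoxLabel.stack, StkRow.out, h2, h3, h4, Stk.degree_graft δ T.sh R.sh hl]

theorem DRow.graft_out {C : BoxLabel → Type u} {δ : BoxLabel → ℤ} {T : DRow C} {R : DRow C}
    (hT : T.sh.Valid) (hR : R.sh.Valid)
    (hl : R.sh.length = T.sh.inputs) : (T.graft R).sh.Valid ∧
      (T.graft R).sh.length = T.sh.length ∧
      (T.graft R).sh.out δ = (T.sh.out δ).stack (R.sh.out δ) := by
  obtain ⟨h1, h2, h3, h4, h5⟩ := StkRow.graft_spec T.sh R.sh hT hR hl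
  rw [DRow.sh_graft]
  refine ⟨h1, h5, ?_⟩
  simp [BoxLabel.stack, StkRow.out, h2, h3, h4, StkRow.degree_graft δ T.sh R.sh hl]

section homogeneous
variable (k : Type u) [CommRing k]
variable (C : BoxLabel → Type u) [∀ g, AddCommGroup (C g)] [∀ g, Module k (C g)]

/-- The homogeneous elements of `T(C)`, as the span of pure tensors. -/
noncomputable def homog (δ : BoxLabel → ℤ) (g : BoxLabel) : Submodule k (FreeBox k C) :=
  Submodule.span k {x | ∃ T : DStk C, T.sh.Valid ∧ T.sh.out δ = g ∧ T.val k = x}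

/-- The homogeneous rows of length `n`. -/
noncomputable def rowHomog (δ : BoxLabel → ℤ) (n : ℕ) (g : BoxLabel) : Submodule k (FreeRow k C) :=
  Submodule.span k {x | ∃ R : DRow C, R.sh.Valid ∧ R.sh.length = n ∧ R.sh.out δ = g ∧ R.val k = x}

variable {k C} {δ : BoxLabel → ℤ}

theorem DStk.val_mem_homog {T : DStk C} (h : T.sh.Valid) : T.val k ∈ homog k C δ (T.sh.out δ) :=
  Submodule.subset_span ⟨T, h, rfl, rfl⟩

theorem DRow.val_mem_rowHomog {R : DRow C} (h : R.sh.Valid) :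
    R.val k ∈ rowHomog k C δ R.sh.length (R.sh.out δ) :=
  Submodule.subset_span ⟨R, h, rfl, rfl, rfl⟩

theorem freeIn_mem_homog (t : Stk) (y : Stk.tens k C t) :
    freeIn k C t y ∈ homog k C δ (t.out δ) := by
  by_cases h : t.Valid
  · induction Stk.exists_rep t y using Submodule.span_induction with
    | mem z hz =>
      obtain ⟨T, hT⟩ := hz
      obtain rfl := hT.shape
      rw [hT.freeIn]
      exact DStk.val_mem_homog h
    | zero => simp
    | add a b _ _ ha hb => rw [map_add]; exact add_mem ha hb
    | smul r a _ h => rw [map_smul]; exact Submodule.smul_mem _ _ h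
  · simp [freeIn_of_not_valid h]

theorem freeBoxOperad_gr (g : BoxLabel) : (freeBoxOperad k C δ).gr g = homog k C δ g := by
  apply le_antisymm
  · refine iSup_le fun t => iSup_le fun ht => ?_
    rintro _ ⟨y, rfl⟩
    exact ht ▸ freeIn_mem_homog t y
  · refine Submodule.span_le.2 ?_
    rintro _ ⟨T, _, h2, rfl⟩
    exact Submodule.mem_iSup_of_mem T.sh (Submodule.mem_iSup_of_mem h2 ⟨_, rfl⟩)

theorem homog_ext {M : Type*} [AddCommMonoid M] [Module k M] {g : BoxLabel}
    (f f' : FreeBox k C →ₗ[k] M)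
    (h : ∀ T : DStk C, T.sh.Valid → T.sh.out δ = g → f (T.val k) = f' (T.val k))
    {x : FreeBox k C} (hx : x ∈ homog k C δ g) : f x = f' x := by
  refine LinearMap.eqOn_span ?_ hx
  rintro _ ⟨T, h1, h2, rfl⟩
  exact h T h1 h2

theorem rowHomog_ext {M : Type*} [AddCommMonoid M] [Module k M] {n : ℕ} {g : BoxLabel}
    (f f' : FreeRow k C →ₗ[k] M)
    (h : ∀ R : DRow C, R.sh.Valid → R.sh.length = n → R.sh.out δ = g →
      f (R.val k) = f' (R.val k))
    {x : FreeRow k C} (hx : x ∈ rowHomog k C δ n g) : f x = f' x := by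
  refine LinearMap.eqOn_span ?_ hx
  rintro _ ⟨T, h1, h2, h3, rfl⟩
  exact h T h1 h2 h3

variable (k C δ) in
/-- The decomposition of an element of `T(C)` into homogeneous components. -/
noncomputable def decompFree : FreeBox k C →ₗ[k] ⨁ g, homog k C δ g :=
  DirectSum.toModule k Stacking _ fun S =>
    DirectSum.lof k BoxLabel (fun g => homog k C δ g) (S.1.out δ) ∘ₗ
      (freeIn k C S.1).codRestrict _ (freeIn_mem_homog S.1)

theorem decompFree_freeIn {t : Stk} (h : t.Valid) (y : Stk.tens k C t) :
    decompFree k C δ (freeIn k C t y) =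
      DirectSum.lof k BoxLabel (fun g => homog k C δ g) (t.out δ)
        ⟨freeIn k C t y, freeIn_mem_homog t y⟩ := by
  conv_lhs => rw [freeIn_of_valid h]
  rw [decompFree, DirectSum.toModule_lof]
  rfl

theorem decompFree_of_mem {g : BoxLabel} {x : FreeBox k C} (hx : x ∈ homog k C δ g) :
    decompFree k C δ x = DirectSum.lof k BoxLabel (fun g => homog k C δ g) g ⟨x, hx⟩ := by
  induction hx using Submodule.span_induction with
  | mem x h =>
    obtain ⟨T, h1, rfl, rfl⟩ := h
    exact decompFree_freeIn h1 _
  | zero => rw [map_zero]; exact (map_zero _).symm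
  | add a b ha hb iha ihb => rw [map_add, iha, ihb, ← map_add]; rfl
  | smul r a ha iha => rw [map_smul, iha, ← map_smul]; rfl

theorem homog_isInternal : DirectSum.IsInternal (homog k C δ) := by
  let _ : DirectSum.Decomposition (homog k C δ) :=
    { decompose' := decompFree k C δ, left_inv := ?_, right_inv := ?_ }
  · exact DirectSum.Decomposition.isInternal _
  · intro x
    induction x using DirectSum.induction_on with
    | zero => simp
    | add a b ha hb => rw [map_add, map_add, ha, hb]
    | of S y =>
      have e1 : DirectSum.of (fun S : Stacking => (Stk.tens k C S.1 : Type u)) S y =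
        freeIn k C S.1 y := (freeIn_of_valid S.2 y).symm
      rw [e1, decompFree_freeIn S.2]
      exact DirectSum.coeAddMonoidHom_of _ _ _
  · intro x
    induction x using DirectSum.induction_on with
    | zero => simp
    | add a b ha hb => rw [map_add, map_add, ha, hb]
    | of g y =>
      rw [DirectSum.coeAddMonoidHom_of, decompFree_of_mem y.2]
      rfl

/-! ### Bilinear identities on homogeneous elements -/

section bilinear

theorem map₂_mem {M N P : Type*} [AddCommMonoid M] [Module k M] [AddCommMonoid N] [Module k N]
    [AddCommMonoid P] [Module k P] (f : M →ₗ[k] N →ₗ[k] P) {s : Set M} {t : Set N}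
    {W : Submodule k P} (h : ∀ x ∈ s, ∀ y ∈ t, f x y ∈ W) {x : M} {y : N}
    (hx : x ∈ Submodule.span k s) (hy : y ∈ Submodule.span k t) : f x y ∈ W := by
  have := Submodule.apply_mem_map₂ f hx hy
  rw [Submodule.map₂_span_span] at this
  exact Submodule.span_le.2 (by rintro _ ⟨a, ha, b, hb, rfl⟩; exact h a ha b hb) this

theorem graftMul_mem {g h : BoxLabel} {x : FreeBox k C} {r : FreeRow k C}
    (hx : x ∈ homog k C δ g) (hr : r ∈ rowHomog k C δ g.q h) :
    graftMul k C δ x r ∈ homog k C δ (g.stack h) := by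
  refine map₂_mem _ ?_ hx hr
  rintro _ ⟨T, hT, rfl, rfl⟩ _ ⟨R, hR, hl, rfl, rfl⟩
  rw [graftMul_val δ hT hl]
  obtain ⟨h1, h2⟩ := DStk.graft_out (δ := δ) hT hR hl
  exact Submodule.smul_mem _ _ (h2 ▸ DStk.val_mem_homog h1)

theorem rowGraftMul_mem {n : ℕ} {g h : BoxLabel} {x r : FreeRow k C}
    (hx : x ∈ rowHomog k C δ n g) (hr : r ∈ rowHomog k C δ g.q h) :
    rowGraftMul k C δ x r ∈ rowHomog k C δ n (g.stack h) := by
  refine map₂_mem _ ?_ hx hr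
  rintro _ ⟨T, hT, rfl, rfl, rfl⟩ _ ⟨R, hR, hl, rfl, rfl⟩
  rw [rowGraftMul_val δ hl]
  obtain ⟨h1, h2, h3⟩ := DRow.graft_out (δ := δ) hT hR hl
  exact Submodule.smul_mem _ _ (Submodule.subset_span ⟨_, h1, h2, h3, rfl⟩)

theorem nodeMul_mem {g h : BoxLabel} (x : C g) {r : FreeRow k C}
    (hr : r ∈ rowHomog k C δ g.q h) :
    nodeMul k C g x r ∈ homog k C δ ⟨g.p + h.p, h.q, g.r + h.r, δ g + h.deg⟩ := by
  induction hr using Submodule.span_induction with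
  | mem r hr =>
    obtain ⟨R, hR, hl, rfl, rfl⟩ := hr
    rw [nodeMul_val]
    refine Submodule.subset_span ⟨.node _ x R, ⟨hl, hR⟩, ?_, rfl⟩
    simp [Stk.out, DStk.sh, StkRow.out, Stk.left, Stk.right, Stk.inputs]
  | zero => simp
  | add a b _ _ ha hb => rw [map_add]; exact add_mem ha hb
  | smul r a _ h => rw [map_smul]; exact Submodule.smul_mem _ _ h

theorem consMul_mem {g h : BoxLabel} {n : ℕ} {x : FreeBox k C} {r : FreeRow k C}
    (hx : x ∈ homog k C δ g) (hr : r ∈ rowHomog k C δ n h) (hs : g.r = h.p) :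
    consMul k C x r ∈ rowHomog k C δ (n + 1) ⟨g.p, g.q + h.q, h.r, g.deg + h.deg⟩ := by
  refine map₂_mem _ ?_ hx hr
  rintro _ ⟨T, hT, rfl, rfl⟩ _ ⟨R, hR, rfl, rfl, rfl⟩
  rw [consMul_val hT]
  refine Submodule.subset_span ⟨.cons T R, ⟨hT, hR, hs⟩, rfl, ?_, rfl⟩
  simp [StkRow.out, DRow.sh, StkRow.left, StkRow.right, StkRow.inputs, Stk.out]

/-- Associativity of stacking. -/
theorem graftMul_assoc {g h i : BoxLabel} {x : FreeBox k C} {r s : FreeRow k C}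
    (hx : x ∈ homog k C δ g) (hr : r ∈ rowHomog k C δ g.q h) (hs : s ∈ rowHomog k C δ h.q i) :
    graftMul k C δ (graftMul k C δ x r) s = graftMul k C δ x (rowGraftMul k C δ r s) := by
  refine rowHomog_ext (graftMul k C δ (graftMul k C δ x r))
    (graftMul k C δ x ∘ₗ rowGraftMul k C δ r) (fun F hF lF _ => ?_) hs
  refine rowHomog_ext ((graftMul k C δ).flip (F.val k) ∘ₗ graftMul k C δ x)
    (graftMul k C δ x ∘ₗ (rowGraftMul k C δ).flip (F.val k)) (fun R hR lR oR => ?_) hr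
  refine homog_ext ((graftMul k C δ).flip (F.val k) ∘ₗ (graftMul k C δ).flip (R.val k))
    ((graftMul k C δ).flip (rowGraftMul k C δ (R.val k) (F.val k))) (fun T hT oT => ?_) hx
  subst oR oT
  replace lF : F.sh.length = R.sh.inputs := lF
  replace lR : R.sh.length = T.sh.inputs := lR
  simp only [LinearMap.comp_apply, LinearMap.flip_apply]
  obtain ⟨h1, h2⟩ := DStk.graft_out (δ := δ) hT hR lR
  obtain ⟨h1', h2', h3'⟩ := DRow.graft_out (δ := δ) hR hF lF
  rw [graftMul_val δ hT lR, map_smul, LinearMap.smul_apply, graftMul_val δ h1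
    (by rw [lF]; exact (congrArg BoxLabel.q h2).symm), rowGraftMul_val δ lF, map_smul,
    graftMul_val δ hT (by rw [h2', lR]), smul_smul, smul_smul, ← koszul_add, ← koszul_add,
    DStk.shuf_assoc δ T R F hT hR hF lR lF, DStk.graft_assoc T R F hT hR hF lR lF]

theorem graftMul_nodeMul {g h i : BoxLabel} (x : C g) {r s : FreeRow k C}
    (hr : r ∈ rowHomog k C δ g.q h) (hs : s ∈ rowHomog k C δ h.q i) :
    graftMul k C δ (nodeMul k C g x r) s = nodeMul k C g x (rowGraftMul k C δ r s) := by
  refine rowHomog_ext (graftMul k C δ (nodeMul k C g x r))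
    (nodeMul k C g x ∘ₗ rowGraftMul k C δ r) (fun F hF lF _ => ?_) hs
  refine rowHomog_ext ((graftMul k C δ).flip (F.val k) ∘ₗ nodeMul k C g x)
    (nodeMul k C g x ∘ₗ (rowGraftMul k C δ).flip (F.val k)) (fun R hR lR oR => ?_) hr
  subst oR
  replace lF : F.sh.length = R.sh.inputs := lF
  simp only [LinearMap.comp_apply, LinearMap.flip_apply]
  rw [nodeMul_val, rowGraftMul_val δ lF, map_smul, nodeMul_val, graftMul_val (T := .node g x R) δ ⟨lR, hR⟩ lF]
  rfl

theorem rowGraftMul_consMul {g h i j : BoxLabel} {n : ℕ} {x : FreeBox k C} {r s s' : FreeRow k C}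
    (hx : x ∈ homog k C δ g) (hr : r ∈ rowHomog k C δ n h)
    (hs : s ∈ rowHomog k C δ g.q i) (hs' : s' ∈ rowHomog k C δ h.q j) (hij : i.r = j.p) :
    rowGraftMul k C δ (consMul k C x r) (appMul k C s s') = koszul k (h.deg * i.deg) •
      consMul k C (graftMul k C δ x s) (rowGraftMul k C δ r s') := by
  refine rowHomog_ext (rowGraftMul k C δ (consMul k C x r) ∘ₗ appMul k C s)
    (koszul k (h.deg * i.deg) • (consMul k C (graftMul k C δ x s) ∘ₗ rowGraftMul k C δ r))
    (fun F' hF' lF' oF' => ?_) hs'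
  refine rowHomog_ext (rowGraftMul k C δ (consMul k C x r) ∘ₗ (appMul k C).flip (F'.val k))
    (koszul k (h.deg * i.deg) • ((consMul k C).flip (rowGraftMul k C δ r (F'.val k)) ∘ₗ
      graftMul k C δ x)) (fun F hF lF oF => ?_) hs
  refine rowHomog_ext ((rowGraftMul k C δ).flip (appMul k C (F.val k) (F'.val k)) ∘ₗ consMul k C x)
    (koszul k (h.deg * i.deg) • (consMul k C (graftMul k C δ x (F.val k)) ∘ₗ
      (rowGraftMul k C δ).flip (F'.val k))) (fun R hR lR oR => ?_) hr
  refine homog_ext ((rowGraftMul k C δ).flip (appMul k C (F.val k) (F'.val k)) ∘ₗ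
      (consMul k C).flip (R.val k))
    (koszul k (h.deg * i.deg) • ((consMul k C).flip (rowGraftMul k C δ (R.val k) (F'.val k)) ∘ₗ
      (graftMul k C δ).flip (F.val k))) (fun T hT oT => ?_) hx
  subst oR oT oF oF'
  replace lF : F.sh.length = T.sh.inputs := lF
  replace lF' : F'.sh.length = R.sh.inputs := lF'
  replace hij : F.sh.right = F'.sh.left := hij
  simp only [LinearMap.comp_apply, LinearMap.flip_apply, LinearMap.smul_apply]
  have t1 := DRow.take_append F F' hij
  have t2 := DRow.drop_append F F'
  rw [lF] at t1 t2
  have hl : (F.append F').sh.length = (DRow.cons T R).sh.inputs := by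
    rw [DRow.length_append, lF, lF']; rfl
  rw [consMul_val hT, appMul_val hF, rowGraftMul_val δ hl, graftMul_val δ hT lF,
    rowGraftMul_val δ lF', map_smul, map_smul, LinearMap.smul_apply,
    consMul_val (DStk.graft_out (δ := δ) hT hF lF).1, smul_smul, smul_smul, ← koszul_add,
    ← koszul_add]
  have s1 : (DRow.cons T R).graft (F.append F') = .cons (T.graft F) (R.graft F') := by
    rw [DRow.graft, t1, t2]
  have s2 : (DRow.cons T R).sh.shuf δ (F.append F').sh = R.sh.degree δ * F.sh.degree δ +
      T.sh.shuf δ F.sh + R.sh.shuf δ F'.sh := by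
    rw [DRow.sh, StkRow.shuf, ← DRow.sh_take, ← DRow.sh_drop, t1, t2]
  rw [s1, s2]
  congr 2
  simp only [StkRow.out]; ring

theorem rowGraftMul_nil (s s' : ℕ) : rowGraftMul k C δ ((DRow.nil s : DRow C).val k)
    ((DRow.nil s' : DRow C).val k) = (DRow.nil (s + s') : DRow C).val k := by
  rw [rowGraftMul_val δ rfl]
  simp [DRow.sh, StkRow.shuf, DRow.graft, StkRow.left]

end bilinear
end homogeneous

/-! ### The free graded box operad -/

namespace ElemRow
variable {B : Type u}

@[simp] theorem left_take (n : ℕ) (f : ElemRow B) : (f.take n).left = f.left := by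
  cases n <;> cases f <;> simp [take, left]

@[simp] theorem length_drop (n : ℕ) (f : ElemRow B) : (f.drop n).length = f.length - n := by
  induction n generalizing f with
  | zero => simp [drop]
  | succ n ih => cases f <;> simp [drop, length, ih]

theorem length_take {n : ℕ} {f : ElemRow B} (h : n ≤ f.length) : (f.take n).length = n := by
  induction n generalizing f with
  | zero => simp [take, length]
  | succ n ih => cases f with
    | nil => simp [length] at h
    | cons g x c => simp [take, length, ih (by simpa [length] using h)]

theorem Matching.take_drop {k : Type u} [CommRing k] [AddCommGroup B] [Module k B]
    {gr : BoxLabel → Submodule k B} {f : ElemRow B} (h : f.Matching gr) (n : ℕ) :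
    (f.take n).Matching gr ∧ (f.drop n).Matching gr ∧ (f.take n).right = (f.drop n).left := by
  induction n generalizing f with
  | zero => simp [ElemRow.take, ElemRow.drop, Matching, right, h]
  | succ n ih => cases f with
    | nil => simp [ElemRow.take, ElemRow.drop, Matching, right, left]
    | cons g x c =>
      obtain ⟨ht, hc, hs⟩ := h
      obtain ⟨h1, h2, h3⟩ := ih hc
      exact ⟨⟨ht, h1, by simpa using hs⟩, h2, h3⟩

/-- The label of a row of elements: outer sides, vertical inputs and total degree. -/
def label (f : ElemRow B) : BoxLabel := ⟨f.left, f.inputs, f.right, f.deg⟩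

theorem length_eq_zero {f : ElemRow B} (h : f.length = 0) : ∃ s, f = nil s := by
  cases f with
  | nil s => exact ⟨s, rfl⟩
  | cons => simp [length] at h

end ElemRow

theorem StkRow.leaves_spec (n : ℕ) : (StkRow.leaves n).Valid ∧ (StkRow.leaves n).length = n ∧
    (StkRow.leaves n).left = 0 ∧ (StkRow.leaves n).right = 0 ∧ (StkRow.leaves n).inputs = n ∧
    (StkRow.leaves n).boxes = [] := by
  induction n with
  | zero => simp [leaves, Valid, length, left, right, inputs, boxes]
  | succ n ih =>
    obtain ⟨h1, h2, h3, h4, h5, h6⟩ := ih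
    refine ⟨⟨trivial, h1, h3.symm⟩, ?_, rfl, h4, ?_, ?_⟩
    · simp [leaves, length, h2]
    · simp [leaves, inputs, h5, Stk.inputs, add_comm]
    · simp [leaves, boxes, h6, Stk.boxes]

theorem DRow.take_drop_leaves {C : BoxLabel → Type u} (m n : ℕ) :
    (DRow.leaves (m + n) : DRow C).take m = DRow.leaves m ∧
    (DRow.leaves (m + n) : DRow C).drop m = DRow.leaves n := by
  induction m with
  | zero => simp [DRow.take, DRow.drop, DRow.leaves, (StkRow.leaves_spec n).2.2.1]
  | succ m ih =>
    rw [Nat.succ_add]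
    simp [DRow.take, DRow.drop, DRow.leaves, ih]

mutual
theorem DStk.graft_leaves {C : BoxLabel → Type u} {δ : BoxLabel → ℤ} :
    ∀ T : DStk C, T.graft (DRow.leaves T.sh.inputs) = T ∧
    T.sh.shuf δ (DRow.leaves T.sh.inputs : DRow C).sh = 0
  | .leaf => ⟨rfl, rfl⟩
  | .node g x c => by
    obtain ⟨h1, h2⟩ := DRow.graft_leaves c
    exact ⟨congrArg (DStk.node g x) h1, h2⟩
theorem DRow.graft_leaves {C : BoxLabel → Type u} {δ : BoxLabel → ℤ} :
    ∀ T : DRow C, T.graft (DRow.leaves T.sh.inputs) = T ∧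
    T.sh.shuf δ (DRow.leaves T.sh.inputs : DRow C).sh = 0
  | .nil s => ⟨rfl, rfl⟩
  | .cons t c => by
    obtain ⟨h1, h2⟩ := DStk.graft_leaves t
    obtain ⟨h3, h4⟩ := DRow.graft_leaves c
    obtain ⟨e1, e2⟩ := DRow.take_drop_leaves (C := C) t.sh.inputs c.sh.inputs
    constructor
    · change DRow.cons (t.graft ((DRow.leaves (t.sh.inputs + c.sh.inputs)).take t.sh.inputs))
        (c.graft ((DRow.leaves (t.sh.inputs + c.sh.inputs)).drop t.sh.inputs)) = _
      rw [e1, e2, h1, h3]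
    · change StkRow.shuf δ (.cons t.sh c.sh)
        (DRow.leaves (t.sh.inputs + c.sh.inputs) : DRow C).sh = 0
      rw [StkRow.shuf, ← DRow.sh_take, ← DRow.sh_drop, e1, e2, h2, h4]
      simp [StkRow.degree, (StkRow.leaves_spec t.sh.inputs).2.2.2.2.2]
end

section free
variable {k : Type u} [CommRing k]
variable {C : BoxLabel → Type u} [∀ g, AddCommGroup (C g)] [∀ g, Module k (C g)]
variable {δ : BoxLabel → ℤ}

theorem rowOf_nil (s : ℕ) : rowOf k C (.nil s) = (DRow.nil s : DRow C).val k := rfl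

theorem rowOf_mem {xs : ElemRow (FreeBox k C)} (h : xs.Matching (freeBoxOperad k C δ).gr) :
    rowOf k C xs ∈ rowHomog k C δ xs.length xs.label := by
  induction xs with
  | nil s =>
    have h := DRow.val_mem_rowHomog (k := k) (δ := δ) (R := (DRow.nil s : DRow C)) trivial
    rw [rowOf_nil]
    exact h
  | cons g x xs ih =>
    obtain ⟨h1, h2, h3⟩ := h
    rw [freeBoxOperad_gr] at h1
    exact consMul_mem (h := xs.label) h1 (ih h2) h3

theorem rowOf_take_drop (n : ℕ) (xs : ElemRow (FreeBox k C)) :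
    appMul k C (rowOf k C (xs.take n)) (rowOf k C (xs.drop n)) = rowOf k C xs := by
  induction n generalizing xs with
  | zero => cases xs <;> exact appMul_nil _ _
  | succ n ih =>
    cases xs with
    | nil s => exact appMul_nil _ _
    | cons g x xs =>
      simp only [ElemRow.take, ElemRow.drop, rowOf, appMul_consMul, ih]

theorem rowGraftMul_rowOf {xs ys : ElemRow (FreeBox k C)}
    (hx : xs.Matching (freeBoxOperad k C δ).gr) (hy : ys.Matching (freeBoxOperad k C δ).gr)
    (hl : ys.length = xs.inputs) :
    rowGraftMul k C δ (rowOf k C xs) (rowOf k C ys) =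
      BoxOperadData.shuffleSign k xs ys •
        rowOf k C ((freeBoxOperad k C δ).compRow xs ys) := by
  induction xs generalizing ys with
  | nil s =>
    obtain ⟨s', rfl⟩ := ElemRow.length_eq_zero hl
    rw [rowOf_nil, rowOf_nil, rowGraftMul_nil]
    simp [BoxOperadData.shuffleSign, BoxOperadData.compRow, rowOf_nil, ElemRow.left]
  | cons g x xs ih =>
    obtain ⟨h1, h2, h3⟩ := hx
    rw [freeBoxOperad_gr] at h1
    obtain ⟨m1, m2, m3⟩ := hy.take_drop g.q
    replace hl : ys.length = g.q + xs.inputs := hl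
    have l1 : (ys.take g.q).length = g.q := ElemRow.length_take (by omega)
    have l2 : (ys.drop g.q).length = xs.inputs := by simp [hl]
    have r1 := rowOf_mem m1
    have r2 := rowOf_mem m2
    rw [l1] at r1
    rw [l2] at r2
    rw [← rowOf_take_drop g.q ys, rowOf, rowGraftMul_consMul h1 (rowOf_mem h2) r1 r2 m3,
      ih h2 m2 l2, BoxOperadData.shuffleSign, BoxOperadData.compRow, rowOf, map_smul, smul_smul]
    rfl

theorem shuffleSign_mul_self {B : Type u} (xs ys : ElemRow B) :
    BoxOperadData.shuffleSign k xs ys * BoxOperadData.shuffleSign k xs ys = 1 := by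
  induction xs generalizing ys with
  | nil s => simp [BoxOperadData.shuffleSign]
  | cons g x xs ih =>
    rw [BoxOperadData.shuffleSign, mul_mul_mul_comm, ih, koszul_mul_self, one_mul]

theorem rowOf_units (n : ℕ) :
    rowOf k C (ElemRow.units (freeBoxOperad k C δ).one n) = (DRow.leaves n : DRow C).val k := by
  induction n with
  | zero => rfl
  | succ n ih =>
    rw [ElemRow.units, rowOf, ih]
    exact consMul_val (T := .leaf) trivial _

theorem graftMul_leaves {g : BoxLabel} {x : FreeBox k C} (hx : x ∈ homog k C δ g) :
    graftMul k C δ x ((DRow.leaves g.q : DRow C).val k) = x := by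
  refine homog_ext ((graftMul k C δ).flip _) LinearMap.id (fun T hT oT => ?_) hx
  subst oT
  obtain ⟨h1, h2⟩ := DStk.graft_leaves (δ := δ) T
  rw [LinearMap.flip_apply]
  change graftMul k C δ (T.val k) ((DRow.leaves T.sh.inputs : DRow C).val k) = T.val k
  rw [graftMul_val δ hT (by simp [(StkRow.leaves_spec _).2.1]), h1, h2, koszul_zero, one_smul]

theorem graftMul_one {g : BoxLabel} {x : FreeBox k C} (hx : x ∈ homog k C δ g) (s : ℕ) :
    graftMul k C δ ((DStk.leaf : DStk C).val k)
      (consMul k C x ((DRow.nil s : DRow C).val k)) = x := by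
  refine homog_ext (graftMul k C δ ((DStk.leaf : DStk C).val k) ∘ₗ
    (consMul k C).flip ((DRow.nil s : DRow C).val k)) LinearMap.id (fun T hT oT => ?_) hx
  simp only [LinearMap.comp_apply, LinearMap.flip_apply, LinearMap.id_apply]
  rw [consMul_val hT, graftMul_val (T := .leaf) δ trivial rfl]
  simp [DStk.sh, Stk.shuf, DStk.graft]

theorem rowOf_prepend (l : List (BoxLabel × FreeBox k C)) :
    ∃ L : FreeRow k C →ₗ[k] FreeRow k C, ∀ xs, rowOf k C (ElemRow.prepend l xs) = L (rowOf k C xs) := by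
  induction l with
  | nil => exact ⟨LinearMap.id, fun _ => rfl⟩
  | cons a l ih =>
    obtain ⟨L, hL⟩ := ih
    exact ⟨consMul k C a.2 ∘ₗ L, fun xs => by simp [ElemRow.prepend, rowOf, hL]⟩

theorem BoxLabel.comp_eq_stack {B : Type u} (g : BoxLabel) (xs : ElemRow B) :
    g.comp xs = g.stack xs.label := rfl

theorem freeBoxOperad_comp_linear_row (x : FreeBox k C) (l : List (BoxLabel × FreeBox k C))
    (g : BoxLabel) (xs : ElemRow (FreeBox k C)) : IsLinearMap k fun y =>
      graftMul k C δ x (rowOf k C (ElemRow.prepend l (.cons g y xs))) := by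
  obtain ⟨L, hL⟩ := rowOf_prepend l
  simp only [hL, rowOf]
  exact (graftMul k C δ x ∘ₗ L ∘ₗ (consMul k C).flip (rowOf k C xs)).isLinear

theorem freeBoxOperad_comp_assoc (g : BoxLabel) (x : FreeBox k C) (xs ys : ElemRow (FreeBox k C))
    (hx : x ∈ homog k C δ g) (hxs : xs.Matching (freeBoxOperad k C δ).gr) (hl : xs.length = g.q)
    (hys : ys.Matching (freeBoxOperad k C δ).gr) (hl' : ys.length = xs.inputs) :
    graftMul k C δ x (rowOf k C ((freeBoxOperad k C δ).compRow xs ys)) =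
      BoxOperadData.shuffleSign k xs ys •
        graftMul k C δ (graftMul k C δ x (rowOf k C xs)) (rowOf k C ys) := by
  have h1 := rowOf_mem hys
  rw [hl'] at h1
  have h2 := rowOf_mem hxs
  rw [hl] at h2
  rw [graftMul_assoc hx h2 (i := ys.label) h1, rowGraftMul_rowOf hxs hys hl', map_smul,
    smul_smul, shuffleSign_mul_self, one_smul]

theorem freeBoxOperad_comp_mem (g : BoxLabel) (x : FreeBox k C) (xs : ElemRow (FreeBox k C))
    (hx : x ∈ homog k C δ g) (hxs : xs.Matching (freeBoxOperad k C δ).gr) (hl : xs.length = g.q) :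
    graftMul k C δ x (rowOf k C xs) ∈ homog k C δ (g.comp xs) := by
  have h2 := rowOf_mem hxs
  rw [hl] at h2
  rw [BoxLabel.comp_eq_stack]
  exact graftMul_mem hx h2

variable (k C δ) in
/-- Stackings, with decorations in `C`, form a graded box operad. -/
theorem freeBoxOperad_isGraded : (freeBoxOperad k C δ).IsGradedBoxOperad := by
  have hgr : (freeBoxOperad k C δ).gr = homog k C δ := funext fun g => freeBoxOperad_gr g
  refine ⟨?_, ?_, ?_, ?_, ?_, ?_, ?_, ?_⟩
  · rw [hgr]
    exact homog_isInternal
  · exact fun xs => ((graftMul k C δ).flip (rowOf k C xs)).isLinear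
  · exact freeBoxOperad_comp_linear_row
  · intro g x xs hx hxs hl
    rw [freeBoxOperad_gr] at hx ⊢
    exact freeBoxOperad_comp_mem g x xs hx hxs hl
  · rw [freeBoxOperad_gr]
    exact DStk.val_mem_homog (T := .leaf) trivial
  · intro g x hx
    rw [freeBoxOperad_gr] at hx
    exact graftMul_one hx g.r
  · intro g x hx
    rw [freeBoxOperad_gr] at hx
    change graftMul k C δ x (rowOf k C _) = x
    rw [rowOf_units, graftMul_leaves hx]
  · intro g x xs ys hx hxs hl hys hl'
    rw [freeBoxOperad_gr] at hx
    exact freeBoxOperad_comp_assoc g x xs ys hx hxs hl hys hl'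

end free

/-! ### Derivations of the free box operad -/

section derivation
variable {k : Type u} [CommRing k]
variable {C : BoxLabel → Type u} [∀ g, AddCommGroup (C g)] [∀ g, Module k (C g)]
variable {δ : BoxLabel → ℤ}

/-- Linear maps on `T(C)` are determined by their values on decorated stackings. -/
theorem freeBox_ext {M : Type*} [AddCommMonoid M] [Module k M] {f f' : FreeBox k C →ₗ[k] M}
    (h : ∀ T : DStk C, T.sh.Valid → f (T.val k) = f' (T.val k)) : f = f' := by
  refine DirectSum.linearMap_ext k fun S => LinearMap.ext fun y => ?_
  induction Stk.exists_rep S.1 y using Submodule.span_induction with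
  | mem y hy =>
    obtain ⟨T, hT⟩ := hy
    have h1 := hT.freeIn
    rw [freeIn_of_valid S.2] at h1
    have h2 := h T (hT.shape ▸ S.2)
    rw [← h1] at h2
    exact h2
  | zero => simp
  | add a b _ _ ha hb => rw [map_add, map_add, ha, hb]
  | smul r a _ h => rw [map_smul, map_smul, h]

theorem freeRow_ext {M : Type*} [AddCommMonoid M] [Module k M] {f f' : FreeRow k C →ₗ[k] M}
    (h : ∀ R : DRow C, f (R.val k) = f' (R.val k)) : f = f' := by
  refine DirectSum.linearMap_ext k fun S => LinearMap.ext fun y => ?_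
  induction StkRow.exists_rep S y using Submodule.span_induction with
  | mem y hy =>
    obtain ⟨T, hT⟩ := hy
    have h1 := hT.rowIn
    have h2 := h T
    rw [← h1] at h2
    exact h2
  | zero => simp
  | add a b _ _ ha hb => rw [map_add, map_add, ha, hb]
  | smul r a _ h => rw [map_smul, map_smul, h]

variable (k C δ) in
/-- The action of the derivation `freeDeriv` on rows. -/
noncomputable def rowDeriv (ψ : ∀ g, C g →ₗ[k] FreeBox k C) : FreeRow k C →ₗ[k] FreeRow k C :=
  DirectSum.toModule k StkRow (FreeRow k C) fun c => c.derivMap k C δ ψ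

variable (ψ : ∀ g, C g →ₗ[k] FreeBox k C)

theorem freeDeriv_freeIn {t : Stk} (h : t.Valid) (y : Stk.tens k C t) :
    freeDeriv k C δ ψ (freeIn k C t y) = t.derivMap k C δ ψ y := by
  rw [freeIn_of_valid h, freeDeriv, DirectSum.toModule_lof]

theorem rowDeriv_rowIn (c : StkRow) (y : StkRow.tens k C c) :
    rowDeriv k C δ ψ (rowIn k C c y) = c.derivMap k C δ ψ y := by
  rw [rowIn, rowDeriv, DirectSum.toModule_lof]

theorem freeDeriv_one : freeDeriv k C δ ψ ((DStk.leaf : DStk C).val k) = 0 := by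
  rw [DStk.val, freeDeriv_freeIn ψ (t := (DStk.leaf : DStk C).sh) trivial]
  rfl

theorem rowDeriv_nil (s : ℕ) : rowDeriv k C δ ψ ((DRow.nil s : DRow C).val k) = 0 := by
  rw [DRow.val, rowDeriv_rowIn]
  rfl

theorem freeDeriv_nodeMul {g h : BoxLabel} (x : C g) {r : FreeRow k C}
    (hr : r ∈ rowHomog k C δ g.q h) : freeDeriv k C δ ψ (nodeMul k C g x r) =
      graftMul k C δ (ψ g x) r + koszul k (δ g) • nodeMul k C g x (rowDeriv k C δ ψ r) := by
  refine rowHomog_ext (freeDeriv k C δ ψ ∘ₗ nodeMul k C g x)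
    (graftMul k C δ (ψ g x) + koszul k (δ g) • (nodeMul k C g x ∘ₗ rowDeriv k C δ ψ))
    (fun R hR lR _ => ?_) hr
  simp only [LinearMap.comp_apply, LinearMap.add_apply, LinearMap.smul_apply]
  rw [DRow.val, nodeMul_rowIn, freeDeriv_freeIn ψ (t := .node g R.sh) ⟨lR, hR⟩, rowDeriv_rowIn]
  rfl

theorem rowDeriv_consMul {g : BoxLabel} {x : FreeBox k C} (hx : x ∈ homog k C δ g)
    (r : FreeRow k C) : rowDeriv k C δ ψ (consMul k C x r) =
      consMul k C (freeDeriv k C δ ψ x) r +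
        koszul k g.deg • consMul k C x (rowDeriv k C δ ψ r) := by
  refine homog_ext (rowDeriv k C δ ψ ∘ₗ (consMul k C).flip r)
    ((consMul k C).flip r ∘ₗ freeDeriv k C δ ψ +
      koszul k g.deg • (consMul k C).flip (rowDeriv k C δ ψ r)) (fun T hT oT => ?_) hx
  subst oT
  have : rowDeriv k C δ ψ ∘ₗ consMul k C (T.val k) =
      consMul k C (freeDeriv k C δ ψ (T.val k)) + koszul k (T.sh.out δ).deg •
        (consMul k C (T.val k) ∘ₗ rowDeriv k C δ ψ) := by
    refine freeRow_ext fun R => ?_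
    simp only [LinearMap.comp_apply, LinearMap.add_apply, LinearMap.smul_apply]
    rw [DRow.val, DStk.val, consMul_freeIn hT, freeDeriv_freeIn ψ hT, rowDeriv_rowIn,
      rowDeriv_rowIn]
    rfl
  exact LinearMap.congr_fun this r

theorem rowDeriv_appMul : ∀ {R : DRow C} (_ : R.sh.Valid) (r : FreeRow k C),
    rowDeriv k C δ ψ (appMul k C (R.val k) r) = appMul k C (rowDeriv k C δ ψ (R.val k)) r +
      koszul k (R.sh.degree δ) • appMul k C (R.val k) (rowDeriv k C δ ψ r)
  | .nil s, _, r => by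
    rw [appMul_nil, appMul_nil, rowDeriv_nil]
    simp [DRow.sh]
  | .cons T R, h, r => by
    have hT := DStk.val_mem_homog (k := k) (δ := δ) h.1
    have ih := rowDeriv_appMul h.2.1 r
    rw [← consMul_val h.1, appMul_consMul, rowDeriv_consMul ψ hT, ih, rowDeriv_consMul ψ hT,
      appMul_consMul, DRow.sh, StkRow.degree_cons, koszul_add]
    simp only [map_add, map_smul, LinearMap.add_apply, LinearMap.smul_apply, appMul_consMul,
      smul_add, smul_smul, add_assoc]
    rfl

variable {ψ}

variable (δ) in
/-- `ψ` preserves arities and lowers degrees by one. -/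
abbrev LowersDegree (ψ : ∀ g, C g →ₗ[k] FreeBox k C) : Prop :=
  ∀ g x, ψ g x ∈ homog k C δ ⟨g.p, g.q, g.r, δ g - 1⟩

mutual
theorem DStk.freeDeriv_val_mem (hψ : LowersDegree δ ψ) : ∀ T : DStk C, T.sh.Valid →
    freeDeriv k C δ ψ (T.val k) ∈ homog k C δ (T.sh.out δ).pred
  | .leaf, _ => by simp [freeDeriv_one]
  | .node g x R, h => by
    have hR := DRow.val_mem_rowHomog (k := k) (δ := δ) h.2
    rw [show R.sh.length = g.q from h.1] at hR
    have h2 := DRow.rowDeriv_val_mem hψ R h.2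
    rw [show R.sh.length = g.q from h.1] at h2
    rw [← nodeMul_val, freeDeriv_nodeMul ψ x hR]
    have e1 := graftMul_mem (g := ⟨g.p, g.q, g.r, δ g - 1⟩) (hψ g x) hR
    have e2 := nodeMul_mem x h2
    have l1 : BoxLabel.stack ⟨g.p, g.q, g.r, δ g - 1⟩ (R.sh.out δ) =
        ((DStk.node g x R).sh.out δ).pred := by
      simp [BoxLabel.stack, BoxLabel.pred, StkRow.out, Stk.out, DStk.sh, Stk.left, Stk.right,
        Stk.inputs]; ring
    have l2 : (⟨g.p + (R.sh.out δ).pred.p, (R.sh.out δ).pred.q, g.r + (R.sh.out δ).pred.r,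
        δ g + (R.sh.out δ).pred.deg⟩ : BoxLabel) = ((DStk.node g x R).sh.out δ).pred := by
      simp [BoxLabel.pred, StkRow.out, Stk.out, DStk.sh, Stk.left, Stk.right,
        Stk.inputs]; ring
    rw [l1] at e1
    rw [l2] at e2
    exact add_mem e1 (Submodule.smul_mem _ _ e2)
theorem DRow.rowDeriv_val_mem (hψ : LowersDegree δ ψ) : ∀ R : DRow C, R.sh.Valid →
    rowDeriv k C δ ψ (R.val k) ∈ rowHomog k C δ R.sh.length (R.sh.out δ).pred
  | .nil s, _ => by simp [rowDeriv_nil]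
  | .cons T R, h => by
    have hT := DStk.val_mem_homog (k := k) (δ := δ) h.1
    have hR := DRow.val_mem_rowHomog (k := k) (δ := δ) h.2.1
    rw [← consMul_val h.1, rowDeriv_consMul ψ hT]
    have e1 := consMul_mem (DStk.freeDeriv_val_mem hψ T h.1) hR h.2.2
    have e2 := consMul_mem hT (DRow.rowDeriv_val_mem hψ R h.2.1) h.2.2
    have l1 : (⟨(T.sh.out δ).pred.p, (T.sh.out δ).pred.q + (R.sh.out δ).q, (R.sh.out δ).r,
        (T.sh.out δ).pred.deg + (R.sh.out δ).deg⟩ : BoxLabel) =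
        ((DRow.cons T R).sh.out δ).pred := by
      simp [BoxLabel.pred, StkRow.out, Stk.out, DRow.sh, StkRow.left, StkRow.right,
        StkRow.inputs]; ring
    have l2 : (⟨(T.sh.out δ).p, (T.sh.out δ).q + (R.sh.out δ).pred.q, (R.sh.out δ).pred.r,
        (T.sh.out δ).deg + (R.sh.out δ).pred.deg⟩ : BoxLabel) =
        ((DRow.cons T R).sh.out δ).pred := by
      simp [BoxLabel.pred, StkRow.out, Stk.out, DRow.sh, StkRow.left, StkRow.right,
        StkRow.inputs]; ring
    rw [l1] at e1
    rw [l2] at e2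
    exact add_mem e1 (Submodule.smul_mem _ _ e2)
end

theorem freeDeriv_mem (hψ : LowersDegree δ ψ) {g : BoxLabel} {x : FreeBox k C}
    (hx : x ∈ homog k C δ g) :
    freeDeriv k C δ ψ x ∈ homog k C δ g.pred := by
  have : homog k C δ g ≤ (homog k C δ g.pred).comap (freeDeriv k C δ ψ) := by
    refine Submodule.span_le.2 ?_
    rintro _ ⟨T, hT, rfl, rfl⟩
    exact DStk.freeDeriv_val_mem hψ T hT
  exact this hx

theorem rowDeriv_mem (hψ : LowersDegree δ ψ) {n : ℕ} {g : BoxLabel} {x : FreeRow k C}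
    (hx : x ∈ rowHomog k C δ n g) :
    rowDeriv k C δ ψ x ∈ rowHomog k C δ n g.pred := by
  have : rowHomog k C δ n g ≤ (rowHomog k C δ n g.pred).comap (rowDeriv k C δ ψ) := by
    refine Submodule.span_le.2 ?_
    rintro _ ⟨T, hT, rfl, rfl, rfl⟩
    exact DRow.rowDeriv_val_mem hψ T hT
  exact this hx

mutual
/-- The Leibniz rule for stacking on top of a decorated stacking. -/
theorem DStk.freeDeriv_graftMul (hψ : LowersDegree δ ψ) : ∀ T : DStk C, T.sh.Valid →
    ∀ {h : BoxLabel} {r : FreeRow k C},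
    r ∈ rowHomog k C δ T.sh.inputs h → freeDeriv k C δ ψ (graftMul k C δ (T.val k) r) =
      graftMul k C δ (freeDeriv k C δ ψ (T.val k)) r +
        koszul k (T.sh.degree δ) • graftMul k C δ (T.val k) (rowDeriv k C δ ψ r)
  | .leaf, _, h, r, hr => by
    refine rowHomog_ext (freeDeriv k C δ ψ ∘ₗ graftMul k C δ ((DStk.leaf : DStk C).val k))
      (graftMul k C δ (freeDeriv k C δ ψ ((DStk.leaf : DStk C).val k)) +
        koszul k ((DStk.leaf : DStk C).sh.degree δ) •
          (graftMul k C δ ((DStk.leaf : DStk C).val k) ∘ₗ rowDeriv k C δ ψ))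
      (fun R hR lR _ => ?_) hr
    match R, hR, lR with
    | .cons T (.nil s), hR, lR =>
      have hT := DStk.val_mem_homog (k := k) (δ := δ) hR.1
      simp only [LinearMap.comp_apply, LinearMap.add_apply, LinearMap.smul_apply]
      rw [freeDeriv_one, ← consMul_val hR.1, graftMul_one hT, rowDeriv_consMul ψ hT,
        rowDeriv_nil, map_add, graftMul_one (DStk.freeDeriv_val_mem hψ T hR.1)]
      simp [DStk.sh]
    | .cons T (.cons T' R), hR, lR =>
      simp [DRow.sh, StkRow.length, DStk.sh, Stk.inputs] at lR
    | .nil s, hR, lR => simp [DRow.sh, StkRow.length, DStk.sh, Stk.inputs] at lR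
  | .node g x R, hT, h, r, hr => by
    have hl : R.sh.length = g.q := hT.1
    have hR := DRow.val_mem_rowHomog (k := k) (δ := δ) hT.2
    have hR' := DRow.rowDeriv_val_mem hψ R hT.2
    rw [hl] at hR hR'
    have ih := DRow.rowDeriv_rowGraftMul hψ R hT.2 (r := r) hr
    rw [← nodeMul_val, graftMul_nodeMul x hR hr, freeDeriv_nodeMul ψ x (rowGraftMul_mem hR hr),
      freeDeriv_nodeMul ψ x hR, ih]
    simp only [map_add, LinearMap.add_apply, map_smul, LinearMap.smul_apply]
    rw [graftMul_assoc (g := ⟨g.p, g.q, g.r, δ g - 1⟩) (hψ g x) hR hr,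
      graftMul_nodeMul x hR' hr, graftMul_nodeMul x hR (rowDeriv_mem hψ hr), DStk.sh,
      Stk.degree_node, koszul_add]
    simp only [smul_add, smul_smul, add_assoc]
theorem DRow.rowDeriv_rowGraftMul (hψ : LowersDegree δ ψ) : ∀ T : DRow C, T.sh.Valid →
    ∀ {h : BoxLabel} {r : FreeRow k C},
    r ∈ rowHomog k C δ T.sh.inputs h → rowDeriv k C δ ψ (rowGraftMul k C δ (T.val k) r) =
      rowGraftMul k C δ (rowDeriv k C δ ψ (T.val k)) r +
        koszul k (T.sh.degree δ) • rowGraftMul k C δ (T.val k) (rowDeriv k C δ ψ r)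
  | .nil s, _, h, r, hr => by
    refine rowHomog_ext (rowDeriv k C δ ψ ∘ₗ rowGraftMul k C δ ((DRow.nil s : DRow C).val k))
      (rowGraftMul k C δ (rowDeriv k C δ ψ ((DRow.nil s : DRow C).val k)) +
        koszul k ((DRow.nil s : DRow C).sh.degree δ) •
          (rowGraftMul k C δ ((DRow.nil s : DRow C).val k) ∘ₗ rowDeriv k C δ ψ))
      (fun R hR lR _ => ?_) hr
    match R, hR, lR with
    | .cons T R, hR, lR => simp [DRow.sh, StkRow.length, StkRow.inputs] at lR
    | .nil s', hR, lR =>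
      simp only [LinearMap.comp_apply, LinearMap.add_apply, LinearMap.smul_apply]
      rw [rowDeriv_nil, rowDeriv_nil, rowGraftMul_nil, rowDeriv_nil]
      simp
  | .cons T R, hv, h, r, hr => by
    refine rowHomog_ext (rowDeriv k C δ ψ ∘ₗ rowGraftMul k C δ ((DRow.cons T R).val k))
      (rowGraftMul k C δ (rowDeriv k C δ ψ ((DRow.cons T R).val k)) +
        koszul k ((DRow.cons T R : DRow C).sh.degree δ) •
          (rowGraftMul k C δ ((DRow.cons T R).val k) ∘ₗ rowDeriv k C δ ψ))
      (fun F hF lF _ => ?_) hr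
    simp only [LinearMap.comp_apply, LinearMap.add_apply, LinearMap.smul_apply]
    have hT := DStk.val_mem_homog (k := k) (δ := δ) hv.1
    have hT' := DStk.freeDeriv_val_mem hψ T hv.1
    have hR := DRow.val_mem_rowHomog (k := k) (δ := δ) hv.2.1
    have hR' := DRow.rowDeriv_val_mem hψ R hv.2.1
    have lF' : F.sh.length = T.sh.inputs + R.sh.inputs := lF
    obtain ⟨v1, v2, v3⟩ := hF.take_drop T.sh.inputs
    rw [← DRow.sh_take] at v1 v3
    rw [← DRow.sh_drop] at v2 v3
    have l1 : (F.take T.sh.inputs).sh.length = T.sh.inputs := by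
      rw [DRow.sh_take]; exact StkRow.length_take (by omega)
    have l2 : (F.drop T.sh.inputs).sh.length = R.sh.inputs := by
      simp [lF']
    rw [← DRow.append_take_drop T.sh.inputs F]
    generalize F.take T.sh.inputs = F₁ at *
    generalize F.drop T.sh.inputs = F₂ at *
    have m1 := DRow.val_mem_rowHomog (k := k) (δ := δ) v1
    have m2 := DRow.val_mem_rowHomog (k := k) (δ := δ) v2
    have m1' := DRow.rowDeriv_val_mem hψ F₁ v1
    have m2' := DRow.rowDeriv_val_mem hψ F₂ v2
    rw [l1] at m1 m1'
    rw [l2] at m2 m2'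
    have i1 := DStk.freeDeriv_graftMul hψ T hv.1 m1
    have i2 := DRow.rowDeriv_rowGraftMul hψ R hv.2.1 m2
    rw [← consMul_val hv.1, ← appMul_val v1, rowGraftMul_consMul hT hR m1 m2 v3, map_smul,
      rowDeriv_consMul ψ (graftMul_mem hT m1), i1, i2, rowDeriv_consMul ψ hT, rowDeriv_appMul ψ v1]
    simp only [map_add, map_smul, LinearMap.add_apply, LinearMap.smul_apply]
    rw [rowGraftMul_consMul hT' hR m1 m2 v3, rowGraftMul_consMul hT hR' m1 m2 v3,
      rowGraftMul_consMul hT hR m1' m2 v3, rowGraftMul_consMul hT hR m1 m2' v3]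
    simp only [BoxLabel.stack, BoxLabel.pred, Stk.out, StkRow.out, DRow.sh, StkRow.degree_cons,
      sub_mul, mul_sub, koszul_add, koszul_sub, one_mul, mul_one]
    have e := koszul_mul_self k (R.sh.degree δ)
    match_scalars
    · ring
    · linear_combination (-koszul k (R.sh.degree δ * F₁.sh.degree δ) *
        koszul k (T.sh.degree δ)) * e
    · ring
    · ring
end

theorem freeDeriv_graftMul (hψ : LowersDegree δ ψ) {g h : BoxLabel} {x : FreeBox k C}
    {r : FreeRow k C}
    (hx : x ∈ homog k C δ g) (hr : r ∈ rowHomog k C δ g.q h) :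
    freeDeriv k C δ ψ (graftMul k C δ x r) = graftMul k C δ (freeDeriv k C δ ψ x) r +
        koszul k g.deg • graftMul k C δ x (rowDeriv k C δ ψ r) := by
  refine homog_ext (freeDeriv k C δ ψ ∘ₗ (graftMul k C δ).flip r)
    ((graftMul k C δ).flip r ∘ₗ freeDeriv k C δ ψ +
      koszul k g.deg • (graftMul k C δ).flip (rowDeriv k C δ ψ r)) (fun T hT oT => ?_) hx
  subst oT
  exact DStk.freeDeriv_graftMul hψ T hT hr

theorem leibniz_freeDeriv (L : FreeRow k C →ₗ[k] FreeBox k C) {xs : ElemRow (FreeBox k C)}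
    (h : xs.Matching (freeBoxOperad k C δ).gr) :
    BoxOperadData.leibniz k (freeDeriv k C δ ψ) (fun ys => L (rowOf k C ys)) xs =
      L (rowDeriv k C δ ψ (rowOf k C xs)) := by
  induction xs generalizing L with
  | nil s => rw [BoxOperadData.leibniz, rowOf_nil, rowDeriv_nil, map_zero]
  | cons g x xs ih =>
    obtain ⟨h1, h2, h3⟩ := h
    rw [freeBoxOperad_gr] at h1
    rw [BoxOperadData.leibniz, show rowOf k C (.cons g x xs) = consMul k C x (rowOf k C xs) from rfl,
      rowDeriv_consMul ψ h1, map_add, map_smul]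
    congr 2
    exact ih (L ∘ₗ consMul k C x) h2

/-- `freeDeriv ψ` is a derivation of the free box operad. -/
theorem freeDeriv_isDerivation (hψ : LowersDegree δ ψ) :
    (freeBoxOperad k C δ).IsDerivation (freeDeriv k C δ ψ) := by
  refine ⟨?_, ?_, ?_⟩
  · intro g x hx
    rw [freeBoxOperad_gr] at hx ⊢
    exact freeDeriv_mem hψ hx
  · exact freeDeriv_one ψ
  · intro g x xs hx hxs hl
    rw [freeBoxOperad_gr] at hx
    have h1 := rowOf_mem hxs
    rw [hl] at h1
    have h2 := leibniz_freeDeriv (ψ := ψ) (graftMul k C δ x) hxs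
    have h3 := freeDeriv_graftMul hψ hx h1
    rw [← h2] at h3
    exact h3

theorem rowDeriv_leaves (n : ℕ) : rowDeriv k C δ ψ ((DRow.leaves n : DRow C).val k) = 0 := by
  induction n with
  | zero => exact rowDeriv_nil ψ 0
  | succ n ih =>
    have h : (DRow.leaves (n + 1) : DRow C).val k =
      consMul k C ((DStk.leaf : DStk C).val k) ((DRow.leaves n : DRow C).val k) :=
      (consMul_val (T := .leaf) trivial _).symm
    rw [h, rowDeriv_consMul ψ (DStk.val_mem_homog (T := .leaf) trivial), ih, freeDeriv_one]
    simp

theorem freeGen_eq_val (g : BoxLabel) (x : C g) :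
    freeGen k C g x = (DStk.node g x (DRow.leaves g.q)).val k := by
  have h : ∀ n, (DRow.leaves n : DRow C).Rep k (StkRow.leaves n) (tensOnes k C n) := by
    intro n
    induction n with
    | zero => exact rfl
    | succ n ih => exact DStk.Rep.cons (T := .leaf) rfl ih
  exact (h g.q).node.freeIn

theorem leaves_mem (n : ℕ) : (DRow.leaves n : DRow C).val k ∈ rowHomog k C δ n ⟨0, n, 0, 0⟩ := by
  obtain ⟨h1, h2, h3, h4, h5, h6⟩ := StkRow.leaves_spec n
  refine Submodule.subset_span ⟨_, by simpa using h1, by simpa using h2, ?_, rfl⟩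
  simp [StkRow.out, h3, h4, h5, StkRow.degree, h6]

theorem freeDeriv_freeGen (hψ : LowersDegree δ ψ) (g : BoxLabel) (x : C g) :
    freeDeriv k C δ ψ (freeGen k C g x) = ψ g x := by
  rw [freeGen_eq_val, ← nodeMul_val, freeDeriv_nodeMul ψ x (leaves_mem _),
    rowDeriv_leaves, map_zero, smul_zero, add_zero,
    graftMul_leaves (g := ⟨g.p, g.q, g.r, δ g - 1⟩) (hψ g x)]

mutual
theorem DStk.freeDeriv_sq (hψ : LowersDegree δ ψ) (h : ∀ g x, freeDeriv k C δ ψ (ψ g x) = 0) :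
    ∀ T : DStk C, T.sh.Valid →
    freeDeriv k C δ ψ (freeDeriv k C δ ψ (T.val k)) = 0
  | .leaf, _ => by rw [freeDeriv_one, map_zero]
  | .node g x R, hT => by
    have hl : R.sh.length = g.q := hT.1
    have hR := DRow.val_mem_rowHomog (k := k) (δ := δ) hT.2
    have hR' := DRow.rowDeriv_val_mem hψ R hT.2
    rw [hl] at hR hR'
    rw [← nodeMul_val, freeDeriv_nodeMul ψ x hR, map_add, map_smul,
      freeDeriv_graftMul hψ (g := ⟨g.p, g.q, g.r, δ g - 1⟩) (hψ g x) hR, h,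
      freeDeriv_nodeMul ψ x hR', DRow.rowDeriv_sq hψ h R hT.2, koszul_sub_one]
    simp
theorem DRow.rowDeriv_sq (hψ : LowersDegree δ ψ) (h : ∀ g x, freeDeriv k C δ ψ (ψ g x) = 0) :
    ∀ T : DRow C, T.sh.Valid →
    rowDeriv k C δ ψ (rowDeriv k C δ ψ (T.val k)) = 0
  | .nil s, _ => by rw [rowDeriv_nil, map_zero]
  | .cons T R, hv => by
    have hT := DStk.val_mem_homog (k := k) (δ := δ) hv.1
    have hT' := DStk.freeDeriv_val_mem hψ T hv.1
    rw [← consMul_val hv.1, rowDeriv_consMul ψ hT, map_add, map_smul, rowDeriv_consMul ψ hT',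
      rowDeriv_consMul ψ hT, DStk.freeDeriv_sq hψ h T hv.1, DRow.rowDeriv_sq hψ h R hv.2.1,
      BoxLabel.pred, koszul_sub_one]
    simp
end

/-- The square of an odd derivation is a derivation, so that it vanishes as soon as it vanishes on
the generators. -/
theorem freeDeriv_comp_self (hψ : LowersDegree δ ψ) (h : ∀ g x, freeDeriv k C δ ψ (ψ g x) = 0) :
    freeDeriv k C δ ψ ∘ₗ freeDeriv k C δ ψ = 0 :=
  freeBox_ext fun T hT => DStk.freeDeriv_sq hψ h T hT

end derivation

theorem DRow.leaves_graft {C : BoxLabel → Type u} {δ : BoxLabel → ℤ} (n : ℕ) (R : DRow C)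
    (h : R.sh.length = n) :
    (DRow.leaves n).graft R = R ∧ (DRow.leaves n : DRow C).sh.shuf δ R.sh = 0 := by
  induction n generalizing R with
  | zero =>
    cases R with
    | nil s => simp [DRow.leaves, DRow.graft, DRow.sh, StkRow.left, StkRow.shuf]
    | cons => simp [DRow.sh, StkRow.length] at h
  | succ n ih =>
    cases R with
    | nil s => simp [DRow.sh, StkRow.length] at h
    | cons T R =>
      obtain ⟨h1, h2⟩ := ih R (by simpa [DRow.sh, StkRow.length] using h)
      constructor
      · exact congrArg (DRow.cons T) h1
      · simp only [DRow.sh_leaves] at h2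
        simp [DRow.leaves, DRow.sh, StkRow.shuf, DStk.sh, Stk.shuf, Stk.inputs, StkRow.drop, h2,
          StkRow.degree, (StkRow.leaves_spec n).2.2.2.2.2]

section uniqueness
variable {k : Type u} [CommRing k]
variable {C : BoxLabel → Type u} [∀ g, AddCommGroup (C g)] [∀ g, Module k (C g)]
variable {δ : BoxLabel → ℤ}

theorem graftMul_freeGen {g : BoxLabel} (x : C g) {R : DRow C} (h : R.sh.length = g.q) :
    graftMul k C δ (freeGen k C g x) (R.val k) = (DStk.node g x R).val k := by
  obtain ⟨h1, h2⟩ := DRow.leaves_graft (δ := δ) g.q R h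
  obtain ⟨v1, v2, v3, v4, v5, v6⟩ := StkRow.leaves_spec g.q
  rw [freeGen_eq_val, graftMul_val (T := .node g x (DRow.leaves g.q)) δ
    ⟨by simpa using v2, by simpa using v1⟩ (by simp [DStk.sh, Stk.inputs, v5, h])]
  simp only [DStk.sh, Stk.shuf, DStk.graft, h1, h2, koszul_zero, one_smul]

theorem freeGen_mem (g : BoxLabel) (x : C g) :
    freeGen k C g x ∈ homog k C δ ⟨g.p, g.q, g.r, δ g⟩ := by
  rw [freeGen_eq_val, ← nodeMul_val]
  simpa using nodeMul_mem (δ := δ) x (leaves_mem (k := k) (C := C) g.q)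

variable (k δ) in
/-- A decorated row as a row of elements of `T(C)`. -/
noncomputable def DRow.toElem : DRow C → ElemRow (FreeBox k C)
  | .nil s => .nil s
  | .cons T R => .cons (T.sh.out δ) (T.val k) R.toElem

theorem DRow.toElem_spec : ∀ {R : DRow C}, R.sh.Valid →
    (R.toElem k δ).Matching (freeBoxOperad k C δ).gr ∧ rowOf k C (R.toElem k δ) = R.val k ∧
      (R.toElem k δ).length = R.sh.length ∧ (R.toElem k δ).left = R.sh.left
  | .nil s, _ => ⟨trivial, rfl, rfl, rfl⟩
  | .cons T R, h => by
    obtain ⟨h1, h2, h3, h4⟩ := DRow.toElem_spec h.2.1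
    refine ⟨⟨?_, h1, h4 ▸ h.2.2⟩, ?_, ?_, rfl⟩
    · rw [freeBoxOperad_gr]; exact DStk.val_mem_homog h.1
    · rw [DRow.toElem, rowOf, h2, consMul_val h.1]
    · simp [DRow.toElem, ElemRow.length, h3, DRow.sh, StkRow.length]

mutual
theorem DStk.derivation_unique {D D' : FreeBox k C →ₗ[k] FreeBox k C}
    (hD : (freeBoxOperad k C δ).IsDerivation D) (hD' : (freeBoxOperad k C δ).IsDerivation D')
    (h : ∀ g x, D (freeGen k C g x) = D' (freeGen k C g x)) : ∀ T : DStk C, T.sh.Valid →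
    D (T.val k) = D' (T.val k)
  | .leaf, _ => hD.map_one.trans hD'.map_one.symm
  | .node g x R, hT => by
    obtain ⟨h1, h2, h3, h4⟩ := DRow.toElem_spec (k := k) (δ := δ) hT.2
    have hx : freeGen k C g x ∈ (freeBoxOperad k C δ).gr ⟨g.p, g.q, g.r, δ g⟩ := by
      rw [freeBoxOperad_gr]; exact freeGen_mem g x
    have hl : (R.toElem k δ).length = g.q := h3.trans hT.1
    have e : (DStk.node g x R).val k =
        (freeBoxOperad k C δ).comp (freeGen k C g x) (R.toElem k δ) := by
      rw [← graftMul_freeGen (δ := δ) x hT.1, ← h2]; rfl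
    rw [e, hD.map_comp _ _ _ hx h1 hl, hD'.map_comp _ _ _ hx h1 hl, h,
      DRow.leibniz_unique hD hD' h R hT.2]
theorem DRow.leibniz_unique {D D' : FreeBox k C →ₗ[k] FreeBox k C}
    (hD : (freeBoxOperad k C δ).IsDerivation D) (hD' : (freeBoxOperad k C δ).IsDerivation D')
    (h : ∀ g x, D (freeGen k C g x) = D' (freeGen k C g x)) : ∀ R : DRow C, R.sh.Valid →
    ∀ F : ElemRow (FreeBox k C) → FreeBox k C,
    BoxOperadData.leibniz k D F (R.toElem k δ) = BoxOperadData.leibniz k D' F (R.toElem k δ)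
  | .nil s, _, F => rfl
  | .cons T R, hR, F => by
    rw [DRow.toElem, BoxOperadData.leibniz, BoxOperadData.leibniz,
      DStk.derivation_unique hD hD' h T hR.1, DRow.leibniz_unique hD hD' h R hR.2.1]
end

/-- Derivations of the free box operad are determined by their values on the generators. -/
theorem derivation_ext {D D' : FreeBox k C →ₗ[k] FreeBox k C}
    (hD : (freeBoxOperad k C δ).IsDerivation D) (hD' : (freeBoxOperad k C δ).IsDerivation D')
    (h : ∀ g x, D (freeGen k C g x) = D' (freeGen k C g x)) : D = D' :=
  freeBox_ext fun T hT => DStk.derivation_unique hD hD' h T hT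

variable {ψ ψ' : ∀ g, C g →ₗ[k] FreeBox k C}

mutual
theorem DStk.freeDeriv_add : ∀ T : DStk C, T.sh.Valid →
    freeDeriv k C δ (fun g => ψ g + ψ' g) (T.val k) =
      freeDeriv k C δ ψ (T.val k) + freeDeriv k C δ ψ' (T.val k)
  | .leaf, _ => by simp only [freeDeriv_one, add_zero]
  | .node g x R, h => by
    have hR := DRow.val_mem_rowHomog (k := k) (δ := δ) h.2
    rw [show R.sh.length = g.q from h.1] at hR
    rw [← nodeMul_val, freeDeriv_nodeMul _ x hR, freeDeriv_nodeMul _ x hR,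
      freeDeriv_nodeMul _ x hR, DRow.rowDeriv_add R h.2]
    simp only [map_add, LinearMap.add_apply, smul_add]
    abel
theorem DRow.rowDeriv_add : ∀ T : DRow C, T.sh.Valid →
    rowDeriv k C δ (fun g => ψ g + ψ' g) (T.val k) =
      rowDeriv k C δ ψ (T.val k) + rowDeriv k C δ ψ' (T.val k)
  | .nil s, _ => by simp only [rowDeriv_nil, add_zero]
  | .cons T R, h => by
    have hT := DStk.val_mem_homog (k := k) (δ := δ) h.1
    rw [← consMul_val h.1, rowDeriv_consMul _ hT, rowDeriv_consMul _ hT,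
      rowDeriv_consMul _ hT, DStk.freeDeriv_add T h.1, DRow.rowDeriv_add R h.2.1]
    simp only [map_add, LinearMap.add_apply, smul_add]
    abel
end

theorem freeDeriv_add : freeDeriv k C δ (fun g => ψ g + ψ' g) =
    freeDeriv k C δ ψ + freeDeriv k C δ ψ' :=
  freeBox_ext fun T hT => DStk.freeDeriv_add T hT

end uniqueness

/-! ### Cuts and factorizations of stackings -/

namespace StkRow

theorem append_spec : ∀ (f f' : StkRow), f.right = f'.left →
    (f.append f').left = f.left ∧ (f.append f').right = f'.right ∧
    (f.append f').length = f.length + f'.length ∧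
    (f.append f').take f.length = f ∧ (f.append f').drop f.length = f'
  | .nil s, f', h => by
    have h' : s = f'.left := h
    simp [append, left, length, take, drop, h']
  | .cons t c, f', h => by
    obtain ⟨h1, h2, h3, h4, h5⟩ := append_spec c f' h
    simp [append, left, length, take, drop, right, h2, h3, h4, h5]; omega

theorem append_valid : ∀ {f f' : StkRow}, f.Valid → f'.Valid → f.right = f'.left →
    (f.append f').Valid
  | .nil _, _, _, h', _ => h'
  | .cons _ c, f', h, h', hs =>
    ⟨h.1, append_valid h.2.1 h' hs, h.2.2.trans (append_spec c f' hs).1.symm⟩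

theorem append_take_drop (n : ℕ) (f : StkRow) : (f.take n).append (f.drop n) = f := by
  induction n generalizing f with
  | zero => simp [take, drop, append]
  | succ n ih => cases f <;> simp [take, drop, append, ih]

end StkRow

/-- Cutting the stacking `t` into a lower part `a` and a row `f` on top of it. -/
structure Stk.IsCut (a : Stk) (f : StkRow) (t : Stk) : Prop where
  valid : a.Valid
  valid_row : f.Valid
  length : f.length = a.inputs
  graft : a.graft f = t

/-- Cutting the row `c` into a lower part `a` and a row `f` on top of it. -/
structure StkRow.IsCut (a f c : StkRow) : Prop where
  valid : a.Valid
  valid_row : f.Valid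
  length : f.length = a.inputs
  graft : a.graft f = c

theorem Stk.IsCut.left {a : Stk} {f : StkRow} {t : Stk} (h : a.IsCut f t) :
    t.left = a.left + f.left := by
  rw [← h.graft]; exact (Stk.graft_spec a f h.valid h.valid_row h.length).2.1

theorem Stk.IsCut.right {a : Stk} {f : StkRow} {t : Stk} (h : a.IsCut f t) :
    t.right = a.right + f.right := by
  rw [← h.graft]; exact (Stk.graft_spec a f h.valid h.valid_row h.length).2.2.1

theorem Stk.IsCut.inputs {a : Stk} {f : StkRow} {t : Stk} (h : a.IsCut f t) :
    t.inputs = f.inputs := by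
  rw [← h.graft]; exact (Stk.graft_spec a f h.valid h.valid_row h.length).2.2.2

theorem StkRow.IsCut.left {a f t : StkRow} (h : a.IsCut f t) : t.left = a.left + f.left := by
  rw [← h.graft]; exact (StkRow.graft_spec a f h.valid h.valid_row h.length).2.1

theorem StkRow.IsCut.length_eq {a f t : StkRow} (h : a.IsCut f t) : t.length = a.length := by
  rw [← h.graft]; exact (StkRow.graft_spec a f h.valid h.valid_row h.length).2.2.2.2

theorem Stk.isCut_leaf {t : Stk} (h : t.Valid) : Stk.leaf.IsCut (.cons t (.nil t.right)) t :=
  ⟨trivial, ⟨h, trivial, rfl⟩, rfl, rfl⟩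

theorem StkRow.IsCut.node {g : BoxLabel} {a f c : StkRow} (h : a.IsCut f c)
    (hc : (Stk.node g c).Valid) : (Stk.node g a).IsCut f (.node g c) :=
  ⟨⟨h.length_eq ▸ hc.1, h.valid⟩, h.valid_row, h.length, congrArg (Stk.node g) h.graft⟩

theorem Stk.IsCut.cons {a : Stk} {f : StkRow} {t : Stk} (h : a.IsCut f t) {b f' c : StkRow}
    (h' : b.IsCut f' c) (hc : (StkRow.cons t c).Valid) (hf : f.right = f'.left) :
    (StkRow.cons a b).IsCut (f.append f') (.cons t c) := by
  obtain ⟨h1, h2, h3, h4, h5⟩ := StkRow.append_spec f f' hf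
  rw [h.length] at h4 h5
  have e1 := h.right
  have e2 := h'.left
  have e3 : t.right = c.left := hc.2.2
  refine ⟨⟨h.valid, h'.valid, by omega⟩, StkRow.append_valid h.valid_row h'.valid_row hf, ?_, ?_⟩
  · rw [h3, h.length, h'.length]; rfl
  · rw [StkRow.graft, h4, h5, h.graft, h'.graft]

theorem StkRow.IsCut.of_nil {a f : StkRow} {s : ℕ} (h : a.IsCut f (.nil s)) :
    ∃ i j, i + j = s ∧ a = .nil i ∧ f = .nil j := by
  obtain ⟨i, rfl⟩ := StkRow.length_eq_zero (f := a) h.length_eq.symm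
  obtain ⟨j, rfl⟩ := StkRow.length_eq_zero (f := f) h.length
  have := h.graft
  simp only [StkRow.graft, StkRow.left, StkRow.nil.injEq] at this
  exact ⟨i, j, this, rfl, rfl⟩

/-- Every cut of a row `t, c` comes from cuts of `t` and of `c`. -/
theorem StkRow.IsCut.of_cons {a f : StkRow} {t : Stk} {c : StkRow} (h : a.IsCut f (.cons t c)) :
    ∃ a₁ b f₁ f₂, a = .cons a₁ b ∧ f = f₁.append f₂ ∧ f₁.right = f₂.left ∧ a₁.IsCut f₁ t ∧
      b.IsCut f₂ c := by
  match a, h with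
  | .nil s, h => simpa [StkRow.length] using h.length_eq
  | .cons a₁ b, h =>
    have hl : f.length = a₁.inputs + b.inputs := h.length
    obtain ⟨v1, v2, v3⟩ := h.valid_row.take_drop a₁.inputs
    have hg := h.graft
    simp only [StkRow.graft, StkRow.cons.injEq] at hg
    exact ⟨a₁, b, f.take a₁.inputs, f.drop a₁.inputs, rfl, (StkRow.append_take_drop _ _).symm, v3,
      ⟨h.valid.1, v1, StkRow.length_take (by omega), hg.1⟩,
      ⟨h.valid.2.1, v2, by simp [hl], hg.2⟩⟩

theorem Stk.IsCut.of_leaf {a : Stk} {f : StkRow} (h : a.IsCut f .leaf) :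
    a = .leaf ∧ f = .cons .leaf (.nil 0) := by
  match a, h with
  | .node g c, h => exact absurd h.graft (by simp [Stk.graft])
  | .leaf, h =>
    refine ⟨rfl, ?_⟩
    match f, h with
    | .nil s, h => exact absurd h.length (by simp [StkRow.length, Stk.inputs])
    | .cons t (.cons _ _), h => exact absurd h.length (by simp [StkRow.length, Stk.inputs])
    | .cons t (.nil s), h =>
      have h1 : t = .leaf := h.graft
      subst h1
      have h2 : Stk.leaf.right = s := h.valid_row.2.2
      rw [← h2]; rfl

/-- A cut of a stacking runs below the bottom box or comes from a cut of the row above it. -/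
theorem Stk.IsCut.of_node {a : Stk} {f : StkRow} {g : BoxLabel} {c : StkRow}
    (h : a.IsCut f (.node g c)) :
    (a = .leaf ∧ f = .cons (.node g c) (.nil (g.r + c.right))) ∨
      ∃ b, a = .node g b ∧ b.IsCut f c := by
  match a, h with
  | .node g' b, h =>
    have hg := h.graft
    simp only [Stk.graft, Stk.node.injEq] at hg
    obtain ⟨rfl, hg⟩ := hg
    exact Or.inr ⟨b, rfl, h.valid.2, h.valid_row, h.length, hg⟩
  | .leaf, h =>
    left
    refine ⟨rfl, ?_⟩
    match f, h with
    | .nil s, h => exact absurd h.length (by simp [StkRow.length, Stk.inputs])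
    | .cons t (.cons _ _), h => exact absurd h.length (by simp [StkRow.length, Stk.inputs])
    | .cons t (.nil s), h =>
      have h1 : t = .node g c := h.graft
      subst h1
      have h2 : (Stk.node g c).right = s := h.valid_row.2.2
      rw [← h2]; rfl

section sums
variable {M : Type*} [AddCommMonoid M]

mutual
/-- `∑ F a f` over all ways to write a stacking as a row `f` on top of a stacking `a`. -/
def Stk.cutSum : Stk → (Stk → StkRow → M) → M
  | .leaf, F => F .leaf (.cons .leaf (.nil 0))
  | .node g c, F => F .leaf (.cons (.node g c) (.nil (g.r + c.right))) +
      StkRow.cutSum c fun a f => F (.node g a) f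
/-- `∑ F a f` over all ways to write a row as a row `f` on top of a row `a`. -/
def StkRow.cutSum : StkRow → (StkRow → StkRow → M) → M
  | .nil s, F => ∑ p ∈ Finset.HasAntidiagonal.antidiagonal s, F (.nil p.1) (.nil p.2)
  | .cons t c, F => Stk.cutSum t fun a f => StkRow.cutSum c fun b f' =>
      if f.right = f'.left then F (.cons a b) (f.append f') else 0
end

mutual
theorem Stk.cutSum_congr : ∀ {t : Stk} {F G : Stk → StkRow → M}, t.Valid →
    (∀ a f, a.IsCut f t → F a f = G a f) → t.cutSum F = t.cutSum G
  | .leaf, _, _, ht, h => h _ _ (Stk.isCut_leaf ht)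
  | .node _ _, _, _, ht, h => congrArg₂ (· + ·) (h _ _ (Stk.isCut_leaf ht))
      (StkRow.cutSum_congr ht.2 fun _ _ hc => h _ _ (hc.node ht))
theorem StkRow.cutSum_congr : ∀ {t : StkRow} {F G : StkRow → StkRow → M}, t.Valid →
    (∀ a f, a.IsCut f t → F a f = G a f) → t.cutSum F = t.cutSum G
  | .nil s, F, G, ht, h => by
    refine Finset.sum_congr rfl fun p hp => h _ _ ⟨trivial, trivial, rfl, ?_⟩
    simpa [StkRow.graft, StkRow.left] using hp
  | .cons t c, F, G, ht, h => by
    refine Stk.cutSum_congr ht.1 fun a f ha => StkRow.cutSum_congr ht.2.1 fun b f' hb => ?_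
    split_ifs with hs
    · exact h _ _ (ha.cons hb ht hs)
    · rfl
end

mutual
theorem Stk.map_cutSum {N : Type*} [AddCommMonoid N] (φ : M →+ N) :
    ∀ (t : Stk) (F : Stk → StkRow → M), φ (t.cutSum F) = t.cutSum fun a f => φ (F a f)
  | .leaf, F => rfl
  | .node g c, F => by rw [Stk.cutSum, Stk.cutSum, map_add, StkRow.map_cutSum φ c]
theorem StkRow.map_cutSum {N : Type*} [AddCommMonoid N] (φ : M →+ N) :
    ∀ (t : StkRow) (F : StkRow → StkRow → M), φ (t.cutSum F) = t.cutSum fun a f => φ (F a f)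
  | .nil s, F => by rw [StkRow.cutSum, StkRow.cutSum, map_sum]
  | .cons t c, F => by
    rw [StkRow.cutSum, StkRow.cutSum, Stk.map_cutSum φ t]
    simp only [StkRow.map_cutSum φ c, apply_ite φ, map_zero]
end

mutual
theorem Stk.cutSum_add : ∀ (t : Stk) (F G : Stk → StkRow → M),
    (t.cutSum fun a f => F a f + G a f) = t.cutSum F + t.cutSum G
  | .leaf, F, G => rfl
  | .node g c, F, G => by
    rw [Stk.cutSum, Stk.cutSum, Stk.cutSum, StkRow.cutSum_add c]; exact add_add_add_comm _ _ _ _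
theorem StkRow.cutSum_add : ∀ (t : StkRow) (F G : StkRow → StkRow → M),
    (t.cutSum fun a f => F a f + G a f) = t.cutSum F + t.cutSum G
  | .nil s, F, G => Finset.sum_add_distrib
  | .cons t c, F, G => by
    rw [StkRow.cutSum, StkRow.cutSum, StkRow.cutSum, ← Stk.cutSum_add t]
    congr 1; funext a f
    rw [← StkRow.cutSum_add c]
    congr 1; funext b f'
    split_ifs <;> simp
end

mutual
theorem Stk.cutSum_zero : ∀ (t : Stk), (t.cutSum fun _ _ => (0 : M)) = 0
  | .leaf => rfl
  | .node g c => by rw [Stk.cutSum, StkRow.cutSum_zero c, add_zero]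
theorem StkRow.cutSum_zero : ∀ (t : StkRow), (t.cutSum fun _ _ => (0 : M)) = 0
  | .nil s => by simp [StkRow.cutSum]
  | .cons t c => by simp [StkRow.cutSum, StkRow.cutSum_zero c, Stk.cutSum_zero t]
end

open Classical in
mutual
/-- A cut occurs exactly once in the sum over all cuts. -/
theorem Stk.cutSum_single : ∀ {t : Stk} (_ : t.Valid) {a₀ : Stk} {f₀ : StkRow}
    (_ : a₀.IsCut f₀ t) (m : M), (t.cutSum fun a f => if a = a₀ ∧ f = f₀ then m else 0) = m
  | .leaf, _, a₀, f₀, h, m => by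
    obtain ⟨rfl, rfl⟩ := h.of_leaf
    simp [Stk.cutSum]
  | .node g c, ht, a₀, f₀, h, m => by
    rw [Stk.cutSum]
    obtain ⟨rfl, rfl⟩ | ⟨b, rfl, hb⟩ := h.of_node
    · simp [StkRow.cutSum_zero]
    · simp [StkRow.cutSum_single ht.2 hb m]
theorem StkRow.cutSum_single : ∀ {t : StkRow} (_ : t.Valid) {a₀ f₀ : StkRow}
    (_ : a₀.IsCut f₀ t) (m : M), (t.cutSum fun a f => if a = a₀ ∧ f = f₀ then m else 0) = m
  | .nil s, ht, a₀, f₀, h, m => by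
    obtain ⟨i, j, hs, rfl, rfl⟩ := h.of_nil
    rw [StkRow.cutSum, Finset.sum_eq_single (i, j)]
    · simp
    · intro p _ hp
      rw [if_neg]
      rintro ⟨h1, h2⟩
      apply hp
      simp only [StkRow.nil.injEq] at h1 h2
      exact Prod.ext h1 h2
    · intro hn
      exact absurd (Finset.HasAntidiagonal.mem_antidiagonal.2 hs) hn
  | .cons t c, ht, a₀, f₀, h, m => by
    obtain ⟨a₁, b₁, f₁, f₂, rfl, rfl, hs, h1, h2⟩ := h.of_cons
    rw [StkRow.cutSum]
    have e1 := StkRow.append_spec f₁ f₂ hs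
    refine Eq.trans (Stk.cutSum_congr (G := fun a f => if a = a₁ ∧ f = f₁ then m else 0) ht.1
      fun a f ha => ?_) (Stk.cutSum_single ht.1 h1 m)
    split_ifs with h3
    · obtain ⟨rfl, rfl⟩ := h3
      refine Eq.trans (StkRow.cutSum_congr (G := fun b f' => if b = b₁ ∧ f' = f₂ then m else 0)
        ht.2.1 fun b f' hb => ?_) (StkRow.cutSum_single ht.2.1 h2 m)
      by_cases h5 : b = b₁ ∧ f' = f₂
      · obtain ⟨rfl, rfl⟩ := h5
        simp [hs]
      · rw [if_neg h5]
        split_ifs with h4 h6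
        · obtain ⟨h6, h7⟩ := h6
          rw [StkRow.cons.injEq] at h6
          have := (StkRow.append_spec f f' h4).2.2.2.2
          rw [h7, e1.2.2.2.2] at this
          exact absurd ⟨h6.2, this.symm⟩ h5
        · rfl
        · rfl
    · refine Eq.trans (StkRow.cutSum_congr (G := fun _ _ => (0 : M)) ht.2.1 fun b f' hb => ?_)
        (StkRow.cutSum_zero c)
      split_ifs with h4 h5
      · obtain ⟨h6, h7⟩ := h5
        rw [StkRow.cons.injEq] at h6
        have := (StkRow.append_spec f f' h4).2.2.2.1
        rw [h7, ha.length, h6.1, ← h1.length, e1.2.2.2.1] at this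
        exact absurd ⟨h6.1, this.symm⟩ h3
      · rfl
      · rfl
end

end sums

/-! ### Factorizations of a stacking by substitution -/

mutual
/-- Total degree of the boxes that come before a given one in standard order. -/
def Stk.Pos.before (δ : BoxLabel → ℤ) : {t : Stk} → {h : BoxLabel} → Stk.Pos t h → ℤ
  | _, _, .root _ _ => 0
  | _, _, .above g v => δ g + v.before δ
/-- Total degree of the boxes of a row that come before a given one in standard order. -/
def StkRow.Pos.before (δ : BoxLabel → ℤ) : {c : StkRow} → {h : BoxLabel} → StkRow.Pos c h → ℤ
  | _, _, .here v _ => v.before δ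
  | _, _, .there t v => t.degree δ + v.before δ
end

mutual
/-- The exponent of the Koszul sign of the shuffle in a substitution. -/
def Stk.Pos.shuf (δ : BoxLabel → ℤ) (s : Stk) : {t : Stk} → {h : BoxLabel} → Stk.Pos t h → ℤ
  | _, _, .root _ c => s.shuf δ c
  | _, _, .above _ v => v.shuf δ s
/-- The exponent of the Koszul sign of the shuffle in a substitution. -/
def StkRow.Pos.shuf (δ : BoxLabel → ℤ) (s : Stk) :
    {c : StkRow} → {h : BoxLabel} → StkRow.Pos c h → ℤ
  | _, _, .here v _ => v.shuf δ s
  | _, _, .there _ v => v.shuf δ s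
end

section substMap
variable {k : Type u} [CommRing k]
variable {C : BoxLabel → Type u} [∀ g, AddCommGroup (C g)] [∀ g, Module k (C g)]

mutual
theorem Stk.Pos.substMap_eq (δ : BoxLabel → ℤ) (t' : Stk) : ∀ {t : Stk} {h : BoxLabel}
    (v : t.Pos h) (φ : C h →ₗ[k] Stk.tens k C t') (y : Stk.tens k C t),
    v.substMap k C δ t' φ y = koszul k (v.shuf δ t') • v.substMap k C zdeg t' φ y
  | _, _, .root g c, φ, y => by
    change t'.graftMap k C δ c _ = koszul k (t'.shuf δ c) • t'.graftMap k C zdeg c _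
    rw [Stk.graftMap_eq k C δ]
    rfl
  | _, _, .above (c := c) g v, φ, y => by
    induction y using TensorProduct.induction_on with
    | zero => exact (map_zero _).trans ((congrArg _ (map_zero _)).trans (smul_zero _)).symm
    | add y z hy hz =>
      exact (map_add _ _ _).trans (((congrArg₂ _ hy hz).trans (smul_add _ _ _).symm).trans
        (congrArg _ (map_add _ _ _).symm))
    | tmul x y =>
      change x ⊗ₜ[k] (v.substMap k C δ t' φ y) = _ • x ⊗ₜ[k] (v.substMap k C zdeg t' φ y)
      rw [StkRow.Pos.substMap_eq δ t' v φ y]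
      exact TensorProduct.tmul_smul _ _ _
theorem StkRow.Pos.substMap_eq (δ : BoxLabel → ℤ) (t' : Stk) : ∀ {t : StkRow} {h : BoxLabel}
    (v : t.Pos h) (φ : C h →ₗ[k] Stk.tens k C t') (y : StkRow.tens k C t),
    v.substMap k C δ t' φ y = koszul k (v.shuf δ t') • v.substMap k C zdeg t' φ y
  | _, _, .here (t := t) v c, φ, y => by
    induction y using TensorProduct.induction_on with
    | zero => exact (map_zero _).trans ((congrArg _ (map_zero _)).trans (smul_zero _)).symm
    | add y z hy hz =>
      exact (map_add _ _ _).trans (((congrArg₂ _ hy hz).trans (smul_add _ _ _).symm).trans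
        (congrArg _ (map_add _ _ _).symm))
    | tmul x y =>
      change (v.substMap k C δ t' φ x) ⊗ₜ[k] y = _ • (v.substMap k C zdeg t' φ x) ⊗ₜ[k] y
      rw [Stk.Pos.substMap_eq δ t' v φ x]
      exact (TensorProduct.smul_tmul' _ _ _).symm
  | _, _, .there (c := c) t v, φ, y => by
    induction y using TensorProduct.induction_on with
    | zero => exact (map_zero _).trans ((congrArg _ (map_zero _)).trans (smul_zero _)).symm
    | add y z hy hz =>
      exact (map_add _ _ _).trans (((congrArg₂ _ hy hz).trans (smul_add _ _ _).symm).trans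
        (congrArg _ (map_add _ _ _).symm))
    | tmul x y =>
      change x ⊗ₜ[k] (v.substMap k C δ t' φ y) = _ • x ⊗ₜ[k] (v.substMap k C zdeg t' φ y)
      rw [StkRow.Pos.substMap_eq δ t' v φ y]
      exact TensorProduct.tmul_smul _ _ _
end

end substMap

/-- `T` is the result of substituting `t'` into the box `v` of `t`, where all sides match. -/
structure Stk.Pos.IsFact {t : Stk} {h : BoxLabel} (v : t.Pos h) (t' T : Stk) : Prop where
  valid : t.Valid
  valid_inner : t'.Valid
  ne_leaf : t' ≠ .leaf
  out : t'.out BoxLabel.deg = h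
  subst : v.subst t' = T
  left : t.left = T.left
  right : t.right = T.right
  inputs : t.inputs = T.inputs

/-- `T` is the result of substituting `t'` into the box `v` of the row `t`, where all sides
match. -/
structure StkRow.Pos.IsFact {t : StkRow} {h : BoxLabel} (v : t.Pos h) (t' : Stk) (T : StkRow) :
    Prop where
  valid : t.Valid
  valid_inner : t'.Valid
  ne_leaf : t' ≠ .leaf
  out : t'.out BoxLabel.deg = h
  subst : v.subst t' = T
  left : t.left = T.left
  right : t.right = T.right
  inputs : t.inputs = T.inputs
  length : t.length = T.length

theorem Stk.IsCut.isFact {a : Stk} {f : StkRow} {T : Stk} (h : a.IsCut f T) (ha : a ≠ .leaf) :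
    (Stk.Pos.root (a.out BoxLabel.deg) f).IsFact a T where
  valid := ⟨h.length, h.valid_row⟩
  valid_inner := h.valid
  ne_leaf := ha
  out := rfl
  subst := h.graft
  left := h.left.symm
  right := h.right.symm
  inputs := h.inputs.symm

theorem StkRow.Pos.IsFact.above {g : BoxLabel} {c : StkRow} {h : BoxLabel} {v : c.Pos h} {t' : Stk}
    {T : StkRow} (H : v.IsFact t' T) (hT : (Stk.node g T).Valid) :
    (Stk.Pos.above g v).IsFact t' (.node g T) where
  valid := ⟨H.length.trans hT.1, H.valid⟩
  valid_inner := H.valid_inner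
  ne_leaf := H.ne_leaf
  out := H.out
  subst := congrArg (Stk.node g) H.subst
  left := congrArg (g.p + ·) H.left
  right := congrArg (g.r + ·) H.right
  inputs := H.inputs

theorem Stk.Pos.IsFact.here {t : Stk} {h : BoxLabel} {v : t.Pos h} {t' T : Stk} {c : StkRow}
    (H : v.IsFact t' T) (hT : (StkRow.cons T c).Valid) :
    (StkRow.Pos.here v c).IsFact t' (.cons T c) where
  valid := ⟨H.valid, hT.2.1, H.right.trans hT.2.2⟩
  valid_inner := H.valid_inner
  ne_leaf := H.ne_leaf
  out := H.out
  subst := congrArg (StkRow.cons · c) H.subst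
  left := H.left
  right := rfl
  inputs := congrArg (· + c.inputs) H.inputs
  length := rfl

theorem StkRow.Pos.IsFact.there {t : Stk} {c : StkRow} {h : BoxLabel} {v : c.Pos h} {t' : Stk}
    {T : StkRow} (H : v.IsFact t' T) (hT : (StkRow.cons t T).Valid) :
    (StkRow.Pos.there t v).IsFact t' (.cons t T) where
  valid := ⟨hT.1, H.valid, hT.2.2.trans H.left.symm⟩
  valid_inner := H.valid_inner
  ne_leaf := H.ne_leaf
  out := H.out
  subst := congrArg (StkRow.cons t) H.subst
  left := rfl
  right := H.right
  inputs := congrArg (t.inputs + ·) H.inputs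
  length := congrArg (· + 1) H.length

section sums
variable {M : Type*} [AddCommMonoid M]

mutual
/-- `∑ F t h v t'` over all ways to write a stacking as the result of substituting a stacking
`t' ≠ leaf` into a box `v` of a stacking `t`; the label `h` of `v` is that of the output of `t'`. -/
def Stk.factSum : Stk → ((t : Stk) → (h : BoxLabel) → t.Pos h → Stk → M) → M
  | .leaf, _ => 0
  | .node g c, F => (c.cutSum fun a f => F (.node ((Stk.node g a).out BoxLabel.deg) f)
      ((Stk.node g a).out BoxLabel.deg) (.root _ f) (.node g a)) +
      StkRow.factSum c fun c₀ h v s => F (.node g c₀) h (.above g v) s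
/-- The same sum for a row. -/
def StkRow.factSum : StkRow → ((t : StkRow) → (h : BoxLabel) → t.Pos h → Stk → M) → M
  | .nil _, _ => 0
  | .cons t c, F => (Stk.factSum t fun t₀ h v t' => F (.cons t₀ c) h (.here v c) t') +
      StkRow.factSum c fun c₀ h v t' => F (.cons t c₀) h (.there t v) t'
end

mutual
theorem Stk.factSum_congr : ∀ {T : Stk} {F G : (t : Stk) → (h : BoxLabel) → t.Pos h → Stk → M},
    T.Valid → (∀ t h (v : t.Pos h) t', v.IsFact t' T → F t h v t' = G t h v t') →
    T.factSum F = T.factSum G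
  | .leaf, _, _, _, _ => rfl
  | .node _ _, _, _, hT, h => congrArg₂ (· + ·)
      (StkRow.cutSum_congr hT.2 fun _ _ hc => h _ _ _ _ ((hc.node hT).isFact nofun))
      (StkRow.factSum_congr hT.2 fun _ _ _ _ H => h _ _ _ _ (H.above hT))
theorem StkRow.factSum_congr : ∀ {T : StkRow}
    {F G : (t : StkRow) → (h : BoxLabel) → t.Pos h → Stk → M}, T.Valid →
    (∀ t h (v : t.Pos h) t', v.IsFact t' T → F t h v t' = G t h v t') → T.factSum F = T.factSum G
  | .nil _, _, _, _, _ => rfl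
  | .cons _ _, _, _, hT, h => congrArg₂ (· + ·)
      (Stk.factSum_congr hT.1 fun _ _ _ _ H => h _ _ _ _ (H.here hT))
      (StkRow.factSum_congr hT.2.1 fun _ _ _ _ H => h _ _ _ _ (H.there hT))
end

mutual
theorem Stk.map_factSum {N : Type*} [AddCommMonoid N] (φ : M →+ N) :
    ∀ (T : Stk) (F : (t : Stk) → (h : BoxLabel) → t.Pos h → Stk → M),
    φ (T.factSum F) = T.factSum fun t h v t' => φ (F t h v t')
  | .leaf, F => map_zero φ
  | .node g c, F => by
    rw [Stk.factSum, Stk.factSum, map_add, StkRow.map_factSum φ c, StkRow.map_cutSum φ c]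
theorem StkRow.map_factSum {N : Type*} [AddCommMonoid N] (φ : M →+ N) :
    ∀ (T : StkRow) (F : (t : StkRow) → (h : BoxLabel) → t.Pos h → Stk → M),
    φ (T.factSum F) = T.factSum fun t h v t' => φ (F t h v t')
  | .nil s, F => map_zero φ
  | .cons t c, F => by
    rw [StkRow.factSum, StkRow.factSum, map_add, Stk.map_factSum φ t, StkRow.map_factSum φ c]
end

mutual
theorem Stk.factSum_add : ∀ (T : Stk) (F G : (t : Stk) → (h : BoxLabel) → t.Pos h → Stk → M),
    (T.factSum fun t h v t' => F t h v t' + G t h v t') = T.factSum F + T.factSum G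
  | .leaf, F, G => (add_zero 0).symm
  | .node g c, F, G => by
    rw [Stk.factSum, Stk.factSum, Stk.factSum, StkRow.factSum_add c, StkRow.cutSum_add c]
    exact add_add_add_comm _ _ _ _
theorem StkRow.factSum_add : ∀ (T : StkRow)
    (F G : (t : StkRow) → (h : BoxLabel) → t.Pos h → Stk → M),
    (T.factSum fun t h v t' => F t h v t' + G t h v t') = T.factSum F + T.factSum G
  | .nil s, F, G => (add_zero 0).symm
  | .cons t c, F, G => by
    rw [StkRow.factSum, StkRow.factSum, StkRow.factSum, StkRow.factSum_add c, Stk.factSum_add t]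
    exact add_add_add_comm _ _ _ _
end

mutual
theorem Stk.factSum_zero : ∀ (T : Stk), (T.factSum fun _ _ _ _ => (0 : M)) = 0
  | .leaf => rfl
  | .node g c => by
    rw [Stk.factSum, StkRow.factSum_zero c, StkRow.cutSum_zero c, add_zero]
theorem StkRow.factSum_zero : ∀ (T : StkRow), (T.factSum fun _ _ _ _ => (0 : M)) = 0
  | .nil s => rfl
  | .cons t c => by rw [StkRow.factSum, StkRow.factSum_zero c, Stk.factSum_zero t, add_zero]
end

end sums

/-! ### The sign twist of the thin desuspension -/

/-- The change of degree under thin desuspension. -/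
def BoxLabel.shift (g : BoxLabel) : ℤ := if g.Thin then -1 else 0

theorem BoxLabel.sdeg_eq (g : BoxLabel) : g.sdeg = g.deg + g.shift := by
  unfold sdeg shift; split_ifs <;> ring

/-- For boxes `g₁, …, gₙ`, the exponent `∑_{i<j} |gᵢ| e(gⱼ)`, where `e(g)` is the change of degree
under thin desuspension. It is the sign of `s_thin⁻¹ ⊗ ⋯ ⊗ s_thin⁻¹` on `c₁ ⊗ ⋯ ⊗ cₙ`. -/
def twist : List BoxLabel → ℤ
  | [] => 0
  | g :: l => g.deg * (l.map BoxLabel.shift).sum + twist l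

theorem twist_append (l m : List BoxLabel) : twist (l ++ m) = twist l + twist m +
    (l.map BoxLabel.deg).sum * (m.map BoxLabel.shift).sum := by
  induction l with
  | nil => simp [twist]
  | cons g l ih => simp [twist, ih]; ring

theorem Stk.degree_sdeg (t : Stk) :
    t.degree BoxLabel.sdeg = t.degree BoxLabel.deg + t.degree BoxLabel.shift := by
  unfold Stk.degree
  rw [← List.sum_map_add]; congr 1; exact List.map_congr_left fun g _ => g.sdeg_eq

theorem StkRow.degree_sdeg (t : StkRow) :
    t.degree BoxLabel.sdeg = t.degree BoxLabel.deg + t.degree BoxLabel.shift := by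
  unfold StkRow.degree
  rw [← List.sum_map_add]; congr 1; exact List.map_congr_left fun g _ => g.sdeg_eq

theorem twist_node (g : BoxLabel) (c : StkRow) : twist (Stk.node g c).boxes =
    g.deg * c.degree BoxLabel.shift + twist c.boxes := rfl

theorem twist_cons (t : Stk) (c : StkRow) : twist (StkRow.cons t c).boxes =
    twist t.boxes + twist c.boxes + t.degree BoxLabel.deg * c.degree BoxLabel.shift :=
  twist_append _ _

theorem StkRow.boxes_take_append_drop (n : ℕ) (f : StkRow) :
    (f.take n).boxes ++ (f.drop n).boxes = f.boxes := by
  induction n generalizing f with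
  | zero => simp [take, drop, boxes]
  | succ n ih => cases f <;> simp [take, drop, boxes, ih]

mutual
/-- The twist compares the Koszul signs of a shuffle before and after thin desuspension. -/
theorem Stk.twist_graft : ∀ (t : Stk) (f : StkRow), f.length = t.inputs →
    ∃ m, twist (t.graft f).boxes = twist t.boxes + twist f.boxes +
      t.degree BoxLabel.deg * f.degree BoxLabel.shift + t.shuf BoxLabel.sdeg f -
      t.shuf BoxLabel.deg f - t.shuf BoxLabel.shift f - 2 * m
  | .leaf, f, hl => by
    cases f with
    | nil => simp [StkRow.length, Stk.inputs] at hl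
    | cons t c =>
      obtain ⟨s, rfl⟩ := StkRow.length_eq_zero (by simpa [StkRow.length, Stk.inputs] using hl)
      exact ⟨0, by simp [Stk.graft, Stk.shuf, StkRow.boxes, Stk.boxes, twist]⟩
  | .node g c, f, hl => by
    obtain ⟨m, hm⟩ := StkRow.twist_graft c f hl
    refine ⟨m, ?_⟩
    simp only [Stk.graft, twist_node, Stk.shuf, Stk.degree_node,
      StkRow.degree_graft _ c f hl]
    linear_combination hm
theorem StkRow.twist_graft : ∀ (t : StkRow) (f : StkRow), f.length = t.inputs →
    ∃ m, twist (t.graft f).boxes = twist t.boxes + twist f.boxes +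
      t.degree BoxLabel.deg * f.degree BoxLabel.shift + t.shuf BoxLabel.sdeg f -
      t.shuf BoxLabel.deg f - t.shuf BoxLabel.shift f - 2 * m
  | .nil s, f, hl => by
    obtain ⟨s, rfl⟩ := StkRow.length_eq_zero (by simpa [StkRow.inputs] using hl)
    exact ⟨0, by simp [StkRow.graft, StkRow.shuf, StkRow.boxes, twist]⟩
  | .cons t c, f, hl => by
    have hle : t.inputs ≤ f.length := by simp [hl, StkRow.inputs]
    have l1 := StkRow.length_take hle
    have l2 : (f.drop t.inputs).length = c.inputs := by simp [hl, StkRow.inputs]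
    obtain ⟨m, hm⟩ := Stk.twist_graft t _ l1
    obtain ⟨n, hn⟩ := StkRow.twist_graft c _ l2
    refine ⟨m + n + c.degree BoxLabel.deg * (f.take t.inputs).degree BoxLabel.shift, ?_⟩
    have e1 := twist_append (f.take t.inputs).boxes (f.drop t.inputs).boxes
    rw [StkRow.boxes_take_append_drop] at e1
    simp only [StkRow.graft, twist_cons, StkRow.shuf, StkRow.degree_cons,
      StkRow.degree_graft _ c _ l2, Stk.degree_graft _ t _ l1, e1, StkRow.degree_sdeg,
      ← StkRow.degree_take_add_drop BoxLabel.shift t.inputs f]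
    simp only [StkRow.degree]
    simp only [StkRow.degree] at hm hn
    linear_combination hm + hn
end

mutual
theorem Stk.Pos.degree_subst (δ : BoxLabel → ℤ) {t' : Stk} : ∀ {t : Stk} {h : BoxLabel}
    (v : t.Pos h), t.Valid → t'.inputs = h.q →
    (v.subst t').degree δ = t.degree δ + t'.degree δ - δ h
  | _, _, .root g c, ht, hq => by
    simp only [Stk.Pos.subst, Stk.degree_graft δ t' c (ht.1.trans hq.symm), Stk.degree_node]; ring
  | _, _, .above g v, ht, hq => by
    simp only [Stk.Pos.subst, Stk.degree_node, StkRow.Pos.degree_subst δ v ht.2 hq]; ring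
theorem StkRow.Pos.degree_subst (δ : BoxLabel → ℤ) {t' : Stk} : ∀ {t : StkRow} {h : BoxLabel}
    (v : t.Pos h), t.Valid → t'.inputs = h.q →
    (v.subst t').degree δ = t.degree δ + t'.degree δ - δ h
  | _, _, .here v c, ht, hq => by
    simp only [StkRow.Pos.subst, StkRow.degree_cons, Stk.Pos.degree_subst δ v ht.1 hq]; ring
  | _, _, .there t v, ht, hq => by
    simp only [StkRow.Pos.subst, StkRow.degree_cons, StkRow.Pos.degree_subst δ v ht.2.1 hq]; ring
end

mutual
/-- The twist compares the Koszul signs of a substitution before and after thin desuspension. The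
last term accounts for moving an operation of degree `t'.degree shift - h.shift` past the boxes
before `v`. -/
theorem Stk.Pos.twist_subst {t' : Stk} : ∀ {t : Stk} {h : BoxLabel} (v : t.Pos h), t.Valid →
    t'.out BoxLabel.deg = h → ∃ m, twist (v.subst t').boxes = twist t.boxes + twist t'.boxes +
      v.shuf BoxLabel.sdeg t' - v.shuf BoxLabel.deg t' - v.shuf BoxLabel.shift t' - 2 * m +
      v.before BoxLabel.deg * (t'.degree BoxLabel.shift - h.shift)
  | _, _, .root g c, ht, hq => by
    subst hq
    obtain ⟨m, hm⟩ := Stk.twist_graft t' c ht.1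
    refine ⟨m, ?_⟩
    simp only [Stk.Pos.subst, Stk.Pos.shuf, twist_node, hm, Stk.Pos.before, Stk.out]
    ring
  | _, _, .above g v, ht, hq => by
    obtain ⟨m, hm⟩ := StkRow.Pos.twist_subst v ht.2 hq
    refine ⟨m, ?_⟩
    simp only [Stk.Pos.subst, Stk.Pos.shuf, twist_node, hm, Stk.Pos.before,
      StkRow.Pos.degree_subst _ v ht.2 (congrArg BoxLabel.q hq)]
    ring
theorem StkRow.Pos.twist_subst {t' : Stk} : ∀ {t : StkRow} {h : BoxLabel} (v : t.Pos h), t.Valid →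
    t'.out BoxLabel.deg = h → ∃ m, twist (v.subst t').boxes = twist t.boxes + twist t'.boxes +
      v.shuf BoxLabel.sdeg t' - v.shuf BoxLabel.deg t' - v.shuf BoxLabel.shift t' - 2 * m +
      v.before BoxLabel.deg * (t'.degree BoxLabel.shift - h.shift)
  | _, _, .here v c, ht, hq => by
    obtain ⟨m, hm⟩ := Stk.Pos.twist_subst v ht.1 hq
    refine ⟨m, ?_⟩
    have hd : t'.degree BoxLabel.deg = _ := congrArg BoxLabel.deg hq
    simp only [StkRow.Pos.subst, StkRow.Pos.shuf, twist_cons, hm, StkRow.Pos.before, hd,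
      Stk.Pos.degree_subst _ v ht.1 (congrArg BoxLabel.q hq)]
    ring
  | _, _, .there t v, ht, hq => by
    obtain ⟨m, hm⟩ := StkRow.Pos.twist_subst v ht.2.1 hq
    refine ⟨m, ?_⟩
    simp only [StkRow.Pos.subst, StkRow.Pos.shuf, twist_cons, hm, StkRow.Pos.before,
      StkRow.Pos.degree_subst _ v ht.2.1 (congrArg BoxLabel.q hq)]
    ring
end

mutual
theorem Stk.Pos.before_sdeg : ∀ {t : Stk} {h : BoxLabel} (v : t.Pos h),
    v.before BoxLabel.sdeg = v.before BoxLabel.deg + v.before BoxLabel.shift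
  | _, _, .root g c => (add_zero 0).symm
  | _, _, .above g v => by
    simp only [Stk.Pos.before, StkRow.Pos.before_sdeg v, BoxLabel.sdeg_eq]; ring
theorem StkRow.Pos.before_sdeg : ∀ {t : StkRow} {h : BoxLabel} (v : t.Pos h),
    v.before BoxLabel.sdeg = v.before BoxLabel.deg + v.before BoxLabel.shift
  | _, _, .here v c => Stk.Pos.before_sdeg v
  | _, _, .there t v => by
    simp only [StkRow.Pos.before, StkRow.Pos.before_sdeg v, Stk.degree_sdeg]; ring
end

/-! ### Horizontal cuts of a stacking -/

mutual
/-- `t.Sep i j` means that `t` can be cut horizontally, between its boxes, from the height `i` on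
the left (counted in horizontal inputs) to the height `j` on the right. -/
def Stk.Sep : Stk → ℕ → ℕ → Prop
  | .leaf, i, j => i = 0 ∧ j = 0
  | .node g c, i, j => (i = 0 ∧ j = 0) ∨ ∃ a b, i = g.p + a ∧ j = g.r + b ∧ StkRow.Sep c a b
/-- The same relation for a row. -/
def StkRow.Sep : StkRow → ℕ → ℕ → Prop
  | .nil s, i, j => i = j ∧ i ≤ s
  | .cons t c, i, j => ∃ m, Stk.Sep t i m ∧ StkRow.Sep c m j
end

/-- No box is semi-thin. -/
def Stk.NoSemi (t : Stk) : Prop := ∀ g ∈ t.boxes, ¬ g.SemiThin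

/-- No box is semi-thin. -/
def StkRow.NoSemi (t : StkRow) : Prop := ∀ g ∈ t.boxes, ¬ g.SemiThin

theorem Stk.noSemi_node {g : BoxLabel} {c : StkRow} :
    (Stk.node g c).NoSemi ↔ ¬ g.SemiThin ∧ c.NoSemi := by
  simp [Stk.NoSemi, StkRow.NoSemi, Stk.boxes]

theorem StkRow.noSemi_cons {t : Stk} {c : StkRow} :
    (StkRow.cons t c).NoSemi ↔ t.NoSemi ∧ c.NoSemi := by
  simp [Stk.NoSemi, StkRow.NoSemi, StkRow.boxes, or_imp, forall_and]

mutual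
theorem Stk.sep_zero : ∀ t : Stk, t.Sep 0 0
  | .leaf => ⟨rfl, rfl⟩
  | .node _ _ => Or.inl ⟨rfl, rfl⟩
theorem StkRow.sep_zero : ∀ t : StkRow, t.Sep 0 0
  | .nil s => ⟨rfl, Nat.zero_le s⟩
  | .cons t c => ⟨0, Stk.sep_zero t, StkRow.sep_zero c⟩
end

mutual
theorem Stk.sep_full : ∀ {t : Stk}, t.Valid → t.Sep t.left t.right
  | .leaf, _ => ⟨rfl, rfl⟩
  | .node _ c, ht => Or.inr ⟨c.left, c.right, rfl, rfl, StkRow.sep_full ht.2⟩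
theorem StkRow.sep_full : ∀ {t : StkRow}, t.Valid → t.Sep t.left t.right
  | .nil _, _ => ⟨rfl, le_rfl⟩
  | .cons t _, ht => ⟨t.right, Stk.sep_full ht.1, ht.2.2 ▸ StkRow.sep_full ht.2.1⟩
end

mutual
theorem Stk.Sep.le : ∀ {t : Stk} {i j : ℕ}, t.Sep i j → i ≤ t.left ∧ j ≤ t.right
  | .leaf, i, j, h => ⟨h.1.le, h.2.le⟩
  | .node g c, i, j, .inl h => by simp [h.1, h.2]
  | .node g c, i, j, .inr ⟨i', j', hi, hj, h⟩ => by
    have := StkRow.Sep.le h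
    simp only [Stk.left, Stk.right]; omega
theorem StkRow.Sep.le : ∀ {t : StkRow} {i j : ℕ}, t.Sep i j → i ≤ t.left ∧ j ≤ t.right
  | .nil _, _, _, h => ⟨h.2, h.1 ▸ h.2⟩
  | .cons _ _, _, _, ⟨_, h1, h2⟩ => ⟨(Stk.Sep.le h1).1, (StkRow.Sep.le h2).2⟩
end

mutual
/-- Without semi-thin boxes, horizontal cuts do not touch each other at the left or right side. -/
theorem Stk.Sep.lt_iff : ∀ {t : Stk} {i j i' j' : ℕ}, t.NoSemi → t.Sep i j → t.Sep i' j' →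
    (i < i' ↔ j < j')
  | .leaf, i, j, i', j', _, h, h' => by simp [h.1, h.2, h'.1, h'.2]
  | .node g c, i, j, i', j', hn, h, h' => by
    obtain ⟨hg, hc⟩ := Stk.noSemi_node.1 hn
    have hpr : 0 < g.p ∧ 0 < g.r ∨ g.p = 0 ∧ g.r = 0 := by
      unfold BoxLabel.SemiThin at hg; omega
    rcases h with ⟨rfl, rfl⟩ | ⟨a, b, rfl, rfl, h⟩ <;>
      rcases h' with ⟨rfl, rfl⟩ | ⟨a', b', rfl, rfl, h'⟩
    · simp
    · have := StkRow.Sep.lt_iff hc c.sep_zero h'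
      omega
    · simp
    · have := StkRow.Sep.lt_iff hc h h'
      omega
theorem StkRow.Sep.lt_iff : ∀ {t : StkRow} {i j i' j' : ℕ}, t.NoSemi → t.Sep i j → t.Sep i' j' →
    (i < i' ↔ j < j')
  | .nil s, i, j, i', j', _, h, h' => by rw [h.1, h'.1]
  | .cons t c, i, j, i', j', hn, ⟨m, h1, h2⟩, ⟨m', h1', h2'⟩ => by
    obtain ⟨ht, hc⟩ := StkRow.noSemi_cons.1 hn
    exact (Stk.Sep.lt_iff ht h1 h1').trans (StkRow.Sep.lt_iff hc h2 h2')
end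

theorem Stk.Sep.eq_iff {t : Stk} {i j i' j' : ℕ} (hn : t.NoSemi) (h : t.Sep i j)
    (h' : t.Sep i' j') : i = i' ↔ j = j' := by
  have h1 := h.lt_iff hn h'
  have h2 := h'.lt_iff hn h
  omega

theorem StkRow.Sep.eq_iff {t : StkRow} {i j i' j' : ℕ} (hn : t.NoSemi) (h : t.Sep i j)
    (h' : t.Sep i' j') : i = i' ↔ j = j' := by
  have h1 := h.lt_iff hn h'
  have h2 := h'.lt_iff hn h
  omega

theorem StkRow.sep_append : ∀ {f f' : StkRow} {i j : ℕ}, f.right = f'.left →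
    ((f.append f').Sep i j ↔ ∃ m, f.Sep i m ∧ f'.Sep m j)
  | .nil s, f', i, j, h => by
    constructor
    · intro h'
      exact ⟨i, ⟨rfl, h'.le.1.trans_eq h.symm⟩, h'⟩
    · rintro ⟨m, ⟨rfl, -⟩, h'⟩
      exact h'
  | .cons t c, f', i, j, h => by
    simp only [append, StkRow.Sep, sep_append (f := c) h]
    constructor
    · rintro ⟨m, h1, n, h2, h3⟩; exact ⟨n, ⟨m, h1, h2⟩, h3⟩
    · rintro ⟨n, ⟨m, h1, h2⟩, h3⟩; exact ⟨m, h1, n, h2, h3⟩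

mutual
theorem Stk.Sep.graft : ∀ {a : Stk} (f : StkRow) {i j : ℕ}, a.Sep i j → (a.graft f).Sep i j
  | .leaf, f, i, j, ⟨hi, hj⟩ => by subst hi hj; exact Stk.sep_zero _
  | .node g c, f, i, j, .inl h => Or.inl h
  | .node g c, f, i, j, .inr ⟨i', j', hi, hj, h⟩ =>
    Or.inr ⟨i', j', hi, hj, StkRow.Sep.graft f h⟩
theorem StkRow.Sep.graft : ∀ {a : StkRow} (f : StkRow) {i j : ℕ}, a.Sep i j → (a.graft f).Sep i j
  | .nil _, _, _, _, h => ⟨h.1, h.2.trans (Nat.le_add_right _ _)⟩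
  | .cons _ _, _, _, _, ⟨m, h1, h2⟩ => ⟨m, Stk.Sep.graft _ h1, StkRow.Sep.graft _ h2⟩
end

mutual
theorem Stk.Sep.graft_above : ∀ {a : Stk} {f : StkRow} {i j : ℕ}, a.Valid → f.Valid →
    f.length = a.inputs → f.Sep i j → (a.graft f).Sep (a.left + i) (a.right + j)
  | .leaf, f, i, j, ha, hf, hl, h => by
    match f, hf, hl, h with
    | .nil s, hf, hl, h => simp [StkRow.length, Stk.inputs] at hl
    | .cons t (.cons _ _), hf, hl, h => simp [StkRow.length, Stk.inputs] at hl
    | .cons t (.nil s), hf, hl, ⟨m, h1, h2, _⟩ =>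
      subst h2
      simpa [Stk.left, show Stk.leaf.right = 0 from rfl, Stk.graft] using h1
  | .node g c, f, i, j, ha, hf, hl, h =>
    Or.inr ⟨c.left + i, c.right + j, by simp [Stk.left, add_assoc], by simp [Stk.right, add_assoc],
      StkRow.Sep.graft_above ha.2 hf hl h⟩
theorem StkRow.Sep.graft_above : ∀ {a : StkRow} {f : StkRow} {i j : ℕ}, a.Valid → f.Valid →
    f.length = a.inputs → f.Sep i j → (a.graft f).Sep (a.left + i) (a.right + j)
  | .nil s, f, i, j, ha, hf, hl, h => by
    obtain ⟨s', rfl⟩ := StkRow.length_eq_zero (by simpa [StkRow.inputs] using hl)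
    exact ⟨congrArg (s + ·) h.1, Nat.add_le_add_left h.2 s⟩
  | .cons t c, f, i, j, ha, hf, hl, h => by
    obtain ⟨h1, h2, h3⟩ := hf.take_drop t.inputs
    have hle : t.inputs ≤ f.length := by simp [hl, StkRow.inputs]
    rw [← StkRow.append_take_drop t.inputs f, StkRow.sep_append h3] at h
    obtain ⟨m, h4, h5⟩ := h
    refine ⟨t.right + m, Stk.Sep.graft_above ha.1 h1 (StkRow.length_take hle) h4, ?_⟩
    rw [ha.2.2]
    exact StkRow.Sep.graft_above ha.2.1 h2 (by simp [hl, StkRow.inputs]) h5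
end

mutual
/-- The horizontal cuts of a vertical composite, without semi-thin boxes below, come from the lower
or from the upper part. -/
theorem Stk.Sep.of_graft : ∀ {a : Stk} {f : StkRow} {i j : ℕ}, a.Valid → a.NoSemi → f.Valid →
    f.length = a.inputs → (a.graft f).Sep i j →
    a.Sep i j ∨ ∃ i' j', i = a.left + i' ∧ j = a.right + j' ∧ f.Sep i' j'
  | .leaf, f, i, j, ha, hn, hf, hl, h => by
    match f, hf, hl, h with
    | .nil s, hf, hl, h => simp [StkRow.length, Stk.inputs] at hl
    | .cons t (.cons _ _), hf, hl, h => simp [StkRow.length, Stk.inputs] at hl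
    | .cons t (.nil s), hf, hl, h =>
      have h' : t.Sep i j := h
      exact Or.inr ⟨i, j, (Nat.zero_add i).symm, (Nat.zero_add j).symm, j, h', rfl,
        h'.le.2.trans hf.2.2.le⟩
  | .node g c, f, i, j, ha, hn, hf, hl, h => by
    rcases h with h | ⟨i', j', rfl, rfl, h⟩
    · exact Or.inl (Or.inl h)
    · rcases StkRow.Sep.of_graft ha.2 (Stk.noSemi_node.1 hn).2 hf hl h with h' | ⟨a, b, rfl, rfl, h'⟩
      · exact Or.inl (Or.inr ⟨i', j', rfl, rfl, h'⟩)
      · exact Or.inr ⟨a, b, (add_assoc _ _ _).symm, (add_assoc _ _ _).symm, h'⟩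
theorem StkRow.Sep.of_graft : ∀ {a : StkRow} {f : StkRow} {i j : ℕ}, a.Valid → a.NoSemi →
    f.Valid → f.length = a.inputs → (a.graft f).Sep i j →
    a.Sep i j ∨ ∃ i' j', i = a.left + i' ∧ j = a.right + j' ∧ f.Sep i' j'
  | .nil s, f, i, j, ha, hn, hf, hl, h => by
    obtain ⟨s', rfl⟩ := StkRow.length_eq_zero (by simpa [StkRow.inputs] using hl)
    obtain ⟨rfl, h2⟩ := h
    rcases le_total i s with h1 | h1
    · exact Or.inl ⟨rfl, h1⟩
    · simp only [StkRow.left] at h2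
      exact Or.inr ⟨i - s, i - s, by simp only [StkRow.left]; omega,
        by simp only [StkRow.right]; omega, rfl, by omega⟩
  | .cons t c, f, i, j, ha, hn, hf, hl, ⟨m, h, h'⟩ => by
    obtain ⟨f1, f2, f3⟩ := hf.take_drop t.inputs
    have hle : t.inputs ≤ f.length := by simp [hl, StkRow.inputs]
    obtain ⟨n1, n2⟩ := StkRow.noSemi_cons.1 hn
    have key : ∀ i' m' j', (f.take t.inputs).Sep i' m' → (f.drop t.inputs).Sep m' j' →
        f.Sep i' j' := by
      intro i' m' j' h1 h2
      rw [← StkRow.append_take_drop t.inputs f, StkRow.sep_append f3]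
      exact ⟨m', h1, h2⟩
    have hs : t.right = c.left := ha.2.2
    rcases Stk.Sep.of_graft ha.1 n1 f1 (StkRow.length_take hle) h with
      h1 | ⟨i', m', rfl, rfl, h1⟩ <;>
    rcases StkRow.Sep.of_graft ha.2.1 n2 f2 (by simp [hl, StkRow.inputs]) h' with
      h2 | ⟨m'', j', hm, rfl, h2⟩
    · exact Or.inl ⟨m, h1, h2⟩
    · -- strictness of the cuts of `t` forces the cut to run along the top of `t`
      have hm' := h1.le.2
      have e1 : m'' = 0 := by omega
      subst e1
      have e2 := (h1.eq_iff n1 (Stk.sep_full ha.1)).2 (by omega)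
      exact Or.inr ⟨0, j', by simpa [StkRow.left] using e2, rfl,
        key 0 0 j' (StkRow.sep_zero _) h2⟩
    · have hm' := h2.le.1
      have e1 : m' = 0 := by omega
      subst e1
      have e2 := (h2.eq_iff n2 (StkRow.sep_full ha.2.1)).1 (by omega)
      exact Or.inr ⟨i', 0, rfl, by simpa [StkRow.right] using e2,
        key i' 0 0 h1 (StkRow.sep_zero _)⟩
    · have e1 : m' = m'' := by omega
      subst e1
      exact Or.inr ⟨i', j', rfl, rfl, key i' m' j' h1 h2⟩
end

mutual
theorem Stk.Sep.exists_cut : ∀ {t : Stk} {i j : ℕ}, t.Valid → t.Sep i j →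
    ∃ (a : Stk) (f : StkRow), a.IsCut f t ∧ a.left = i ∧ a.right = j
  | .leaf, i, j, ht, ⟨hi, hj⟩ => ⟨_, _, Stk.isCut_leaf ht, hi.symm, hj.symm⟩
  | .node g c, i, j, ht, .inl ⟨hi, hj⟩ => ⟨_, _, Stk.isCut_leaf ht, hi.symm, hj.symm⟩
  | .node g c, i, j, ht, .inr ⟨i', j', hi, hj, h⟩ => by
    obtain ⟨a, f, h1, rfl, rfl⟩ := StkRow.Sep.exists_cut ht.2 h
    exact ⟨_, _, h1.node ht, hi.symm, hj.symm⟩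
theorem StkRow.Sep.exists_cut : ∀ {t : StkRow} {i j : ℕ}, t.Valid → t.Sep i j →
    ∃ a f : StkRow, a.IsCut f t ∧ a.left = i ∧ a.right = j
  | .nil s, i, j, ht, ⟨hi, hj⟩ =>
    ⟨.nil i, .nil (s - i), ⟨trivial, trivial, rfl, by
      simp only [StkRow.graft, StkRow.left, StkRow.nil.injEq]; omega⟩, rfl, hi⟩
  | .cons t c, i, j, ht, ⟨m, h, h'⟩ => by
    obtain ⟨a, f, h1, h2, h3⟩ := Stk.Sep.exists_cut ht.1 h
    obtain ⟨b, f', h1', h2', h3'⟩ := StkRow.Sep.exists_cut ht.2.1 h'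
    have e1 := h1.right
    have e2 := h1'.left
    have e3 := ht.2.2
    exact ⟨_, _, h1.cons h1' ht (by omega), h2, h3'⟩
end

mutual
/-- Substitution of a stacking that has the same horizontal cuts as a single box does not change
the horizontal cuts. -/
theorem Stk.Pos.sep_subst {t' : Stk} (hv : t'.Valid) (hn : t'.NoSemi)
    (hs : ∀ i j, t'.Sep i j → (i = 0 ∧ j = 0) ∨ (i = t'.left ∧ j = t'.right)) :
    ∀ {t : Stk} {h : BoxLabel} (v : t.Pos h), t.Valid → t'.out BoxLabel.deg = h →
    ∀ i j, (v.subst t').Sep i j ↔ t.Sep i j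
  | _, _, .root g c, ht, ho, i, j => by
    subst ho
    constructor
    · intro h
      rcases h.of_graft hv hn ht.2 ht.1 with h' | ⟨i', j', rfl, rfl, h'⟩
      · rcases hs i j h' with h' | ⟨rfl, rfl⟩
        · exact Or.inl h'
        · exact Or.inr ⟨0, 0, rfl, rfl, c.sep_zero⟩
      · exact Or.inr ⟨i', j', rfl, rfl, h'⟩
    · rintro (⟨rfl, rfl⟩ | ⟨i', j', rfl, rfl, h⟩)
      · exact Stk.sep_zero _
      · exact Stk.Sep.graft_above hv ht.2 ht.1 h
  | _, _, .above g v, ht, ho, i, j => by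
    simp only [Stk.Pos.subst, Stk.Sep, StkRow.Pos.sep_subst hv hn hs v ht.2 ho]
theorem StkRow.Pos.sep_subst {t' : Stk} (hv : t'.Valid) (hn : t'.NoSemi)
    (hs : ∀ i j, t'.Sep i j → (i = 0 ∧ j = 0) ∨ (i = t'.left ∧ j = t'.right)) :
    ∀ {t : StkRow} {h : BoxLabel} (v : t.Pos h), t.Valid → t'.out BoxLabel.deg = h →
    ∀ i j, (v.subst t').Sep i j ↔ t.Sep i j
  | _, _, .here v c, ht, ho, i, j => by
    simp only [StkRow.Pos.subst, StkRow.Sep, Stk.Pos.sep_subst hv hn hs v ht.1 ho]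
  | _, _, .there t v, ht, ho, i, j => by
    simp only [StkRow.Pos.subst, StkRow.Sep, StkRow.Pos.sep_subst hv hn hs v ht.2.1 ho]
end

/-! ### Indicator functions of the constituents of thin-quadratic stackings -/

mutual
/-- Indicator function of the stackings without boxes. -/
def Stk.bare : Stk → ℤ
  | .leaf => 1
  | .node _ _ => 0
/-- Indicator function of the rows of open inputs, with sides `0`. -/
def StkRow.bare : StkRow → ℤ
  | .nil s => if s = 0 then 1 else 0
  | .cons t c => Stk.bare t * StkRow.bare c
end

mutual
/-- Indicator function of the stackings with exactly one box, which is thin. -/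
def Stk.oneThin : Stk → ℤ
  | .leaf => 0
  | .node g c => if g.Thin then StkRow.bare c else 0
/-- Indicator function of the rows with sides `0` and with exactly one box, which is thin. -/
def StkRow.oneThin : StkRow → ℤ
  | .nil _ => 0
  | .cons t c => Stk.oneThin t * StkRow.bare c + Stk.bare t * StkRow.oneThin c
end

mutual
/-- Indicator function of the stackings all of whose boxes are non-thin. -/
def Stk.thick : Stk → ℤ
  | .leaf => 1
  | .node g c => if 0 < g.p ∧ 0 < g.r then StkRow.thick c else 0
/-- Indicator function of the rows all of whose boxes are non-thin. -/
def StkRow.thick : StkRow → ℤ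
  | .nil _ => 1
  | .cons t c => Stk.thick t * StkRow.thick c
end

/-- There are horizontal wires, and no horizontal cut separates them. -/
def StkRow.Indec (c : StkRow) : Prop :=
  0 < c.left ∧ ∀ i j, c.Sep i j → i = 0 ∨ i = c.left

open Classical in
/-- Indicator function of the horizontally connected rows of non-thin boxes. -/
noncomputable def StkRow.indec (c : StkRow) : ℤ := if c.Indec then c.thick else 0

open Classical in
/-- The coefficient of a stacking in the thin desuspended infinitesimal decomposition, up to the
twist of the signs: `1` for the types I and III, `-1` for type II, and `0` for the stackings that are
not thin-quadratic. -/
noncomputable def Stk.tqSign : Stk → ℤ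
  | .leaf => 0
  | .node g c => if g.SemiThin then 0 else if g.Thin then c.oneThin + c.indec else -c.oneThin

theorem Stk.eq_leaf_of_bare : ∀ {t : Stk}, t.bare ≠ 0 → t = .leaf
  | .leaf, _ => rfl
  | .node _ _, h => absurd rfl h

theorem StkRow.eq_leaves_of_bare : ∀ {c : StkRow}, c.bare ≠ 0 → c = StkRow.leaves c.length
  | .nil s, h => by
    have : s = 0 := by by_contra hs; simp [bare, hs] at h
    subst this; rfl
  | .cons t c, h => by
    obtain ⟨h1, h2⟩ := mul_ne_zero_iff.1 h
    obtain rfl := Stk.eq_leaf_of_bare h1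
    exact congrArg (StkRow.cons .leaf) (eq_leaves_of_bare h2)

@[simp] theorem StkRow.bare_leaves (n : ℕ) : (StkRow.leaves n).bare = 1 := by
  induction n with
  | zero => rfl
  | succ n ih => simp [leaves, bare, Stk.bare, ih]

theorem StkRow.bare_spec {c : StkRow} (h : c.bare ≠ 0) :
    c.bare = 1 ∧ c.left = 0 ∧ c.right = 0 ∧ c.boxes = [] ∧ c.thick = 1 := by
  rw [eq_leaves_of_bare h]
  have := StkRow.leaves_spec c.length
  refine ⟨bare_leaves _, this.2.2.1, this.2.2.2.1, this.2.2.2.2.2, ?_⟩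
  induction c.length with
  | zero => rfl
  | succ n ih => simp [leaves, thick, Stk.thick, ih]

theorem Stk.oneThin_spec : ∀ {t : Stk}, t.oneThin ≠ 0 →
    t.oneThin = 1 ∧ t.left = 0 ∧ t.right = 0 ∧ ∃ h : BoxLabel, h.Thin ∧ t.boxes = [h]
  | .leaf, h => absurd rfl h
  | .node g c, h => by
    rw [oneThin] at h ⊢
    by_cases hg : g.Thin
    · rw [if_pos hg] at h ⊢
      obtain ⟨h1, h2, h3, h4, -⟩ := StkRow.bare_spec h
      exact ⟨h1, by simp [left, h2, hg.1], by simp [right, h3, hg.2], g, hg, by simp [boxes, h4]⟩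
    · exact absurd (if_neg hg) h

theorem StkRow.oneThin_spec : ∀ {c : StkRow}, c.oneThin ≠ 0 →
    c.oneThin = 1 ∧ c.left = 0 ∧ c.right = 0 ∧ ∃ h : BoxLabel, h.Thin ∧ c.boxes = [h]
  | .nil s, h => absurd rfl h
  | .cons t c, h => by
    by_cases h1 : t.oneThin = 0
    · have h2 : t.bare * c.oneThin ≠ 0 := by simpa [oneThin, h1] using h
      obtain ⟨h3, h4⟩ := mul_ne_zero_iff.1 h2
      obtain rfl := Stk.eq_leaf_of_bare h3
      obtain ⟨h5, h6, h7, h, h8, h9⟩ := oneThin_spec h4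
      exact ⟨by simp [oneThin, h1, h5, Stk.bare], rfl, h7, h, h8, by simp [boxes, Stk.boxes, h9]⟩
    · obtain ⟨h3, h4, h5, h', h6, h7⟩ := Stk.oneThin_spec h1
      have hb : t.bare = 0 := by
        cases t with
        | leaf => exact absurd rfl h1
        | node g c => rfl
      have h2 : c.bare ≠ 0 := by
        intro h2; simp [oneThin, hb, h2] at h
      obtain ⟨b1, b2, b3, b4, -⟩ := bare_spec h2
      exact ⟨by simp [oneThin, hb, b1, h3], h4, b3, h', h6, by simp [boxes, b4, h7]⟩

mutual
theorem Stk.thick_spec : ∀ {t : Stk}, t.thick ≠ 0 → t.thick = 1 ∧ ∀ g ∈ t.boxes, 0 < g.p ∧ 0 < g.r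
  | .leaf, _ => ⟨rfl, by simp [Stk.boxes]⟩
  | .node g c, h => by
    unfold Stk.thick at h ⊢
    by_cases hg : 0 < g.p ∧ 0 < g.r
    · rw [if_pos hg] at h ⊢
      obtain ⟨h1, h2⟩ := StkRow.thick_spec h
      exact ⟨h1, by simpa [Stk.boxes, hg] using h2⟩
    · exact absurd (if_neg hg) h
theorem StkRow.thick_spec : ∀ {t : StkRow}, t.thick ≠ 0 →
    t.thick = 1 ∧ ∀ g ∈ t.boxes, 0 < g.p ∧ 0 < g.r
  | .nil s, _ => ⟨rfl, by simp [StkRow.boxes]⟩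
  | .cons t c, h => by
    obtain ⟨h1, h2⟩ := mul_ne_zero_iff.1 h
    obtain ⟨h3, h4⟩ := Stk.thick_spec h1
    obtain ⟨h5, h6⟩ := StkRow.thick_spec h2
    exact ⟨by simp [StkRow.thick, h3, h5], by simpa [StkRow.boxes, or_imp, forall_and] using
      ⟨⟨fun g hg => (h4 g hg).1, fun g hg => (h6 g hg).1⟩,
        fun g hg => (h4 g hg).2, fun g hg => (h6 g hg).2⟩⟩
end

theorem BoxLabel.shift_of_pos {g : BoxLabel} (h : 0 < g.p ∧ 0 < g.r) : g.shift = 0 :=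
  if_neg fun h' => h.1.ne' h'.1

theorem StkRow.noSemi_of_thick {c : StkRow} (h : c.thick ≠ 0) : c.NoSemi := fun g hg => by
  have := (StkRow.thick_spec h).2 g hg
  unfold BoxLabel.SemiThin; omega

theorem StkRow.noSemi_of_oneThin {c : StkRow} (h : c.oneThin ≠ 0) : c.NoSemi := fun g hg => by
  obtain ⟨-, -, -, g', h1, h2⟩ := StkRow.oneThin_spec h
  rw [h2, List.mem_singleton] at hg
  subst hg
  unfold BoxLabel.SemiThin; unfold BoxLabel.Thin at h1; omega

theorem StkRow.indec_spec {c : StkRow} (h : c.indec ≠ 0) : c.Indec ∧ c.thick ≠ 0 := by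
  unfold indec at h
  split_ifs at h with h1
  · exact ⟨h1, h⟩
  · exact absurd rfl h

theorem StkRow.degree_shift_of_thick {c : StkRow} (h : c.thick ≠ 0) :
    c.degree BoxLabel.shift = 0 :=
  List.sum_eq_zero fun x hx => by
    obtain ⟨g, hg, rfl⟩ := List.mem_map.1 hx
    exact BoxLabel.shift_of_pos ((StkRow.thick_spec h).2 g hg)

theorem StkRow.degree_shift_of_oneThin {c : StkRow} (h : c.oneThin ≠ 0) :
    c.degree BoxLabel.shift = -1 := by
  obtain ⟨-, -, -, g', h1, h2⟩ := StkRow.oneThin_spec h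
  simp [degree, h2, BoxLabel.shift, h1]

/-- Thin-quadratic stackings have no other horizontal cuts than a single box has, and have one more
desuspension than their output. -/
theorem Stk.tqSign_spec : ∀ {t : Stk}, t.Valid → t.tqSign ≠ 0 → t.NoSemi ∧
    (∀ i j, t.Sep i j → (i = 0 ∧ j = 0) ∨ (i = t.left ∧ j = t.right)) ∧
    (t.out BoxLabel.deg).shift = t.degree BoxLabel.shift + 1
  | .leaf, _, h => absurd rfl h
  | .node g c, hv, h => by
    rw [tqSign] at h
    by_cases hg : g.SemiThin
    · exact absurd (if_pos hg) h
    rw [if_neg hg] at h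
    by_cases ho : c.oneThin = 0
    · by_cases ht : g.Thin
      · rw [if_pos ht, ho, zero_add] at h
        obtain ⟨h1, h2⟩ := StkRow.indec_spec h
        have hn := StkRow.noSemi_of_thick h2
        refine ⟨Stk.noSemi_node.2 ⟨hg, hn⟩, ?_, ?_⟩
        · rintro i j (h3 | ⟨i', j', rfl, rfl, h3⟩)
          · exact Or.inl h3
          · rw [left, right, ht.1, ht.2]
            rcases h1.2 i' j' h3 with rfl | rfl
            · have := (h3.eq_iff hn c.sep_zero).1 rfl
              simp [this]
            · have := (h3.eq_iff hn (StkRow.sep_full hv.2)).1 rfl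
              simp [this]
        · have h3 : ¬ ((Stk.node g c).out BoxLabel.deg).Thin := by
            rintro ⟨h3, -⟩
            have := h1.1
            simp only [out, left] at h3
            omega
          simp [BoxLabel.shift, h3, ht, StkRow.degree_shift_of_thick h2]
      · rw [if_neg ht, ho] at h
        exact absurd rfl h
    · obtain ⟨-, h1, h2, h', h3, h4⟩ := StkRow.oneThin_spec ho
      refine ⟨Stk.noSemi_node.2 ⟨hg, StkRow.noSemi_of_oneThin ho⟩, ?_, ?_⟩
      · rintro i j (h3 | ⟨i', j', rfl, rfl, h3⟩)
        · exact Or.inl h3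
        · have := h3.le
          exact Or.inr ⟨by simp only [left]; omega, by simp only [right]; omega⟩
      · rw [degree_node, StkRow.degree_shift_of_oneThin ho, neg_add_cancel_right]
        simp [BoxLabel.shift, BoxLabel.Thin, out, left, right, h1, h2]
        rfl

/-! ### Convolution sums over the cuts of a row -/

theorem StkRow.append_leaves (m n : ℕ) :
    (StkRow.leaves m).append (StkRow.leaves n) = StkRow.leaves (m + n) := by
  induction m with
  | zero => simp [leaves, append]
  | succ m ih => rw [Nat.add_right_comm]; exact congrArg (StkRow.cons .leaf) ih

theorem StkRow.bare_append : ∀ {f f' : StkRow}, f.right = f'.left →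
    (f.append f').bare = f.bare * f'.bare
  | .nil s, f', h => by
    by_cases hs : s = 0
    · simp [append, bare, hs]
    · have : f'.bare = 0 := by
        by_contra h'
        exact hs (h.trans (bare_spec h').2.1)
      simp [append, bare, this]
  | .cons t c, f', h => by
    rw [append, bare, bare, bare_append (f := c) h, mul_assoc]

theorem StkRow.oneThin_append : ∀ {f f' : StkRow}, f.right = f'.left →
    (f.append f').oneThin = f.oneThin * f'.bare + f.bare * f'.oneThin
  | .nil s, f', h => by
    by_cases hs : s = 0
    · simp [append, bare, oneThin, hs]
    · have : f'.oneThin = 0 := by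
        by_contra h'
        exact hs (h.trans (oneThin_spec h').2.1)
      simp [append, bare, oneThin, this]
  | .cons t c, f', h => by
    rw [append, oneThin, oneThin, oneThin_append (f := c) h, bare_append (f := c) h, bare]; ring

theorem StkRow.thick_append : ∀ (f f' : StkRow), (f.append f').thick = f.thick * f'.thick
  | .nil s, f' => by simp [append, thick]
  | .cons t c, f' => by rw [append, thick, thick, thick_append c, mul_assoc]

theorem StkRow.cutSum_mul (t : Stk) (c : StkRow) (G : Stk → StkRow → ℤ)
    (H : StkRow → StkRow → ℤ) :
    (t.cutSum fun a f => c.cutSum fun b f' => G a f * H b f') = t.cutSum G * c.cutSum H := by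
  have h1 : ∀ a f, (c.cutSum fun b f' => G a f * H b f') = G a f * c.cutSum H := fun a f =>
    (StkRow.map_cutSum (AddMonoidHom.mulLeft (G a f)) c H).symm
  simp only [h1]
  exact (Stk.map_cutSum (AddMonoidHom.mulRight (c.cutSum H)) t G).symm

/-- Sums over the cuts of a row `t, c` that are products, when the summands force the cuts of `t`
and `c` to fit together. -/
theorem StkRow.cutSum_cons {t : Stk} {c : StkRow} (hv : (StkRow.cons t c).Valid)
    {F : StkRow → StkRow → ℤ} {E : Stk → StkRow → StkRow → StkRow → ℤ}
    (h : ∀ a f b f', a.IsCut f t → b.IsCut f' c → f.right = f'.left →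
      F (.cons a b) (f.append f') = E a f b f')
    (h0 : ∀ a f b f', E a f b f' ≠ 0 → a.right = 0 ∧ b.left = 0 ∨ f.right = 0 ∧ f'.left = 0) :
    (StkRow.cons t c).cutSum F = t.cutSum fun a f => c.cutSum fun b f' => E a f b f' := by
  rw [StkRow.cutSum]
  refine Stk.cutSum_congr hv.1 fun a f ha => StkRow.cutSum_congr hv.2.1 fun b f' hb => ?_
  by_cases hs : f.right = f'.left
  · rw [if_pos hs]; exact h a f b f' ha hb hs
  · rw [if_neg hs]
    by_contra hE
    have e1 := ha.right
    have e2 := hb.left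
    have e3 : t.right = c.left := hv.2.2
    rcases h0 a f b f' (Ne.symm hE) with h | h <;> omega

theorem Stk.cutSum_bare_mul (F : Stk → StkRow → ℤ) : ∀ t : Stk,
    (t.cutSum fun a f => a.bare * F a f) = F .leaf (.cons t (.nil t.right))
  | .leaf => one_mul _
  | .node g c => by
    rw [cutSum]
    simp only [bare, zero_mul, one_mul, StkRow.cutSum_zero, add_zero]
    rfl

/-- Rows without boxes are units for the convolution, on the left. -/
theorem StkRow.cutSum_bare_mul : ∀ {c : StkRow} (F : StkRow → StkRow → ℤ), c.Valid →
    (c.cutSum fun a f => a.bare * F a f) = F (StkRow.leaves c.length) c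
  | .nil s, F, _ => by
    rw [cutSum, Finset.sum_eq_single (0, s)]
    · simp [bare, length, leaves]
    · rintro ⟨i, j⟩ hij hne
      have hi : i ≠ 0 := by
        rintro rfl
        rw [Finset.HasAntidiagonal.mem_antidiagonal, zero_add] at hij
        exact hne (Prod.ext rfl hij)
      simp [bare, hi]
    · intro hn
      exact absurd (Finset.HasAntidiagonal.mem_antidiagonal.2 (zero_add s)) hn
  | .cons t c, F, hv => by
    rw [cutSum]
    have h1 : ∀ (a : Stk) (f : StkRow), (c.cutSum fun b f' => if f.right = f'.left then
        (cons a b).bare * F (.cons a b) (f.append f') else 0) = a.bare *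
          (if f.right = c.left then F (.cons a (leaves c.length)) (f.append c) else 0) := by
      intro a f
      have := cutSum_bare_mul (c := c) (fun b f' => a.bare *
        (if f.right = f'.left then F (.cons a b) (f.append f') else 0)) hv.2.1
      refine Eq.trans ?_ this
      congr 1; funext b f'
      split_ifs
      · rw [bare]; ring
      · ring
    simp only [h1]
    rw [Stk.cutSum_bare_mul (fun a f => if f.right = c.left then
      F (.cons a (leaves c.length)) (f.append c) else 0) t]
    rw [if_pos (show (cons t (nil t.right)).right = c.left from hv.2.2)]
    rfl

mutual
theorem Stk.cutSum_mul_bare (F : Stk → StkRow → ℤ) : ∀ {t : Stk}, t.Valid →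
    (t.cutSum fun a f => F a f * f.bare) = F t (StkRow.leaves t.inputs)
  | .leaf, _ => by simp [Stk.cutSum, StkRow.bare, Stk.bare, Stk.inputs, StkRow.leaves]
  | .node g c, hv => by
    rw [Stk.cutSum, StkRow.cutSum_mul_bare (fun a f => F (.node g a) f) hv.2]
    simp [StkRow.bare, Stk.bare, Stk.inputs]
/-- Rows without boxes are units for the convolution, on the right. -/
theorem StkRow.cutSum_mul_bare (F : StkRow → StkRow → ℤ) : ∀ {c : StkRow}, c.Valid →
    (c.cutSum fun a f => F a f * f.bare) = F c (StkRow.leaves c.inputs)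
  | .nil s, _ => by
    rw [StkRow.cutSum, Finset.sum_eq_single (s, 0)]
    · simp [StkRow.bare, StkRow.inputs, StkRow.leaves]
    · rintro ⟨i, j⟩ hij hne
      have hi : j ≠ 0 := by
        rintro rfl
        rw [Finset.HasAntidiagonal.mem_antidiagonal, add_zero] at hij
        exact hne (Prod.ext hij rfl)
      simp [StkRow.bare, hi]
    · intro hn
      exact absurd (Finset.HasAntidiagonal.mem_antidiagonal.2 (add_zero s)) hn
  | .cons t c, hv => by
    rw [StkRow.cutSum]
    have h1 : ∀ (a : Stk) (f : StkRow), (c.cutSum fun b f' => if f.right = f'.left then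
        F (.cons a b) (f.append f') * (f.append f').bare else 0) =
          F (.cons a c) (f.append (StkRow.leaves c.inputs)) * f.bare := by
      intro a f
      have := StkRow.cutSum_mul_bare (fun b f' => F (.cons a b) (f.append f') * f.bare) hv.2.1
      refine Eq.trans ?_ this
      congr 1; funext b f'
      split_ifs with hs
      · rw [StkRow.bare_append hs]; ring
      · by_contra h
        obtain ⟨h2, h3⟩ := mul_ne_zero_iff.1 (Ne.symm h)
        exact hs ((StkRow.bare_spec (right_ne_zero_of_mul h2)).2.2.1.trans
          (StkRow.bare_spec h3).2.1.symm)
    simp only [h1]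
    rw [Stk.cutSum_mul_bare (fun a f => F (.cons a c) (f.append (StkRow.leaves c.inputs))) hv.1,
      StkRow.append_leaves]
    rfl
end

mutual
theorem Stk.shuf_eq_zero_left {δ : BoxLabel → ℤ} : ∀ {a : Stk} (f : StkRow),
    (∀ g ∈ a.boxes, δ g = 0) → a.shuf δ f = 0
  | .leaf, _, _ => rfl
  | .node _ _, f, h => StkRow.shuf_eq_zero_left f fun g' hg => h g' (List.mem_cons_of_mem _ hg)
theorem StkRow.shuf_eq_zero_left {δ : BoxLabel → ℤ} : ∀ {a : StkRow} (f : StkRow),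
    (∀ g ∈ a.boxes, δ g = 0) → a.shuf δ f = 0
  | .nil s, f, _ => rfl
  | .cons t c, f, h => by
    have h1 : c.degree δ = 0 := List.sum_eq_zero fun x hx => by
      obtain ⟨g, hg, rfl⟩ := List.mem_map.1 hx
      exact h g (List.mem_append_right _ hg)
    rw [StkRow.shuf, Stk.shuf_eq_zero_left _ fun g hg => h g (List.mem_append_left _ hg),
      StkRow.shuf_eq_zero_left _ fun g hg => h g (List.mem_append_right _ hg), h1]
    ring
end

mutual
theorem Stk.shuf_eq_zero_right {δ : BoxLabel → ℤ} : ∀ (a : Stk) {f : StkRow},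
    (∀ g ∈ f.boxes, δ g = 0) → a.shuf δ f = 0
  | .leaf, _, _ => rfl
  | .node _ c, _, h => StkRow.shuf_eq_zero_right c h
theorem StkRow.shuf_eq_zero_right {δ : BoxLabel → ℤ} : ∀ (a : StkRow) {f : StkRow},
    (∀ g ∈ f.boxes, δ g = 0) → a.shuf δ f = 0
  | .nil s, f, _ => rfl
  | .cons t c, f, h => by
    rw [← StkRow.boxes_take_append_drop t.inputs f] at h
    have h1 : (f.take t.inputs).degree δ = 0 := List.sum_eq_zero fun x hx => by
      obtain ⟨g, hg, rfl⟩ := List.mem_map.1 hx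
      exact h g (List.mem_append_left _ hg)
    rw [StkRow.shuf, Stk.shuf_eq_zero_right _ fun g hg => h g (List.mem_append_left _ hg),
      StkRow.shuf_eq_zero_right _ fun g hg => h g (List.mem_append_right _ hg), h1]
    ring
end

theorem StkRow.boxes_of_bare {c : StkRow} (h : c.bare ≠ 0) (δ : BoxLabel → ℤ) :
    ∀ g ∈ c.boxes, δ g = 0 := by simp [(StkRow.bare_spec h).2.2.2.1]

theorem StkRow.degree_of_bare {c : StkRow} (h : c.bare ≠ 0) (δ : BoxLabel → ℤ) :
    c.degree δ = 0 := by simp [StkRow.degree, (StkRow.bare_spec h).2.2.2.1]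

@[simp] theorem StkRow.boxes_leaves (n : ℕ) : (StkRow.leaves n).boxes = [] :=
  (StkRow.leaves_spec n).2.2.2.2.2

theorem Stk.right_eq_zero {t : Stk} (h : t.bare ≠ 0 ∨ t.oneThin ≠ 0) : t.right = 0 := by
  rcases h with h | h
  · rw [Stk.eq_leaf_of_bare h]; rfl
  · exact (Stk.oneThin_spec h).2.2.1

theorem StkRow.right_eq_zero {t : StkRow} (h : t.bare ≠ 0 ∨ t.oneThin ≠ 0) : t.right = 0 := by
  rcases h with h | h
  · exact (StkRow.bare_spec h).2.2.1
  · exact (StkRow.oneThin_spec h).2.2.1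

theorem StkRow.left_eq_zero {t : StkRow} (h : t.bare ≠ 0 ∨ t.oneThin ≠ 0) : t.left = 0 := by
  rcases h with h | h
  · exact (StkRow.bare_spec h).2.1
  · exact (StkRow.oneThin_spec h).2.1

theorem StkRow.oneThin_single (t : Stk) : (StkRow.cons t (.nil t.right)).oneThin = t.oneThin := by
  by_cases h : t.oneThin = 0
  · simp [oneThin, h]
  · simp [oneThin, bare, (Stk.oneThin_spec h).2.2.1]

mutual
/-- Indicator function of the stackings of two thin boxes, one above the other one. -/
def Stk.twoThin : Stk → ℤ
  | .leaf => 0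
  | .node g c => if g.Thin then c.oneThin else 0
/-- Indicator function of the rows with sides `0` that consist of two thin boxes, one above the
other one. -/
def StkRow.twoThin : StkRow → ℤ
  | .nil _ => 0
  | .cons t c => Stk.twoThin t * c.bare + t.bare * StkRow.twoThin c
end

mutual
theorem Stk.cutSum_oneThin_oneThin : ∀ {t : Stk}, t.Valid →
    (t.cutSum fun a f => a.oneThin * f.oneThin * koszul ℤ (a.shuf BoxLabel.shift f)) = t.twoThin
  | .leaf, _ => by simp [Stk.cutSum, Stk.oneThin, Stk.twoThin]
  | .node g c, hv => by
    rw [Stk.cutSum, Stk.twoThin]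
    by_cases hg : g.Thin
    · have h1 := StkRow.cutSum_bare_mul (c := c)
        (fun a f => f.oneThin * koszul ℤ (a.shuf BoxLabel.shift f)) hv.2
      rw [StkRow.shuf_eq_zero_left _ (by simp), koszul_zero, mul_one] at h1
      simpa [Stk.oneThin, hg, Stk.shuf, mul_assoc] using h1
    · simp [Stk.oneThin, hg, StkRow.cutSum_zero]
/-- The sum over the ways to remove two thin boxes one after the other. Thin boxes side by side can be
removed in both orders, with opposite signs, so that only thin boxes above each other remain. -/
theorem StkRow.cutSum_oneThin_oneThin : ∀ {t : StkRow}, t.Valid →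
    (t.cutSum fun a f => a.oneThin * f.oneThin * koszul ℤ (a.shuf BoxLabel.shift f)) = t.twoThin
  | .nil s, _ => by simp [StkRow.cutSum, StkRow.oneThin, StkRow.twoThin]
  | .cons t c, hv => by
    rw [StkRow.cutSum_cons hv (E := fun a f b f' =>
      (a.oneThin * f.oneThin * koszul ℤ (a.shuf BoxLabel.shift f)) * (b.bare * f'.bare) +
      (a.bare * f.bare) * (b.oneThin * f'.oneThin * koszul ℤ (b.shuf BoxLabel.shift f')) +
      (a.oneThin * f.bare) * (b.bare * f'.oneThin) +
      (-(a.bare * f.oneThin)) * (b.oneThin * f'.bare))]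
    · simp only [StkRow.cutSum_add, Stk.cutSum_add, StkRow.cutSum_mul,
        Stk.cutSum_oneThin_oneThin hv.1, StkRow.cutSum_oneThin_oneThin hv.2.1]
      have e1 : (t.cutSum fun a f => -(a.bare * f.oneThin)) = -t.oneThin := by
        have h1 := Stk.cutSum_bare_mul (fun _ f => f.oneThin) t
        rw [StkRow.oneThin_single] at h1
        rw [← h1]
        exact (Stk.map_cutSum (negAddMonoidHom (α := ℤ)) t _).symm
      rw [e1, Stk.cutSum_mul_bare (fun a _ => a.bare) hv.1,
        Stk.cutSum_mul_bare (fun a _ => a.oneThin) hv.1,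
        StkRow.cutSum_mul_bare (fun a _ => a.bare) hv.2.1,
        StkRow.cutSum_mul_bare (fun a _ => a.oneThin) hv.2.1,
        StkRow.cutSum_bare_mul (fun _ f => f.oneThin) hv.2.1, StkRow.twoThin]
      ring
    · intro a f b f' ha hb hs
      obtain ⟨-, -, -, h1, h2⟩ := StkRow.append_spec f f' hs
      rw [ha.length] at h1 h2
      rw [StkRow.shuf, h1, h2, StkRow.oneThin_append hs, StkRow.oneThin]
      set m := b.degree BoxLabel.shift * f.degree BoxLabel.shift + a.shuf BoxLabel.shift f +
        b.shuf BoxLabel.shift f' with hm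
      have ha0 : a.bare ≠ 0 → a.shuf BoxLabel.shift f = 0 := fun h => by
        rw [Stk.eq_leaf_of_bare h]; rfl
      have t1 : a.oneThin * b.bare * (f.oneThin * f'.bare) * koszul ℤ m =
          a.oneThin * b.bare * (f.oneThin * f'.bare) * koszul ℤ (a.shuf BoxLabel.shift f) := by
        by_cases hb0 : b.bare = 0
        · simp [hb0]
        · rw [hm, StkRow.degree_of_bare hb0, StkRow.shuf_eq_zero_left _ (StkRow.boxes_of_bare hb0 _)]
          simp
      have t2 : a.oneThin * b.bare * (f.bare * f'.oneThin) * koszul ℤ m =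
          a.oneThin * b.bare * (f.bare * f'.oneThin) := by
        by_cases hb0 : b.bare = 0
        · simp [hb0]
        by_cases hf0 : f.bare = 0
        · simp [hf0]
        · rw [hm, StkRow.degree_of_bare hb0, StkRow.shuf_eq_zero_left _ (StkRow.boxes_of_bare hb0 _),
            Stk.shuf_eq_zero_right _ (StkRow.boxes_of_bare hf0 _)]
          simp
      have t3 : a.bare * b.oneThin * (f.oneThin * f'.bare) * koszul ℤ m =
          -(a.bare * b.oneThin * (f.oneThin * f'.bare)) := by
        by_cases h1 : a.bare = 0
        · simp [h1]
        by_cases h2 : b.oneThin = 0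
        · simp [h2]
        by_cases h3 : f.oneThin = 0
        · simp [h3]
        by_cases h4 : f'.bare = 0
        · simp [h4]
        rw [hm, StkRow.degree_shift_of_oneThin h2, StkRow.degree_shift_of_oneThin h3, ha0 h1,
          StkRow.shuf_eq_zero_right _ (StkRow.boxes_of_bare h4 _)]
        simp [koszul_one]
      have t4 : a.bare * b.oneThin * (f.bare * f'.oneThin) * koszul ℤ m =
          a.bare * b.oneThin * (f.bare * f'.oneThin) * koszul ℤ (b.shuf BoxLabel.shift f') := by
        by_cases h1 : a.bare = 0
        · simp [h1]
        by_cases h4 : f.bare = 0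
        · simp [h4]
        rw [hm, StkRow.degree_of_bare h4, ha0 h1]
        simp
      linear_combination t1 + t2 + t3 + t4
    · intro a f b f' hE
      left
      constructor
      · by_contra h
        have h1 : a.bare = 0 := by by_contra h'; exact h (Stk.right_eq_zero (.inl h'))
        have h2 : a.oneThin = 0 := by by_contra h'; exact h (Stk.right_eq_zero (.inr h'))
        simp [h1, h2] at hE
      · by_contra h
        have h1 : b.bare = 0 := by by_contra h'; exact h (StkRow.left_eq_zero (.inl h'))
        have h2 : b.oneThin = 0 := by by_contra h'; exact h (StkRow.left_eq_zero (.inr h'))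
        simp [h1, h2] at hE
end

mutual
theorem Stk.Pos.bare_eq_zero : ∀ {t : Stk} {h : BoxLabel} (_ : t.Pos h), t.bare = 0
  | _, _, .root _ _ => rfl
  | _, _, .above _ _ => rfl
theorem StkRow.Pos.bare_eq_zero : ∀ {t : StkRow} {h : BoxLabel} (_ : t.Pos h), t.bare = 0
  | _, _, .here v c => by rw [StkRow.bare, Stk.Pos.bare_eq_zero v, zero_mul]
  | _, _, .there t v => by rw [StkRow.bare, StkRow.Pos.bare_eq_zero v, mul_zero]
end

theorem Stk.factSum_mul_right (T : Stk) (F : (t : Stk) → (h : BoxLabel) → t.Pos h → Stk → ℤ)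
    (m : ℤ) : (T.factSum fun t h v t' => F t h v t' * m) = T.factSum F * m :=
  (Stk.map_factSum (AddMonoidHom.mulRight m) T F).symm

theorem StkRow.factSum_mul_left (T : StkRow)
    (F : (t : StkRow) → (h : BoxLabel) → t.Pos h → Stk → ℤ)
    (m : ℤ) : (T.factSum fun t h v t' => m * F t h v t') = m * T.factSum F :=
  (StkRow.map_factSum (AddMonoidHom.mulLeft m) T F).symm

theorem StkRow.indec_eq_zero {c : StkRow} (h : c.left = 0) : c.indec = 0 :=
  if_neg fun h' => h'.1.ne' h

mutual
theorem Stk.factSum_oneThin : ∀ {T : Stk}, T.Valid →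
    (T.factSum fun t _ v t' => t.oneThin * t'.tqSign *
      koszul ℤ (v.before BoxLabel.shift + v.shuf BoxLabel.shift t')) = T.twoThin
  | .leaf, _ => rfl
  | .node g c, hv => by
    rw [Stk.factSum]
    have h1 : (c.factSum fun c₀ h v t' => (Stk.node g c₀).oneThin * t'.tqSign *
        koszul ℤ ((Stk.Pos.above g v).before BoxLabel.shift +
          (Stk.Pos.above g v).shuf BoxLabel.shift t')) = 0 := by
      rw [← StkRow.factSum_zero c]
      congr 1; funext c₀ h v t'
      simp [Stk.oneThin, v.bare_eq_zero]
    rw [h1, add_zero]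
    have h2 := StkRow.cutSum_mul_bare (fun a f =>
      (if ((Stk.node g a).out BoxLabel.deg).Thin then 1 else 0) * (Stk.node g a).tqSign *
        koszul ℤ ((Stk.node g a).shuf BoxLabel.shift f)) hv.2
    rw [Stk.shuf_eq_zero_right _ (by simp), koszul_zero, mul_one] at h2
    rw [Stk.twoThin]
    refine Eq.trans (StkRow.cutSum_congr hv.2 fun a f _ => ?_) (h2.trans ?_)
    · simp only [Stk.oneThin, Stk.Pos.before, Stk.Pos.shuf, zero_add]
      split_ifs <;> ring
    · by_cases hg : g.Thin
      · rw [if_pos hg]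
        have hs : ¬ g.SemiThin := by
          unfold BoxLabel.SemiThin; unfold BoxLabel.Thin at hg; omega
        by_cases ho : ((Stk.node g c).out BoxLabel.deg).Thin
        · have : c.left = 0 := by have := ho.1; simp only [Stk.out, Stk.left] at this; omega
          rw [if_pos ho, Stk.tqSign, if_neg hs, if_pos hg, StkRow.indec_eq_zero this]; ring
        · rw [if_neg ho, zero_mul]
          by_contra h
          obtain ⟨-, h3, h4, -⟩ := StkRow.oneThin_spec (Ne.symm h)
          exact ho ⟨by simp [Stk.out, Stk.left, h3, hg.1], by simp [Stk.out, Stk.right, h4, hg.2]⟩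
      · rw [if_neg hg, if_neg, zero_mul]
        rintro ⟨h3, h4⟩
        simp only [Stk.out, Stk.left, Stk.right] at h3 h4
        exact hg ⟨by omega, by omega⟩
/-- The sum over the ways to see a row as a single thin box in which a thin-quadratic stacking is
substituted. -/
theorem StkRow.factSum_oneThin : ∀ {T : StkRow}, T.Valid →
    (T.factSum fun t _ v t' => t.oneThin * t'.tqSign *
      koszul ℤ (v.before BoxLabel.shift + v.shuf BoxLabel.shift t')) = T.twoThin
  | .nil s, _ => rfl
  | .cons t c, hv => by
    rw [StkRow.factSum, StkRow.twoThin, ← Stk.factSum_oneThin hv.1,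
      ← StkRow.factSum_oneThin hv.2.1, ← Stk.factSum_mul_right, ← StkRow.factSum_mul_left]
    congr 2
    · funext t₀ h v t'
      simp only [StkRow.oneThin, v.bare_eq_zero, StkRow.Pos.before, StkRow.Pos.shuf]; ring
    · funext c₀ h v t'
      simp only [StkRow.oneThin, v.bare_eq_zero, StkRow.Pos.before, StkRow.Pos.shuf]
      by_cases ht : t.bare = 0
      · rw [ht]; ring
      · rw [Stk.eq_leaf_of_bare ht, Stk.degree_leaf, zero_add]; ring
end

mutual
theorem Stk.thick_graft : ∀ (a : Stk) (f : StkRow), f.length = a.inputs →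
    (a.graft f).thick = a.thick * f.thick
  | .leaf, f, hl => by
    cases f with
    | nil => simp [StkRow.length, Stk.inputs] at hl
    | cons t c =>
      obtain ⟨s, rfl⟩ := StkRow.length_eq_zero (by simpa [StkRow.length, Stk.inputs] using hl)
      simp [Stk.graft, Stk.thick, StkRow.thick]
  | .node g c, f, hl => by
    rw [Stk.graft, Stk.thick, Stk.thick, StkRow.thick_graft c f hl]
    split_ifs <;> ring
theorem StkRow.thick_graft : ∀ (a f : StkRow), f.length = a.inputs →
    (a.graft f).thick = a.thick * f.thick
  | .nil s, f, hl => by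
    obtain ⟨s, rfl⟩ := StkRow.length_eq_zero (by simpa [StkRow.inputs] using hl)
    simp [StkRow.graft, StkRow.thick]
  | .cons t c, f, hl => by
    have hle : t.inputs ≤ f.length := by simp [hl, StkRow.inputs]
    have h1 := StkRow.thick_append (f.take t.inputs) (f.drop t.inputs)
    rw [StkRow.append_take_drop] at h1
    rw [StkRow.graft, StkRow.thick, StkRow.thick, Stk.thick_graft t _ (StkRow.length_take hle),
      StkRow.thick_graft c _ (by simp [hl, StkRow.inputs]), h1]
    ring
end

mutual
/-- Without thin and semi-thin boxes, a cut is determined by its height on the left. -/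
theorem Stk.IsCut.unique : ∀ {t a a' : Stk} {f f' : StkRow}, t.Valid → t.thick ≠ 0 → a.IsCut f t →
    a'.IsCut f' t → a.left = a'.left → a = a' ∧ f = f'
  | .leaf, a, a', f, f', _, _, h, h', _ => by
    obtain ⟨rfl, rfl⟩ := h.of_leaf
    obtain ⟨rfl, rfl⟩ := h'.of_leaf
    exact ⟨rfl, rfl⟩
  | .node g c, a, a', f, f', hv, hn, h, h', hl => by
    rw [Stk.thick] at hn
    by_cases hg : 0 < g.p ∧ 0 < g.r
    · rw [if_pos hg] at hn
      rcases h.of_node with ⟨rfl, rfl⟩ | ⟨b, rfl, hb⟩ <;>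
        rcases h'.of_node with ⟨rfl, rfl⟩ | ⟨b', rfl, hb'⟩
      · exact ⟨rfl, rfl⟩
      · simp only [Stk.left] at hl; omega
      · simp only [Stk.left] at hl; omega
      · simp only [Stk.left] at hl
        obtain ⟨rfl, rfl⟩ := StkRow.IsCut.unique hv.2 hn hb hb' (by omega)
        exact ⟨rfl, rfl⟩
    · exact absurd (if_neg hg) hn
theorem StkRow.IsCut.unique : ∀ {t a a' : StkRow} {f f' : StkRow}, t.Valid → t.thick ≠ 0 →
    a.IsCut f t → a'.IsCut f' t → a.left = a'.left → a = a' ∧ f = f'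
  | .nil s, a, a', f, f', _, _, h, h', hl => by
    obtain ⟨i, j, h1, rfl, rfl⟩ := h.of_nil
    obtain ⟨i', j', h1', rfl, rfl⟩ := h'.of_nil
    simp only [StkRow.left] at hl
    subst hl
    have : j = j' := by omega
    subst this
    exact ⟨rfl, rfl⟩
  | .cons t c, a, a', f, f', hv, hn, h, h', hl => by
    obtain ⟨n1, n2⟩ := mul_ne_zero_iff.1 hn
    obtain ⟨a₁, b, f₁, f₂, rfl, rfl, hs, h1, h2⟩ := h.of_cons
    obtain ⟨a₁', b', f₁', f₂', rfl, rfl, hs', h1', h2'⟩ := h'.of_cons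
    obtain ⟨rfl, rfl⟩ := Stk.IsCut.unique hv.1 n1 h1 h1' hl
    have e1 := h2.left
    have e2 := h2'.left
    obtain ⟨rfl, rfl⟩ := StkRow.IsCut.unique hv.2.1 n2 h2 h2' (by omega)
    exact ⟨rfl, rfl⟩
end

theorem StkRow.bare_of_thick : ∀ {c : StkRow}, c.Valid → c.thick ≠ 0 → c.left = 0 → c.bare = 1
  | .nil s, _, _, h => if_pos h
  | .cons t c, hv, hn, h => by
    obtain ⟨n1, n2⟩ := mul_ne_zero_iff.1 hn
    match t, hv, n1, h with
    | .leaf, hv, _, _ => simp [bare, Stk.bare, bare_of_thick hv.2.1 n2 hv.2.2.symm]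
    | .node g c', hv, n1, h =>
      have := (Stk.thick_spec n1).2 g (by simp [Stk.boxes])
      simp only [left, Stk.left] at h
      omega

/-- A row of non-thin boxes has a unique lowest horizontally connected part, unless there are no
horizontal wires at all. -/
theorem StkRow.cutSum_indec_thick {c : StkRow} (hv : c.Valid) :
    (c.cutSum fun a f => a.indec * f.thick) = c.thick - c.bare := by
  classical
  by_cases hn : c.thick = 0
  · have hb : c.bare = 0 := by
      by_contra h
      have := (bare_spec h).2.2.2.2
      omega
    rw [hn, hb, sub_zero, ← StkRow.cutSum_zero c]
    refine StkRow.cutSum_congr hv fun a f h => ?_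
    have h1 := thick_graft a f h.length
    rw [h.graft, hn] at h1
    unfold indec
    split_ifs
    · exact h1.symm
    · exact zero_mul _
  have hn1 := (thick_spec hn).1
  by_cases hl : c.left = 0
  · rw [bare_of_thick hv hn hl, hn1, sub_self, ← StkRow.cutSum_zero c]
    refine StkRow.cutSum_congr hv fun a f h => ?_
    have := h.left
    rw [indec_eq_zero (by omega), zero_mul]
  · have hb : c.bare = 0 := by
      by_contra h
      exact hl (bare_spec h).2.1
    rw [hb, hn1, sub_zero]
    -- the lowest cut at a positive height
    have hex : ∃ i, 0 < i ∧ ∃ j, c.Sep i j := ⟨c.left, Nat.pos_of_ne_zero hl, _, sep_full hv⟩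
    obtain ⟨hpos, j, hj⟩ := Nat.find_spec hex
    obtain ⟨a₀, f₀, hc, hal, har⟩ := hj.exists_cut hv
    have hthick : ∀ a f : StkRow, a.IsCut f c → a.thick ≠ 0 ∧ f.thick ≠ 0 := fun a f h => by
      rw [← mul_ne_zero_iff, ← thick_graft a f h.length, h.graft]; exact hn
    refine Eq.trans (StkRow.cutSum_congr hv fun a f h => ?_) (StkRow.cutSum_single hv hc (1 : ℤ))
    obtain ⟨ha, hf⟩ := hthick a f h
    rw [(thick_spec hf).1, mul_one, indec, (thick_spec ha).1]
    refine if_congr ?_ rfl rfl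
    constructor
    · rintro ⟨h1, h2⟩
      refine h.unique hv hn hc (le_antisymm ?_ ?_)
      · rcases le_total a.left a₀.left with h3 | h3
        · exact h3
        · have hj' : (a.graft f).Sep a₀.left a₀.right := by rw [h.graft, hal, har]; exact hj
          rcases hj'.of_graft h.valid (noSemi_of_thick ha) h.valid_row h.length with
            h4 | ⟨i', j', h4, -, -⟩
          · rcases h2 _ _ h4 with h5 | h5 <;> omega
          · omega
      · rw [hal]
        exact Nat.find_min' hex ⟨h1, a.right, by
          rw [← h.graft]; exact (sep_full h.valid).graft f⟩
    · rintro ⟨rfl, rfl⟩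
      refine ⟨by omega, fun i j hij => ?_⟩
      rcases Nat.eq_zero_or_pos i with h1 | h1
      · exact Or.inl h1
      · right
        refine le_antisymm hij.le.1 ?_
        rw [hal]
        exact Nat.find_min' hex ⟨h1, j, by rw [← h.graft]; exact hij.graft f⟩

theorem StkRow.right_pos {c : StkRow} (hv : c.Valid) (hn : c.NoSemi) (h : 0 < c.left) :
    0 < c.right := (c.sep_zero.lt_iff hn (sep_full hv)).1 h

theorem StkRow.cutSum_sub (t : StkRow) (F G : StkRow → StkRow → ℤ) :
    (t.cutSum fun a f => F a f - G a f) = t.cutSum F - t.cutSum G := by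
  have h := StkRow.cutSum_add t (fun a f => F a f - G a f) G
  simp only [sub_add_cancel] at h
  exact eq_sub_of_add_eq h.symm

open Classical in
theorem Stk.tqSign_node (g : BoxLabel) (c : StkRow) : (Stk.node g c).tqSign =
    if g.SemiThin then 0 else if g.Thin then c.oneThin + c.indec else -c.oneThin := rfl

mutual
theorem Stk.factSum_thick : ∀ {T : Stk}, T.Valid →
    (T.factSum fun t _ _ t' => t.thick * t'.tqSign) =
      (T.cutSum fun a f => a.oneThin * f.thick) - T.cutSum fun a f => a.thick * f.oneThin
  | .leaf, _ => by simp [Stk.factSum, Stk.cutSum, Stk.oneThin, StkRow.oneThin]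
  | .node g c, hv => by
    have e0 : (StkRow.cons (.node g c) (.nil (g.r + c.right))).oneThin = (Stk.node g c).oneThin :=
      StkRow.oneThin_single _
    rw [Stk.factSum, Stk.cutSum, Stk.cutSum, e0]
    simp only [Stk.thick, Stk.oneThin, zero_mul, one_mul, zero_add]
    by_cases hg : g.SemiThin
    · have h1 : ¬ g.Thin := by
        unfold BoxLabel.SemiThin at hg; unfold BoxLabel.Thin; omega
      have h2 : ¬ (0 < g.p ∧ 0 < g.r) := by unfold BoxLabel.SemiThin at hg; omega
      simp [Stk.tqSign_node, hg, h1, h2, StkRow.cutSum_zero, StkRow.factSum_zero]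
    by_cases ht : g.Thin
    · have h2 : ¬ (0 < g.p ∧ 0 < g.r) := by unfold BoxLabel.Thin at ht; omega
      simp only [Stk.tqSign_node, if_neg hg, if_pos ht, if_neg h2, zero_mul, StkRow.cutSum_zero,
        StkRow.factSum_zero, add_zero, StkRow.cutSum_bare_mul (fun _ f => f.thick) hv.2]
      refine Eq.trans (StkRow.cutSum_congr hv.2 fun a f h => ?_)
        (StkRow.cutSum_indec_thick hv.2)
      by_cases ha : a.indec = 0
      · rw [ha, add_zero, zero_mul]
        by_cases ho : a.oneThin = 0
        · rw [ho, mul_zero]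
        · rw [if_neg, zero_mul]
          have := (StkRow.oneThin_spec ho).2.1
          simp [Stk.out, Stk.left, ht.1, this]
      · obtain ⟨h3, h4⟩ := StkRow.indec_spec ha
        have ho : a.oneThin = 0 := by
          by_contra ho
          have := (StkRow.oneThin_spec ho).2.1
          have := h3.1
          omega
        have := StkRow.right_pos h.valid (StkRow.noSemi_of_thick h4) h3.1
        rw [ho, zero_add, if_pos, mul_comm]
        exact ⟨Nat.add_pos_right _ h3.1, Nat.add_pos_right _ this⟩
    · have h2 : 0 < g.p ∧ 0 < g.r := by
        unfold BoxLabel.SemiThin at hg; unfold BoxLabel.Thin at ht; omega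
      simp only [Stk.tqSign_node, if_neg hg, if_neg ht, if_pos h2, zero_mul, StkRow.cutSum_zero,
        zero_add, StkRow.factSum_thick hv.2, zero_sub]
      have e1 : (c.cutSum fun a f => (if 0 < ((Stk.node g a).out BoxLabel.deg).p ∧
          0 < ((Stk.node g a).out BoxLabel.deg).r then f.thick else 0) * -a.oneThin) =
          -c.cutSum fun a f => a.oneThin * f.thick := by
        refine Eq.trans ?_ (StkRow.map_cutSum (negAddMonoidHom (α := ℤ)) c _).symm
        congr 1; funext a f
        change _ = -(a.oneThin * f.thick)
        rw [if_pos ⟨Nat.add_pos_left h2.1 _, Nat.add_pos_left h2.2 _⟩]; ring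
      rw [e1]; ring
/-- A row of non-thin boxes in one of which a thin-quadratic stacking is substituted has exactly one
thin box. It occurs with both signs, unless it is at the top or at the bottom of the row. -/
theorem StkRow.factSum_thick : ∀ {T : StkRow}, T.Valid →
    (T.factSum fun t _ _ t' => t.thick * t'.tqSign) =
      (T.cutSum fun a f => a.oneThin * f.thick) - T.cutSum fun a f => a.thick * f.oneThin
  | .nil s, _ => by simp [StkRow.factSum, StkRow.cutSum, StkRow.oneThin]
  | .cons t c, hv => by
    have e1 : (StkRow.cons t c).cutSum (fun a f => a.oneThin * f.thick) =
        (t.cutSum fun a f => a.oneThin * f.thick) * c.thick +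
          t.thick * c.cutSum fun a f => a.oneThin * f.thick := by
      rw [StkRow.cutSum_cons hv (E := fun a f b f' =>
        (a.oneThin * f.thick) * (b.bare * f'.thick) + (a.bare * f.thick) * (b.oneThin * f'.thick))]
      · simp only [StkRow.cutSum_add, Stk.cutSum_add, StkRow.cutSum_mul,
          StkRow.cutSum_bare_mul (fun _ f => f.thick) hv.2.1,
          Stk.cutSum_bare_mul (fun _ f => f.thick) t]
        simp [StkRow.thick]
      · intro a f b f' ha hb hs
        rw [StkRow.thick_append, StkRow.oneThin]; ring
      · intro a f b f' hE
        left
        constructor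
        · by_contra h
          have h1 : a.bare = 0 := by by_contra h'; exact h (Stk.right_eq_zero (.inl h'))
          have h2 : a.oneThin = 0 := by by_contra h'; exact h (Stk.right_eq_zero (.inr h'))
          simp [h1, h2] at hE
        · by_contra h
          have h1 : b.bare = 0 := by by_contra h'; exact h (StkRow.left_eq_zero (.inl h'))
          have h2 : b.oneThin = 0 := by by_contra h'; exact h (StkRow.left_eq_zero (.inr h'))
          simp [h1, h2] at hE
    have e2 : (StkRow.cons t c).cutSum (fun a f => a.thick * f.oneThin) =
        (t.cutSum fun a f => a.thick * f.oneThin) * c.thick +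
          t.thick * c.cutSum fun a f => a.thick * f.oneThin := by
      rw [StkRow.cutSum_cons hv (E := fun a f b f' =>
        (a.thick * f.oneThin) * (b.thick * f'.bare) + (a.thick * f.bare) * (b.thick * f'.oneThin))]
      · simp only [StkRow.cutSum_add, Stk.cutSum_add, StkRow.cutSum_mul,
          StkRow.cutSum_mul_bare (fun a _ => a.thick) hv.2.1,
          Stk.cutSum_mul_bare (fun a _ => a.thick) hv.1]
      · intro a f b f' ha hb hs
        rw [StkRow.oneThin_append hs, StkRow.thick]; ring
      · intro a f b f' hE
        right
        constructor
        · by_contra h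
          have h1 : f.bare = 0 := by by_contra h'; exact h (StkRow.right_eq_zero (.inl h'))
          have h2 : f.oneThin = 0 := by by_contra h'; exact h (StkRow.right_eq_zero (.inr h'))
          simp [h1, h2] at hE
        · by_contra h
          have h1 : f'.bare = 0 := by by_contra h'; exact h (StkRow.left_eq_zero (.inl h'))
          have h2 : f'.oneThin = 0 := by by_contra h'; exact h (StkRow.left_eq_zero (.inr h'))
          simp [h1, h2] at hE
    have e3 : (StkRow.cons t c).factSum (fun t _ _ t' => t.thick * t'.tqSign) =
        (t.factSum fun t _ _ t' => t.thick * t'.tqSign) * c.thick +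
          t.thick * c.factSum fun t _ _ t' => t.thick * t'.tqSign := by
      rw [StkRow.factSum, ← Stk.factSum_mul_right, ← StkRow.factSum_mul_left]
      congr 2
      · funext t₀ h v t'
        rw [StkRow.thick]; ring
      · funext t₀ h v t'
        rw [StkRow.thick]; ring
    rw [e1, e2, e3, Stk.factSum_thick hv.1, StkRow.factSum_thick hv.2.1]
    ring
end

theorem StkRow.indec_iff {c c' : StkRow} (hl : c.left = c'.left)
    (h : ∀ i j, c.Sep i j ↔ c'.Sep i j) : c.Indec ↔ c'.Indec := by
  simp only [Indec, hl, h]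

theorem StkRow.IsCut.indec_iff_of_oneThin {a f c : StkRow} (h : a.IsCut f c)
    (ha : a.oneThin ≠ 0) : f.Indec ↔ c.Indec := by
  have h0 := left_eq_zero (.inr ha)
  have h1 := right_eq_zero (.inr ha)
  refine indec_iff (by rw [h.left, h0, zero_add]) fun i j => ⟨fun hij => ?_, fun hij => ?_⟩
  · have := hij.graft_above h.valid h.valid_row h.length
    rwa [h0, h1, zero_add, zero_add, h.graft] at this
  · rw [← h.graft] at hij
    rcases hij.of_graft h.valid (noSemi_of_oneThin ha) h.valid_row h.length with
      h2 | ⟨i', j', rfl, rfl, h2⟩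
    · have := h2.le
      obtain rfl : i = 0 := by omega
      obtain rfl : j = 0 := by omega
      exact f.sep_zero
    · rwa [h0, h1, zero_add, zero_add]

theorem StkRow.IsCut.indec_iff_of_thick {a f c : StkRow} (h : a.IsCut f c)
    (ha : a.thick ≠ 0) (hf : f.oneThin ≠ 0) : a.Indec ↔ c.Indec := by
  have h0 := left_eq_zero (.inr hf)
  have h1 := right_eq_zero (.inr hf)
  refine indec_iff (by rw [h.left, h0, add_zero]) fun i j => ⟨fun hij => ?_, fun hij => ?_⟩
  · rw [← h.graft]; exact hij.graft f
  · rw [← h.graft] at hij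
    rcases hij.of_graft h.valid (noSemi_of_thick ha) h.valid_row h.length with
      h2 | ⟨i', j', rfl, rfl, h2⟩
    · exact h2
    · have := h2.le
      obtain rfl : i' = 0 := by omega
      obtain rfl : j' = 0 := by omega
      exact sep_full h.valid

mutual
theorem Stk.Pos.before_of_thick : ∀ {t : Stk} {h : BoxLabel} (v : t.Pos h), t.thick ≠ 0 →
    v.before BoxLabel.shift = 0 ∧ ∀ t', v.shuf BoxLabel.shift t' = 0
  | _, _, .root g c, hn => ⟨rfl, fun t' => Stk.shuf_eq_zero_right t' fun g' hg =>
      BoxLabel.shift_of_pos ((Stk.thick_spec hn).2 g' (List.mem_cons_of_mem _ hg))⟩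
  | _, _, .above g v, hn => by
    have hg := (Stk.thick_spec hn).2 g (by simp [Stk.boxes])
    rw [Stk.thick, if_pos hg] at hn
    obtain ⟨h1, h2⟩ := StkRow.Pos.before_of_thick v hn
    exact ⟨by rw [Stk.Pos.before, h1, BoxLabel.shift_of_pos hg, add_zero], h2⟩
theorem StkRow.Pos.before_of_thick : ∀ {t : StkRow} {h : BoxLabel} (v : t.Pos h), t.thick ≠ 0 →
    v.before BoxLabel.shift = 0 ∧ ∀ t', v.shuf BoxLabel.shift t' = 0
  | _, _, .here v c, hn => Stk.Pos.before_of_thick v (mul_ne_zero_iff.1 hn).1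
  | _, _, .there t v, hn => by
    obtain ⟨h1, h2⟩ := StkRow.Pos.before_of_thick v (mul_ne_zero_iff.1 hn).2
    have h3 : t.degree BoxLabel.shift = 0 := List.sum_eq_zero fun x hx => by
      obtain ⟨g, hg, rfl⟩ := List.mem_map.1 hx
      exact BoxLabel.shift_of_pos ((Stk.thick_spec (mul_ne_zero_iff.1 hn).1).2 g hg)
    exact ⟨by rw [StkRow.Pos.before, h1, h3, add_zero], h2⟩
end

/-- `StkRow.factSum_thick` for horizontally connected rows: neither the substitution of a
thin-quadratic stacking nor a thin box at the top or at the bottom changes the horizontal cuts. -/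
theorem StkRow.factSum_indec {c : StkRow} (hv : c.Valid) :
    (c.factSum fun t _ v t' => t.indec * t'.tqSign *
      koszul ℤ (v.before BoxLabel.shift + v.shuf BoxLabel.shift t')) =
    (c.cutSum fun a f => a.oneThin * f.indec) - c.cutSum fun a f => a.indec * f.oneThin := by
  classical
  have key := congrArg (fun m : ℤ => (if c.Indec then 1 else 0) * m) (StkRow.factSum_thick hv)
  simp only [mul_sub] at key
  rw [← StkRow.factSum_mul_left] at key
  have e1 : ∀ F : StkRow → StkRow → ℤ, (if c.Indec then (1 : ℤ) else 0) * c.cutSum F =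
      c.cutSum fun a f => (if c.Indec then 1 else 0) * F a f := fun F =>
    StkRow.map_cutSum (AddMonoidHom.mulLeft (if c.Indec then (1 : ℤ) else 0)) c F
  rw [e1, e1] at key
  refine Eq.trans (StkRow.factSum_congr hv fun t h v t' H => ?_) (key.trans ?_)
  · by_cases ht : t.thick = 0
    · simp [indec, ht]
    by_cases ht' : t'.tqSign = 0
    · simp [ht']
    obtain ⟨h1, h2, -⟩ := Stk.tqSign_spec H.valid_inner ht'
    have h3 := StkRow.indec_iff H.left.symm fun i j => by
      rw [← H.subst]; exact StkRow.Pos.sep_subst H.valid_inner h1 h2 v H.valid H.out i j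
    obtain ⟨h4, h5⟩ := v.before_of_thick ht
    rw [h4, h5, add_zero, koszul_zero, mul_one, indec]
    simp only [← h3]
    split_ifs <;> ring
  · congr 1
    · refine StkRow.cutSum_congr hv fun a f h => ?_
      by_cases ha : a.oneThin = 0
      · simp [ha]
      · rw [indec]
        simp only [h.indec_iff_of_oneThin ha]
        split_ifs <;> ring
    · refine StkRow.cutSum_congr hv fun a f h => ?_
      by_cases ha : a.thick = 0
      · simp [ha, indec]
      by_cases hf : f.oneThin = 0
      · simp [hf]
      · rw [indec]
        simp only [h.indec_iff_of_thick ha hf]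
        split_ifs <;> ring

/-- The combinatorial heart of `d_□² = 0`: the ways to obtain a stacking by substituting a
thin-quadratic stacking into a thin-quadratic stacking cancel each other. -/
theorem Stk.factSum_tqSign : ∀ {T : Stk}, T.Valid →
    (T.factSum fun t _ v t' => t.tqSign * t'.tqSign *
      koszul ℤ (v.before BoxLabel.shift + v.shuf BoxLabel.shift t')) = 0
  | .leaf, _ => rfl
  | .node g c, hv => by
    have hc := hv.2
    rw [Stk.factSum]
    simp only [Stk.Pos.before, Stk.Pos.shuf, zero_add, add_assoc, Stk.shuf]
    by_cases hg : g.SemiThin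
    · simp [Stk.tqSign_node, hg, StkRow.cutSum_zero, StkRow.factSum_zero]
    by_cases ht : g.Thin
    · have hs : g.shift = -1 := if_pos ht
      -- substitution into a box above the bottom box; the sign is due to the odd bottom box
      have e1 : (c.factSum fun c₀ h v t' => (Stk.node g c₀).tqSign * t'.tqSign *
          koszul ℤ (g.shift + (v.before BoxLabel.shift + v.shuf BoxLabel.shift t'))) =
          -(c.factSum (fun c₀ h v t' => c₀.oneThin * t'.tqSign *
            koszul ℤ (v.before BoxLabel.shift + v.shuf BoxLabel.shift t')) +
          c.factSum fun c₀ h v t' => c₀.indec * t'.tqSign *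
            koszul ℤ (v.before BoxLabel.shift + v.shuf BoxLabel.shift t')) := by
        rw [← StkRow.factSum_add, ← neg_one_mul, ← StkRow.factSum_mul_left]
        congr 1; funext c₀ h v t'
        rw [Stk.tqSign_node, if_neg hg, if_pos ht, hs, koszul_add, koszul_neg, koszul_one]; ring
      -- substitution into the bottom box, which is thin or not according to the row `a` on it
      have e2 : (c.cutSum fun a f => (Stk.node ((Stk.node g a).out BoxLabel.deg) f).tqSign *
          (Stk.node g a).tqSign * koszul ℤ (a.shuf BoxLabel.shift f)) =
          (c.cutSum fun a f => a.oneThin * f.oneThin * koszul ℤ (a.shuf BoxLabel.shift f)) +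
          ((c.cutSum fun a f => a.oneThin * f.indec) - c.cutSum fun a f => a.indec * f.oneThin) := by
        rw [← StkRow.cutSum_sub, ← StkRow.cutSum_add]
        refine StkRow.cutSum_congr hc fun a f h => ?_
        rw [Stk.tqSign_node, Stk.tqSign_node, if_neg hg, if_pos ht]
        by_cases ha : a.indec = 0
        · by_cases ho : a.oneThin = 0
          · simp [ha, ho]
          · have h1 : ((Stk.node g a).out BoxLabel.deg).Thin := by
              have h1 := StkRow.left_eq_zero (.inr ho)
              have h2 := StkRow.right_eq_zero (.inr ho)
              exact ⟨by simp [Stk.out, Stk.left, h1, ht.1], by simp [Stk.out, Stk.right, h2, ht.2]⟩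
            have h2 : ¬ ((Stk.node g a).out BoxLabel.deg).SemiThin := by
              unfold BoxLabel.SemiThin; unfold BoxLabel.Thin at h1; omega
            rw [if_neg h2, if_pos h1, ha]
            by_cases hf : f.indec = 0
            · rw [hf]; ring
            · rw [StkRow.shuf_eq_zero_right a fun g' hg' => BoxLabel.shift_of_pos
                ((StkRow.thick_spec (StkRow.indec_spec hf).2).2 g' hg'), koszul_zero]
              ring
        · obtain ⟨h3, h4⟩ := StkRow.indec_spec ha
          have ho : a.oneThin = 0 := by
            by_contra ho
            have := StkRow.left_eq_zero (.inr ho)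
            have := h3.1
            omega
          have h5 := StkRow.right_pos h.valid (StkRow.noSemi_of_thick h4) h3.1
          have h6 : 0 < ((Stk.node g a).out BoxLabel.deg).p := Nat.add_pos_right _ h3.1
          have h7 : 0 < ((Stk.node g a).out BoxLabel.deg).r := Nat.add_pos_right _ h5
          rw [if_neg (by unfold BoxLabel.SemiThin; omega), if_neg (by unfold BoxLabel.Thin; omega),
            ho, StkRow.shuf_eq_zero_left f fun g' hg' => BoxLabel.shift_of_pos
              ((StkRow.thick_spec h4).2 g' hg'), koszul_zero]
          ring
      rw [e1, e2, StkRow.cutSum_oneThin_oneThin hc, StkRow.factSum_oneThin hc,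
        StkRow.factSum_indec hc]
      ring
    · have hs : g.shift = 0 := if_neg ht
      have hpr : 0 < g.p ∧ 0 < g.r := by
        unfold BoxLabel.SemiThin at hg; unfold BoxLabel.Thin at ht; omega
      have e1 : (c.factSum fun c₀ h v t' => (Stk.node g c₀).tqSign * t'.tqSign *
          koszul ℤ (g.shift + (v.before BoxLabel.shift + v.shuf BoxLabel.shift t'))) =
          -c.factSum (fun c₀ h v t' => c₀.oneThin * t'.tqSign *
            koszul ℤ (v.before BoxLabel.shift + v.shuf BoxLabel.shift t')) := by
        rw [← neg_one_mul, ← StkRow.factSum_mul_left]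
        congr 1; funext c₀ h v t'
        rw [Stk.tqSign_node, if_neg hg, if_neg ht, hs, zero_add]; ring
      have e2 : (c.cutSum fun a f => (Stk.node ((Stk.node g a).out BoxLabel.deg) f).tqSign *
          (Stk.node g a).tqSign * koszul ℤ (a.shuf BoxLabel.shift f)) =
          c.cutSum fun a f => a.oneThin * f.oneThin * koszul ℤ (a.shuf BoxLabel.shift f) := by
        congr 1; funext a f
        have h6 : 0 < ((Stk.node g a).out BoxLabel.deg).p := Nat.add_pos_left hpr.1 _
        have h7 : 0 < ((Stk.node g a).out BoxLabel.deg).r := Nat.add_pos_left hpr.2 _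
        rw [Stk.tqSign_node, Stk.tqSign_node, if_neg hg, if_neg ht,
          if_neg (by unfold BoxLabel.SemiThin; omega), if_neg (by unfold BoxLabel.Thin; omega)]
        ring
      rw [e1, e2, StkRow.cutSum_oneThin_oneThin hc, StkRow.factSum_oneThin hc]
      ring

/-! ### Connectivity of the horizontal graph -/

theorem Quot.card_eq_one_iff {α : Type*} (r : α → α → Prop) : Nat.card (Quot r) = 1 ↔
    Nonempty α ∧ ∀ P : α → Prop, (∀ a b, r a b → (P a ↔ P b)) → ∀ a b, P a ↔ P b := by
  rw [Nat.card_eq_one_iff_unique]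
  constructor
  · rintro ⟨h1, ⟨q⟩⟩
    refine ⟨⟨q.out⟩, fun P hP a b => ?_⟩
    have : Quot.mk r a = Quot.mk r b := Subsingleton.elim _ _
    have h2 := congrArg (Quot.lift P fun a b h => propext (hP a b h)) this
    exact Iff.of_eq h2
  · rintro ⟨⟨a⟩, h⟩
    refine ⟨⟨fun x y => ?_⟩, ⟨Quot.mk r a⟩⟩
    induction x using Quot.ind with | _ x => ?_
    induction y using Quot.ind with | _ y => ?_
    exact ((h (fun z => Quot.mk r z = Quot.mk r x) (fun a b hab => by
      rw [Quot.sound hab]) x y).1 rfl).symm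

/-- The bottom box is a component of its own. -/
theorem Stk.components_node (g : BoxLabel) (c : StkRow) : (Stk.node g c).components = 2 ↔
    Nat.card (Quot c.Adj) = 1 := by
  let e : Quot (Stk.Adj (.node g c)) ≃ Option (Quot c.Adj) :=
    { toFun := Quot.lift (fun x : (Stk.node g c).Cell => match x with
          | .root _ _ => none
          | .above _ a => some (Quot.mk _ a)) (by
            rintro _ _ ⟨_, h⟩
            exact congrArg some (Quot.sound h))
      invFun := fun x => x.elim (Quot.mk _ (.root g c))
        (Quot.lift (fun a => Quot.mk _ (.above g a)) fun a b h => Quot.sound (.above g h))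
      left_inv := by
        rintro ⟨x⟩
        cases x <;> rfl
      right_inv := by
        rintro (_ | x)
        · rfl
        · induction x using Quot.ind
          rfl }
  rw [Stk.components, Nat.card_congr e]
  cases finite_or_infinite (Quot c.Adj)
  · rw [Finite.card_option]; omega
  · simp

theorem Stk.leftPort_node {g : BoxLabel} {c : StkRow} {i : ℕ} {a : (Stk.node g c).Cell} :
    Stk.LeftPort (.node g c) i a ↔ (i < g.p ∧ a = .root g c) ∨
      ∃ j b, i = g.p + j ∧ a = .above g b ∧ c.LeftPort j b := by
  constructor
  · rintro (⟨_, _, _, h⟩ | ⟨_, h⟩)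
    · exact Or.inl ⟨h, rfl⟩
    · exact Or.inr ⟨_, _, rfl, rfl, h⟩
  · rintro (⟨h, rfl⟩ | ⟨j, b, rfl, rfl, h⟩)
    · exact .root g c i h
    · exact .above g h

theorem Stk.rightPort_node {g : BoxLabel} {c : StkRow} {i : ℕ} {a : (Stk.node g c).Cell} :
    Stk.RightPort (.node g c) i a ↔ (i < g.r ∧ a = .root g c) ∨
      ∃ j b, i = g.r + j ∧ a = .above g b ∧ c.RightPort j b := by
  constructor
  · rintro (⟨_, _, _, h⟩ | ⟨_, h⟩)
    · exact Or.inl ⟨h, rfl⟩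
    · exact Or.inr ⟨_, _, rfl, rfl, h⟩
  · rintro (⟨h, rfl⟩ | ⟨j, b, rfl, rfl, h⟩)
    · exact .root g c i h
    · exact .above g h

theorem StkRow.leftPort_nil {s i : ℕ} {a : (StkRow.nil s).Cell} :
    StkRow.LeftPort (.nil s) i a ↔ ∃ h : i < s, a = .wire ⟨i, h⟩ := by
  constructor
  · rintro ⟨i⟩
    exact ⟨i.2, rfl⟩
  · rintro ⟨h, rfl⟩
    exact .wire ⟨i, h⟩

theorem StkRow.rightPort_nil {s i : ℕ} {a : (StkRow.nil s).Cell} :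
    StkRow.RightPort (.nil s) i a ↔ ∃ h : i < s, a = .wire ⟨i, h⟩ := by
  constructor
  · rintro ⟨i⟩
    exact ⟨i.2, rfl⟩
  · rintro ⟨h, rfl⟩
    exact .wire ⟨i, h⟩

theorem StkRow.leftPort_cons {t : Stk} {c : StkRow} {i : ℕ} {a : (StkRow.cons t c).Cell} :
    StkRow.LeftPort (.cons t c) i a ↔ ∃ b, a = .here b c ∧ t.LeftPort i b := by
  constructor
  · rintro (_ | ⟨h, _⟩)
    exact ⟨_, rfl, h⟩
  · rintro ⟨b, rfl, h⟩
    exact .here h c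

theorem StkRow.rightPort_cons {t : Stk} {c : StkRow} {i : ℕ} {a : (StkRow.cons t c).Cell} :
    StkRow.RightPort (.cons t c) i a ↔ ∃ b, a = .there t b ∧ c.RightPort i b := by
  constructor
  · rintro (_ | ⟨_, h⟩)
    exact ⟨_, rfl, h⟩
  · rintro ⟨b, rfl, h⟩
    exact .there t h

mutual
theorem Stk.exists_leftPort : ∀ {t : Stk} {i : ℕ}, i < t.left → ∃ a, t.LeftPort i a
  | .leaf, i, h => absurd h (Nat.not_lt_zero i)
  | .node g c, i, h => by
    by_cases hi : i < g.p
    · exact ⟨_, .root g c i hi⟩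
    · simp only [Stk.left] at h
      obtain ⟨a, ha⟩ := StkRow.exists_leftPort (t := c) (i := i - g.p) (by omega)
      exact ⟨.above g a, Stk.leftPort_node.2 (.inr ⟨_, a, by omega, rfl, ha⟩)⟩
theorem StkRow.exists_leftPort : ∀ {t : StkRow} {i : ℕ}, i < t.left → ∃ a, t.LeftPort i a
  | .nil s, i, h => ⟨_, .wire ⟨i, h⟩⟩
  | .cons t c, i, h => by
    obtain ⟨a, ha⟩ := Stk.exists_leftPort (t := t) h
    exact ⟨_, .here ha c⟩
end

mutual
theorem Stk.exists_rightPort : ∀ {t : Stk} {i : ℕ}, i < t.right → ∃ a, t.RightPort i a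
  | .leaf, i, h => absurd h (Nat.not_lt_zero i)
  | .node g c, i, h => by
    by_cases hi : i < g.r
    · exact ⟨_, .root g c i hi⟩
    · simp only [Stk.right] at h
      obtain ⟨a, ha⟩ := StkRow.exists_rightPort (t := c) (i := i - g.r) (by omega)
      exact ⟨.above g a, Stk.rightPort_node.2 (.inr ⟨_, a, by omega, rfl, ha⟩)⟩
theorem StkRow.exists_rightPort : ∀ {t : StkRow} {i : ℕ}, i < t.right → ∃ a, t.RightPort i a
  | .nil s, i, h => ⟨_, .wire ⟨i, h⟩⟩
  | .cons t c, i, h => by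
    obtain ⟨a, ha⟩ := StkRow.exists_rightPort (t := c) h
    exact ⟨_, .there t ha⟩
end

mutual
theorem Stk.LeftPort.lt : ∀ {t : Stk} {i : ℕ} {a : t.Cell}, t.LeftPort i a → i < t.left
  | _, _, _, .root g c i hi => Nat.lt_add_right _ hi
  | _, _, _, .above g h => Nat.add_lt_add_left (StkRow.LeftPort.lt h) g.p
theorem StkRow.LeftPort.lt : ∀ {t : StkRow} {i : ℕ} {a : t.Cell}, t.LeftPort i a → i < t.left
  | _, _, _, .wire i => i.2
  | _, _, _, .here h c => Stk.LeftPort.lt h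
end

mutual
theorem Stk.RightPort.lt : ∀ {t : Stk} {i : ℕ} {a : t.Cell}, t.RightPort i a → i < t.right
  | _, _, _, .root g c i hi => Nat.lt_add_right _ hi
  | _, _, _, .above g h => Nat.add_lt_add_left (StkRow.RightPort.lt h) g.r
theorem StkRow.RightPort.lt : ∀ {t : StkRow} {i : ℕ} {a : t.Cell}, t.RightPort i a → i < t.right
  | _, _, _, .wire i => i.2
  | _, _, _, .there t h => by
    have := StkRow.RightPort.lt h
    exact this
end

mutual
theorem Stk.LeftPort.unique : ∀ {t : Stk} {i : ℕ} {a b : t.Cell}, t.LeftPort i a →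
    t.LeftPort i b → a = b
  | .leaf, _, _, _, h, _ => nomatch h
  | .node g c, i, a, b, h, h' => by
    rcases Stk.leftPort_node.1 h with ⟨h1, rfl⟩ | ⟨j, x, h1, rfl, h2⟩ <;>
      rcases Stk.leftPort_node.1 h' with ⟨h1', rfl⟩ | ⟨j', x', h1', rfl, h2'⟩
    · rfl
    · omega
    · omega
    · obtain rfl : j = j' := by omega
      rw [StkRow.LeftPort.unique h2 h2']
theorem StkRow.LeftPort.unique : ∀ {t : StkRow} {i : ℕ} {a b : t.Cell}, t.LeftPort i a →
    t.LeftPort i b → a = b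
  | .nil s, i, a, b, h, h' => by
    obtain ⟨_, rfl⟩ := StkRow.leftPort_nil.1 h
    obtain ⟨_, rfl⟩ := StkRow.leftPort_nil.1 h'
    rfl
  | .cons t c, i, a, b, h, h' => by
    obtain ⟨x, rfl, h1⟩ := StkRow.leftPort_cons.1 h
    obtain ⟨x', rfl, h1'⟩ := StkRow.leftPort_cons.1 h'
    rw [Stk.LeftPort.unique h1 h1']
end

mutual
/-- A horizontal cut separates the cells below it from the cells above it. -/
theorem Stk.Sep.exists_coloring : ∀ {t : Stk} {i j : ℕ}, t.Sep i j → ∃ P : t.Cell → Prop,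
    (∀ a b, t.Adj a b → (P a ↔ P b)) ∧ (∀ m a, t.LeftPort m a → (P a ↔ m < i)) ∧
    (∀ m a, t.RightPort m a → (P a ↔ m < j))
  | .leaf, i, j, _ => ⟨fun _ => True, nofun, nofun, nofun⟩
  | .node g c, i, j, .inl ⟨hi, hj⟩ => ⟨fun _ => False, by simp, by simp [hi], by simp [hj]⟩
  | .node g c, i, j, .inr ⟨i', j', hi, hj, h⟩ => by
    obtain ⟨P, h1, h2, h3⟩ := StkRow.Sep.exists_coloring h
    refine ⟨fun x => match x with
      | .root _ _ => True
      | .above _ a => P a, ?_, ?_, ?_⟩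
    · rintro _ _ ⟨_, h⟩
      exact h1 _ _ h
    · intro m a ha
      rcases Stk.leftPort_node.1 ha with ⟨h4, rfl⟩ | ⟨m', b, rfl, rfl, h4⟩
      · simp only [true_iff]; omega
      · simp only [h2 _ _ h4]; omega
    · intro m a ha
      rcases Stk.rightPort_node.1 ha with ⟨h4, rfl⟩ | ⟨m', b, rfl, rfl, h4⟩
      · simp only [true_iff]; omega
      · simp only [h3 _ _ h4]; omega
theorem StkRow.Sep.exists_coloring : ∀ {t : StkRow} {i j : ℕ}, t.Sep i j →
    ∃ P : t.Cell → Prop, (∀ a b, t.Adj a b → (P a ↔ P b)) ∧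
    (∀ m a, t.LeftPort m a → (P a ↔ m < i)) ∧ (∀ m a, t.RightPort m a → (P a ↔ m < j))
  | .nil s, i, j, ⟨hij, hs⟩ => by
    subst hij
    refine ⟨fun x => match x with | .wire w => w.1 < i, nofun, ?_, ?_⟩
    · intro m a ha
      obtain ⟨_, rfl⟩ := StkRow.leftPort_nil.1 ha
      rfl
    · intro m a ha
      obtain ⟨_, rfl⟩ := StkRow.rightPort_nil.1 ha
      rfl
  | .cons t c, i, j, ⟨m, h, h'⟩ => by
    obtain ⟨P, h1, h2, h3⟩ := Stk.Sep.exists_coloring h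
    obtain ⟨Q, h1', h2', h3'⟩ := StkRow.Sep.exists_coloring h'
    refine ⟨fun x => match x with
      | .here a _ => P a
      | .there _ a => Q a, ?_, ?_, ?_⟩
    · rintro _ _ (⟨ha, hb⟩ | ⟨h, _⟩ | ⟨_, h⟩)
      · exact (h3 _ _ ha).trans (h2' _ _ hb).symm
      · exact h1 _ _ h
      · exact h1' _ _ h
    · intro m a ha
      obtain ⟨b, rfl, h4⟩ := StkRow.leftPort_cons.1 ha
      exact h2 _ _ h4
    · intro m a ha
      obtain ⟨b, rfl, h4⟩ := StkRow.rightPort_cons.1 ha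
      exact h3' _ _ h4
end

/-- A horizontal cut in the middle of the row would disconnect its horizontal graph. -/
theorem StkRow.indec_of_connected {c : StkRow} (hl : 0 < c.left)
    (hc : ∀ P : c.Cell → Prop, (∀ a b, c.Adj a b → (P a ↔ P b)) → ∀ a b, P a ↔ P b) :
    c.Indec := by
  refine ⟨hl, fun i j h => ?_⟩
  by_contra! hij
  have hle := h.le.1
  obtain ⟨P, h1, h2, -⟩ := h.exists_coloring
  obtain ⟨a, ha⟩ := exists_leftPort hl
  obtain ⟨b, hb⟩ := exists_leftPort (t := c) (i := c.left - 1) (by omega)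
  have := hc P h1 a b
  rw [h2 _ _ ha, h2 _ _ hb] at this
  omega

theorem Stk.thick_node {g : BoxLabel} {c : StkRow} (h : (Stk.node g c).thick ≠ 0) :
    0 < g.p ∧ 0 < g.r ∧ c.thick ≠ 0 := by
  have hg := (Stk.thick_spec h).2 g (by simp [Stk.boxes])
  rw [Stk.thick, if_pos hg] at h
  exact ⟨hg.1, hg.2, h⟩

theorem Stk.noSemi_of_thick {t : Stk} (h : t.thick ≠ 0) : t.NoSemi := fun g hg => by
  have := (Stk.thick_spec h).2 g hg
  unfold BoxLabel.SemiThin; omega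

theorem Stk.right_pos {t : Stk} (hv : t.Valid) (hn : t.NoSemi) (h : 0 < t.left) :
    0 < t.right := (t.sep_zero.lt_iff hn (Stk.sep_full hv)).1 h

mutual
/-- The lowest wires on the left and on the right belong to the same component. -/
theorem Stk.connected_bottom : ∀ {t : Stk} {P : t.Cell → Prop}, t.Valid → t.thick ≠ 0 →
    (∀ a b, t.Adj a b → (P a ↔ P b)) → ∀ {a b}, t.LeftPort 0 a → t.RightPort 0 b → (P a ↔ P b)
  | .leaf, P, _, _, _, _, _, h, _ => nomatch h
  | .node g c, P, hv, hn, hP, a, b, ha, hb => by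
    obtain ⟨h1, h2, -⟩ := Stk.thick_node hn
    rcases Stk.leftPort_node.1 ha with ⟨-, rfl⟩ | ⟨j, x, h3, -⟩
    · rcases Stk.rightPort_node.1 hb with ⟨-, rfl⟩ | ⟨j, x, h3, -⟩
      · rfl
      · omega
    · omega
theorem StkRow.connected_bottom : ∀ {t : StkRow} {P : t.Cell → Prop}, t.Valid → t.thick ≠ 0 →
    (∀ a b, t.Adj a b → (P a ↔ P b)) → ∀ {a b}, t.LeftPort 0 a → t.RightPort 0 b → (P a ↔ P b)
  | .nil s, P, _, _, _, a, b, ha, hb => by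
    obtain ⟨_, rfl⟩ := StkRow.leftPort_nil.1 ha
    obtain ⟨_, rfl⟩ := StkRow.rightPort_nil.1 hb
    rfl
  | .cons t c, P, hv, hn, hP, a, b, ha, hb => by
    obtain ⟨n1, n2⟩ := mul_ne_zero_iff.1 hn
    obtain ⟨x, rfl, hx⟩ := StkRow.leftPort_cons.1 ha
    obtain ⟨y, rfl, hy⟩ := StkRow.rightPort_cons.1 hb
    have hr := Stk.right_pos hv.1 (Stk.noSemi_of_thick n1) hx.lt
    obtain ⟨m, hm⟩ := Stk.exists_rightPort hr
    rw [hv.2.2] at hr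
    obtain ⟨m', hm'⟩ := StkRow.exists_leftPort hr
    have e1 := Stk.connected_bottom (P := fun x => P (.here x c)) hv.1 n1
      (fun a b h => hP _ _ (.here h c)) hx hm
    have e2 := StkRow.connected_bottom (P := fun x => P (.there t x)) hv.2.1 n2
      (fun a b h => hP _ _ (.there t h)) hm' hy
    exact e1.trans ((hP _ _ (.join hm hm')).trans e2)
end

mutual
/-- Neighbouring wires on the left that belong to different components are separated by a horizontal
cut, whose neighbours on the right are separated, too. -/
theorem Stk.exists_sep : ∀ {t : Stk} {P : t.Cell → Prop}, t.Valid → t.thick ≠ 0 →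
    (∀ a b, t.Adj a b → (P a ↔ P b)) → ∀ {i a b}, t.LeftPort i a → t.LeftPort (i + 1) b →
    ¬ (P a ↔ P b) → ∃ j, t.Sep (i + 1) (j + 1) ∧ ∃ a b, t.RightPort j a ∧ t.RightPort (j + 1) b ∧
      ¬ (P a ↔ P b)
  | .leaf, P, _, _, _, _, _, _, h, _, _ => nomatch h
  | .node g c, P, hv, hn, hP, i, a, b, ha, hb, hab => by
    obtain ⟨h1, h2, n2⟩ := Stk.thick_node hn
    have hP' : ∀ a b, c.Adj a b → (P (.above g a) ↔ P (.above g b)) :=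
      fun a b h => hP _ _ (.above g h)
    rcases Stk.leftPort_node.1 ha with ⟨h3, rfl⟩ | ⟨j, x, rfl, rfl, hx⟩
    · rcases Stk.leftPort_node.1 hb with ⟨-, rfl⟩ | ⟨j, y, h4, rfl, hy⟩
      · exact absurd Iff.rfl hab
      · obtain rfl : j = 0 := by omega
        obtain ⟨z, hz⟩ := StkRow.exists_rightPort
          (StkRow.right_pos hv.2 (StkRow.noSemi_of_thick n2) hy.lt)
        have e := StkRow.connected_bottom (P := fun x => P (.above g x)) hv.2 n2 hP' hy hz
        refine ⟨g.r - 1, Or.inr ⟨0, 0, by omega, by omega, c.sep_zero⟩, .root g c, .above g z,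
          .root g c _ (by omega), Stk.rightPort_node.2 (.inr ⟨0, z, by omega, rfl, hz⟩), ?_⟩
        rwa [← e]
    · rcases Stk.leftPort_node.1 hb with ⟨h4, rfl⟩ | ⟨j', y, h4, rfl, hy⟩
      · omega
      · obtain rfl : j' = j + 1 := by omega
        obtain ⟨m, hm, a', b', ha', hb', h5⟩ :=
          StkRow.exists_sep (P := fun x => P (.above g x)) hv.2 n2 hP' hx hy hab
        exact ⟨g.r + m, Or.inr ⟨j + 1, m + 1, by omega, by omega, hm⟩, .above g a', .above g b',
          .above g ha', .above g hb', h5⟩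
theorem StkRow.exists_sep : ∀ {t : StkRow} {P : t.Cell → Prop}, t.Valid → t.thick ≠ 0 →
    (∀ a b, t.Adj a b → (P a ↔ P b)) → ∀ {i a b}, t.LeftPort i a → t.LeftPort (i + 1) b →
    ¬ (P a ↔ P b) → ∃ j, t.Sep (i + 1) (j + 1) ∧ ∃ a b, t.RightPort j a ∧ t.RightPort (j + 1) b ∧
      ¬ (P a ↔ P b)
  | .nil s, P, _, _, _, i, a, b, ha, hb, hab => by
    obtain ⟨_, rfl⟩ := StkRow.leftPort_nil.1 ha
    obtain ⟨h, rfl⟩ := StkRow.leftPort_nil.1 hb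
    exact ⟨i, ⟨rfl, h.le⟩, _, _, StkRow.rightPort_nil.2 ⟨_, rfl⟩, StkRow.rightPort_nil.2 ⟨_, rfl⟩, hab⟩
  | .cons t c, P, hv, hn, hP, i, a, b, ha, hb, hab => by
    obtain ⟨n1, n2⟩ := mul_ne_zero_iff.1 hn
    obtain ⟨x, rfl, hx⟩ := StkRow.leftPort_cons.1 ha
    obtain ⟨y, rfl, hy⟩ := StkRow.leftPort_cons.1 hb
    obtain ⟨m, hm, a', b', ha', hb', h5⟩ := Stk.exists_sep (P := fun x => P (.here x c)) hv.1 n1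
      (fun a b h => hP _ _ (.here h c)) hx hy hab
    have h6 := hb'.lt
    rw [hv.2.2] at h6
    obtain ⟨x', hx'⟩ := StkRow.exists_leftPort (t := c) (i := m) (by omega)
    obtain ⟨y', hy'⟩ := StkRow.exists_leftPort h6
    rw [hP _ _ (.join ha' hx'), hP _ _ (.join hb' hy')] at h5
    obtain ⟨j, hj, a'', b'', ha'', hb'', h7⟩ := StkRow.exists_sep (P := fun x => P (.there t x))
      hv.2.1 n2 (fun a b h => hP _ _ (.there t h)) hx' hy' h5
    exact ⟨j, ⟨_, hm, hj⟩, _, _, .there t ha'', .there t hb'', h7⟩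
end

mutual
theorem Stk.connected_left : ∀ {t : Stk} {P : t.Cell → Prop}, t.Valid → t.thick ≠ 0 →
    (∀ a b, t.Adj a b → (P a ↔ P b)) → ∀ x, ∃ i b, t.LeftPort i b ∧ (P x ↔ P b)
  | .leaf, P, _, _, _, x => nomatch x
  | .node g c, P, hv, hn, hP, x => by
    obtain ⟨h1, h2, n2⟩ := Stk.thick_node hn
    match x with
    | .root _ _ => exact ⟨0, _, .root g c 0 h1, Iff.rfl⟩
    | .above _ x =>
      obtain ⟨i, b, hb, hx⟩ := StkRow.connected_left (P := fun x => P (.above g x)) hv.2 n2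
        (fun a b h => hP _ _ (.above g h)) x
      exact ⟨_, _, .above g hb, hx⟩
/-- Every component of the horizontal graph touches the left side. -/
theorem StkRow.connected_left : ∀ {t : StkRow} {P : t.Cell → Prop}, t.Valid → t.thick ≠ 0 →
    (∀ a b, t.Adj a b → (P a ↔ P b)) → ∀ x, ∃ i b, t.LeftPort i b ∧ (P x ↔ P b)
  | .nil s, P, _, _, _, x => by
    match x with
    | .wire i => exact ⟨_, _, .wire i, Iff.rfl⟩
  | .cons t c, P, hv, hn, hP, x => by
    obtain ⟨n1, n2⟩ := mul_ne_zero_iff.1 hn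
    have key : ∀ y, ∃ i b, (StkRow.cons t c).LeftPort i b ∧ (P (.here y c) ↔ P b) := by
      intro y
      obtain ⟨i, b, hb, hy⟩ := Stk.connected_left (P := fun x => P (.here x c)) hv.1 n1
        (fun a b h => hP _ _ (.here h c)) y
      exact ⟨i, _, .here hb c, hy⟩
    match x with
    | .here y _ => exact key y
    | .there _ y =>
      obtain ⟨i, b, hb, hy⟩ := StkRow.connected_left (P := fun x => P (.there t x)) hv.2.1 n2
        (fun a b h => hP _ _ (.there t h)) y
      have hi := hb.lt
      rw [← hv.2.2] at hi
      obtain ⟨z, hz⟩ := Stk.exists_rightPort hi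
      obtain ⟨i', b', hb', h⟩ := key z
      exact ⟨i', b', hb', hy.trans ((hP _ _ (.join hz hb)).symm.trans h)⟩
end

/-- If the horizontal graph of a row of non-thin boxes falls apart, then a horizontal cut separates
its wires on the left. -/
theorem StkRow.connected_of_indec {c : StkRow} (hv : c.Valid) (h : c.Indec) (hn : c.thick ≠ 0) :
    Nat.card (Quot c.Adj) = 1 := by
  rw [Quot.card_eq_one_iff]
  obtain ⟨a₀, ha₀⟩ := exists_leftPort h.1
  refine ⟨⟨a₀⟩, fun P hP => ?_⟩
  have h1 : ∀ i a, c.LeftPort i a → (P a ↔ P a₀) := by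
    intro i
    induction i with
    | zero => intro a ha; rw [ha.unique ha₀]
    | succ i ih =>
      intro b hb
      have hlt := hb.lt
      obtain ⟨a, ha⟩ := exists_leftPort (t := c) (i := i) (by omega)
      rw [← ih a ha]
      by_contra hab
      obtain ⟨j, hj, -⟩ := exists_sep hv hn hP ha hb fun h => hab h.symm
      rcases h.2 _ _ hj with h2 | h2 <;> omega
  have h2 : ∀ x, P x ↔ P a₀ := fun x => by
    obtain ⟨i, b, hb, hx⟩ := connected_left hv hn hP x
    exact hx.trans (h1 i b hb)
  exact fun a b => (h2 a).trans (h2 b).symm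

/-! ### Thin-quadratic stackings -/

mutual
/-- The cell is a thin box. -/
def Stk.Cell.IsThin : {t : Stk} → t.Cell → Prop
  | _, .root g _ => g.Thin
  | _, .above _ a => a.IsThin
/-- The cell is a thin box. -/
def StkRow.Cell.IsThin : {t : StkRow} → t.Cell → Prop
  | _, .wire _ => False
  | _, .here a _ => a.IsThin
  | _, .there _ a => a.IsThin
end

mutual
theorem Stk.LeftPort.not_isThin : ∀ {t : Stk} {i : ℕ} {a : t.Cell}, t.LeftPort i a → ¬ a.IsThin
  | _, _, _, .root g c i hi, h => (Nat.zero_le i).not_gt (h.1 ▸ hi)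
  | _, _, _, .above g h', h => StkRow.LeftPort.not_isThin h' h
theorem StkRow.LeftPort.not_isThin : ∀ {t : StkRow} {i : ℕ} {a : t.Cell}, t.LeftPort i a →
    ¬ a.IsThin
  | _, _, _, .wire i, h => h
  | _, _, _, .here h' c, h => Stk.LeftPort.not_isThin h' h
end

mutual
theorem Stk.RightPort.not_isThin : ∀ {t : Stk} {i : ℕ} {a : t.Cell}, t.RightPort i a → ¬ a.IsThin
  | _, _, _, .root g c i hi, h => (Nat.zero_le i).not_gt (h.2 ▸ hi)
  | _, _, _, .above g h', h => StkRow.RightPort.not_isThin h' h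
theorem StkRow.RightPort.not_isThin : ∀ {t : StkRow} {i : ℕ} {a : t.Cell}, t.RightPort i a →
    ¬ a.IsThin
  | _, _, _, .wire i, h => h
  | _, _, _, .there t h', h => StkRow.RightPort.not_isThin h' h
end

mutual
/-- Thin boxes are components of their own. -/
theorem Stk.Adj.isThin_iff : ∀ {t : Stk} {a b : t.Cell}, t.Adj a b → (a.IsThin ↔ b.IsThin)
  | _, _, _, .above g h => StkRow.Adj.isThin_iff h
theorem StkRow.Adj.isThin_iff : ∀ {t : StkRow} {a b : t.Cell}, t.Adj a b → (a.IsThin ↔ b.IsThin)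
  | _, _, _, .join ha hb => by
    have h1 := Stk.RightPort.not_isThin ha
    have h2 := StkRow.LeftPort.not_isThin hb
    exact iff_of_false h1 h2
  | _, _, _, .here h c => Stk.Adj.isThin_iff h
  | _, _, _, .there t h => by
    have := StkRow.Adj.isThin_iff h
    exact this
end

mutual
theorem Stk.exists_cell : ∀ {t : Stk} {g : BoxLabel}, g ∈ t.boxes → ∃ a : t.Cell, a.IsThin ↔ g.Thin
  | .leaf, g, h => absurd h List.not_mem_nil
  | .node g' c, g, h => by
    rcases List.mem_cons.1 h with rfl | h
    · exact ⟨.root g c, Iff.rfl⟩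
    · obtain ⟨a, ha⟩ := StkRow.exists_cell h
      exact ⟨.above g' a, ha⟩
theorem StkRow.exists_cell : ∀ {t : StkRow} {g : BoxLabel}, g ∈ t.boxes →
    ∃ a : t.Cell, a.IsThin ↔ g.Thin
  | .nil s, g, h => absurd h List.not_mem_nil
  | .cons t c, g, h => by
    rcases List.mem_append.1 h with h | h
    · obtain ⟨a, ha⟩ := Stk.exists_cell h
      exact ⟨.here a c, ha⟩
    · obtain ⟨a, ha⟩ := StkRow.exists_cell h
      exact ⟨.there t a, ha⟩
end

theorem StkRow.isEmpty_cell : ∀ {c : StkRow}, c.bare ≠ 0 → IsEmpty c.Cell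
  | .nil s, h => by
    have : s = 0 := by by_contra hs; simp [bare, hs] at h
    subst this
    exact ⟨fun | .wire i => i.elim0⟩
  | .cons t c, h => by
    obtain ⟨h1, h2⟩ := mul_ne_zero_iff.1 h
    obtain rfl := Stk.eq_leaf_of_bare h1
    have := isEmpty_cell h2
    exact ⟨fun
      | .here a _ => nomatch a
      | .there _ a => this.elim a⟩

theorem Stk.unique_cell : ∀ {t : Stk}, t.oneThin ≠ 0 → ∃ a : t.Cell, ∀ b, b = a
  | .leaf, h => absurd rfl h
  | .node g c, h => by
    have h1 : c.bare ≠ 0 := by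
      intro h1; simp [oneThin, h1] at h
    have := StkRow.isEmpty_cell h1
    exact ⟨.root g c, fun
      | .root _ _ => rfl
      | .above _ a => this.elim a⟩

theorem StkRow.unique_cell : ∀ {c : StkRow}, c.oneThin ≠ 0 → ∃ a : c.Cell, ∀ b, b = a
  | .nil s, h => absurd rfl h
  | .cons t c, h => by
    by_cases h1 : t.oneThin = 0
    · obtain ⟨h3, h4⟩ := mul_ne_zero_iff.1 (show t.bare * c.oneThin ≠ 0 by
        simpa [oneThin, h1] using h)
      obtain rfl := Stk.eq_leaf_of_bare h3
      obtain ⟨a, ha⟩ := unique_cell h4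
      exact ⟨.there _ a, fun
        | .here b _ => nomatch b
        | .there _ b => congrArg _ (ha b)⟩
    · have hb : t.bare = 0 := by
        cases t with
        | leaf => exact absurd rfl h1
        | node g c => rfl
      have h2 : c.bare ≠ 0 := by
        intro h2; simp [oneThin, hb, h2] at h
      have := isEmpty_cell h2
      obtain ⟨a, ha⟩ := Stk.unique_cell h1
      exact ⟨.here a c, fun
        | .here b _ => congrArg (StkRow.Cell.here · c) (ha b)
        | .there _ b => this.elim b⟩

theorem StkRow.connected_of_oneThin {c : StkRow} (h : c.oneThin ≠ 0) :
    Nat.card (Quot c.Adj) = 1 := by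
  obtain ⟨a, ha⟩ := unique_cell h
  rw [Quot.card_eq_one_iff]
  exact ⟨⟨a⟩, fun P _ x y => by rw [ha x, ha y]⟩

theorem StkRow.bare_of_boxes : ∀ {c : StkRow}, c.Valid → c.boxes = [] → c.left = 0 → c.bare = 1
  | .nil s, _, _, h => if_pos h
  | .cons .leaf c, hv, hb, _ => by
    simp [bare, Stk.bare, bare_of_boxes hv.2.1 hb hv.2.2.symm]
  | .cons (.node g c') c, hv, hb, h => absurd hb (by simp [boxes, Stk.boxes])

theorem StkRow.oneThin_of_boxes : ∀ {c : StkRow} {h : BoxLabel}, c.Valid → c.boxes = [h] →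
    h.Thin → c.left = 0 → c.oneThin = 1
  | .nil s, h, _, hb, _, _ => absurd hb (by simp [boxes])
  | .cons .leaf c, h, hv, hb, ht, _ => by
    simp [oneThin, Stk.bare, Stk.oneThin, oneThin_of_boxes hv.2.1 hb ht hv.2.2.symm]
  | .cons (.node g c') c, h, hv, hb, ht, hl => by
    simp only [boxes, Stk.boxes, List.cons_append, List.cons.injEq, List.append_eq_nil_iff] at hb
    obtain ⟨rfl, h1, h2⟩ := hb
    simp only [left, Stk.left] at hl
    have h3 := bare_of_boxes hv.1.2 h1 (by omega)
    have h4 : c.left = 0 := by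
      rw [← hv.2.2, Stk.right, (bare_spec (h3.symm ▸ one_ne_zero)).2.2.1, ht.2]
    simp [oneThin, Stk.oneThin, Stk.bare, ht, h3, bare_of_boxes hv.2.1 h2 h4]

mutual
theorem Stk.thick_of_boxes : ∀ {t : Stk}, (∀ g ∈ t.boxes, 0 < g.p ∧ 0 < g.r) → t.thick = 1
  | .leaf, _ => rfl
  | .node g c, h => by
    rw [Stk.thick, if_pos (h g List.mem_cons_self),
      StkRow.thick_of_boxes fun g' hg => h g' (List.mem_cons_of_mem _ hg)]
theorem StkRow.thick_of_boxes : ∀ {t : StkRow}, (∀ g ∈ t.boxes, 0 < g.p ∧ 0 < g.r) → t.thick = 1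
  | .nil s, _ => rfl
  | .cons t c, h => by
    rw [StkRow.thick, Stk.thick_of_boxes fun g hg => h g (List.mem_append_left _ hg),
      StkRow.thick_of_boxes fun g hg => h g (List.mem_append_right _ hg), one_mul]
end

mutual
theorem Stk.thin_of_left : ∀ {t : Stk}, t.Valid → t.NoSemi → t.left = 0 → ∀ g ∈ t.boxes, g.Thin
  | .leaf, _, _, _, g, h => absurd h List.not_mem_nil
  | .node g' c, hv, hn, hl, g, h => by
    obtain ⟨h1, h2⟩ := Stk.noSemi_node.1 hn
    simp only [Stk.left] at hl
    rcases List.mem_cons.1 h with rfl | h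
    · unfold BoxLabel.SemiThin at h1; exact ⟨by omega, by omega⟩
    · exact StkRow.thin_of_left hv.2 h2 (by omega) g h
theorem StkRow.thin_of_left : ∀ {t : StkRow}, t.Valid → t.NoSemi → t.left = 0 →
    ∀ g ∈ t.boxes, g.Thin
  | .nil s, _, _, _, g, h => absurd h List.not_mem_nil
  | .cons t c, hv, hn, hl, g, h => by
    obtain ⟨h1, h2⟩ := StkRow.noSemi_cons.1 hn
    rcases List.mem_append.1 h with h | h
    · exact Stk.thin_of_left hv.1 h1 hl g h
    · refine StkRow.thin_of_left hv.2.1 h2 ?_ g h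
      rw [← hv.2.2]
      exact ((t.sep_zero.eq_iff h1 (Stk.sep_full hv.1)).1 hl.symm).symm
end

theorem StkRow.left_eq_zero_iff {c : StkRow} (hv : c.Valid) (hn : c.NoSemi) :
    c.left = 0 ↔ c.right = 0 := by
  have := c.sep_zero.eq_iff hn (sep_full hv)
  omega

/-- The shape of the thin-quadratic stackings: on the bottom box lies either a single thin box, or,
if the bottom box is thin, a horizontally connected row of non-thin boxes. -/
theorem Stk.thinQuadratic_node {g : BoxLabel} {c : StkRow} (hv : (Stk.node g c).Valid) :
    (Stk.node g c).ThinQuadratic ↔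
      ¬ g.SemiThin ∧ (c.oneThin ≠ 0 ∨ g.Thin ∧ c.indec ≠ 0) := by
  rw [ThinQuadratic, Stk.components_node]
  change (Stk.node g c).NoSemi ∧ _ ↔ _
  rw [Stk.noSemi_node, thinDegree]
  have hnt : ∀ h : BoxLabel, ¬ h.SemiThin → ¬ h.Thin → 0 < h.p ∧ 0 < h.r := by
    intro h h1 h2
    unfold BoxLabel.SemiThin at h1; unfold BoxLabel.Thin at h2; omega
  constructor
  · rintro ⟨⟨hg, hn⟩, hd, hc⟩
    refine ⟨hg, ?_⟩
    have hcon := hc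
    rw [Quot.card_eq_one_iff] at hcon
    have hlr := StkRow.left_eq_zero_iff hv.2 hn
    split_ifs at hd with ho
    · left
      have hb : c.boxes.length = 1 := by
        simp only [boxes, List.length_cons] at hd; omega
      obtain ⟨h, hh⟩ := List.length_eq_one_iff.1 hb
      have hl : c.left = 0 := by have := ho.1; simp only [left] at this; omega
      have := StkRow.oneThin_of_boxes hv.2 hh
        (StkRow.thin_of_left hv.2 hn hl h (by simp [hh])) hl
      rw [this]; exact one_ne_zero
    · have hcount : ((Stk.node g c).boxes.countP fun g => g.Thin) = 1 := by omega
      simp only [boxes, List.countP_cons] at hcount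
      by_cases ht : g.Thin
      · right
        have h0 : c.boxes.countP (fun g => g.Thin) = 0 := by simpa [ht] using hcount
        have hth : c.thick = 1 := StkRow.thick_of_boxes fun h hh =>
          hnt h (hn h hh) (by simpa using List.countP_eq_zero.1 h0 h hh)
        have hl : 0 < c.left := by
          simp only [left, right, ht.1, ht.2, zero_add] at ho
          omega
        refine ⟨ht, ?_⟩
        rw [StkRow.indec, if_pos (StkRow.indec_of_connected hl hcon.2), hth]
        exact one_ne_zero
      · left
        have h1 : c.boxes.countP (fun g => g.Thin) = 1 := by simpa [ht] using hcount
        obtain ⟨h, hh, hth⟩ := List.countP_pos_iff.1 (h1.symm ▸ Nat.one_pos)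
        obtain ⟨a, ha⟩ := StkRow.exists_cell hh
        -- the thin box is a component of its own, hence the only one
        have hall : ∀ b : c.Cell, b.IsThin := fun b =>
          (hcon.2 _ (fun _ _ h => h.isThin_iff) a b).1 (ha.2 (by simpa using hth))
        have hthin : ∀ h ∈ c.boxes, h.Thin := fun h hh => by
          obtain ⟨b, hb⟩ := StkRow.exists_cell hh
          exact hb.1 (hall b)
        have hlen : c.boxes.length = 1 := by
          rw [← h1, eq_comm, List.countP_eq_length]
          exact fun h hh => by simpa using hthin h hh
        obtain ⟨h', hh'⟩ := List.length_eq_one_iff.1 hlen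
        have hl : c.left = 0 := by
          by_contra hl
          obtain ⟨b, hb⟩ := StkRow.exists_leftPort (Nat.pos_of_ne_zero hl)
          exact hb.not_isThin (hall b)
        rw [StkRow.oneThin_of_boxes hv.2 hh' (hthin h' (by simp [hh'])) hl]
        exact one_ne_zero
  · rintro ⟨hg, ho | ⟨ht, hi⟩⟩
    · obtain ⟨-, h1, h2, h, h3, h4⟩ := StkRow.oneThin_spec ho
      refine ⟨⟨hg, StkRow.noSemi_of_oneThin ho⟩, ?_, StkRow.connected_of_oneThin ho⟩
      by_cases ht : g.Thin
      · rw [if_pos ⟨by simp [left, h1, ht.1], by simp [right, h2, ht.2]⟩]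
        simp [boxes, h4]
      · rw [if_neg]
        · simp [boxes, h4, h3, ht]
        · have := hnt g hg ht
          simp only [left]; omega
    · obtain ⟨h1, h2⟩ := StkRow.indec_spec hi
      refine ⟨⟨hg, StkRow.noSemi_of_thick h2⟩, ?_, StkRow.connected_of_indec hv.2 h1 h2⟩
      rw [if_neg]
      · have : c.boxes.countP (fun g => g.Thin) = 0 := List.countP_eq_zero.2 fun h hh => by
          have := (StkRow.thick_spec h2).2 h hh
          rw [decide_eq_true_eq]; unfold BoxLabel.Thin; omega
        simp [boxes, this, ht]
      · have := h1.1
        simp only [left]; omega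

theorem twist_eq_zero {l : List BoxLabel} (h : ∀ g ∈ l, g.shift = 0) : twist l = 0 := by
  induction l with
  | nil => rfl
  | cons g l ih =>
    rw [List.forall_mem_cons] at h
    have h1 : (l.map BoxLabel.shift).sum = 0 := List.sum_eq_zero fun x hx => by
      obtain ⟨g, hg, rfl⟩ := List.mem_map.1 hx
      exact h.2 g hg
    rw [twist, ih h.2, h1]; ring

/-- The signs of the infinitesimal decomposition are the signs of `s_thin⁻¹ ⊗ ⋯ ⊗ s_thin⁻¹`, up to
`tqSign`. -/
theorem Stk.thinSign_eq (k : Type*) [CommRing k] : ∀ {t : Stk}, t.Valid →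
    t.thinSign k = koszul k (twist t.boxes) * ((t.tqSign : ℤ) : k)
  | .leaf, _ => by
    rw [thinSign, if_neg]
    · simp [tqSign]
    · rintro ⟨-, -, h⟩
      have : IsEmpty (Quot (Stk.Adj .leaf)) := ⟨fun x => by
        induction x using Quot.ind with | _ x => exact nomatch x⟩
      rw [components, Nat.card_of_isEmpty] at h
      omega
  | .node g c, hv => by
    classical
    rw [thinSign, Stk.thinQuadratic_node hv, tqSign_node, twist_node]
    by_cases hg : g.SemiThin
    · simp [hg]
    by_cases ho : c.oneThin = 0
    · by_cases ht : g.Thin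
      · by_cases hi : c.indec = 0
        · simp [ho, hi]
        · obtain ⟨h1, h2⟩ := StkRow.indec_spec hi
          have hI : ¬ (Stk.node g c).IsTypeI := by
            rintro ⟨-, h, hth, hb⟩
            have := ((StkRow.thick_spec h2).2 h (by simp [hb])).1
            have := hth.1
            omega
          rw [if_pos ⟨hg, .inr ⟨ht, hi⟩⟩, if_neg hI,
            if_neg (show ¬ (Stk.node g c).IsTypeII from not_not_intro ht),
            if_neg hg, if_pos ht, ho, StkRow.degree_shift_of_thick h2,
            twist_eq_zero fun h hh => BoxLabel.shift_of_pos ((StkRow.thick_spec h2).2 h hh),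
            StkRow.indec, if_pos h1, (StkRow.thick_spec h2).1]
          simp
      · rw [if_neg]
        · simp [ho, ht]
        · rintro ⟨-, h | h⟩
          · exact h ho
          · exact ht h.1
    · obtain ⟨h0, h1, h2, h, h3, h4⟩ := StkRow.oneThin_spec ho
      have htw : twist c.boxes = 0 := by simp [h4, twist]
      rw [if_pos ⟨hg, .inl ho⟩, StkRow.degree_shift_of_oneThin ho, htw, h0,
        StkRow.indec_eq_zero h1, if_neg hg]
      have e : koszul k (g.deg * -1 + 0) = koszul k g.deg := by
        rw [add_zero, mul_neg_one, koszul_neg]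
      rw [e]
      by_cases ht : g.Thin
      · rw [if_pos (show (Stk.node g c).IsTypeI from ⟨ht, h, h3, h4⟩), if_pos ht]
        simp [bottomDeg]
      · rw [if_neg (show ¬ (Stk.node g c).IsTypeI from fun h => ht h.1),
          if_pos (show (Stk.node g c).IsTypeII from ht), if_neg ht, bottomDeg, koszul_add_one]
        simp

/-! ### The components of a derivation -/

section components
variable {k : Type u} [CommRing k]
variable {C : BoxLabel → Type u} [∀ g, AddCommGroup (C g)] [∀ g, Module k (C g)]

theorem freeProj_freeIn_self {t : Stk} (h : t.Valid) (y : Stk.tens k C t) :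
    freeProj k C t (freeIn k C t y) = y := by
  simp [freeProj, freeIn, h, DirectSum.component.lof_self]

theorem freeProj_freeIn_ne {t t' : Stk} (h : t' ≠ t) (y : Stk.tens k C t) :
    freeProj k C t' (freeIn k C t y) = 0 := by
  unfold freeProj freeIn
  split_ifs with h1 h2
  · exact (DirectSum.component.of k _ _ _).trans (dif_neg fun e => h (congrArg Subtype.val e).symm)
  · exact map_zero _
  · rfl
  · rfl

variable (k C) in
/-- The projection to a summand. -/
noncomputable def rowProj (c : StkRow) : FreeRow k C →ₗ[k] StkRow.tens k C c :=
  DirectSum.component k StkRow (fun c => (StkRow.tens k C c : Type u)) c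

theorem rowProj_rowIn_self (c : StkRow) (y : StkRow.tens k C c) :
    rowProj k C c (rowIn k C c y) = y := DirectSum.component.lof_self k _ _

theorem rowProj_rowIn_ne {c c' : StkRow} (h : c' ≠ c) (y : StkRow.tens k C c) :
    rowProj k C c' (rowIn k C c y) = 0 :=
  (DirectSum.component.of k _ _ _).trans (dif_neg h.symm)

variable (k C) in
/-- The component of an element of `T(C)` at a stacking, as an element of `T(C)`. -/
noncomputable def boxAt (t : Stk) : FreeBox k C →ₗ[k] FreeBox k C := freeIn k C t ∘ₗ freeProj k C t

variable (k C) in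
/-- The component of an element of the direct sum over rows at a row. -/
noncomputable def rowAt (c : StkRow) : FreeRow k C →ₗ[k] FreeRow k C := rowIn k C c ∘ₗ rowProj k C c

theorem boxAt_apply (t : Stk) (x : FreeBox k C) :
    boxAt k C t x = freeIn k C t (freeProj k C t x) := rfl

theorem rowAt_apply (c : StkRow) (x : FreeRow k C) :
    rowAt k C c x = rowIn k C c (rowProj k C c x) := rfl

theorem boxAt_freeIn_self (t : Stk) (y : Stk.tens k C t) :
    boxAt k C t (freeIn k C t y) = freeIn k C t y := by
  by_cases h : t.Valid
  · rw [boxAt_apply, freeProj_freeIn_self h]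
  · simp [freeIn_of_not_valid h]

theorem boxAt_freeIn_ne {t t' : Stk} (h : t' ≠ t) (y : Stk.tens k C t) :
    boxAt k C t' (freeIn k C t y) = 0 := by
  rw [boxAt_apply, freeProj_freeIn_ne h, map_zero]

theorem rowAt_rowIn_self (c : StkRow) (y : StkRow.tens k C c) :
    rowAt k C c (rowIn k C c y) = rowIn k C c y := by
  rw [rowAt_apply, rowProj_rowIn_self]

theorem rowAt_rowIn_ne {c c' : StkRow} (h : c' ≠ c) (y : StkRow.tens k C c) :
    rowAt k C c' (rowIn k C c y) = 0 := by
  rw [rowAt_apply, rowProj_rowIn_ne h, map_zero]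

theorem freeIn_freeProj_mk (S : Stacking) (x : FreeBox k C) :
    freeIn k C S.1 (freeProj k C S.1 x) =
      DirectSum.of (fun S : Stacking => (Stk.tens k C S.1 : Type u)) S (x S) := by
  rw [freeIn_of_valid S.2]
  simp [freeProj, S.2]
  rfl

theorem freeBox_eq_zero {x : FreeBox k C} (h : ∀ t, t.Valid → boxAt k C t x = 0) : x = 0 := by
  refine DFinsupp.ext fun S => ?_
  have h1 := h S.1 S.2
  rw [boxAt_apply, freeIn_freeProj_mk] at h1
  exact (map_eq_zero_iff _ (DirectSum.of_injective S)).1 h1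

/-- An element of `T(C)` is the sum of its components. -/
theorem mem_span_freeIn {p : Stk → Prop} {x : FreeBox k C}
    (h : ∀ t, freeProj k C t x ≠ 0 → p t) :
    x ∈ Submodule.span k {z | ∃ t, t.Valid ∧ p t ∧ ∃ y, freeIn k C t y = z} := by
  classical
  rw [← DirectSum.sum_support_of x]
  refine Submodule.sum_mem _ fun S hS => ?_
  rw [← freeIn_freeProj_mk]
  refine Submodule.subset_span ⟨S.1, S.2, h _ fun h0 => ?_, _, rfl⟩
  have h1 := freeIn_freeProj_mk S x
  rw [h0, map_zero] at h1
  exact DFinsupp.mem_support_iff.1 hS ((map_eq_zero_iff _ (DirectSum.of_injective S)).1 h1.symm)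

/-- The components of a composite, if there are as many inputs as entries of the row. -/
theorem boxAt_graftMul (δ : BoxLabel → ℤ) {T : Stk} (hT : T.Valid) {x : FreeBox k C} {c : StkRow}
    (hc : c.Valid) (hx : ∀ t, freeProj k C t x ≠ 0 → c.length = t.inputs) (z : StkRow.tens k C c) :
    boxAt k C T (graftMul k C δ x (rowIn k C c z)) = T.cutSum fun a f =>
      graftMul k C δ (boxAt k C a x) (rowAt k C f (rowIn k C c z)) := by
  have hx' := mem_span_freeIn hx
  clear hx
  induction hx' using Submodule.span_induction with
  | zero => simp [Stk.cutSum_zero]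
  | add x y _ _ hx hy => simp only [map_add, LinearMap.add_apply, hx, hy, Stk.cutSum_add]
  | smul r x _ hx =>
    simp only [map_smul, LinearMap.smul_apply, hx]
    exact Stk.map_cutSum (DistribSMul.toAddMonoidHom (FreeBox k C) r) T _
  | mem x h =>
    obtain ⟨t, ht, hl, y, rfl⟩ := h
    rw [graftMul_freeIn δ ht]
    by_cases hg : t.graft c = T
    · subst hg
      rw [boxAt_freeIn_self]
      refine Eq.trans (Eq.symm (Stk.cutSum_single hT ⟨ht, hc, hl, rfl⟩
        (freeIn k C (t.graft c) (t.graftMap k C δ c (y ⊗ₜ z)))))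
        (Stk.cutSum_congr hT fun a f _ => ?_)
      · by_cases ha : a = t
        · by_cases hf : f = c
          · subst ha hf
            rw [if_pos ⟨rfl, rfl⟩, boxAt_freeIn_self, rowAt_rowIn_self, graftMul_freeIn δ ht]
          · rw [if_neg fun h => hf h.2, rowAt_rowIn_ne hf, map_zero]
        · rw [if_neg fun h => ha h.1, boxAt_freeIn_ne ha, map_zero, LinearMap.zero_apply]
    · rw [boxAt_freeIn_ne (Ne.symm hg), ← Stk.cutSum_zero T]
      refine Stk.cutSum_congr hT fun a f h => ?_
      by_cases ha : a = t
      · have hf : f ≠ c := by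
          rintro rfl
          subst ha
          exact hg h.graft
        rw [rowAt_rowIn_ne hf, map_zero]
      · rw [boxAt_freeIn_ne ha, map_zero, LinearMap.zero_apply]

theorem boxAt_leaf_nodeMul (g : BoxLabel) (x : C g) (r : FreeRow k C) :
    boxAt k C .leaf (nodeMul k C g x r) = 0 := by
  refine LinearMap.congr_fun (f := boxAt k C .leaf ∘ₗ nodeMul k C g x) (g := 0)
    (freeRow_ext fun R => ?_) r
  rw [LinearMap.comp_apply, DRow.val, nodeMul_rowIn, boxAt_freeIn_ne (t := .node g R.sh) (t' := .leaf) nofun]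
  rfl

theorem boxAt_nodeMul (g : BoxLabel) (x : C g) (c : StkRow) (r : FreeRow k C) :
    boxAt k C (.node g c) (nodeMul k C g x r) = nodeMul k C g x (rowAt k C c r) := by
  refine LinearMap.congr_fun (f := boxAt k C (.node g c) ∘ₗ nodeMul k C g x)
    (g := nodeMul k C g x ∘ₗ rowAt k C c) (freeRow_ext fun R => ?_) r
  rw [LinearMap.comp_apply, LinearMap.comp_apply, DRow.val, nodeMul_rowIn]
  by_cases h : c = R.sh
  · subst h
    rw [boxAt_freeIn_self, rowAt_rowIn_self, nodeMul_rowIn]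
  · rw [boxAt_freeIn_ne (fun e => h (Stk.node.inj e).2), rowAt_rowIn_ne h, map_zero]

theorem boxAt_nodeMul_ne {g g' : BoxLabel} (hg : g' ≠ g) (x : C g) (c : StkRow) (r : FreeRow k C) :
    boxAt k C (.node g' c) (nodeMul k C g x r) = 0 := by
  refine LinearMap.congr_fun (f := boxAt k C (.node g' c) ∘ₗ nodeMul k C g x)
    (g := 0) (freeRow_ext fun R => ?_) r
  rw [LinearMap.comp_apply, DRow.val, nodeMul_rowIn,
    boxAt_freeIn_ne (fun e => hg (Stk.node.inj e).1)]
  rfl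

theorem rowAt_nil_consMul (s : ℕ) (x : FreeBox k C) (r : FreeRow k C) :
    rowAt k C (.nil s) (consMul k C x r) = 0 := by
  refine LinearMap.congr_fun (f := rowAt k C (.nil s) ∘ₗ (consMul k C).flip r) (g := 0)
    (freeBox_ext fun T hT => ?_) x
  refine LinearMap.congr_fun (f := rowAt k C (.nil s) ∘ₗ consMul k C (T.val k)) (g := 0)
    (freeRow_ext fun R => ?_) r
  rw [LinearMap.comp_apply, DRow.val, DStk.val, consMul_freeIn hT,
    rowAt_rowIn_ne (c := .cons T.sh R.sh) (c' := .nil s) nofun]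
  rfl

theorem rowAt_consMul (t : Stk) (c : StkRow) (x : FreeBox k C) (r : FreeRow k C) :
    rowAt k C (.cons t c) (consMul k C x r) = consMul k C (boxAt k C t x) (rowAt k C c r) := by
  refine LinearMap.congr_fun (f := rowAt k C (.cons t c) ∘ₗ (consMul k C).flip r)
    (g := (consMul k C).flip (rowAt k C c r) ∘ₗ boxAt k C t) (freeBox_ext fun T hT => ?_) x
  refine LinearMap.congr_fun (f := rowAt k C (.cons t c) ∘ₗ consMul k C (T.val k))
    (g := consMul k C (boxAt k C t (T.val k)) ∘ₗ rowAt k C c) (freeRow_ext fun R => ?_) r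
  rw [LinearMap.comp_apply, LinearMap.comp_apply, DRow.val, DStk.val, consMul_freeIn hT]
  by_cases h : t = T.sh
  · by_cases h' : c = R.sh
    · subst h h'
      rw [boxAt_freeIn_self, rowAt_rowIn_self, rowAt_rowIn_self, consMul_freeIn hT]
    · rw [rowAt_rowIn_ne (fun e => h' (StkRow.cons.inj e).2), rowAt_rowIn_ne h', map_zero]
  · rw [rowAt_rowIn_ne (fun e => h (StkRow.cons.inj e).1), boxAt_freeIn_ne h, map_zero,
      LinearMap.zero_apply]

variable (δ : BoxLabel → ℤ) (ψ : ∀ g, C g →ₗ[k] FreeBox k C)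

/-- The contribution of the box `v` of `t` to the value on `x` of the derivation that extends `ψ`:
the component at `t'` of `ψ` is applied to the factor at `v`. -/
noncomputable def Stk.Pos.derivTerm {t : Stk} {h : BoxLabel} (v : t.Pos h) (t' : Stk) :
    FreeBox k C →ₗ[k] FreeBox k C :=
  koszul k (v.before δ) • (freeIn k C (v.subst t') ∘ₗ
    v.substMap k C δ t' (freeProj k C t' ∘ₗ ψ h) ∘ₗ freeProj k C t)

/-- The contribution of the box `v` of a row to the value of the derivation that extends `ψ`. -/
noncomputable def StkRow.Pos.derivTerm {t : StkRow} {h : BoxLabel} (v : t.Pos h) (t' : Stk) :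
    FreeRow k C →ₗ[k] FreeRow k C :=
  koszul k (v.before δ) • (rowIn k C (v.subst t') ∘ₗ
    v.substMap k C δ t' (freeProj k C t' ∘ₗ ψ h) ∘ₗ rowProj k C t)

theorem Stk.Pos.derivTerm_self {t : Stk} {h : BoxLabel} (v : t.Pos h) (t' : Stk) (ht : t.Valid)
    (y : Stk.tens k C t) : v.derivTerm δ ψ t' (freeIn k C t y) = koszul k (v.before δ) •
      freeIn k C (v.subst t') (v.substMap k C δ t' (freeProj k C t' ∘ₗ ψ h) y) := by
  change koszul k (v.before δ) • freeIn k C (v.subst t') (v.substMap k C δ t' (freeProj k C t' ∘ₗ ψ h)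
    (freeProj k C t (freeIn k C t y))) = _
  rw [freeProj_freeIn_self ht]

theorem Stk.Pos.derivTerm_ne {t t₀ : Stk} {h : BoxLabel} (v : t.Pos h) (t' : Stk) (ht : t ≠ t₀)
    (y : Stk.tens k C t₀) : v.derivTerm δ ψ t' (freeIn k C t₀ y) = 0 := by
  change koszul k (v.before δ) • freeIn k C (v.subst t') (v.substMap k C δ t' (freeProj k C t' ∘ₗ ψ h)
    (freeProj k C t (freeIn k C t₀ y))) = _
  rw [freeProj_freeIn_ne ht, map_zero, map_zero, smul_zero]

theorem StkRow.Pos.derivTerm_self {t : StkRow} {h : BoxLabel} (v : t.Pos h) (t' : Stk)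
    (y : StkRow.tens k C t) : v.derivTerm δ ψ t' (rowIn k C t y) = koszul k (v.before δ) •
      rowIn k C (v.subst t') (v.substMap k C δ t' (freeProj k C t' ∘ₗ ψ h) y) := by
  change koszul k (v.before δ) • rowIn k C (v.subst t') (v.substMap k C δ t' (freeProj k C t' ∘ₗ ψ h)
    (rowProj k C t (rowIn k C t y))) = _
  rw [rowProj_rowIn_self]

theorem StkRow.Pos.derivTerm_ne {t t₀ : StkRow} {h : BoxLabel} (v : t.Pos h) (t' : Stk)
    (ht : t ≠ t₀) (y : StkRow.tens k C t₀) : v.derivTerm δ ψ t' (rowIn k C t₀ y) = 0 := by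
  change koszul k (v.before δ) • rowIn k C (v.subst t') (v.substMap k C δ t' (freeProj k C t' ∘ₗ ψ h)
    (rowProj k C t (rowIn k C t₀ y))) = _
  rw [rowProj_rowIn_ne ht, map_zero, map_zero, smul_zero]

theorem Stk.Pos.ne_leaf {t : Stk} {h : BoxLabel} (v : t.Pos h) : t ≠ .leaf := by
  cases v <;> nofun

end components

section derivation_components
variable {k : Type u} [CommRing k]
variable {C : BoxLabel → Type u} [∀ g, AddCommGroup (C g)] [∀ g, Module k (C g)]
variable {δ : BoxLabel → ℤ} {ψ : ∀ g, C g →ₗ[k] FreeBox k C}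

/-- A map `C → T(C)` that preserves arities and degrees, and does not meet the unit stacking. -/
def Supported (ψ : ∀ g, C g →ₗ[k] FreeBox k C) : Prop :=
  ∀ g x (t : Stk), freeProj k C t (ψ g x) ≠ 0 → t ≠ .leaf ∧ t.out BoxLabel.deg = g

/-- The bottom box of a composite comes from the value of `ψ` at that box. -/
theorem boxAt_graftMul_node (hψ : Supported ψ) {T : Stk} {g₀ : BoxLabel} {c₀ : StkRow}
    (hc : (Stk.node g₀ c₀).Valid) (x : C g₀) (z : StkRow.tens k C c₀)
    (a : Stk) (f : StkRow) (ha : a.IsCut f T) :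
    graftMul k C δ (boxAt k C a (ψ g₀ x)) (rowAt k C f (rowIn k C c₀ z)) =
      (Stk.Pos.root (a.out BoxLabel.deg) f).derivTerm δ ψ a
        (freeIn k C (.node g₀ c₀) ((tensNode k C g₀ c₀).symm (x ⊗ₜ z))) := by
  by_cases hf : f = c₀
  · subst hf
    by_cases hg : a.out BoxLabel.deg = g₀
    · subst hg
      rw [Stk.Pos.derivTerm_self δ ψ _ a hc, rowAt_rowIn_self, boxAt_apply,
        graftMul_freeIn δ ha.valid]
      change _ = koszul k 0 • _
      rw [koszul_zero, one_smul]
      rfl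
    · rw [Stk.Pos.derivTerm_ne δ ψ _ a (fun e => hg (Stk.node.inj e).1)]
      have h0 : freeProj k C a (ψ g₀ x) = 0 := by
        by_contra h0
        exact hg (hψ g₀ x a h0).2
      rw [boxAt_apply, h0, map_zero, map_zero, LinearMap.zero_apply]
  · rw [rowAt_rowIn_ne hf, map_zero, Stk.Pos.derivTerm_ne δ ψ _ a
      (fun e => hf (Stk.node.inj e).2)]

/-- No summand comes from the unit stacking. -/
theorem derivTerm_leaf (hψ : Supported ψ) {g₀ : BoxLabel} {c₀ : StkRow}
    (hc : (Stk.node g₀ c₀).Valid) (f : StkRow) (x : C g₀) (z : StkRow.tens k C c₀) :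
    (Stk.Pos.root (Stk.leaf.out BoxLabel.deg) f).derivTerm δ ψ .leaf
      (freeIn k C (.node g₀ c₀) ((tensNode k C g₀ c₀).symm (x ⊗ₜ z))) = 0 := by
  by_cases h : Stk.node (Stk.leaf.out BoxLabel.deg) f = .node g₀ c₀
  · obtain ⟨rfl, rfl⟩ := Stk.node.inj h
    have h0 : freeProj k C .leaf (ψ _ x) = 0 := by
      by_contra h0
      exact (hψ _ x _ h0).1 rfl
    rw [Stk.Pos.derivTerm_self δ ψ _ _ hc]
    change koszul k 0 • freeIn k C (Stk.leaf.graft f) (Stk.leaf.graftMap k C δ f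
      (freeProj k C .leaf (ψ _ x) ⊗ₜ z)) = 0
    rw [h0, TensorProduct.zero_tmul, map_zero, map_zero, smul_zero]
  · exact Stk.Pos.derivTerm_ne δ ψ _ _ h _

/-- The boxes above the bottom box contribute the derivation of the row. -/
theorem derivTerm_above {g g₀ : BoxLabel} {c c₀ : StkRow} {h : BoxLabel} (v : c.Pos h) (t' : Stk)
    (hc : (Stk.node g₀ c₀).Valid) (hg : g = g₀) (x : C g₀) (z : StkRow.tens k C c₀) :
    koszul k (δ g₀) • nodeMul k C g₀ x (v.derivTerm δ ψ t' (rowIn k C c₀ z)) =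
      (Stk.Pos.above g v).derivTerm δ ψ t'
        (freeIn k C (.node g₀ c₀) ((tensNode k C g₀ c₀).symm (x ⊗ₜ z))) := by
  subst hg
  by_cases hf : c = c₀
  · subst hf
    rw [StkRow.Pos.derivTerm_self, Stk.Pos.derivTerm_self δ ψ _ t' hc, map_smul, smul_smul,
      nodeMul_rowIn]
    change _ = koszul k (δ g + v.before δ) • _
    rw [koszul_add]
    rfl
  · rw [StkRow.Pos.derivTerm_ne δ ψ v t' hf, map_zero, smul_zero,
      Stk.Pos.derivTerm_ne δ ψ _ t' (fun e => hf (Stk.node.inj e).2)]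

theorem derivTerm_here {t t₀ : Stk} {c c₀ : StkRow} {h : BoxLabel} (v : t.Pos h) (t' : Stk)
    (hv : (v.subst t').Valid) (ht : t₀.Valid) (y : Stk.tens k C t₀) (z : StkRow.tens k C c₀) :
    consMul k C (v.derivTerm δ ψ t' (freeIn k C t₀ y)) (rowAt k C c (rowIn k C c₀ z)) =
      (StkRow.Pos.here v c).derivTerm δ ψ t'
        (rowIn k C (.cons t₀ c₀) ((tensCons k C t₀ c₀).symm (y ⊗ₜ z))) := by
  by_cases hf : c = c₀
  · subst hf
    by_cases hg : t = t₀
    · subst hg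
      rw [Stk.Pos.derivTerm_self δ ψ v t' ht, StkRow.Pos.derivTerm_self, rowAt_rowIn_self,
        map_smul, LinearMap.smul_apply, consMul_freeIn hv]
      rfl
    · rw [Stk.Pos.derivTerm_ne δ ψ v t' hg, map_zero, LinearMap.zero_apply,
        StkRow.Pos.derivTerm_ne δ ψ _ t' (fun e => hg (StkRow.cons.inj e).1)]
  · rw [rowAt_rowIn_ne hf, map_zero,
      StkRow.Pos.derivTerm_ne δ ψ _ t' (fun e => hf (StkRow.cons.inj e).2)]

theorem derivTerm_there {t t₀ : Stk} {c c₀ : StkRow} {h : BoxLabel} (v : c.Pos h) (t' : Stk)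
    (ht : t₀.Valid) (y : Stk.tens k C t₀) (z : StkRow.tens k C c₀) :
    koszul k (t₀.degree δ) • consMul k C (boxAt k C t (freeIn k C t₀ y))
        (v.derivTerm δ ψ t' (rowIn k C c₀ z)) =
      (StkRow.Pos.there t v).derivTerm δ ψ t'
        (rowIn k C (.cons t₀ c₀) ((tensCons k C t₀ c₀).symm (y ⊗ₜ z))) := by
  by_cases hg : t = t₀
  · subst hg
    by_cases hf : c = c₀
    · subst hf
      rw [StkRow.Pos.derivTerm_self, StkRow.Pos.derivTerm_self, boxAt_freeIn_self,
        map_smul, consMul_freeIn ht, smul_smul]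
      change _ = koszul k (t.degree δ + v.before δ) • _
      rw [koszul_add]
      rfl
    · rw [StkRow.Pos.derivTerm_ne δ ψ v t' hf, map_zero, smul_zero,
        StkRow.Pos.derivTerm_ne δ ψ _ t' (fun e => hf (StkRow.cons.inj e).2)]
  · rw [boxAt_freeIn_ne hg, map_zero, LinearMap.zero_apply, smul_zero,
      StkRow.Pos.derivTerm_ne δ ψ _ t' (fun e => hg (StkRow.cons.inj e).1)]

theorem derivMap_node (g : BoxLabel) (c : StkRow) (x : C g) (z : StkRow.tens k C c) :
    (Stk.node g c).derivMap k C δ ψ ((tensNode k C g c).symm (x ⊗ₜ z)) =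
      graftMul k C δ (ψ g x) (rowIn k C c z) +
        koszul k (δ g) • nodeMul k C g x (c.derivMap k C δ ψ z) := rfl

theorem derivMap_cons (t : Stk) (c : StkRow) (y : Stk.tens k C t) (z : StkRow.tens k C c) :
    (StkRow.cons t c).derivMap k C δ ψ ((tensCons k C t c).symm (y ⊗ₜ z)) =
      consMul k C (t.derivMap k C δ ψ y) (rowIn k C c z) +
        koszul k (t.degree δ) • consMul k C (freeIn k C t y) (c.derivMap k C δ ψ z) := rfl

@[elab_as_elim]
theorem tens_node_induction {g : BoxLabel} {c : StkRow} {p : Stk.tens k C (.node g c) → Prop}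
    (zero : p 0) (add : ∀ y z, p y → p z → p (y + z))
    (tmul : ∀ x z, p ((tensNode k C g c).symm (x ⊗ₜ z))) (y : Stk.tens k C (.node g c)) : p y :=
  TensorProduct.induction_on (motive := p) y zero tmul add

@[elab_as_elim]
theorem tens_cons_induction {t : Stk} {c : StkRow} {p : StkRow.tens k C (.cons t c) → Prop}
    (zero : p 0) (add : ∀ y z, p y → p z → p (y + z))
    (tmul : ∀ x z, p ((tensCons k C t c).symm (x ⊗ₜ z))) (y : StkRow.tens k C (.cons t c)) : p y :=
  TensorProduct.induction_on (motive := p) y zero tmul add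

mutual
/-- The component at `T` of the derivation that extends `ψ` is the sum over all ways to obtain `T`
by a substitution. -/
theorem Stk.boxAt_derivMap (hψ : Supported ψ) : ∀ {T : Stk}, T.Valid → ∀ {t₀ : Stk}, t₀.Valid →
    ∀ y : Stk.tens k C t₀, boxAt k C T (t₀.derivMap k C δ ψ y) =
      T.factSum fun _ _ v t' => v.derivTerm δ ψ t' (freeIn k C t₀ y)
  | T, hT, .leaf, h₀, y => by
    refine (map_zero (boxAt k C T)).trans ?_
    rw [← Stk.factSum_zero T]
    exact Stk.factSum_congr hT fun t h v t' _ =>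
      (Stk.Pos.derivTerm_ne δ ψ v t' v.ne_leaf y).symm
  | T, hT, .node g₀ c₀, h₀, y => by
    induction y using tens_node_induction with
    | zero => simp only [map_zero, Stk.factSum_zero]
    | add y z hy hz => simp only [map_add, hy, hz, Stk.factSum_add]
    | tmul x z =>
      rw [derivMap_node, map_add, map_smul, boxAt_graftMul δ hT h₀.2 (fun t ht => by
        rw [h₀.1, ← (hψ g₀ x t ht).2]; rfl)]
      rw [Stk.cutSum_congr hT fun a f ha => boxAt_graftMul_node hψ h₀ x z a f ha]
      have hleaf : ∀ f : StkRow, (Stk.Pos.root (Stk.leaf.out BoxLabel.deg) f).derivTerm δ ψ .leaf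
          (freeIn k C (.node g₀ c₀) ((tensNode k C g₀ c₀).symm (x ⊗ₜ z))) = 0 := by
        refine fun f => derivTerm_leaf hψ h₀ f x z
      match T, hT with
      | .leaf, hT =>
        rw [boxAt_leaf_nodeMul, smul_zero, add_zero, Stk.factSum]
        exact hleaf _
      | .node g c, hT =>
        rw [Stk.factSum, Stk.cutSum, hleaf, zero_add]
        congr 1
        by_cases hg : g = g₀
        · rw [hg, boxAt_nodeMul, StkRow.rowAt_derivMap hψ hT.2 h₀.2]
          refine Eq.trans (StkRow.map_factSum ((koszul k (δ g₀) • nodeMul k C g₀ x :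
            FreeRow k C →ₗ[k] FreeBox k C) : FreeRow k C →+ FreeBox k C) c _) ?_
          exact StkRow.factSum_congr hT.2 fun t h v t' _ => derivTerm_above v t' h₀ rfl x z
        · rw [boxAt_nodeMul_ne hg, smul_zero, ← StkRow.factSum_zero c]
          exact StkRow.factSum_congr hT.2 fun t h v t' _ =>
            (Stk.Pos.derivTerm_ne δ ψ _ t' (fun e => hg (Stk.node.inj e).1) _).symm
/-- The same formula for a row. -/
theorem StkRow.rowAt_derivMap (hψ : Supported ψ) : ∀ {T : StkRow}, T.Valid → ∀ {c₀ : StkRow},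
    c₀.Valid → ∀ z : StkRow.tens k C c₀, rowAt k C T (c₀.derivMap k C δ ψ z) =
      T.factSum fun _ _ v t' => v.derivTerm δ ψ t' (rowIn k C c₀ z)
  | T, hT, .nil s, h₀, z => by
    refine (map_zero (rowAt k C T)).trans ?_
    rw [← StkRow.factSum_zero T]
    exact StkRow.factSum_congr hT fun t h v t' _ =>
      (StkRow.Pos.derivTerm_ne δ ψ v t' (by cases v <;> nofun) z).symm
  | T, hT, .cons t₀ c₀, h₀, y => by
    induction y using tens_cons_induction with
    | zero => simp only [map_zero, StkRow.factSum_zero]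
    | add y z hy hz => simp only [map_add, hy, hz, StkRow.factSum_add]
    | tmul y z =>
      rw [derivMap_cons, map_add, map_smul]
      match T, hT with
      | .nil s, hT =>
        rw [rowAt_nil_consMul, rowAt_nil_consMul, smul_zero, add_zero]
        rfl
      | .cons t c, hT =>
        rw [StkRow.factSum, rowAt_consMul, rowAt_consMul, Stk.boxAt_derivMap hψ hT.1 h₀.1,
          StkRow.rowAt_derivMap hψ hT.2.1 h₀.2.1]
        congr 1
        · refine Eq.trans (Stk.map_factSum (((consMul k C).flip (rowAt k C c (rowIn k C c₀ z)) :
            FreeBox k C →ₗ[k] FreeRow k C) : FreeBox k C →+ FreeRow k C) t _) ?_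
          exact Stk.factSum_congr hT.1 fun t h v t' H =>
            derivTerm_here v t' (H.subst ▸ hT.1) h₀.1 y z
        · refine Eq.trans (StkRow.map_factSum ((koszul k (t₀.degree δ) • consMul k C
            (boxAt k C t (freeIn k C t₀ y)) :
            FreeRow k C →ₗ[k] FreeRow k C) : FreeRow k C →+ FreeRow k C) c _) ?_
          exact StkRow.factSum_congr hT.2.1 fun _ h v t' _ => derivTerm_there v t' h₀.1 y z
end

/-- The component at `T` of the derivation that extends `ψ` is the sum over all ways to obtain `T`
by a substitution. -/
theorem boxAt_freeDeriv (hψ : Supported ψ) {T : Stk} (hT : T.Valid) (x : FreeBox k C) :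
    boxAt k C T (freeDeriv k C δ ψ x) = T.factSum fun _ _ v t' => v.derivTerm δ ψ t' x := by
  have hx := mem_span_freeIn (p := fun _ => True) (x := x) fun _ _ => trivial
  induction hx using Submodule.span_induction with
  | zero => simp [Stk.factSum_zero]
  | add x y _ _ hx hy => simp only [map_add, hx, hy, Stk.factSum_add]
  | smul r x _ hx =>
    simp only [map_smul, hx]
    exact Stk.map_factSum (DistribSMul.toAddMonoidHom (FreeBox k C) r) T _
  | mem x h =>
    obtain ⟨t, ht, -, y, rfl⟩ := h
    rw [freeDeriv_freeIn ψ ht, Stk.boxAt_derivMap hψ hT ht]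

end derivation_components

/-! ### The square of the infinitesimal decomposition -/

section square
variable {k : Type u} [CommRing k]
variable {C : BoxLabel → Type u} [∀ g, AddCommGroup (C g)] [∀ g, Module k (C g)]

mutual
theorem Stk.Pos.substMap_smul (δ : BoxLabel → ℤ) (t' : Stk) (r : k) : ∀ {t : Stk} {h : BoxLabel}
    (v : t.Pos h) (φ : C h →ₗ[k] Stk.tens k C t') (y : Stk.tens k C t),
    v.substMap k C δ t' (r • φ) y = r • v.substMap k C δ t' φ y
  | _, _, .root g c, φ, y => by
    induction y using tens_node_induction with
    | zero => simp only [map_zero, smul_zero]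
    | add y z hy hz => simp only [map_add, hy, hz, smul_add]
    | tmul x z =>
      change t'.graftMap k C δ c ((r • φ x) ⊗ₜ z) = r • t'.graftMap k C δ c (φ x ⊗ₜ z)
      rw [← TensorProduct.smul_tmul', map_smul]
  | _, _, .above g v, φ, y => by
    induction y using tens_node_induction with
    | zero => simp only [map_zero, smul_zero]
    | add y z hy hz => simp only [map_add, hy, hz, smul_add]
    | tmul x z =>
      change (tensNode k C g (v.subst t')).symm (x ⊗ₜ v.substMap k C δ t' (r • φ) z) =
        r • (tensNode k C g (v.subst t')).symm (x ⊗ₜ v.substMap k C δ t' φ z)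
      rw [StkRow.Pos.substMap_smul δ t' r v, TensorProduct.tmul_smul, map_smul]
theorem StkRow.Pos.substMap_smul (δ : BoxLabel → ℤ) (t' : Stk) (r : k) :
    ∀ {t : StkRow} {h : BoxLabel} (v : t.Pos h) (φ : C h →ₗ[k] Stk.tens k C t')
    (y : StkRow.tens k C t), v.substMap k C δ t' (r • φ) y = r • v.substMap k C δ t' φ y
  | _, _, .here v c, φ, y => by
    induction y using tens_cons_induction with
    | zero => simp only [map_zero, smul_zero]
    | add y z hy hz => simp only [map_add, hy, hz, smul_add]
    | tmul x z =>
      change (tensCons k C (v.subst t') c).symm (v.substMap k C δ t' (r • φ) x ⊗ₜ z) =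
        r • (tensCons k C (v.subst t') c).symm (v.substMap k C δ t' φ x ⊗ₜ z)
      rw [Stk.Pos.substMap_smul δ t' r v, ← TensorProduct.smul_tmul', map_smul]
  | _, _, .there t v, φ, y => by
    induction y using tens_cons_induction with
    | zero => simp only [map_zero, smul_zero]
    | add y z hy hz => simp only [map_add, hy, hz, smul_add]
    | tmul x z =>
      change (tensCons k C t (v.subst t')).symm (x ⊗ₜ v.substMap k C δ t' (r • φ) z) =
        r • (tensCons k C t (v.subst t')).symm (x ⊗ₜ v.substMap k C δ t' φ z)
      rw [StkRow.Pos.substMap_smul δ t' r v, TensorProduct.tmul_smul, map_smul]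
end

/-- The two conventions for degrees give the same substitution up to sign. -/
theorem Stk.Pos.substMap_sdeg {t : Stk} {h : BoxLabel} (v : t.Pos h) (t' : Stk)
    (φ : C h →ₗ[k] Stk.tens k C t') (y : Stk.tens k C t) :
    v.substMap k C BoxLabel.sdeg t' φ y =
      koszul k (v.shuf BoxLabel.sdeg t' - v.shuf BoxLabel.deg t') •
        v.substMap k C BoxLabel.deg t' φ y := by
  rw [v.substMap_eq BoxLabel.sdeg, v.substMap_eq BoxLabel.deg, smul_smul, koszul_sub, mul_assoc,
    koszul_mul_self, mul_one]

variable (𝒞 : ConilpotentDgBoxCooperad k C)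

variable (k C) in
/-- Multiplication of the component at each stacking `t` with the scalar `w t`. -/
noncomputable def boxScale (w : Stk → k) : FreeBox k C →ₗ[k] FreeBox k C :=
  DirectSum.toModule k Stacking (FreeBox k C) fun S => w S.1 • freeIn k C S.1

theorem boxScale_freeIn (w : Stk → k) (t : Stk) (y : Stk.tens k C t) :
    boxScale k C w (freeIn k C t y) = w t • freeIn k C t y := by
  by_cases h : t.Valid
  · conv_lhs => rw [freeIn_of_valid h]
    rw [boxScale, DirectSum.toModule_lof]
    rfl
  · rw [freeIn_of_not_valid h, LinearMap.zero_apply, map_zero, smul_zero]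

theorem infDecomp_apply (g : BoxLabel) (x : C g) :
    𝒞.infDecomp g x = boxScale k C (Stk.thinSign k) (𝒞.Δ g x) := rfl

theorem freeProj_boxScale (w : Stk → k) (t : Stk) (x : FreeBox k C) :
    freeProj k C t (boxScale k C w x) = w t • freeProj k C t x := by
  refine LinearMap.congr_fun (f := freeProj k C t ∘ₗ boxScale k C w)
    (g := w t • freeProj k C t) (freeBox_ext fun T hT => ?_) x
  change freeProj k C t (boxScale k C w (freeIn k C T.sh (T.elt k))) =
    w t • freeProj k C t (freeIn k C T.sh (T.elt k))
  rw [boxScale_freeIn, map_smul]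
  by_cases h : t = T.sh
  · rw [h]
  · rw [freeProj_freeIn_ne h, smul_zero, smul_zero]

theorem infDecomp_supported : Supported 𝒞.infDecomp := fun g x t h =>
  𝒞.Δ_support g x t fun h0 => h <| by rw [infDecomp_apply, freeProj_boxScale, h0, smul_zero]

/-- The signs in `d_□ ∘ d_□`, in terms of the arities of the boxes. -/
theorem sign_of_isFact {t t' T : Stk} {h : BoxLabel} {v : t.Pos h} (H : v.IsFact t' T) :
    koszul k (v.before BoxLabel.sdeg) *
      (koszul k (v.shuf BoxLabel.sdeg t' - v.shuf BoxLabel.deg t') *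
        (t'.thinSign k * t.thinSign k)) =
    koszul k (twist T.boxes) * ((t.tqSign * t'.tqSign *
      koszul ℤ (v.before BoxLabel.shift + v.shuf BoxLabel.shift t') : ℤ) : k) := by
  have hk : ∀ n : ℤ, ((koszul ℤ n : ℤ) : k) = koszul k n := fun n => by simp [koszul]
  rw [Stk.thinSign_eq k H.valid, Stk.thinSign_eq k H.valid_inner]
  push_cast
  rw [hk]
  by_cases h0 : t'.tqSign = 0
  · simp [h0]
  · have hs := (Stk.tqSign_spec H.valid_inner h0).2.2
    rw [H.out] at hs
    obtain ⟨m, hm⟩ := Stk.Pos.twist_subst v H.valid H.out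
    rw [H.subst, hs] at hm
    have key : koszul k (v.before BoxLabel.sdeg) *
        koszul k (v.shuf BoxLabel.sdeg t' - v.shuf BoxLabel.deg t') * koszul k (twist t'.boxes) *
        koszul k (twist t.boxes) = koszul k (twist T.boxes) *
        koszul k (v.before BoxLabel.shift + v.shuf BoxLabel.shift t') := by
      rw [← koszul_add, ← koszul_add, ← koszul_add, ← koszul_add, hm, v.before_sdeg]
      refine koszul_congr k ⟨v.before BoxLabel.deg + m, ?_⟩
      ring
    linear_combination (t.tqSign : k) * (t'.tqSign : k) * key

/-- `d_□² = 0` on generators. -/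
theorem freeDeriv_infDecomp (g : BoxLabel) (x : C g) :
    freeDeriv k C BoxLabel.sdeg 𝒞.infDecomp (𝒞.infDecomp g x) = 0 := by
  refine freeBox_eq_zero fun T hT => ?_
  rw [boxAt_freeDeriv (infDecomp_supported 𝒞) hT]
  have hterm : ∀ (t : Stk) (h : BoxLabel) (v : t.Pos h) (t' : Stk), v.IsFact t' T →
      v.derivTerm BoxLabel.sdeg 𝒞.infDecomp t' (𝒞.infDecomp g x) =
        ((t.tqSign * t'.tqSign * koszul ℤ (v.before BoxLabel.shift + v.shuf BoxLabel.shift t') : ℤ)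
          : k) • koszul k (twist T.boxes) • boxAt k C T (𝒞.Δ g x) := by
    intro t h v t' H
    have h1 : freeProj k C t' ∘ₗ 𝒞.infDecomp h =
        t'.thinSign k • (freeProj k C t' ∘ₗ 𝒞.Δ h) :=
      LinearMap.ext fun y => freeProj_boxScale _ t' (𝒞.Δ h y)
    change koszul k (v.before BoxLabel.sdeg) • freeIn k C (v.subst t')
      (v.substMap k C BoxLabel.sdeg t' (freeProj k C t' ∘ₗ 𝒞.infDecomp h)
        (freeProj k C t (boxScale k C (Stk.thinSign k) (𝒞.Δ g x)))) = _
    rw [h1, freeProj_boxScale, v.substMap_sdeg, Stk.Pos.substMap_smul, map_smul, map_smul,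
      map_smul, map_smul,
      𝒞.coassoc g x t h v t' H.valid H.valid_inner H.ne_leaf H.out, ← boxAt_apply, H.subst,
      smul_smul, smul_smul, smul_smul, smul_smul, mul_assoc, mul_assoc, sign_of_isFact H, mul_comm]
  rw [Stk.factSum_congr hT hterm]
  have h2 := Stk.map_factSum ((LinearMap.toSpanSingleton ℤ (FreeBox k C)
    (koszul k (twist T.boxes) • boxAt k C T (𝒞.Δ g x)) : ℤ →+ FreeBox k C)) T
    fun t _ v t' => t.tqSign * t'.tqSign *
      koszul ℤ (v.before BoxLabel.shift + v.shuf BoxLabel.shift t')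
  rw [Stk.factSum_tqSign hT, map_zero] at h2
  refine Eq.trans (Stk.factSum_congr hT fun t _ v t' _ => ?_) h2.symm
  exact Int.cast_smul_eq_zsmul k _ _

end square

/-! ### The internal differential -/

mutual
/-- A stacking with the degrees of its boxes replaced by `0`. -/
def Stk.forget : Stk → Stk
  | .leaf => .leaf
  | .node g c => .node ⟨g.p, g.q, g.r, 0⟩ (StkRow.forget c)
/-- A row with the degrees of its boxes replaced by `0`. -/
def StkRow.forget : StkRow → StkRow
  | .nil s => .nil s
  | .cons t c => .cons (Stk.forget t) (StkRow.forget c)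
end

mutual
theorem Stk.left_forget : ∀ t : Stk, t.forget.left = t.left
  | .leaf => rfl
  | .node g c => congrArg (g.p + ·) (StkRow.left_forget c)
theorem StkRow.left_forget : ∀ c : StkRow, c.forget.left = c.left
  | .nil _ => rfl
  | .cons t _ => Stk.left_forget t
end

mutual
theorem Stk.bare_forget : ∀ t : Stk, t.forget.bare = t.bare
  | .leaf => rfl
  | .node _ _ => rfl
theorem StkRow.bare_forget : ∀ c : StkRow, c.forget.bare = c.bare
  | .nil _ => rfl
  | .cons t c => congrArg₂ (· * ·) (Stk.bare_forget t) (StkRow.bare_forget c)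
end

mutual
theorem Stk.oneThin_forget : ∀ t : Stk, t.forget.oneThin = t.oneThin
  | .leaf => rfl
  | .node g c => by
    simp only [Stk.forget, Stk.oneThin, StkRow.bare_forget c, BoxLabel.Thin]
    rfl
theorem StkRow.oneThin_forget : ∀ c : StkRow, c.forget.oneThin = c.oneThin
  | .nil s => rfl
  | .cons t c => by
    simp only [StkRow.forget, StkRow.oneThin, StkRow.bare_forget, Stk.bare_forget,
      Stk.oneThin_forget t, StkRow.oneThin_forget c]
end

mutual
theorem Stk.thick_forget : ∀ t : Stk, t.forget.thick = t.thick
  | .leaf => rfl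
  | .node g c => by simp only [Stk.forget, Stk.thick, StkRow.thick_forget c]
theorem StkRow.thick_forget : ∀ c : StkRow, c.forget.thick = c.thick
  | .nil _ => rfl
  | .cons t c => congrArg₂ (· * ·) (Stk.thick_forget t) (StkRow.thick_forget c)
end

mutual
theorem Stk.sep_forget : ∀ (t : Stk) (i j : ℕ), t.forget.Sep i j ↔ t.Sep i j
  | .leaf, i, j => Iff.rfl
  | .node g c, i, j => by simp only [Stk.forget, Stk.Sep, StkRow.sep_forget c]
theorem StkRow.sep_forget : ∀ (c : StkRow) (i j : ℕ), c.forget.Sep i j ↔ c.Sep i j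
  | .nil s, i, j => Iff.rfl
  | .cons t c, i, j => by
    simp only [StkRow.forget, StkRow.Sep, Stk.sep_forget t, StkRow.sep_forget c]
end

/-- `tqSign` only depends on the arities of the boxes. -/
theorem Stk.tqSign_forget : ∀ t : Stk, t.forget.tqSign = t.tqSign
  | .leaf => rfl
  | .node g c => by
    have hi : c.forget.Indec ↔ c.Indec := by
      simp only [StkRow.Indec, StkRow.left_forget, StkRow.sep_forget]
    have h : c.forget.indec = c.indec := by
      rw [StkRow.indec, StkRow.indec, StkRow.thick_forget]
      by_cases hc : c.Indec
      · rw [if_pos hc, if_pos (hi.2 hc)]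
      · rw [if_neg hc, if_neg (mt hi.1 hc)]
    rw [Stk.forget, tqSign_node, tqSign_node, StkRow.oneThin_forget, h]
    rfl

section internal
variable {k : Type u} [CommRing k]
variable {C : BoxLabel → Type u} [∀ g, AddCommGroup (C g)] [∀ g, Module k (C g)]

variable (k C) in
/-- The span of the stackings with given arities of the boxes. -/
noncomputable def boxShape (s : Stk) : Submodule k (FreeBox k C) :=
  Submodule.span k {z | ∃ T : DStk C, T.sh.Valid ∧ T.sh.forget = s ∧ T.val k = z}

variable (k C) in
/-- The span of the rows with given arities of the boxes. -/
noncomputable def rowShape (c : StkRow) : Submodule k (FreeRow k C) :=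
  Submodule.span k {z | ∃ R : DRow C, R.sh.forget = c ∧ R.val k = z}

theorem DStk.val_mem_boxShape (T : DStk C) : T.val k ∈ boxShape k C T.sh.forget := by
  by_cases h : T.sh.Valid
  · exact Submodule.subset_span ⟨T, h, rfl, rfl⟩
  · rw [DStk.val, freeIn_of_not_valid h]
    exact zero_mem _

theorem DRow.val_mem_rowShape (R : DRow C) : R.val k ∈ rowShape k C R.sh.forget :=
  Submodule.subset_span ⟨R, rfl, rfl⟩

theorem nodeMul_mem_boxShape (g : BoxLabel) (x : C g) {c : StkRow} {r : FreeRow k C}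
    (hr : r ∈ rowShape k C c) :
    nodeMul k C g x r ∈ boxShape k C (.node ⟨g.p, g.q, g.r, 0⟩ c) := by
  have h : rowShape k C c ≤ (boxShape k C (.node ⟨g.p, g.q, g.r, 0⟩ c)).comap
      (nodeMul k C g x) := by
    refine Submodule.span_le.2 ?_
    rintro _ ⟨R, rfl, rfl⟩
    rw [SetLike.mem_coe, Submodule.mem_comap, nodeMul_val]
    exact DStk.val_mem_boxShape (DStk.node g x R)
  exact h hr

theorem consMul_mem_rowShape {s : Stk} {c : StkRow} {x : FreeBox k C} {r : FreeRow k C}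
    (hx : x ∈ boxShape k C s) (hr : r ∈ rowShape k C c) :
    consMul k C x r ∈ rowShape k C (.cons s c) := by
  have h := Submodule.apply_mem_map₂ (consMul k C) hx hr
  rw [boxShape, rowShape, Submodule.map₂_span_span] at h
  refine Submodule.span_mono ?_ h
  rintro _ ⟨_, ⟨T, hT, rfl, rfl⟩, _, ⟨R, rfl, rfl⟩, rfl⟩
  exact ⟨.cons T R, rfl, (consMul_val hT R).symm⟩

variable (k) in
/-- A family of maps of degree `-1`, with values in the generators of `T(C)`. -/
noncomputable def genMap (e : ∀ g : BoxLabel, C g →ₗ[k] C g.pred) (g : BoxLabel) :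
    C g →ₗ[k] FreeBox k C := freeGen k C g.pred ∘ₗ e g

variable {δ : BoxLabel → ℤ} (e : ∀ g : BoxLabel, C g →ₗ[k] C g.pred)

theorem freeDeriv_genMap_node {g : BoxLabel} (x : C g) (R : DRow C)
    (h : (DStk.node g x R).sh.Valid) :
    freeDeriv k C δ (genMap k e) ((DStk.node g x R).val k) = nodeMul k C g.pred (e g x) (R.val k) +
      koszul k (δ g) • nodeMul k C g x (rowDeriv k C δ (genMap k e) (R.val k)) := by
  have hR := DRow.val_mem_rowHomog (k := k) (δ := δ) h.2
  rw [show R.sh.length = g.q from h.1] at hR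
  rw [← nodeMul_val, freeDeriv_nodeMul _ x hR]
  congr 1
  rw [nodeMul_val]
  exact graftMul_freeGen (e g x) h.1

theorem rowDeriv_cons (ψ : ∀ g, C g →ₗ[k] FreeBox k C) (T : DStk C) (R : DRow C)
    (h : T.sh.Valid) :
    rowDeriv k C δ ψ ((DRow.cons T R).val k) =
      consMul k C (freeDeriv k C δ ψ (T.val k)) (R.val k) +
      koszul k (T.sh.degree δ) • consMul k C (T.val k) (rowDeriv k C δ ψ (R.val k)) := by
  rw [← consMul_val h, rowDeriv_consMul _ (DStk.val_mem_homog h)]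
  rfl

mutual
/-- The internal differential preserves the arities of the boxes. -/
theorem DStk.freeDeriv_genMap_mem : ∀ T : DStk C, T.sh.Valid →
    freeDeriv k C δ (genMap k e) (T.val k) ∈ boxShape k C T.sh.forget
  | .leaf, _ => by
    rw [freeDeriv_one]
    exact zero_mem _
  | .node g x R, h => by
    rw [freeDeriv_genMap_node e x R h]
    exact add_mem (nodeMul_mem_boxShape g.pred (e g x) R.val_mem_rowShape)
      (Submodule.smul_mem _ _ (nodeMul_mem_boxShape g x (DRow.rowDeriv_genMap_mem R h.2)))
/-- The internal differential preserves the arities of the boxes of a row. -/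
theorem DRow.rowDeriv_genMap_mem : ∀ R : DRow C, R.sh.Valid →
    rowDeriv k C δ (genMap k e) (R.val k) ∈ rowShape k C R.sh.forget
  | .nil s, _ => by
    rw [rowDeriv_nil]
    exact zero_mem _
  | .cons T R, h => by
    rw [rowDeriv_cons _ T R h.1]
    exact add_mem (consMul_mem_rowShape (DStk.freeDeriv_genMap_mem T h.1) R.val_mem_rowShape)
      (Submodule.smul_mem _ _ (consMul_mem_rowShape T.val_mem_boxShape
        (DRow.rowDeriv_genMap_mem R h.2.1)))
end

theorem boxScale_tqSign {s : Stk} {x : FreeBox k C} (hx : x ∈ boxShape k C s) :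
    boxScale k C (fun t => ((t.tqSign : ℤ) : k)) x = ((s.tqSign : ℤ) : k) • x := by
  refine LinearMap.eqOn_span (f := boxScale k C fun t => ((t.tqSign : ℤ) : k))
    (g := ((s.tqSign : ℤ) : k) • LinearMap.id) ?_ hx
  rintro _ ⟨T, hT, rfl, rfl⟩
  change _ = ((T.sh.forget.tqSign : ℤ) : k) • T.val k
  rw [DStk.val, boxScale_freeIn, Stk.tqSign_forget]

/-! ### The internal differential before and after thin desuspension -/

variable (k C) in
/-- Multiplication of the component at each row `c` with the scalar `w c`. -/
noncomputable def rowScale (w : StkRow → k) : FreeRow k C →ₗ[k] FreeRow k C :=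
  DirectSum.toModule k StkRow (FreeRow k C) fun c => w c • rowIn k C c

theorem rowScale_rowIn (w : StkRow → k) (c : StkRow) (y : StkRow.tens k C c) :
    rowScale k C w (rowIn k C c y) = w c • rowIn k C c y := by
  conv_lhs => rw [rowIn]
  rw [rowScale, DirectSum.toModule_lof]
  rfl

variable (k) in
/-- The sign of `s_thin⁻¹ ⊗ ⋯ ⊗ s_thin⁻¹` on the boxes `l`, if it moves past an element of
degree `a` before. -/
def twistSign (a : ℤ) (l : List BoxLabel) : k := koszul k (twist l + a * (l.map BoxLabel.shift).sum)

theorem boxScale_nodeMul (a : ℤ) (g : BoxLabel) (x : C g) (r : FreeRow k C) :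
    boxScale k C (fun t => twistSign k a t.boxes) (nodeMul k C g x r) =
      koszul k (a * g.shift) •
        nodeMul k C g x (rowScale k C (fun c => twistSign k (a + g.deg) c.boxes) r) := by
  refine LinearMap.congr_fun
    (f := boxScale k C (fun t => twistSign k a t.boxes) ∘ₗ nodeMul k C g x)
    (g := koszul k (a * g.shift) • (nodeMul k C g x ∘ₗ
      rowScale k C (fun c => twistSign k (a + g.deg) c.boxes))) (freeRow_ext fun R => ?_) r
  change boxScale k C (fun t => twistSign k a t.boxes) (nodeMul k C g x (rowIn k C R.sh (R.elt k))) =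
    koszul k (a * g.shift) • nodeMul k C g x
      (rowScale k C (fun c => twistSign k (a + g.deg) c.boxes) (rowIn k C R.sh (R.elt k)))
  rw [rowScale_rowIn, map_smul, nodeMul_rowIn, boxScale_freeIn, smul_smul]
  congr 1
  rw [twistSign, twistSign, ← koszul_add, Stk.boxes, twist, List.map_cons, List.sum_cons]
  congr 1; ring

theorem rowScale_consMul (a : ℤ) {g : BoxLabel} {x : FreeBox k C}
    (hx : x ∈ homog k C BoxLabel.deg g) (r : FreeRow k C) :
    rowScale k C (fun c => twistSign k a c.boxes) (consMul k C x r) =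
      consMul k C (boxScale k C (fun t => twistSign k a t.boxes) x)
        (rowScale k C (fun c => twistSign k (a + g.deg) c.boxes) r) := by
  refine homog_ext (rowScale k C (fun c => twistSign k a c.boxes) ∘ₗ (consMul k C).flip r)
    ((consMul k C).flip (rowScale k C (fun c => twistSign k (a + g.deg) c.boxes) r) ∘ₗ
      boxScale k C (fun t => twistSign k a t.boxes)) (fun T hT oT => ?_) hx
  subst oT
  refine LinearMap.congr_fun
    (f := rowScale k C (fun c => twistSign k a c.boxes) ∘ₗ consMul k C (T.val k))
    (g := consMul k C (boxScale k C (fun t => twistSign k a t.boxes) (T.val k)) ∘ₗ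
      rowScale k C (fun c => twistSign k (a + T.sh.degree BoxLabel.deg) c.boxes))
    (freeRow_ext fun R => ?_) r
  change rowScale k C (fun c => twistSign k a c.boxes)
      (consMul k C (freeIn k C T.sh (T.elt k)) (rowIn k C R.sh (R.elt k))) =
    consMul k C (boxScale k C (fun t => twistSign k a t.boxes) (freeIn k C T.sh (T.elt k)))
      (rowScale k C (fun c => twistSign k (a + T.sh.degree BoxLabel.deg) c.boxes)
        (rowIn k C R.sh (R.elt k)))
  rw [rowScale_rowIn, boxScale_freeIn, map_smul, map_smul, LinearMap.smul_apply, consMul_freeIn hT,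
    rowScale_rowIn, smul_smul]
  congr 1
  rw [twistSign, twistSign, twistSign, ← koszul_add, StkRow.boxes, twist_append, List.map_append,
    List.sum_append]
  congr 1
  rw [Stk.degree]; ring

theorem genMap_lowersDegree (hδ : ∀ g : BoxLabel, δ g.pred = δ g - 1) :
    LowersDegree δ (genMap k e) := fun g x => by
  have := freeGen_mem (k := k) (δ := δ) g.pred (e g x)
  rwa [hδ] at this

mutual
/-- The sign twist interchanges the differentials of `T(C)` and of `T(s_thin⁻¹ C)`. -/
theorem DStk.boxScale_freeDeriv {d e : ∀ g : BoxLabel, C g →ₗ[k] C g.pred}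
    (he : ∀ g x, e g x = koszul k g.shift • d g x) : ∀ (T : DStk C) (a : ℤ), T.sh.Valid →
    boxScale k C (fun t => twistSign k a t.boxes)
      (freeDeriv k C BoxLabel.deg (genMap k d) (T.val k)) =
      twistSign k (a + 1) T.sh.boxes • freeDeriv k C BoxLabel.sdeg (genMap k e) (T.val k)
  | .leaf, a, _ => by simp only [freeDeriv_one, map_zero, smul_zero]
  | .node g x R, a, h => by
    rw [freeDeriv_genMap_node d x R h, freeDeriv_genMap_node e x R h, map_add, map_smul,
      boxScale_nodeMul, boxScale_nodeMul, DRow.rowScale_rowDeriv he R _ h.2, he, DRow.val,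
      rowScale_rowIn, smul_add]
    simp only [map_smul, LinearMap.smul_apply, smul_smul]
    congr 2
    · simp only [twistSign, ← koszul_add, DStk.sh, Stk.boxes, twist, List.map_cons, List.sum_cons]
      refine koszul_congr k ⟨- (g.shift + (R.sh.boxes.map BoxLabel.shift).sum), ?_⟩
      rw [show g.pred.shift = g.shift from rfl, show g.pred.deg = g.deg - 1 from rfl]; ring
    · simp only [twistSign, ← koszul_add, DStk.sh, Stk.boxes, twist, List.map_cons, List.sum_cons]
      refine koszul_congr k ⟨- g.shift, ?_⟩
      rw [BoxLabel.sdeg_eq]; ring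
/-- The sign twist interchanges the two differentials on rows. -/
theorem DRow.rowScale_rowDeriv {d e : ∀ g : BoxLabel, C g →ₗ[k] C g.pred}
    (he : ∀ g x, e g x = koszul k g.shift • d g x) : ∀ (R : DRow C) (a : ℤ), R.sh.Valid →
    rowScale k C (fun t => twistSign k a t.boxes)
      (rowDeriv k C BoxLabel.deg (genMap k d) (R.val k)) =
      twistSign k (a + 1) R.sh.boxes • rowDeriv k C BoxLabel.sdeg (genMap k e) (R.val k)
  | .nil s, a, _ => by simp only [rowDeriv_nil, map_zero, smul_zero]
  | .cons T R, a, h => by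
    have hT := DStk.val_mem_homog (k := k) (δ := BoxLabel.deg) h.1
    have hd := freeDeriv_mem (genMap_lowersDegree d fun _ => rfl) hT
    rw [rowDeriv_cons _ T R h.1, rowDeriv_cons _ T R h.1, map_add, map_smul,
      rowScale_consMul a hd, rowScale_consMul a hT, DStk.boxScale_freeDeriv he T a h.1,
      DRow.rowScale_rowDeriv he R _ h.2.1, DRow.val, DStk.val, rowScale_rowIn, boxScale_freeIn,
      smul_add]
    simp only [map_smul, LinearMap.smul_apply, smul_smul]
    congr 2
    · simp only [twistSign, ← koszul_add, DRow.sh, StkRow.boxes, twist_append, List.map_append,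
        List.sum_append, BoxLabel.pred, Stk.out, Stk.degree]
      refine koszul_congr k ⟨- (R.sh.boxes.map BoxLabel.shift).sum, ?_⟩
      ring
    · simp only [twistSign, ← koszul_add, DRow.sh, StkRow.boxes, twist_append, List.map_append,
        List.sum_append, Stk.out, Stk.degree_sdeg]
      simp only [Stk.degree]
      refine koszul_congr k ⟨- (T.sh.boxes.map BoxLabel.shift).sum, ?_⟩
      ring
end

end internal

/-! ### The cobar construction -/

section cobar
variable {k : Type u} [CommRing k]
variable {C : BoxLabel → Type u} [∀ g, AddCommGroup (C g)] [∀ g, Module k (C g)]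
variable (𝒞 : ConilpotentDgBoxCooperad k C)

theorem desuspD_apply (g : BoxLabel) (x : C g) :
    𝒞.desuspD g x = koszul k g.shift • 𝒞.d g x := by
  unfold ConilpotentDgBoxCooperad.desuspD BoxLabel.shift
  split_ifs
  · rw [koszul_neg, koszul_one, neg_one_smul]; rfl
  · rw [koszul_zero, one_smul]

theorem decomposition_mem (g : BoxLabel) (x : C g) : 𝒞.Δ g x ∈ homog k C BoxLabel.deg g := by
  have h := mem_span_freeIn (p := fun t => t.out BoxLabel.deg = g)
    fun t ht => (𝒞.Δ_support g x t ht).2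
  refine Submodule.span_le.2 ?_ h
  rintro _ ⟨t, -, ht, y, rfl⟩
  exact ht ▸ freeIn_mem_homog t y

theorem infDecomp_lowersDegree : LowersDegree BoxLabel.sdeg 𝒞.infDecomp := fun g x => by
  have h : homog k C BoxLabel.deg g ≤
      (homog k C BoxLabel.sdeg ⟨g.p, g.q, g.r, g.sdeg - 1⟩).comap
        (boxScale k C (Stk.thinSign k)) := by
    refine Submodule.span_le.2 ?_
    rintro _ ⟨T, hT, rfl, rfl⟩
    rw [SetLike.mem_coe, Submodule.mem_comap, DStk.val, boxScale_freeIn, Stk.thinSign_eq k hT]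
    by_cases h0 : T.sh.tqSign = 0
    · simp [h0]
    · refine Submodule.smul_mem _ _ ?_
      have hs := (Stk.tqSign_spec hT h0).2.2
      have ho : T.sh.out BoxLabel.sdeg = ⟨T.sh.left, T.sh.inputs, T.sh.right,
          (T.sh.out BoxLabel.deg).sdeg - 1⟩ := by
        rw [Stk.out, Stk.degree_sdeg, BoxLabel.sdeg_eq, hs]
        congr 1
        change T.sh.degree BoxLabel.deg + _ = T.sh.degree BoxLabel.deg + _ - 1
        ring
      exact ho ▸ freeIn_mem_homog T.sh (T.elt k)
  exact h (decomposition_mem 𝒞 g x)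

theorem sdeg_pred (g : BoxLabel) : g.pred.sdeg = g.sdeg - 1 := by
  rw [BoxLabel.sdeg_eq, BoxLabel.sdeg_eq, show g.pred.shift = g.shift from rfl,
    show g.pred.deg = g.deg - 1 from rfl]
  ring

theorem desuspD_lowersDegree : LowersDegree BoxLabel.sdeg (genMap k 𝒞.desuspD) :=
  genMap_lowersDegree _ sdeg_pred

theorem desuspD_desuspD (g : BoxLabel) (x : C g) : 𝒞.desuspD g.pred (𝒞.desuspD g x) = 0 := by
  rw [desuspD_apply, desuspD_apply, map_smul, 𝒞.d_d, smul_zero, smul_zero]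

/-- The differentials of `T(C)` and of `T(s_thin⁻¹ C)` correspond to each other under the
infinitesimal part of a decomposition, up to the sign of an element of degree `-1`. -/
theorem freeDeriv_boxScale {g : BoxLabel} {y : FreeBox k C} (hy : y ∈ homog k C BoxLabel.deg g) :
    freeDeriv k C BoxLabel.sdeg (genMap k 𝒞.desuspD) (boxScale k C (Stk.thinSign k) y) =
      -koszul k g.shift • boxScale k C (Stk.thinSign k)
        (freeDeriv k C BoxLabel.deg (genMap k 𝒞.d) y) := by
  refine homog_ext
    (freeDeriv k C BoxLabel.sdeg (genMap k 𝒞.desuspD) ∘ₗ boxScale k C (Stk.thinSign k))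
    (-koszul k g.shift • (boxScale k C (Stk.thinSign k) ∘ₗ
      freeDeriv k C BoxLabel.deg (genMap k 𝒞.d))) (fun T hT oT => ?_) hy
  subst oT
  change freeDeriv k C BoxLabel.sdeg (genMap k 𝒞.desuspD) (boxScale k C (Stk.thinSign k) (T.val k)) =
    -koszul k (T.sh.out BoxLabel.deg).shift • boxScale k C (Stk.thinSign k)
      (freeDeriv k C BoxLabel.deg (genMap k 𝒞.d) (T.val k))
  -- the coefficient is the product of the twist and of `tqSign`, which only sees arities
  have hw : boxScale k C (Stk.thinSign k) = boxScale k C (fun t => ((t.tqSign : ℤ) : k)) ∘ₗ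
      boxScale k C (fun t => twistSign k 0 t.boxes) := by
    refine freeBox_ext fun T hT => ?_
    rw [LinearMap.comp_apply, DStk.val, boxScale_freeIn, boxScale_freeIn, map_smul,
      boxScale_freeIn, smul_smul, Stk.thinSign_eq k hT, twistSign, zero_mul, add_zero]
  have h1 : boxScale k C (Stk.thinSign k)
      (freeDeriv k C BoxLabel.deg (genMap k 𝒞.d) (T.val k)) =
      (twistSign k 1 T.sh.boxes * ((T.sh.tqSign : ℤ) : k)) •
        freeDeriv k C BoxLabel.sdeg (genMap k 𝒞.desuspD) (T.val k) := by
    rw [hw, LinearMap.comp_apply, DStk.boxScale_freeDeriv (desuspD_apply 𝒞) T 0 hT, map_smul,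
      boxScale_tqSign (DStk.freeDeriv_genMap_mem _ T hT), Stk.tqSign_forget, smul_smul, zero_add]
  rw [h1, DStk.val, boxScale_freeIn, map_smul, smul_smul, Stk.thinSign_eq k hT]
  by_cases h0 : T.sh.tqSign = 0
  · simp [h0]
  · rw [(Stk.tqSign_spec hT h0).2.2, koszul_add_one, neg_neg, ← mul_assoc, twistSign, ← koszul_add]
    congr 2
    refine koszul_congr k ⟨- T.sh.degree BoxLabel.shift, ?_⟩
    rw [Stk.degree]; ring

/-- The internal differential anticommutes with `d_□` on generators. -/
theorem dInt_infDecomp (g : BoxLabel) (x : C g) :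
    freeDeriv k C BoxLabel.sdeg (genMap k 𝒞.desuspD) (𝒞.infDecomp g x) =
      -𝒞.infDecomp g.pred (𝒞.desuspD g x) := by
  rw [infDecomp_apply, freeDeriv_boxScale 𝒞 (decomposition_mem 𝒞 g x), desuspD_apply, map_smul,
    infDecomp_apply, 𝒞.Δ_d, neg_smul]
  rfl

theorem freeDeriv_infDecomp_genMap (g : BoxLabel) (x : C g) :
    freeDeriv k C BoxLabel.sdeg 𝒞.infDecomp (genMap k 𝒞.desuspD g x) =
      𝒞.infDecomp g.pred (𝒞.desuspD g x) :=
  freeDeriv_freeGen (infDecomp_lowersDegree 𝒞) g.pred (𝒞.desuspD g x)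

theorem freeDeriv_genMap_genMap (g : BoxLabel) (x : C g) :
    freeDeriv k C BoxLabel.sdeg (genMap k 𝒞.desuspD) (genMap k 𝒞.desuspD g x) = 0 := by
  refine (freeDeriv_freeGen (desuspD_lowersDegree 𝒞) g.pred (𝒞.desuspD g x)).trans ?_
  change freeGen k C g.pred.pred (𝒞.desuspD g.pred (𝒞.desuspD g x)) = 0
  rw [desuspD_desuspD, map_zero]

theorem dInt_add_dSquare : 𝒞.dInt + 𝒞.dSquare =
    freeDeriv k C BoxLabel.sdeg fun g => genMap k 𝒞.desuspD g + 𝒞.infDecomp g :=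
  freeDeriv_add.symm

theorem sum_lowersDegree :
    LowersDegree BoxLabel.sdeg fun g => genMap k 𝒞.desuspD g + 𝒞.infDecomp g :=
  fun g x => add_mem (desuspD_lowersDegree 𝒞 g x) (infDecomp_lowersDegree 𝒞 g x)

theorem dInt_add_dSquare_comp_self :
    (𝒞.dInt + 𝒞.dSquare) ∘ₗ (𝒞.dInt + 𝒞.dSquare) = 0 := by
  rw [dInt_add_dSquare]
  refine freeDeriv_comp_self (sum_lowersDegree 𝒞) fun g x => ?_
  rw [freeDeriv_add, LinearMap.add_apply, LinearMap.add_apply, map_add, map_add,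
    freeDeriv_genMap_genMap, dInt_infDecomp, freeDeriv_infDecomp_genMap, freeDeriv_infDecomp]
  abel

end cobar

theorem lemma2 {k : Type u} [CommRing k] (C : BoxLabel → Type u)
    [∀ g, AddCommGroup (C g)] [∀ g, Module k (C g)] (𝒞 : ConilpotentDgBoxCooperad k C) :
    -- `d_□` is the unique derivation that extends the infinitesimal decomposition
    ((freeBoxOperad k C BoxLabel.sdeg).IsDerivation 𝒞.dSquare ∧
      (∀ g x, 𝒞.dSquare (freeGen k C g x) = 𝒞.infDecomp g x) ∧
      ∀ D : FreeBox k C →ₗ[k] FreeBox k C,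
        (freeBoxOperad k C BoxLabel.sdeg).IsDerivation D →
        (∀ g x, D (freeGen k C g x) = 𝒞.infDecomp g x) → D = 𝒞.dSquare) ∧
    -- it squares to zero
    𝒞.dSquare ∘ₗ 𝒞.dSquare = 0 ∧
    -- the sum with the internal differential squares to zero
    (𝒞.dInt + 𝒞.dSquare) ∘ₗ (𝒞.dInt + 𝒞.dSquare) = 0 ∧
    -- the cobar construction is a dg box operad
    (freeBoxOperad k C BoxLabel.sdeg).IsDgBoxOperad (𝒞.dInt + 𝒞.dSquare) := by
  have hψ := infDecomp_lowersDegree 𝒞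
  have hD := freeDeriv_isDerivation hψ
  have hg := freeDeriv_freeGen hψ
  refine ⟨⟨hD, hg, fun D h1 h2 => derivation_ext h1 hD fun g x => (h2 g x).trans (hg g x).symm⟩,
    freeDeriv_comp_self hψ (freeDeriv_infDecomp 𝒞), dInt_add_dSquare_comp_self 𝒞,
    freeBoxOperad_isGraded k C _, ?_, dInt_add_dSquare_comp_self 𝒞⟩
  rw [dInt_add_dSquare]
  exact freeDeriv_isDerivation (sum_lowersDegree 𝒞)
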